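/- Let $k$ be an algebraically closed field. All linear structures are over $k$; "small" refers to a fixed universe. **The 2-categories.** * $\mathrm{KV2Vect}$ (Kapranov–Voevodsky 2-vector spaces): objects are natural numbers; a 1-morphism $n\to m$ is an $n\times m$ matrix of finite-dimensional vector spaces; 2-morphisms are matrices of linear maps; composition is matrix multiplication formed with $\oplus$ and $\otimes$; the monoidal structure is multiplication of natural numbers and the tensor product of matrices. * $\mathrm{ALG}$: $k$-algebras, all bimodules (an $A$-$B$-bimodule is a 1-morphism $A\to B$, composition is $M\otimes_B N$), bimodule maps, with $\otimes_k$. $\mathrm{alg}$: the sub-2-category of finite-dimensional algebras and finite-dimensional bimodules. $\mathrm{ALG}^{L}$: all algebras, and only those bimodules which have a right adjoint in $\mathrm{ALG}$. * $\mathrm{LinCat}$: finite abelian linear categories (finite-dimensional hom spaces, all objects of finite length, enough projectives, finitely many isomorphism classes of simple objects), right exact linear functors, natural transformations, with the Deligne tensor product. * $\mathrm{2Vect}$: (essentially) small Cauchy complete, i.e. additive and idempotent complete, linear categories, linear functors, natural transformations, with the Cauchy completion of the tensor product $C\boxtimes D$ of linear categories (objects are pairs, hom spaces are tensor products of hom spaces).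 * $\mathrm{Bimod}$: small linear categories; a 1-morphism $C\to D$ is a bimodule, i.e. a linear functor $P\colon D^{op}\boxtimes C\to \mathrm{Vect}_k$; 2-morphisms are natural transformations; the composite of $P\colon C\to D$ and $Q\colon D\to E$ is $(e,c)\mapsto \bigl(\bigoplus_d Q(e,d)\otimes P(d,c)\bigr)/\bigl(qf\otimes p\sim q\otimes fp\bigr)$; with the tensor product $\boxtimes$ of linear categories. **Full dualizability.** For a 2-category $B$, let $B^{L}$ (resp. $B^{R}$) have the same objects and 2-morphisms, and those 1-morphisms of $B$ which have a right (resp. left) adjoint in $B$; let $B^{L_\infty}=\bigcap_n B^{L\cdots L}$ and $B^{R_\infty}=\bigcap_n B^{R\cdots R}$ be the intersections of the iterates, and $B^{d_1}=(B^{L_\infty})^{R_\infty}$. If $B$ is symmetric monoidal with unit $I$, an object $x$ is dualizable if there are an object $x^*$ and 1-morphisms $e\colon x\otimes x^*\to I$ and $c\colon I\to x^*\otimes x$ with $(e\otimes \mathrm{id}_x)\circ(\mathrm{id}_x\otimes c)\cong \mathrm{id}_x$ and $(\mathrm{id}_{x^*}\otimes e)\circ(c\otimes \mathrm{id}_{x^*})\cong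 \mathrm{id}_{x^*}$; $B^{d_0}$ is the full sub-2-category on the dualizable objects. The fully-dualizable sub-2-category is $B^{fd}=(B^{d_1})^{d_0}$. **The natural inclusions** $\mathrm{KV2Vect}\to C$ send $n$ to the algebra $k^n=k\times\dots\times k$ for $C=\mathrm{ALG},\mathrm{alg},\mathrm{ALG}^L$; to the one-object linear category with endomorphism algebra $k^n$ for $C=\mathrm{Bimod}$; and to the category $(\mathrm{Vect}_k^{fd})^n$ of $n$-tuples of finite-dimensional vector spaces for $C=\mathrm{LinCat},\mathrm{2Vect}$. A matrix $(M_{ij})$ is sent to the bimodule $\bigoplus_{i,j}M_{ij}$ (respectively to the functor $v\mapsto (\bigoplus_i v_i\otimes M_{ij})_j$), and matrices of linear maps to the evident 2-morphisms. **Theorem.** For each of $C=\mathrm{ALG}$, $\mathrm{alg}$, $\mathrm{ALG}^{L}$, $\mathrm{LinCat}$, $\mathrm{2Vect}$ and $\mathrm{Bimod}$, the natural inclusion of $\mathrm{KV2Vect}$ takes values in $C^{fd}$ and induces an equivalence of 2-categories $$\mathrm{KV2Vect}\;\simeq\;C^{fd},$$ i.e. it underlies a pseudofunctor $\mathrm{KV2Vect}\to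 C^{fd}$ that is essentially surjective on objects up to equivalence and an equivalence on all categories of 1-morphisms. Moreover the inclusion preserves the unit object and tensor products of objects up to equivalences which are compatible, up to isomorphism, with the tensor products of 1-morphisms and with the associators, unitors and braidings. -/

import Mathlib

universe w₁ w₂ v v₁ v₂ u u₁ u₂

noncomputable section

open CategoryTheory Limits MonoidalCategory TensorProduct
open scoped Bicategory

namespace TwoVec

/-! ### Sub-2-categories, adjoints of 1-morphisms, duals of objects -/

/-- A locally full sub-2-category of a 2-category: a class of objects and a class of 1-morphisms
containing the identities of the chosen objects and closed under composition; a 1-morphism of the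
sub-2-category is a 1-morphism in `hom` between objects in `obj`, and all 2-morphisms are kept. -/
structure SubBicat (B : Type u) [Bicategory.{w₁, v} B] where
  obj : B → Prop
  hom : ∀ {a b : B}, (a ⟶ b) → Prop
  id_mem : ∀ {a : B}, obj a → hom (𝟙 a)
  comp_mem : ∀ {a b c : B} {f : a ⟶ b} {g : b ⟶ c}, hom f → hom g → hom (f ≫ g)

namespace SubBicat

variable {B : Type u} [Bicategory.{w₁, v} B]

/-- The whole 2-category. -/
def whole (B : Type u) [Bicategory.{w₁, v} B] : SubBicat B where
  obj _ := True
  hom _ := True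
  id_mem _ := trivial
  comp_mem _ _ := trivial

/-- `S.L`: all objects of `S`, and those 1-morphisms of `S` which admit a right adjoint in `S`. -/
def L (S : SubBicat B) : SubBicat B where
  obj := S.obj
  hom {a b} f := S.hom f ∧ ∃ g : b ⟶ a, S.hom g ∧ Nonempty (Bicategory.Adjunction f g)
  id_mem {a} ha := ⟨S.id_mem ha, 𝟙 a, S.id_mem ha, ⟨Bicategory.Adjunction.id a⟩⟩
  comp_mem := by
    rintro a b c f f' ⟨hf, g, hg, ⟨adj⟩⟩ ⟨hf', g', hg', ⟨adj'⟩⟩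
    exact ⟨S.comp_mem hf hf', g' ≫ g, S.comp_mem hg' hg, ⟨adj.comp adj'⟩⟩

/-- `S.R`: all objects of `S`, and those 1-morphisms of `S` which admit a left adjoint in `S`. -/
def R (S : SubBicat B) : SubBicat B where
  obj := S.obj
  hom {a b} f := S.hom f ∧ ∃ g : b ⟶ a, S.hom g ∧ Nonempty (Bicategory.Adjunction g f)
  id_mem {a} ha := ⟨S.id_mem ha, 𝟙 a, S.id_mem ha, ⟨Bicategory.Adjunction.id a⟩⟩
  comp_mem := by
    rintro a b c f f' ⟨hf, g, hg, ⟨adj⟩⟩ ⟨hf', g', hg', ⟨adj'⟩⟩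
    exact ⟨S.comp_mem hf hf', g' ≫ g, S.comp_mem hg' hg, ⟨adj'.comp adj⟩⟩

/-- The intersection of a sequence of sub-2-categories. -/
def inter (S : ℕ → SubBicat B) : SubBicat B where
  obj a := ∀ n, (S n).obj a
  hom f := ∀ n, (S n).hom f
  id_mem h n := (S n).id_mem (h n)
  comp_mem hf hg n := (S n).comp_mem (hf n) (hg n)

/-- The intersection of the iterates `S.L`, `S.L.L`, ... -/
def LInf (S : SubBicat B) : SubBicat B := inter fun n => L^[n] S

/-- The intersection of the iterates `S.R`, `S.R.R`, ... -/
def RInf (S : SubBicat B) : SubBicat B := inter fun n => R^[n] S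

/-- The maximal sub-2-category with duals for 1-morphisms: its 1-morphisms admit infinite chains
of successive right and left adjoints. -/
def d₁ (S : SubBicat B) : SubBicat B := S.LInf.RInf

/-- The objects of a sub-2-category. -/
structure Carrier (S : SubBicat B) where
  of : B
  mem : S.obj of

/-- The 1-morphisms of a sub-2-category. -/
structure Hom {S : SubBicat B} (a b : S.Carrier) where
  of : a.of ⟶ b.of
  mem : S.hom of

/-- The 2-morphisms of a sub-2-category. -/
@[ext]
structure Hom₂ {S : SubBicat B} {a b : S.Carrier} (f g : Hom a b) where
  of : f.of ⟶ g.of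

instance (S : SubBicat B) : CategoryStruct S.Carrier where
  Hom a b := Hom a b
  id a := ⟨𝟙 a.of, S.id_mem a.mem⟩
  comp f g := ⟨f.of ≫ g.of, S.comp_mem f.mem g.mem⟩

instance {S : SubBicat B} (a b : S.Carrier) : Category (a ⟶ b) where
  Hom f g := Hom₂ f g
  id f := ⟨𝟙 f.of⟩
  comp η θ := ⟨η.of ≫ θ.of⟩

section

variable {S : SubBicat B} {a b c : S.Carrier}

@[ext]
lemma hom₂_ext {f g : a ⟶ b} {η θ : f ⟶ g} (h : η.of = θ.of) : η = θ := Hom₂.ext h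

@[simp] lemma comp_of (f : a ⟶ b) (g : b ⟶ c) : (f ≫ g).of = f.of ≫ g.of := rfl

@[simp] lemma id_of (a : S.Carrier) : Hom.of (𝟙 a) = 𝟙 a.of := rfl

@[simp] lemma comp₂_of {f g h : a ⟶ b} (η : f ⟶ g) (θ : g ⟶ h) :
    (η ≫ θ).of = η.of ≫ θ.of := rfl

@[simp] lemma id₂_of (f : a ⟶ b) : Hom₂.of (𝟙 f) = 𝟙 f.of := rfl

/-- 2-isomorphisms of a sub-2-category. -/
@[simps]
def isoMk {f g : a ⟶ b} (e : f.of ≅ g.of) : f ≅ g where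
  hom := ⟨e.hom⟩
  inv := ⟨e.inv⟩

end

/-- A locally full sub-2-category, as a 2-category. -/
instance (S : SubBicat B) : Bicategory S.Carrier where
  homCategory a b := inferInstanceAs (Category (a ⟶ b))
  whiskerLeft f _ _ η := Hom₂.mk (Bicategory.whiskerLeft f.of (Hom₂.of η))
  whiskerRight η h := Hom₂.mk (Bicategory.whiskerRight (Hom₂.of η) h.of)
  associator f g h := isoMk (Bicategory.associator f.of g.of h.of)
  leftUnitor f := isoMk (Bicategory.leftUnitor f.of)
  rightUnitor f := isoMk (Bicategory.rightUnitor f.of)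
  whisker_exchange η θ := by ext; simpa using Bicategory.whisker_exchange _ _

/-- A functor landing in a sub-2-category, restricted to it. -/
def lift {A : Type u₁} [Bicategory.{w₂, v₁} A] (S : SubBicat B) (ι : PrelaxFunctor A B)
    (hobj : ∀ a, S.obj (ι.obj a)) (hmap : ∀ {a b : A} (f : a ⟶ b), S.hom (ι.map f)) :
    PrelaxFunctor A S.Carrier where
  obj a := ⟨ι.obj a, hobj a⟩
  map f := Hom.mk (ι.map f) (hmap f)
  map₂ η := Hom₂.mk (ι.map₂ η)
  map₂_id f := by ext; simp
  map₂_comp η θ := by ext; simp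

end SubBicat

/-- The operations of a symmetric monoidal structure on a 2-category, on objects and 1-morphisms.
(The coherence 2-morphisms do not enter the notion of a dualizable object.) -/
structure TensorData (B : Type u) [Bicategory.{w₁, v} B] where
  unit : B
  tensorObj : B → B → B
  tensorHom {a a' b b' : B} : (a ⟶ a') → (b ⟶ b') → (tensorObj a b ⟶ tensorObj a' b')
  assoc (a b c : B) : tensorObj (tensorObj a b) c ⟶ tensorObj a (tensorObj b c)
  assocInv (a b c : B) : tensorObj a (tensorObj b c) ⟶ tensorObj (tensorObj a b) c
  leftUnitor (a : B) : tensorObj unit a ⟶ a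
  rightUnitor (a : B) : tensorObj a unit ⟶ a
  braiding (a b : B) : tensorObj a b ⟶ tensorObj b a

namespace TensorData

variable {B : Type u} [Bicategory.{w₁, v} B] (T : TensorData B)

/-- `y` is a dual of `x` with evaluation `e : x ⊗ y ⟶ I` and coevaluation `c : I ⟶ y ⊗ x`: the
two zig-zag composites `x ⊗ I ⟶ x ⊗ (y ⊗ x) ⟶ (x ⊗ y) ⊗ x ⟶ I ⊗ x ⟶ x` and
`I ⊗ y ⟶ (y ⊗ x) ⊗ y ⟶ y ⊗ (x ⊗ y) ⟶ y ⊗ I ⟶ y` are isomorphic to the identity (i.e. to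
the unitors, once the unitors `x ⊗ I ⟶ x` and `I ⊗ y ⟶ y` are not suppressed). -/
structure IsDual {x y : B} (e : T.tensorObj x y ⟶ T.unit) (c : T.unit ⟶ T.tensorObj y x) :
    Prop where
  zigzag₁ : Nonempty (T.tensorHom (𝟙 x) c ≫ T.assocInv x y x ≫ T.tensorHom e (𝟙 x) ≫
    T.leftUnitor x ≅ T.rightUnitor x)
  zigzag₂ : Nonempty (T.tensorHom c (𝟙 y) ≫ T.assoc y x y ≫ T.tensorHom (𝟙 y) e ≫
    T.rightUnitor y ≅ T.leftUnitor y)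

/-- An object of the sub-2-category `S` is dualizable in `S` if it has a dual in `S`. -/
def IsDualizable (S : SubBicat B) (x : B) : Prop :=
  S.obj x ∧ ∃ (y : B) (e : T.tensorObj x y ⟶ T.unit) (c : T.unit ⟶ T.tensorObj y x),
    S.obj y ∧ S.hom e ∧ S.hom c ∧ T.IsDual e c

/-- The full sub-2-category of `S` on its dualizable objects. -/
def d₀ (S : SubBicat B) : SubBicat B where
  obj x := T.IsDualizable S x
  hom := S.hom
  id_mem h := S.id_mem h.1
  comp_mem := S.comp_mem

/-- The fully-dualizable sub-2-category. -/
def fd (S : SubBicat B) : SubBicat B := T.d₀ S.d₁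

/-- Compatibility of a functor with tensor products: it preserves the unit and the tensor product
of objects up to equivalences, which are compatible, up to isomorphism, with the tensor product of
1-morphisms, the associators, the unitors and the braidings. -/
structure Preserves {A : Type u₁} [Bicategory.{w₂, v₁} A] (T' : TensorData A) (T : TensorData B)
    (ι : PrelaxFunctor A B) (χ₀ : T.unit ≌ ι.obj T'.unit)
    (χ : ∀ a b, T.tensorObj (ι.obj a) (ι.obj b) ≌ ι.obj (T'.tensorObj a b)) : Prop where
  naturality {a a' b b' : A} (f : a ⟶ a') (g : b ⟶ b') :
    Nonempty (T.tensorHom (ι.map f) (ι.map g) ≫ (χ a' b').hom ≅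
      (χ a b).hom ≫ ι.map (T'.tensorHom f g))
  associativity (a b c : A) :
    Nonempty (T.tensorHom (χ a b).hom (𝟙 (ι.obj c)) ≫ (χ (T'.tensorObj a b) c).hom ≫
        ι.map (T'.assoc a b c) ≅
      T.assoc (ι.obj a) (ι.obj b) (ι.obj c) ≫ T.tensorHom (𝟙 (ι.obj a)) (χ b c).hom ≫
        (χ a (T'.tensorObj b c)).hom)
  left_unitality (a : A) :
    Nonempty (T.tensorHom χ₀.hom (𝟙 (ι.obj a)) ≫ (χ T'.unit a).hom ≫ ι.map (T'.leftUnitor a) ≅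
      T.leftUnitor (ι.obj a))
  right_unitality (a : A) :
    Nonempty (T.tensorHom (𝟙 (ι.obj a)) χ₀.hom ≫ (χ a T'.unit).hom ≫ ι.map (T'.rightUnitor a) ≅
      T.rightUnitor (ι.obj a))
  symmetry (a b : A) :
    Nonempty ((χ a b).hom ≫ ι.map (T'.braiding a b) ≅
      T.braiding (ι.obj a) (ι.obj b) ≫ (χ b a).hom)

end TensorData

/-- An equivalence of 2-categories: a functor which is essentially surjective and fully-faithful,
i.e. an equivalence on the categories of 1-morphisms. -/
structure IsBiequivalence {A : Type u₁} [Bicategory.{w₁, v₁} A] {B : Type u₂}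
    [Bicategory.{w₂, v₂} B] (F : Pseudofunctor A B) : Prop where
  essSurj : ∀ b : B, ∃ a : A, Nonempty (F.obj a ≌ b)
  homEquivalence : ∀ a a' : A, (F.mapFunctor a a').IsEquivalence

/-- The functor given on objects, 1-morphisms and 2-morphisms by `ι : A → B` lands in the
fully-dualizable sub-2-category of `S`, is an equivalence of 2-categories onto it,
and is compatible with the tensor products. -/
def InducesEquivalence {A : Type u₁} [Bicategory.{w₁, v₁} A] {B : Type u₂}
    [Bicategory.{w₂, v₂} B] (T' : TensorData A) (T : TensorData B) (S : SubBicat B)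
    (ι : PrelaxFunctor A B) : Prop :=
  (∃ (hobj : ∀ a, (T.fd S).obj (ι.obj a))
      (hmap : ∀ {a b : A} (f : a ⟶ b), (T.fd S).hom (ι.map f))
      (F : Pseudofunctor A (T.fd S).Carrier),
      F.toPrelaxFunctor = (T.fd S).lift ι hobj hmap ∧ IsBiequivalence F) ∧
    ∃ χ₀ χ, TensorData.Preserves T' T ι χ₀ χ

/-! ### Kapranov–Voevodsky 2-vector spaces -/

section KV

variable (k : Type u) [Field k]

/-- The objects of the Kapranov–Voevodsky 2-category: natural numbers. -/
structure KV (k : Type u) where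
  n : ℕ

namespace KV

variable {k}

/-- A 1-morphism `a ⟶ b`: an `a × b`-matrix of finite-dimensional vector spaces. -/
structure Hom (a b : KV k) where
  entry : Fin a.n → Fin b.n → FGModuleCat.{u} k

/-- A 2-morphism: a matrix of linear maps. -/
@[ext]
structure Hom₂ {a b : KV k} (M N : Hom a b) where
  entry : ∀ i j, M.entry i j →ₗ[k] N.entry i j

instance (a b : KV k) : Category (Hom a b) where
  Hom M N := Hom₂ M N
  id M := ⟨fun _ _ => LinearMap.id⟩
  comp f g := ⟨fun i j => g.entry i j ∘ₗ f.entry i j⟩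

section

variable {a b c d : KV k}

@[ext]
lemma hom₂_ext {M N : Hom a b} {f g : M ⟶ N} (h : ∀ i j x, f.entry i j x = g.entry i j x) :
    f = g :=
  Hom₂.ext (funext fun i => funext fun j => LinearMap.ext (h i j))

@[simp] lemma id_entry (M : Hom a b) (i j x) : Hom₂.entry (𝟙 M) i j x = x := rfl

@[simp] lemma comp_entry {M N P : Hom a b} (f : M ⟶ N) (g : N ⟶ P) (i j x) :
    (f ≫ g).entry i j x = g.entry i j (f.entry i j x) := rfl

/-- The vector space `⨁ j, M i j ⊗ N j l`. -/
abbrev MulEntry (M : Hom a b) (N : Hom b c) (i : Fin a.n) (l : Fin c.n) : Type u :=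
  DirectSum (Fin b.n) fun j => M.entry i j ⊗[k] N.entry j l

/-- The product of matrices of vector spaces. -/
def mul (M : Hom a b) (N : Hom b c) : Hom a c :=
  ⟨fun i l => FGModuleCat.of k (MulEntry M N i l)⟩

/-- The element `m ⊗ n` of the `j`-th summand of an entry of a product. -/
def tmul {M : Hom a b} {N : Hom b c} {i : Fin a.n} {l : Fin c.n} (j : Fin b.n) :
    M.entry i j →ₗ[k] N.entry j l →ₗ[k] (mul M N).entry i l :=
  (TensorProduct.mk k _ _).compr₂
    (DirectSum.lof k (Fin b.n) (fun j => M.entry i j ⊗[k] N.entry j l) j)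

/-- Linear maps out of an entry of a product. -/
def desc {M : Hom a b} {N : Hom b c} {i : Fin a.n} {l : Fin c.n} {X : Type u} [AddCommGroup X]
    [Module k X] (φ : ∀ j, M.entry i j →ₗ[k] N.entry j l →ₗ[k] X) :
    (mul M N).entry i l →ₗ[k] X :=
  DirectSum.toModule k (Fin b.n) X fun j => TensorProduct.lift (φ j)

@[simp]
lemma desc_tmul {M : Hom a b} {N : Hom b c} {i : Fin a.n} {l : Fin c.n} {X : Type u}
    [AddCommGroup X] [Module k X] (φ : ∀ j, M.entry i j →ₗ[k] N.entry j l →ₗ[k] X) (j m n) :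
    desc φ (tmul j m n) = φ j m n := by
  simp only [desc, tmul]
  erw [DirectSum.toModule_lof]
  simp

@[elab_as_elim]
lemma mul_induction {M : Hom a b} {N : Hom b c} {i : Fin a.n} {l : Fin c.n}
    {p : (mul M N).entry i l → Prop} (x : (mul M N).entry i l) (h0 : p 0)
    (hadd : ∀ x y, p x → p y → p (x + y)) (htmul : ∀ j m n, p (tmul j m n)) : p x := by
  change MulEntry M N i l at x
  induction x using DirectSum.induction_on with
  | zero => exact h0
  | add x y hx hy => exact hadd x y hx hy
  | of j t =>
    induction t using TensorProduct.induction_on with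
    | zero => rw [map_zero]; exact h0
    | add x y hx hy => rw [map_add]; exact hadd _ _ hx hy
    | tmul m n => exact htmul j m n

/-- The bijection `σ`, as a matrix: the entries are `k` at the places `(i, σ i)` (written as
functions on a one-point type) and zero elsewhere (written as functions on an empty type). -/
def perm (σ : Fin a.n ≃ Fin b.n) : Hom a b :=
  ⟨fun i j => FGModuleCat.of k (PLift (σ i = j) → k)⟩

/-- The identity matrix. -/
def one (a : KV k) : Hom a a := perm (Equiv.refl _)

/-- The action of the identity matrix from the left. -/
def oneSmul {N : Hom a b} {i : Fin a.n} {l : Fin b.n} (j : Fin a.n) :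
    (one a).entry i j →ₗ[k] N.entry j l →ₗ[k] N.entry i l :=
  if h : i = j then by
    subst h
    exact LinearMap.lsmul k _ ∘ₗ (LinearMap.proj (φ := fun _ : PLift (i = i) => k) ⟨rfl⟩)
  else 0

/-- The action of the identity matrix from the right. -/
def smulOne {M : Hom a b} {i : Fin a.n} {l : Fin b.n} (j : Fin b.n) :
    M.entry i j →ₗ[k] (one b).entry j l →ₗ[k] M.entry i l :=
  if h : j = l then by
    subst h
    exact (LinearMap.lsmul k _ ∘ₗ
      (LinearMap.proj (φ := fun _ : PLift (j = j) => k) ⟨rfl⟩)).flip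
  else 0

/-- The unit element of a diagonal entry of the identity matrix. -/
def oneElt (i : Fin a.n) : (one a).entry i i := fun _ : PLift (i = i) => (1 : k)

lemma one_ext {i : Fin a.n} (x : (one a).entry i i) :
    x = (show PLift (i = i) → k from x) ⟨rfl⟩ • oneElt i :=
  funext fun _ : PLift (i = i) => (mul_one ((show PLift (i = i) → k from x) ⟨rfl⟩)).symm

lemma one_zero {i j : Fin a.n} (h : i ≠ j) (x : (one a).entry i j) : x = 0 :=
  funext fun p : PLift (i = j) => (h p.down).elim

@[simp]
lemma oneSmul_oneElt {N : Hom a b} {i : Fin a.n} {l : Fin b.n} (n : N.entry i l) :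
    oneSmul i (oneElt i) n = n := by
  simp only [oneSmul, dif_pos]
  exact one_smul k n

@[simp]
lemma smulOne_oneElt {M : Hom a b} {i : Fin a.n} {l : Fin b.n} (m : M.entry i l) :
    smulOne l m (oneElt l) = m := by
  unfold smulOne
  rw [dif_pos rfl]
  exact one_smul k m

section

variable {M : Hom a b} {N : Hom b c} {P : Hom c d} {Q : Hom a c} {Q' : Hom a d} {O : Hom a b}

lemma hom_ext_mul {η θ : mul M N ⟶ Q}
    (h : ∀ i l j m n, η.entry i l (tmul j m n) = θ.entry i l (tmul j m n)) : η = θ := by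
  ext i l x
  induction x using mul_induction with
  | h0 => simp only [map_zero]
  | hadd x y hx hy => simp only [map_add, hx, hy]
  | htmul j m n => exact h i l j m n

lemma hom_ext_mul_mul {η θ : mul (mul M N) P ⟶ Q'}
    (h : ∀ i l j j' m n p, η.entry i l (tmul j' (tmul j m n) p) =
      θ.entry i l (tmul j' (tmul j m n) p)) : η = θ :=
  hom_ext_mul fun i l j' x p => by
    induction x using mul_induction with
    | h0 => simp only [map_zero, LinearMap.zero_apply]
    | hadd x y hx hy => simp only [map_add, LinearMap.add_apply, hx, hy]
    | htmul j m n => exact h i l j j' m n p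

lemma hom_ext_mul_mul' {η θ : mul M (mul N P) ⟶ Q'}
    (h : ∀ i l j j' m n p, η.entry i l (tmul j m (tmul j' n p)) =
      θ.entry i l (tmul j m (tmul j' n p))) : η = θ :=
  hom_ext_mul fun i l j m x => by
    induction x using mul_induction with
    | h0 => simp only [map_zero]
    | hadd x y hx hy => simp only [map_add, hx, hy]
    | htmul j' n p => exact h i l j j' m n p

lemma hom_ext_one_mul {η θ : mul (one a) M ⟶ O}
    (h : ∀ i l m, η.entry i l (tmul i (oneElt i) m) = θ.entry i l (tmul i (oneElt i) m)) :
    η = θ :=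
  hom_ext_mul fun i l j x m => by
    by_cases hij : i = j
    · subst hij
      rw [one_ext x]
      simp only [map_smul, LinearMap.smul_apply, h]
    · simp only [one_zero hij x, map_zero, LinearMap.zero_apply]

lemma hom_ext_mul_one {η θ : mul M (one b) ⟶ O}
    (h : ∀ i l m, η.entry i l (tmul l m (oneElt l)) = θ.entry i l (tmul l m (oneElt l))) :
    η = θ :=
  hom_ext_mul fun i l j m x => by
    by_cases hjl : j = l
    · subst hjl
      rw [one_ext x]
      simp only [map_smul, h]
    · simp only [one_zero hjl x, map_zero]

end

/-- Whiskering on the left. -/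
def whiskerLeft (M : Hom a b) {N N' : Hom b c} (η : N ⟶ N') : mul M N ⟶ mul M N' :=
  Hom₂.mk fun _ l => desc fun j => (tmul j).compl₂ (Hom₂.entry η j l)

/-- Whiskering on the right. -/
def whiskerRight {M M' : Hom a b} (η : M ⟶ M') (N : Hom b c) : mul M N ⟶ mul M' N :=
  Hom₂.mk fun i _ => desc fun j => tmul j ∘ₗ Hom₂.entry η i j

/-- The associator. -/
def associatorHom (M : Hom a b) (N : Hom b c) (P : Hom c d) :
    mul (mul M N) P ⟶ mul M (mul N P) :=
  Hom₂.mk fun _ _ => desc fun j' => desc fun j =>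
    (LinearMap.llcomp k _ _ _).compl₁₂ (tmul j) (tmul j')

/-- The inverse of the associator. -/
def associatorInv (M : Hom a b) (N : Hom b c) (P : Hom c d) :
    mul M (mul N P) ⟶ mul (mul M N) P :=
  Hom₂.mk fun _ _ => desc fun j => LinearMap.flip (desc fun j' =>
    LinearMap.lflip.toLinearMap ∘ₗ ((tmul j).compr₂ (tmul j')).flip)

/-- The left unitor. -/
def leftUnitorHom (M : Hom a b) : mul (one a) M ⟶ M :=
  Hom₂.mk fun _ _ => desc oneSmul

/-- The inverse of the left unitor. -/
def leftUnitorInv (M : Hom a b) : M ⟶ mul (one a) M :=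
  Hom₂.mk fun i _ => tmul i (oneElt i)

/-- The right unitor. -/
def rightUnitorHom (M : Hom a b) : mul M (one b) ⟶ M :=
  Hom₂.mk fun _ _ => desc smulOne

/-- The inverse of the right unitor. -/
def rightUnitorInv (M : Hom a b) : M ⟶ mul M (one b) :=
  Hom₂.mk fun _ l => (tmul l).flip (oneElt l)

section

variable {i : Fin a.n}

@[simp] lemma whiskerLeft_tmul (M : Hom a b) {N N' : Hom b c} (η : N ⟶ N') (l j m n) :
    (whiskerLeft M η).entry i l (tmul j m n) = tmul j m (η.entry j l n) := by
  simp [whiskerLeft]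

@[simp] lemma whiskerRight_tmul {M M' : Hom a b} (η : M ⟶ M') (N : Hom b c) (l j m n) :
    (whiskerRight η N).entry i l (tmul j m n) = tmul j (η.entry i j m) n := by
  simp [whiskerRight]

@[simp] lemma associatorHom_tmul (M : Hom a b) (N : Hom b c) (P : Hom c d) (l j j' m n p) :
    (associatorHom M N P).entry i l (tmul j' (tmul j m n) p) = tmul j m (tmul j' n p) := by
  simp [associatorHom]

@[simp] lemma associatorInv_tmul (M : Hom a b) (N : Hom b c) (P : Hom c d) (l j j' m n p) :
    (associatorInv M N P).entry i l (tmul j m (tmul j' n p)) = tmul j' (tmul j m n) p := by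
  simp [associatorInv]

@[simp] lemma leftUnitorHom_tmul (M : Hom a b) (l x) :
    (leftUnitorHom M).entry i l (tmul i (oneElt i) x) = x := by
  simp [leftUnitorHom]

@[simp] lemma leftUnitorInv_apply (M : Hom a b) (l x) :
    (leftUnitorInv M).entry i l x = tmul i (oneElt i) x := rfl

@[simp] lemma rightUnitorHom_tmul (M : Hom a b) (l x) :
    (rightUnitorHom M).entry i l (tmul l x (oneElt l)) = x := by
  simp [rightUnitorHom]

@[simp] lemma rightUnitorInv_apply (M : Hom a b) (l x) :
    (rightUnitorInv M).entry i l x = tmul l x (oneElt l) := rfl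

end

end

instance : Bicategory (KV k) where
  Hom := Hom
  id := one
  comp := mul
  whiskerLeft := whiskerLeft
  whiskerRight := whiskerRight
  associator M N P :=
    { hom := associatorHom M N P
      inv := associatorInv M N P
      hom_inv_id := by apply hom_ext_mul_mul; intros; simp
      inv_hom_id := by apply hom_ext_mul_mul'; intros; simp }
  leftUnitor M :=
    { hom := leftUnitorHom M
      inv := leftUnitorInv M
      hom_inv_id := by apply hom_ext_one_mul; intros; simp
      inv_hom_id := by ext; simp }
  rightUnitor M :=
    { hom := rightUnitorHom M
      inv := rightUnitorInv M
      hom_inv_id := by apply hom_ext_mul_one; intros; simp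
      inv_hom_id := by ext; simp }
  whiskerLeft_id := by intros; apply hom_ext_mul; intros; simp
  whiskerLeft_comp := by intros; apply hom_ext_mul; intros; simp
  id_whiskerLeft := by intros; apply hom_ext_one_mul; intros; simp
  comp_whiskerLeft := by intros; apply hom_ext_mul_mul; intros; simp
  id_whiskerRight := by intros; apply hom_ext_mul; intros; simp
  comp_whiskerRight := by intros; apply hom_ext_mul; intros; simp
  whiskerRight_id := by intros; apply hom_ext_mul_one; intros; simp
  whiskerRight_comp := by intros; apply hom_ext_mul_mul'; intros; simp
  whisker_assoc := by intros; apply hom_ext_mul_mul; intros; simp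
  whisker_exchange := by intros; apply hom_ext_mul; intros; simp
  pentagon := by
    intros
    apply hom_ext_mul_mul
    intro _ _ _ _ x _ _
    induction x using mul_induction with
    | h0 => simp only [map_zero, LinearMap.zero_apply]
    | hadd x y hx hy => simp only [map_add, LinearMap.add_apply, hx, hy]
    | htmul => simp
  triangle := by
    intros
    apply hom_ext_mul_mul
    intro i l j' j m x n
    by_cases h : j' = j
    · subst h
      rw [one_ext x]
      simp
    · rw [one_zero h x]
      simp

/-- The tensor product of matrices. -/
def tensorHom {a a' b b' : KV k} (M : Hom a a') (N : Hom b b') :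
    Hom (k := k) ⟨a.n * b.n⟩ ⟨a'.n * b'.n⟩ :=
  ⟨fun i j => FGModuleCat.of k
    (M.entry (finProdFinEquiv.symm i).1 (finProdFinEquiv.symm j).1 ⊗[k]
      N.entry (finProdFinEquiv.symm i).2 (finProdFinEquiv.symm j).2)⟩

/-- The monoidal structure: the product of natural numbers and the tensor product of matrices. -/
def tensorData (k : Type u) [Field k] : TensorData (KV k) where
  unit := ⟨1⟩
  tensorObj a b := ⟨a.n * b.n⟩
  tensorHom := tensorHom
  assoc a b c := perm (finCongr (mul_assoc a.n b.n c.n))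
  assocInv a b c := perm (finCongr (mul_assoc a.n b.n c.n).symm)
  leftUnitor a := perm (finCongr (one_mul a.n))
  rightUnitor a := perm (finCongr (mul_one a.n))
  braiding a b := perm (finProdFinEquiv.symm.trans
    ((Equiv.prodComm (Fin a.n) (Fin b.n)).trans finProdFinEquiv))

end KV

end KV

/-! ### Algebras and bimodules -/

section Alg

section

variable {C : Type u₁} [Category.{v₁} C] [MonoidalCategory C]

open MonObj

/-- The bimodule `B` over `A` and `B`, for a morphism of algebras `f : A ⟶ B`. -/
def bimodOfHom {A B : Mon C} (f : A ⟶ B) : Bimod A B where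
  X := B.X
  actLeft := f.hom ▷ B.X ≫ μ
  one_actLeft := by
    rw [← comp_whiskerRight_assoc, IsMonHom.one_hom, MonObj.one_mul]
  left_assoc := by
    rw [← comp_whiskerRight_assoc, IsMonHom.mul_hom]
    simp only [MonoidalCategory.tensorHom_def, Category.assoc, comp_whiskerRight, MonObj.mul_assoc,
      whiskerLeft_comp]
    rw [associator_naturality_middle_assoc, associator_naturality_left_assoc,
      ← whisker_exchange_assoc, ← whisker_exchange_assoc]
  actRight := μ
  middle_assoc := by
    simp only [comp_whiskerRight, Category.assoc, MonObj.mul_assoc]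
    rw [associator_naturality_left_assoc, ← whisker_exchange_assoc]

variable [BraidedCategory C]

lemma tensor_assoc_aux {X₁ X₂ Y₁ Y₂ Z₁ Z₂ U₁ U₂ V₁ V₂ W₁ W₂ : C}
    {p₁ : X₁ ⊗ Y₁ ⟶ U₁} {q₁ : U₁ ⊗ Z₁ ⟶ W₁} {r₁ : Y₁ ⊗ Z₁ ⟶ V₁} {s₁ : X₁ ⊗ V₁ ⟶ W₁}
    {p₂ : X₂ ⊗ Y₂ ⟶ U₂} {q₂ : U₂ ⊗ Z₂ ⟶ W₂} {r₂ : Y₂ ⊗ Z₂ ⟶ V₂} {s₂ : X₂ ⊗ V₂ ⟶ W₂}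
    (h₁ : p₁ ▷ Z₁ ≫ q₁ = (α_ X₁ Y₁ Z₁).hom ≫ X₁ ◁ r₁ ≫ s₁)
    (h₂ : p₂ ▷ Z₂ ≫ q₂ = (α_ X₂ Y₂ Z₂).hom ≫ X₂ ◁ r₂ ≫ s₂) :
    (tensorμ X₁ X₂ Y₁ Y₂ ≫ (p₁ ⊗ₘ p₂)) ▷ (Z₁ ⊗ Z₂) ≫ tensorμ U₁ U₂ Z₁ Z₂ ≫ (q₁ ⊗ₘ q₂) =
      (α_ (X₁ ⊗ X₂) (Y₁ ⊗ Y₂) (Z₁ ⊗ Z₂)).hom ≫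
        (X₁ ⊗ X₂) ◁ (tensorμ Y₁ Y₂ Z₁ Z₂ ≫ (r₁ ⊗ₘ r₂)) ≫
          tensorμ X₁ X₂ V₁ V₂ ≫ (s₁ ⊗ₘ s₂) := by
  simp only [comp_whiskerRight_assoc, whiskerLeft_comp_assoc]
  slice_lhs 2 3 => rw [tensorμ_natural_left]
  slice_lhs 3 4 => rw [tensorHom_comp_tensorHom, h₁, h₂, ← tensorHom_comp_tensorHom,
    ← tensorHom_comp_tensorHom]
  slice_lhs 1 3 => rw [tensor_associativity]
  slice_lhs 3 4 => rw [← tensorμ_natural_right]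
  simp

/-- The tensor product of bimodules. -/
def bimodTensor {A A' B B' : Mon C} (M : Bimod A A') (N : Bimod B B') :
    Bimod (A ⊗ B) (A' ⊗ B') where
  X := M.X ⊗ N.X
  actLeft := tensorμ A.X B.X M.X N.X ≫ (M.actLeft ⊗ₘ N.actLeft)
  one_actLeft := by
    rw [Mon.tensorObj_one]
    simp only [comp_whiskerRight_assoc]
    slice_lhs 2 3 => rw [tensorμ_natural_left]
    slice_lhs 3 4 => rw [tensorHom_comp_tensorHom, M.one_actLeft, N.one_actLeft]
    exact (tensor_left_unitality M.X N.X).symm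
  left_assoc := by
    rw [Mon.tensorObj_mul]
    exact tensor_assoc_aux M.left_assoc N.left_assoc
  actRight := tensorμ M.X N.X A'.X B'.X ≫ (M.actRight ⊗ₘ N.actRight)
  actRight_one := by
    rw [Mon.tensorObj_one]
    simp only [whiskerLeft_comp_assoc]
    slice_lhs 2 3 => rw [tensorμ_natural_right]
    slice_lhs 3 4 => rw [tensorHom_comp_tensorHom, M.actRight_one, N.actRight_one]
    exact (tensor_right_unitality M.X N.X).symm
  right_assoc := by
    rw [Mon.tensorObj_mul, Iso.eq_inv_comp]
    refine (tensor_assoc_aux ?_ ?_).symm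
    · simp
    · simp
  middle_assoc := tensor_assoc_aux M.middle_assoc N.middle_assoc

end

variable (k : Type u) [Field k]

/-- Algebras over `k`, as monoids in the monoidal category of vector spaces over `k`. -/
def ALG : Type (u + 1) := Mon (ModuleCat.{u} k)

/-- The 2-category of algebras, bimodules and bimodule maps; the composite of an `A`-`B`-bimodule
`M : A ⟶ B` and a `B`-`C`-bimodule `N : B ⟶ C` is `M ⊗_B N`. -/
instance : Bicategory (ALG k) := Bimod.monBicategory (C := ModuleCat.{u} k)

namespace ALG

variable {k}

/-- The algebra underlying an object. -/
def mon (A : ALG k) : Mon (ModuleCat.{u} k) := A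

/-- The bimodule underlying a 1-morphism. -/
def bimod {A B : ALG k} (M : A ⟶ B) : Bimod A.mon B.mon := M

variable (k)

/-- The tensor product over `k` of algebras and of bimodules; the structure morphisms are given by
the associator, unitor and braiding isomorphisms of algebras. -/
def tensorData : TensorData (ALG k) where
  unit := 𝟙_ (Mon (ModuleCat.{u} k))
  tensorObj (A B : Mon (ModuleCat.{u} k)) := (A ⊗ B : Mon (ModuleCat.{u} k))
  tensorHom M N := bimodTensor M N
  assoc (A B C : Mon (ModuleCat.{u} k)) := bimodOfHom (α_ A B C).hom
  assocInv (A B C : Mon (ModuleCat.{u} k)) := bimodOfHom (α_ A B C).inv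
  leftUnitor (A : Mon (ModuleCat.{u} k)) := bimodOfHom (λ_ A).hom
  rightUnitor (A : Mon (ModuleCat.{u} k)) := bimodOfHom (ρ_ A).hom
  braiding (A B : Mon (ModuleCat.{u} k)) := bimodOfHom (β_ A B).hom

/-- The sub-2-category `alg` of finite-dimensional algebras and finite-dimensional bimodules. -/
def alg : SubBicat (ALG k) where
  obj A := Module.Finite k A.mon.X
  hom M := Module.Finite k (bimod M).X
  id_mem h := h
  comp_mem {A B C} {M N} hM hN := by
    let M := bimod M
    let N := bimod N
    let π : (M.X ⊗ N.X : ModuleCat.{u} k) ⟶ Bimod.TensorBimod.X M N := coequalizer.π _ _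
    have : Module.Finite k (M.X ⊗ N.X : ModuleCat.{u} k) :=
      haveI : Module.Finite k M.X := hM
      haveI : Module.Finite k N.X := hN
      inferInstanceAs (Module.Finite k (M.X ⊗[k] N.X))
    exact Module.Finite.of_surjective π.hom ((ModuleCat.epi_iff_surjective π).1
      (coequalizer.π_epi))

/-- The algebra `k × ... × k` (`n` factors). -/
def pow (n : ℕ) : ALG k :=
  ModuleCat.MonModuleEquivalenceAlgebra.inverse.obj (AlgCat.of k (Fin n → k))

variable {k}

/-- The action of `k × ... × k` on the rows of a matrix. -/
def rowSmul {m n : ℕ} (E : Fin m → Fin n → Type u) [∀ i j, AddCommGroup (E i j)]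
    [∀ i j, Module k (E i j)] : (Fin m → k) →ₗ[k] (∀ i j, E i j) →ₗ[k] (∀ i j, E i j) :=
  LinearMap.mk₂ k (fun r x i j => r i • x i j)
    (fun _ _ _ => funext fun _ => funext fun _ => add_smul _ _ _)
    (fun _ _ _ => funext fun _ => funext fun _ => mul_smul _ _ _)
    (fun _ _ _ => funext fun _ => funext fun _ => smul_add _ _ _)
    (fun _ _ _ => funext fun _ => funext fun _ => smul_comm _ _ _)

/-- The action of `k × ... × k` on the columns of a matrix. -/
def colSmul {m n : ℕ} (E : Fin m → Fin n → Type u) [∀ i j, AddCommGroup (E i j)]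
    [∀ i j, Module k (E i j)] : (∀ i j, E i j) →ₗ[k] (Fin n → k) →ₗ[k] (∀ i j, E i j) :=
  LinearMap.mk₂ k (fun x r i j => r j • x i j)
    (fun _ _ _ => funext fun _ => funext fun _ => smul_add _ _ _)
    (fun _ _ _ => funext fun _ => funext fun _ => smul_comm _ _ _)
    (fun _ _ _ => funext fun _ => funext fun _ => add_smul _ _ _)
    (fun _ _ _ => funext fun _ => funext fun _ => mul_smul _ _ _)

/-- The direct sum of the entries of a matrix of vector spaces, as a bimodule: the `i`-th factor
of `k × ... × k` acts on the `i`-th row from the left, the `j`-th factor of `k × ... × k` acts on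
the `j`-th column from the right. -/
def ofMatrix {a b : KV k} (M : a ⟶ b) : Bimod (pow k a.n).mon (pow k b.n).mon where
  X := ModuleCat.of k (∀ i j, KV.Hom.entry M i j)
  actLeft := ModuleCat.ofHom (TensorProduct.lift (rowSmul fun i j => KV.Hom.entry M i j))
  one_actLeft := by
    refine ModuleCat.MonoidalCategory.tensor_ext fun r m => ?_
    rfl
  left_assoc := by
    refine ModuleCat.MonoidalCategory.tensor_ext₃' fun r s m => ?_
    exact funext fun i => funext fun j => mul_smul (r i) (s i) (m i j)
  actRight := ModuleCat.ofHom (TensorProduct.lift (colSmul fun i j => KV.Hom.entry M i j))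
  actRight_one := by
    refine ModuleCat.MonoidalCategory.tensor_ext fun m r => ?_
    rfl
  right_assoc := by
    refine ModuleCat.MonoidalCategory.tensor_ext₃ fun m r s => ?_
    exact funext fun i => funext fun j =>
      (congrArg (· • m i j) (mul_comm (r j) (s j))).trans (mul_smul (s j) (r j) (m i j))
  middle_assoc := by
    refine ModuleCat.MonoidalCategory.tensor_ext₃' fun r m s => ?_
    exact funext fun i => funext fun j => smul_comm (s j) (r i) (m i j)

/-- The natural inclusion of the Kapranov–Voevodsky 2-category into the 2-category of algebras:
`n` is sent to the `n`-fold product `k × ... × k`, a matrix of vector spaces is sent to the direct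
sum of its entries. -/
def incl (k : Type u) [Field k] : PrelaxFunctor (KV k) (ALG k) where
  obj a := pow k a.n
  map M := ofMatrix M
  map₂ {a b M N} η := Bimod.Hom.mk (M := ofMatrix M) (N := ofMatrix N)
    (ModuleCat.ofHom (LinearMap.pi fun i => LinearMap.pi fun j =>
      KV.Hom₂.entry η i j ∘ₗ LinearMap.proj j ∘ₗ LinearMap.proj i))
    (by
      refine ModuleCat.MonoidalCategory.tensor_ext fun r m => ?_
      exact funext fun i => funext fun j => map_smul (KV.Hom₂.entry η i j) (r i) (m i j))
    (by
      refine ModuleCat.MonoidalCategory.tensor_ext fun m r => ?_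
      exact funext fun i => funext fun j => map_smul (KV.Hom₂.entry η i j) (r j) (m i j))
  map₂_id _ := rfl
  map₂_comp _ _ := rfl

end ALG

end Alg

/-! ### Linear categories -/

section LinTensor

variable (k : Type u) [Field k]

/-- The tensor product `C ⊠ D` of linear categories: its objects are pairs of objects. -/
structure LinTensor (k : Type u) (C : Type u₁) (D : Type u₂) where
  fst : C
  snd : D

namespace LinTensor

variable {C : Type u₁} [Category.{u} C] [Preadditive C] [CategoryTheory.Linear k C]
  {D : Type u₂} [Category.{u} D] [Preadditive D] [CategoryTheory.Linear k D]

/-- The composition of `C ⊠ D`, with `(f ⊗ g) ≫ (f' ⊗ g') = (f ≫ f') ⊗ (g ≫ g')`. -/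
def compl (X Y Z : LinTensor k C D) :
    ((X.fst ⟶ Y.fst) ⊗[k] (X.snd ⟶ Y.snd)) →ₗ[k] ((Y.fst ⟶ Z.fst) ⊗[k] (Y.snd ⟶ Z.snd)) →ₗ[k]
      ((X.fst ⟶ Z.fst) ⊗[k] (X.snd ⟶ Z.snd)) :=
  TensorProduct.map₂ (Linear.comp X.fst Y.fst Z.fst) (Linear.comp X.snd Y.snd Z.snd)

/-- The morphisms of `C ⊠ D` are the tensor products of the spaces of morphisms. -/
instance : Category.{u} (LinTensor k C D) where
  Hom X Y := (X.fst ⟶ Y.fst) ⊗[k] (X.snd ⟶ Y.snd)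
  id X := 𝟙 X.fst ⊗ₜ 𝟙 X.snd
  comp {X Y Z} f g := compl k X Y Z f g
  id_comp {X Y} f := by
    induction f using TensorProduct.induction_on with
    | zero => simp
    | add x y hx hy => rw [map_add, hx, hy]
    | tmul f g => simp [compl]
  comp_id {X Y} f := by
    induction f using TensorProduct.induction_on with
    | zero => simp
    | add x y hx hy => rw [map_add, LinearMap.add_apply, hx, hy]
    | tmul f g => simp [compl]
  assoc {W X Y Z} f g h := by
    induction f using TensorProduct.induction_on with
    | zero => simp
    | add x y hx hy => simp only [map_add, LinearMap.add_apply, hx, hy]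
    | tmul f f' =>
      induction g using TensorProduct.induction_on with
      | zero => simp
      | add x y hx hy => simp only [map_add, LinearMap.add_apply, hx, hy]
      | tmul g g' =>
        induction h using TensorProduct.induction_on with
        | zero => simp
        | add x y hx hy => simp only [map_add, hx, hy]
        | tmul h h' => simp [compl]

instance : Preadditive (LinTensor k C D) where
  homGroup X Y := inferInstanceAs (AddCommGroup ((X.fst ⟶ Y.fst) ⊗[k] (X.snd ⟶ Y.snd)))
  add_comp X Y Z f f' g := LinearMap.map_add₂ (compl k X Y Z) f f' g
  comp_add X Y Z f g g' := LinearMap.map_add (compl k X Y Z f) g g'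

instance : CategoryTheory.Linear k (LinTensor k C D) where
  homModule X Y := inferInstanceAs (Module k ((X.fst ⟶ Y.fst) ⊗[k] (X.snd ⟶ Y.snd)))
  smul_comp X Y Z r f g := LinearMap.map_smul₂ (compl k X Y Z) r f g
  comp_smul X Y Z f r g := LinearMap.map_smul (compl k X Y Z f) r g

/-- The morphism `f ⊗ g` of `C ⊠ D`. -/
def tmul {X Y : LinTensor k C D} :
    (X.fst ⟶ Y.fst) →ₗ[k] (X.snd ⟶ Y.snd) →ₗ[k] (X ⟶ Y) :=
  TensorProduct.mk k _ _

@[elab_as_elim]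
lemma hom_induction {X Y : LinTensor k C D} {p : (X ⟶ Y) → Prop} (f : X ⟶ Y) (h0 : p 0)
    (hadd : ∀ f g, p f → p g → p (f + g)) (htmul : ∀ f g, p (tmul k f g)) : p f :=
  TensorProduct.induction_on (motive := p) f h0 htmul hadd

@[simp]
lemma id_eq (X : LinTensor k C D) : 𝟙 X = tmul k (𝟙 X.fst) (𝟙 X.snd) := rfl

@[simp]
lemma tmul_comp {X Y Z : LinTensor k C D} (f : X.fst ⟶ Y.fst) (g : X.snd ⟶ Y.snd)
    (f' : Y.fst ⟶ Z.fst) (g' : Y.snd ⟶ Z.snd) :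
    (tmul k f g : X ⟶ Y) ≫ (tmul k f' g' : Y ⟶ Z) = tmul k (f ≫ f') (g ≫ g') := by
  change compl k X Y Z (f ⊗ₜ g) (f' ⊗ₜ g') = (f ≫ f') ⊗ₜ (g ≫ g')
  simp [compl]

end LinTensor

/-- A `k`-algebra `A`, as a linear category with one object. -/
structure Star (A : Type u) : Type u where

instance (A : Type u) [Ring A] : Category.{u} (Star A) where
  Hom _ _ := A
  id _ := 1
  comp f g := f * g
  id_comp := one_mul
  comp_id := mul_one
  assoc := mul_assoc

instance (A : Type u) [Ring A] : Preadditive (Star A) where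
  homGroup _ _ := inferInstanceAs (AddCommGroup A)
  add_comp _ _ _ f f' g := add_mul (R := A) f f' g
  comp_add _ _ _ f g g' := mul_add (R := A) f g g'

instance (A : Type u) [Ring A] [Algebra k A] : CategoryTheory.Linear k (Star A) where
  homModule _ _ := inferInstanceAs (Module k A)
  smul_comp _ _ _ r f g := smul_mul_assoc (β := A) r f g
  comp_smul _ _ _ f r g := mul_smul_comm (β := A) r f g

end LinTensor

section LinTensorFunctors

variable {k : Type u} [Field k]

/-- A linear functor, from its linear effect on morphisms. -/
@[simps]
def linFunctor {C : Type u₁} [Category.{u} C] [Preadditive C] [CategoryTheory.Linear k C]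
    {D : Type u₂} [Category.{u} D] [Preadditive D] [CategoryTheory.Linear k D] (obj : C → D)
    (map : ∀ X Y : C, (X ⟶ Y) →ₗ[k] (obj X ⟶ obj Y))
    (map_id : ∀ X, map X X (𝟙 X) = 𝟙 (obj X))
    (map_comp : ∀ (X Y Z : C) (f : X ⟶ Y) (g : Y ⟶ Z),
      map X Z (f ≫ g) = map X Y f ≫ map Y Z g) : C ⥤ D where
  obj := obj
  map {X Y} f := map X Y f
  map_id := map_id
  map_comp f g := map_comp _ _ _ f g

section

variable {C : Type u₁} [Category.{u} C] [Preadditive C] [CategoryTheory.Linear k C]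
  {D : Type u₂} [Category.{u} D] [Preadditive D] [CategoryTheory.Linear k D] {obj : C → D}
  {map : ∀ X Y : C, (X ⟶ Y) →ₗ[k] (obj X ⟶ obj Y)} {map_id : ∀ X, map X X (𝟙 X) = 𝟙 (obj X)}
  {map_comp : ∀ (X Y Z : C) (f : X ⟶ Y) (g : Y ⟶ Z), map X Z (f ≫ g) = map X Y f ≫ map Y Z g}

lemma linFunctor_additive : (linFunctor obj map map_id map_comp).Additive where
  map_add {X Y f g} := map_add (map X Y) f g

lemma linFunctor_linear : (linFunctor obj map map_id map_comp).Linear k where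
  map_smul {X Y} f r := map_smul (map X Y) r f

end

namespace LinTensor

variable (k)
  (A : Type u₁) [Category.{u} A] [Preadditive A] [CategoryTheory.Linear k A]
  (B : Type u₂) [Category.{u} B] [Preadditive B] [CategoryTheory.Linear k B]
  (C : Type v₁) [Category.{u} C] [Preadditive C] [CategoryTheory.Linear k C]

/-- The functor `(A ⊠ B) ⊠ C ⥤ A ⊠ (B ⊠ C)`. -/
def assocFunctor : LinTensor k (LinTensor k A B) C ⥤ LinTensor k A (LinTensor k B C) :=
  linFunctor (fun X => ⟨X.fst.fst, X.fst.snd, X.snd⟩)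
    (fun X Y => (TensorProduct.assoc k (X.fst.fst ⟶ Y.fst.fst) (X.fst.snd ⟶ Y.fst.snd)
      (X.snd ⟶ Y.snd)).toLinearMap)
    (fun _ => rfl) (fun X Y Z f g => by
      induction f using hom_induction with
      | h0 => simp only [Limits.zero_comp, map_zero]
      | hadd x y hx hy => simp only [map_add, Preadditive.add_comp, hx, hy]
      | htmul f f₃ =>
        induction f using hom_induction with
        | h0 => simp only [Limits.zero_comp, map_zero, LinearMap.zero_apply]
        | hadd x y hx hy => simp only [map_add, LinearMap.add_apply, Preadditive.add_comp, hx, hy]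
        | htmul f₁ f₂ =>
          induction g using hom_induction with
          | h0 => simp only [Limits.comp_zero, map_zero]
          | hadd x y hx hy => simp only [map_add, Preadditive.comp_add, hx, hy]
          | htmul g g₃ =>
            induction g using hom_induction with
            | h0 => simp only [Limits.comp_zero, map_zero, LinearMap.zero_apply]
            | hadd x y hx hy =>
              simp only [map_add, LinearMap.add_apply, Preadditive.comp_add, hx, hy]
            | htmul g₁ g₂ => rfl)

/-- The functor `A ⊠ (B ⊠ C) ⥤ (A ⊠ B) ⊠ C`. -/
def assocInvFunctor : LinTensor k A (LinTensor k B C) ⥤ LinTensor k (LinTensor k A B) C :=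
  linFunctor (fun X => ⟨⟨X.fst, X.snd.fst⟩, X.snd.snd⟩)
    (fun X Y => (TensorProduct.assoc k (X.fst ⟶ Y.fst) (X.snd.fst ⟶ Y.snd.fst)
      (X.snd.snd ⟶ Y.snd.snd)).symm.toLinearMap)
    (fun _ => rfl) (fun X Y Z f g => by
      induction f using hom_induction with
      | h0 => simp only [Limits.zero_comp, map_zero]
      | hadd x y hx hy => simp only [map_add, Preadditive.add_comp, hx, hy]
      | htmul f₁ f =>
        induction f using hom_induction with
        | h0 => simp only [Limits.zero_comp, map_zero]
        | hadd x y hx hy => simp only [map_add, Preadditive.add_comp, hx, hy]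
        | htmul f₂ f₃ =>
          induction g using hom_induction with
          | h0 => simp only [Limits.comp_zero, map_zero]
          | hadd x y hx hy => simp only [map_add, Preadditive.comp_add, hx, hy]
          | htmul g₁ g =>
            induction g using hom_induction with
            | h0 => simp only [Limits.comp_zero, map_zero]
            | hadd x y hx hy => simp only [map_add, Preadditive.comp_add, hx, hy]
            | htmul g₂ g₃ => rfl)

/-- The functor `Star k ⊠ A ⥤ A`. -/
def leftUnitorFunctor : LinTensor k (Star k) A ⥤ A :=
  linFunctor (fun X => X.snd) (fun X Y => (TensorProduct.lid k (X.snd ⟶ Y.snd)).toLinearMap)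
    (fun X => one_smul k (𝟙 X.snd)) (fun X Y Z f g => by
      induction f using hom_induction with
      | h0 => simp only [Limits.zero_comp, map_zero]
      | hadd x y hx hy => simp only [map_add, Preadditive.add_comp, hx, hy]
      | htmul f₁ f₂ =>
        induction g using hom_induction with
        | h0 => simp only [Limits.comp_zero, map_zero]
        | hadd x y hx hy => simp only [map_add, Preadditive.comp_add, hx, hy]
        | htmul g₁ g₂ =>
          let f₁ : k := f₁
          let g₁ : k := g₁
          change (f₁ * g₁) • (f₂ ≫ g₂) = (f₁ • f₂) ≫ (g₁ • g₂)
          simp only [mul_smul, Linear.smul_comp, Linear.comp_smul]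
          exact smul_comm _ _ _)

/-- The functor `A ⊠ Star k ⥤ A`. -/
def rightUnitorFunctor : LinTensor k A (Star k) ⥤ A :=
  linFunctor (fun X => X.fst) (fun X Y => (TensorProduct.rid k (X.fst ⟶ Y.fst)).toLinearMap)
    (fun X => one_smul k (𝟙 X.fst)) (fun X Y Z f g => by
      induction f using hom_induction with
      | h0 => simp only [Limits.zero_comp, map_zero]
      | hadd x y hx hy => simp only [map_add, Preadditive.add_comp, hx, hy]
      | htmul f₁ f₂ =>
        induction g using hom_induction with
        | h0 => simp only [Limits.comp_zero, map_zero]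
        | hadd x y hx hy => simp only [map_add, Preadditive.comp_add, hx, hy]
        | htmul g₁ g₂ =>
          let f₂ : k := f₂
          let g₂ : k := g₂
          change (f₂ * g₂) • (f₁ ≫ g₁) = (f₂ • f₁) ≫ (g₂ • g₁)
          simp only [mul_smul, Linear.smul_comp, Linear.comp_smul]
          exact smul_comm _ _ _)

/-- The functor `A ⊠ B ⥤ B ⊠ A`. -/
def braidingFunctor : LinTensor k A B ⥤ LinTensor k B A :=
  linFunctor (fun X => ⟨X.snd, X.fst⟩)
    (fun X Y => (TensorProduct.comm k (X.fst ⟶ Y.fst) (X.snd ⟶ Y.snd)).toLinearMap)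
    (fun _ => rfl) (fun X Y Z f g => by
      induction f using hom_induction with
      | h0 => simp only [Limits.zero_comp, map_zero]
      | hadd x y hx hy => simp only [map_add, Preadditive.add_comp, hx, hy]
      | htmul f₁ f₂ =>
        induction g using hom_induction with
        | h0 => simp only [Limits.comp_zero, map_zero]
        | hadd x y hx hy => simp only [map_add, Preadditive.comp_add, hx, hy]
        | htmul g₁ g₂ => rfl)

instance : (assocFunctor k A B C).Additive := linFunctor_additive
instance : (assocFunctor k A B C).Linear k := linFunctor_linear

instance : (assocInvFunctor k A B C).Additive := linFunctor_additive
instance : (assocInvFunctor k A B C).Linear k := linFunctor_linear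

instance : (leftUnitorFunctor k A).Additive := linFunctor_additive
instance : (leftUnitorFunctor k A).Linear k := linFunctor_linear

instance : (rightUnitorFunctor k A).Additive := linFunctor_additive
instance : (rightUnitorFunctor k A).Linear k := linFunctor_linear

instance : (braidingFunctor k A B).Additive := linFunctor_additive
instance : (braidingFunctor k A B).Linear k := linFunctor_linear

end LinTensor

end LinTensorFunctors

/-! ### Small linear categories and bimodules -/

section Bim

/-- Small `k`-linear categories. -/
structure SmallCat (k : Type u) [Field k] : Type (u + 1) where
  carrier : Type u
  [category : Category.{u} carrier]
  [preadditive : Preadditive carrier]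
  [linear : CategoryTheory.Linear k carrier]

namespace SmallCat

variable {k : Type u} [Field k]

instance : CoeSort (SmallCat k) (Type u) := ⟨SmallCat.carrier⟩

instance (C : SmallCat k) : Category.{u} C := C.category
instance (C : SmallCat k) : Preadditive C := C.preadditive
instance (C : SmallCat k) : CategoryTheory.Linear k C := C.linear

/-- A bimodule from `C` to `D`, i.e. a linear functor `P : Dᵒᵖ ⊠ C ⥤ Vect`. Morphisms
`g : d' ⟶ d` of `D` and `f : c ⟶ c'` of `C` induce the linear map
`act g f = P (g ⊗ f) : P d c ⟶ P d' c'`. -/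
structure Hom (C D : SmallCat k) where
  obj : D → C → ModuleCat.{u} k
  act {d d' : D} {c c' : C} : (d' ⟶ d) →ₗ[k] (c ⟶ c') →ₗ[k] obj d c →ₗ[k] obj d' c'
  act_id {d : D} {c : C} (x : obj d c) : act (𝟙 d) (𝟙 c) x = x
  act_act {d d' d'' : D} {c c' c'' : C} (g : d' ⟶ d) (g' : d'' ⟶ d') (f : c ⟶ c')
    (f' : c' ⟶ c'') (x : obj d c) : act g' f' (act g f x) = act (g' ≫ g) (f ≫ f') x

attribute [simp] Hom.act_id Hom.act_act

/-- A map of bimodules, i.e. a natural transformation. -/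
@[ext]
structure Hom₂ {C D : SmallCat k} (P Q : Hom C D) where
  app : ∀ (d : D) (c : C), P.obj d c →ₗ[k] Q.obj d c
  app_act : ∀ {d d' : D} {c c' : C} (g : d' ⟶ d) (f : c ⟶ c') (x : P.obj d c),
    app d' c' (P.act g f x) = Q.act g f (app d c x)

attribute [simp] Hom₂.app_act

instance (C D : SmallCat k) : Category (Hom C D) where
  Hom P Q := Hom₂ P Q
  id P := ⟨fun _ _ => LinearMap.id, by intros; rfl⟩
  comp η θ := ⟨fun d c => θ.app d c ∘ₗ η.app d c, by intros; simp⟩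

section

variable {A B C D : SmallCat k}

@[ext]
lemma hom₂_ext {P Q : Hom C D} {η θ : P ⟶ Q} (h : ∀ d c x, η.app d c x = θ.app d c x) :
    η = θ :=
  Hom₂.ext (funext fun d => funext fun c => LinearMap.ext (h d c))

@[simp] lemma id_app (P : Hom C D) (d c x) : Hom₂.app (𝟙 P) d c x = x := rfl

@[simp] lemma comp_app {P Q R : Hom C D} (η : P ⟶ Q) (θ : Q ⟶ R) (d c x) :
    (η ≫ θ).app d c x = θ.app d c (η.app d c x) := rfl

open scoped Classical in
/-- The relations `(q · f) ⊗ p = q ⊗ (f · p)` on `⨁ b, Q c b ⊗ P b a`, for `f : b ⟶ b'`. -/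
def compRel (P : Hom A B) (Q : Hom B C) (c : C) (a : A) :
    Submodule k (DirectSum B fun b => Q.obj c b ⊗[k] P.obj b a) :=
  Submodule.span k {x | ∃ (b b' : B) (f : b ⟶ b') (q : Q.obj c b) (p : P.obj b' a),
    x = DirectSum.lof k B (fun b => Q.obj c b ⊗[k] P.obj b a) b' (Q.act (𝟙 c) f q ⊗ₜ p) -
      DirectSum.lof k B (fun b => Q.obj c b ⊗[k] P.obj b a) b (q ⊗ₜ P.act f (𝟙 a) p)}

/-- The values of the composite of two bimodules: the coend `∫ b, Q c b ⊗ P b a`. -/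
def compObj (P : Hom A B) (Q : Hom B C) (c : C) (a : A) : ModuleCat.{u} k :=
  ModuleCat.of k ((DirectSum B fun b => Q.obj c b ⊗[k] P.obj b a) ⧸ compRel P Q c a)

open scoped Classical in
/-- The class of `q ⊗ p` in a composite. -/
def preTmul {P : Hom A B} {Q : Hom B C} {c : C} {a : A} (b : B) :
    Q.obj c b →ₗ[k] P.obj b a →ₗ[k] compObj P Q c a :=
  (TensorProduct.mk k _ _).compr₂ ((compRel P Q c a).mkQ ∘ₗ
    DirectSum.lof k B (fun b => Q.obj c b ⊗[k] P.obj b a) b)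

lemma pre_act_tmul {P : Hom A B} {Q : Hom B C} {c : C} {a : A} {b b' : B} (f : b ⟶ b')
    (q : Q.obj c b) (p : P.obj b' a) :
    (preTmul b' (Q.act (𝟙 c) f q) p : compObj P Q c a) = preTmul b q (P.act f (𝟙 a) p) :=
  (Submodule.Quotient.eq _).2 (Submodule.subset_span ⟨b, b', f, q, p, rfl⟩)

open scoped Classical in
/-- Linear maps out of a composite. -/
def preDesc {P : Hom A B} {Q : Hom B C} {c : C} {a : A} {X : Type u} [AddCommGroup X] [Module k X]
    (φ : ∀ b, Q.obj c b →ₗ[k] P.obj b a →ₗ[k] X)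
    (h : ∀ {b b' : B} (f : b ⟶ b') (q : Q.obj c b) (p : P.obj b' a),
      φ b' (Q.act (𝟙 c) f q) p = φ b q (P.act f (𝟙 a) p)) :
    compObj P Q c a →ₗ[k] X :=
  (compRel P Q c a).liftQ (DirectSum.toModule k B X fun b => TensorProduct.lift (φ b)) (by
    refine Submodule.span_le.2 ?_
    rintro _ ⟨b, b', f, q, p, rfl⟩
    simp [DirectSum.toModule_lof, h])

@[simp]
lemma preDesc_tmul {P : Hom A B} {Q : Hom B C} {c : C} {a : A} {X : Type u} [AddCommGroup X]
    [Module k X] (φ : ∀ b, Q.obj c b →ₗ[k] P.obj b a →ₗ[k] X) (h) (b q p) :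
    preDesc φ h (preTmul b q p) = φ b q p := by
  classical
  change DirectSum.toModule k B X (fun b => TensorProduct.lift (φ b))
    (DirectSum.lof k B (fun b => Q.obj c b ⊗[k] P.obj b a) b (q ⊗ₜ p)) = _
  simp [DirectSum.toModule_lof]

@[elab_as_elim]
lemma pre_comp_induction {P : Hom A B} {Q : Hom B C} {c : C} {a : A} {p : compObj P Q c a → Prop}
    (x : compObj P Q c a) (h0 : p 0) (hadd : ∀ x y, p x → p y → p (x + y))
    (htmul : ∀ b x y, p (preTmul b x y)) : p x := by
  classical
  obtain ⟨x, rfl⟩ := Submodule.mkQ_surjective _ x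
  induction x using DirectSum.induction_on with
  | zero => rw [map_zero]; exact h0
  | add x y hx hy => rw [map_add]; exact hadd _ _ hx hy
  | of b t =>
    induction t using TensorProduct.induction_on with
    | zero => rw [map_zero, map_zero]; exact h0
    | add x y hx hy => rw [map_add, map_add]; exact hadd _ _ hx hy
    | tmul x y => exact htmul b x y

lemma pre_comp_linear_ext {P : Hom A B} {Q : Hom B C} {c : C} {a : A} {X : Type u} [AddCommGroup X]
    [Module k X] {φ ψ : compObj P Q c a →ₗ[k] X}
    (h : ∀ b q p, φ (preTmul b q p) = ψ (preTmul b q p)) : φ = ψ := by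
  ext x
  induction x using pre_comp_induction with
  | h0 => simp
  | hadd x y hx hy => simp [hx, hy]
  | htmul => exact h _ _ _

/-- The action on a composite. -/
def compAct (P : Hom A B) (Q : Hom B C) {c c' : C} {a a' : A} (g : c' ⟶ c) (f : a ⟶ a') :
    compObj P Q c a →ₗ[k] compObj P Q c' a' :=
  preDesc (fun b => (preTmul b).compl₁₂ (Q.act g (𝟙 b)) (P.act (𝟙 b) f)) (by
    intro b b' h q p
    have h₁ := pre_act_tmul h (Q.act g (𝟙 b) q) (P.act (𝟙 b') f p)
    simpa using h₁)

@[simp]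
lemma pre_compAct_tmul (P : Hom A B) (Q : Hom B C) {c c' : C} {a a' : A} (g : c' ⟶ c) (f : a ⟶ a')
    (b q p) : compAct P Q g f (preTmul b q p) = preTmul b (Q.act g (𝟙 b) q) (P.act (𝟙 b) f p) := by
  simp [compAct]

/-- The composite of two bimodules. -/
def comp (P : Hom A B) (Q : Hom B C) : Hom A C where
  obj := compObj P Q
  act := LinearMap.mk₂ k (compAct P Q)
    (by intros; apply pre_comp_linear_ext; intros; simp)
    (by intros; apply pre_comp_linear_ext; intros; simp)
    (by intros; apply pre_comp_linear_ext; intros; simp)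
    (by intros; apply pre_comp_linear_ext; intros; simp)
  act_id x := by
    induction x using pre_comp_induction with
    | h0 => simp
    | hadd x y hx hy => rw [map_add, hx, hy]
    | htmul => simp
  act_act g g' f f' x := by
    induction x using pre_comp_induction with
    | h0 => simp
    | hadd x y hx hy => simp only [map_add, hx, hy]
    | htmul => simp

/-- The class of `q ⊗ p` in a composite. -/
def tmul {P : Hom A B} {Q : Hom B C} {c : C} {a : A} (b : B) :
    Q.obj c b →ₗ[k] P.obj b a →ₗ[k] (comp P Q).obj c a :=
  preTmul b

@[simp]
lemma comp_act_tmul (P : Hom A B) (Q : Hom B C) {c c' : C} {a a' : A} (g : c' ⟶ c) (f : a ⟶ a')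
    (b) (q : Q.obj c b) (p : P.obj b a) :
    (comp P Q).act g f (tmul b q p) = tmul b (Q.act g (𝟙 b) q) (P.act (𝟙 b) f p) :=
  pre_compAct_tmul P Q g f b q p

section

variable {P : Hom A B} {Q : Hom B C} {c : C} {a : A} {X : Type u} [AddCommGroup X] [Module k X]

lemma act_tmul {b b' : B} (f : b ⟶ b') (q : Q.obj c b) (p : P.obj b' a) :
    tmul b' (Q.act (𝟙 c) f q) p = tmul b q (P.act f (𝟙 a) p) :=
  pre_act_tmul f q p

/-- Linear maps out of a composite. -/
def desc (φ : ∀ b, Q.obj c b →ₗ[k] P.obj b a →ₗ[k] X)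
    (h : ∀ {b b' : B} (f : b ⟶ b') (q : Q.obj c b) (p : P.obj b' a),
      φ b' (Q.act (𝟙 c) f q) p = φ b q (P.act f (𝟙 a) p)) :
    (comp P Q).obj c a →ₗ[k] X :=
  preDesc φ h

@[simp]
lemma desc_tmul (φ : ∀ b, Q.obj c b →ₗ[k] P.obj b a →ₗ[k] X) (h) (b q p) :
    desc φ h (tmul b q p) = φ b q p :=
  preDesc_tmul φ h b q p

@[elab_as_elim]
lemma comp_induction {p : (comp P Q).obj c a → Prop} (x : (comp P Q).obj c a) (h0 : p 0)
    (hadd : ∀ x y, p x → p y → p (x + y)) (htmul : ∀ b x y, p (tmul b x y)) : p x :=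
  pre_comp_induction (p := p) x h0 hadd htmul

lemma comp_linear_ext {φ ψ : (comp P Q).obj c a →ₗ[k] X}
    (h : ∀ b q p, φ (tmul b q p) = ψ (tmul b q p)) : φ = ψ :=
  pre_comp_linear_ext h

end

/-- The bimodule `(d, c) ↦ (d ⟶ F c)` represented by a linear functor `F : C ⥤ D`. -/
@[simps]
def ofFunctor (F : C ⥤ D) [F.Additive] [F.Linear k] : Hom C D where
  obj d c := ModuleCat.of k (d ⟶ F.obj c)
  act := LinearMap.mk₂ k (fun g f => Linear.leftComp k _ g ∘ₗ Linear.rightComp k _ (F.map f))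
    (by intros; ext; simp) (by intros; ext; simp) (by intros; ext; simp) (by intros; ext; simp)
  act_id x := by simp
  act_act g g' f f' x := by simp

/-- The identity bimodule `(c, c') ↦ (c ⟶ c')`. -/
def one (C : SmallCat k) : Hom C C := ofFunctor (𝟭 C)

/-- Morphisms of `C`, as elements of the identity bimodule. -/
def homElt {c d : C} : (c ⟶ d) ≃ₗ[k] (one C).obj c d := LinearEquiv.refl k (c ⟶ d)

@[simp]
lemma one_act {c c' d d' : C} (g : c' ⟶ c) (f : d ⟶ d') (x : c ⟶ d) :
    (one C).act g f (homElt x) = homElt (g ≫ x ≫ f) := by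
  rfl

lemma tmul_one {P : Hom A B} {b : B} {a a' : A} (p : P.obj b a') (f : a' ⟶ a) :
    (tmul a' p (homElt f) : (comp (one A) P).obj b a) =
      tmul a (P.act (𝟙 b) f p) (homElt (𝟙 a)) := by
  rw [act_tmul, one_act]
  simp

lemma one_tmul {P : Hom A B} {b b' : B} {a : A} (p : P.obj b' a) (g : b ⟶ b') :
    (tmul b' (homElt g) p : (comp P (one B)).obj b a) =
      tmul b (homElt (𝟙 b)) (P.act g (𝟙 a) p) := by
  rw [← act_tmul, one_act]
  simp

section

variable {P : Hom A B} {Q : Hom B C} {R : Hom C D} {S : Hom A C} {S' : Hom A D} {S'' : Hom A B}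

lemma hom_ext_comp {η θ : comp P Q ⟶ S}
    (h : ∀ c a b q p, η.app c a (tmul b q p) = θ.app c a (tmul b q p)) : η = θ := by
  ext c a x
  induction x using comp_induction with
  | h0 => simp only [map_zero]
  | hadd x y hx hy => simp only [map_add, hx, hy]
  | htmul b q p => exact h c a b q p

lemma hom_ext_comp_comp {η θ : comp (comp P Q) R ⟶ S'}
    (h : ∀ d a c b r q p, η.app d a (tmul c r (tmul b q p : (comp P Q).obj c a)) =
      θ.app d a (tmul c r (tmul b q p : (comp P Q).obj c a))) : η = θ :=
  hom_ext_comp fun d a c r x => by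
    induction x using comp_induction with
    | h0 => simp only [map_zero]
    | hadd x y hx hy => simp only [map_add, hx, hy]
    | htmul b q p => exact h d a c b r q p

lemma hom_ext_comp_comp' {η θ : comp P (comp Q R) ⟶ S'}
    (h : ∀ d a c b r q p, η.app d a (tmul b (tmul c r q : (comp Q R).obj d b) p) =
      θ.app d a (tmul b (tmul c r q : (comp Q R).obj d b) p)) : η = θ :=
  hom_ext_comp fun d a b x p => by
    induction x using comp_induction with
    | h0 => simp only [map_zero, LinearMap.zero_apply]
    | hadd x y hx hy => simp only [map_add, LinearMap.add_apply, hx, hy]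
    | htmul c r q => exact h d a c b r q p

lemma hom_ext_one_comp {η θ : comp (one A) P ⟶ S''}
    (h : ∀ b a p, η.app b a (tmul a p (homElt (𝟙 a))) =
      θ.app b a (tmul a p (homElt (𝟙 a)))) : η = θ :=
  hom_ext_comp fun b a a' p f => by
    have := tmul_one p f
    exact (congrArg (η.app b a) this).trans ((h b a _).trans (congrArg (θ.app b a) this).symm)

lemma hom_ext_comp_one {η θ : comp P (one B) ⟶ S''}
    (h : ∀ b a p, η.app b a (tmul b (homElt (𝟙 b)) p) =
      θ.app b a (tmul b (homElt (𝟙 b)) p)) : η = θ :=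
  hom_ext_comp fun b a b' g p => by
    have := one_tmul p g
    exact (congrArg (η.app b a) this).trans ((h b a _).trans (congrArg (θ.app b a) this).symm)

end

/-- Whiskering on the left. -/
def whiskerLeft (P : Hom A B) {Q Q' : Hom B C} (η : Q ⟶ Q') : comp P Q ⟶ comp P Q' :=
  Hom₂.mk (fun c _ => desc (fun b => tmul b ∘ₗ Hom₂.app η c b) (by
      intro b b' f q p
      simp [act_tmul]))
    (by
      intro c c' a a' g f x
      induction x using comp_induction with
      | h0 => simp only [map_zero]
      | hadd x y hx hy => simp only [map_add, hx, hy]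
      | htmul b q p => simp)

/-- Whiskering on the right. -/
def whiskerRight {P P' : Hom A B} (η : P ⟶ P') (Q : Hom B C) : comp P Q ⟶ comp P' Q :=
  Hom₂.mk (fun _ a => desc (fun b => (tmul b).compl₂ (Hom₂.app η b a)) (by
      intro b b' f q p
      simp [act_tmul]))
    (by
      intro c c' a a' g f x
      induction x using comp_induction with
      | h0 => simp only [map_zero]
      | hadd x y hx hy => simp only [map_add, hx, hy]
      | htmul b q p => simp)

@[simp] lemma whiskerLeft_tmul (P : Hom A B) {Q Q' : Hom B C} (η : Q ⟶ Q') (c a b q p) :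
    (whiskerLeft P η).app c a (tmul b q p) = (tmul b (η.app c b q) p : compObj P Q' c a) := by
  simp [whiskerLeft]

@[simp] lemma whiskerRight_tmul {P P' : Hom A B} (η : P ⟶ P') (Q : Hom B C) (c a b q p) :
    (whiskerRight η Q).app c a (tmul b q p) = (tmul b q (η.app b a p) : compObj P' Q c a) := by
  simp [whiskerRight]

/-- The associator, on values. -/
def associatorApp (P : Hom A B) (Q : Hom B C) (R : Hom C D) (d : D) (a : A) :
    (comp (comp P Q) R).obj d a →ₗ[k] (comp P (comp Q R)).obj d a :=
  desc (fun c =>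
    { toFun r := desc (fun b => tmul b ∘ₗ (tmul c r : Q.obj c b →ₗ[k] (comp Q R).obj d b)) (by
        intro b b' f q p
        have := act_tmul (P := P) (Q := comp Q R) f (tmul c r q : (comp Q R).obj d b) p
        simpa using this)
      map_add' r r' := by apply comp_linear_ext; intros; simp
      map_smul' t r := by apply comp_linear_ext; intros; simp }) (by
    intro c c' f r x
    induction x using comp_induction with
    | h0 => simp only [map_zero]
    | hadd x y hx hy => simp only [map_add, hx, hy]
    | htmul b q p => simp [act_tmul])

/-- The inverse of the associator, on values. -/
def associatorInvApp (P : Hom A B) (Q : Hom B C) (R : Hom C D) (d : D) (a : A) :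
    (comp P (comp Q R)).obj d a →ₗ[k] (comp (comp P Q) R).obj d a :=
  desc (fun b => desc (fun c => (LinearMap.llcomp k _ _ _).compl₁₂ (tmul c)
      (tmul b : Q.obj c b →ₗ[k] P.obj b a →ₗ[k] (comp P Q).obj c a)) (by
    intro c c' f r q
    ext p
    have := act_tmul (P := comp P Q) (Q := R) f r (tmul b q p : compObj P Q c' a)
    simpa using this)) (by
    intro b b' f x p
    induction x using comp_induction with
    | h0 => simp only [map_zero, LinearMap.zero_apply]
    | hadd x y hx hy => simp only [map_add, LinearMap.add_apply, hx, hy]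
    | htmul c r q => simp [act_tmul])

@[simp] lemma associatorApp_tmul (P : Hom A B) (Q : Hom B C) (R : Hom C D) (d a c b r q p) :
    associatorApp P Q R d a (tmul c r (tmul b q p : (comp P Q).obj c a)) =
      tmul b (tmul c r q : (comp Q R).obj d b) p := by
  simp [associatorApp]

@[simp] lemma associatorInvApp_tmul (P : Hom A B) (Q : Hom B C) (R : Hom C D) (d a c b r q p) :
    associatorInvApp P Q R d a (tmul b (tmul c r q : (comp Q R).obj d b) p) =
      tmul c r (tmul b q p : (comp P Q).obj c a) := by
  simp [associatorInvApp]

/-- The associator `(R ⊗ (Q ⊗ P)) ⟶ (R ⊗ Q) ⊗ P`. -/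
def associatorHom (P : Hom A B) (Q : Hom B C) (R : Hom C D) :
    comp (comp P Q) R ⟶ comp P (comp Q R) :=
  Hom₂.mk (associatorApp P Q R) (by
    intro d d' a a' g f x
    induction x using comp_induction with
    | h0 => simp only [map_zero]
    | hadd x y hx hy => simp only [map_add, hx, hy]
    | htmul c r x =>
      induction x using comp_induction with
      | h0 => simp only [map_zero]
      | hadd x y hx hy => simp only [map_add, hx, hy]
      | htmul b q p => simp)

/-- The inverse of the associator. -/
def associatorInv (P : Hom A B) (Q : Hom B C) (R : Hom C D) :
    comp P (comp Q R) ⟶ comp (comp P Q) R :=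
  Hom₂.mk (associatorInvApp P Q R) (by
    intro d d' a a' g f x
    induction x using comp_induction with
    | h0 => simp only [map_zero]
    | hadd x y hx hy => simp only [map_add, hx, hy]
    | htmul c x p =>
      induction x using comp_induction with
      | h0 => simp only [map_zero, LinearMap.zero_apply]
      | hadd x y hx hy => simp only [map_add, LinearMap.add_apply, hx, hy]
      | htmul b q p => simp)

@[simp] lemma associatorHom_tmul (P : Hom A B) (Q : Hom B C) (R : Hom C D) (d a c b r q p) :
    (associatorHom P Q R).app d a (tmul c r (tmul b q p : (comp P Q).obj c a)) =
      (tmul b (tmul c r q : (comp Q R).obj d b) p : (comp P (comp Q R)).obj d a) :=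
  associatorApp_tmul P Q R d a c b r q p

@[simp] lemma associatorInv_tmul (P : Hom A B) (Q : Hom B C) (R : Hom C D) (d a c b r q p) :
    (associatorInv P Q R).app d a (tmul b (tmul c r q : (comp Q R).obj d b) p) =
      (tmul c r (tmul b q p : (comp P Q).obj c a) : (comp (comp P Q) R).obj d a) :=
  associatorInvApp_tmul P Q R d a c b r q p

/-- The left unitor, given by the action. -/
def leftUnitorHom (P : Hom A B) : comp (one A) P ⟶ P :=
  Hom₂.mk (fun b a => desc (fun _ =>
      LinearMap.flip (P.act (𝟙 b) ∘ₗ homElt.symm.toLinearMap)) (by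
      intro a₁ a₂ f p g
      obtain ⟨g, rfl⟩ := homElt.surjective g
      simp))
    (by
      intro b b' a a' g f x
      induction x using comp_induction with
      | h0 => simp only [map_zero]
      | hadd x y hx hy => simp only [map_add, hx, hy]
      | htmul a₁ p h =>
        obtain ⟨h, rfl⟩ := homElt.surjective h
        simp)

/-- The inverse of the left unitor. -/
def leftUnitorInv (P : Hom A B) : P ⟶ comp (one A) P :=
  Hom₂.mk (fun _ a => LinearMap.flip (tmul a) (homElt (𝟙 a))) (by
    intro b b' a a' g f p
    have := tmul_one (P.act g (𝟙 a) p) f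
    simpa using this.symm)

/-- The right unitor, given by the action. -/
def rightUnitorHom (P : Hom A B) : comp P (one B) ⟶ P :=
  Hom₂.mk (fun b a => desc (fun _ =>
      LinearMap.flip P.act (𝟙 a) ∘ₗ homElt.symm.toLinearMap) (by
      intro b₁ b₂ f g p
      obtain ⟨g, rfl⟩ := homElt.surjective g
      simp))
    (by
      intro b b' a a' g f x
      induction x using comp_induction with
      | h0 => simp only [map_zero]
      | hadd x y hx hy => simp only [map_add, hx, hy]
      | htmul b₁ h p =>
        obtain ⟨h, rfl⟩ := homElt.surjective h
        simp)

/-- The inverse of the right unitor. -/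
def rightUnitorInv (P : Hom A B) : P ⟶ comp P (one B) :=
  Hom₂.mk (fun b _ => tmul b (homElt (𝟙 b))) (by
    intro b b' a a' g f p
    have := one_tmul (P.act (𝟙 b) f p) g
    simpa using this.symm)

@[simp] lemma leftUnitorHom_tmul (P : Hom A B) (b a a' p) (f : a' ⟶ a) :
    (leftUnitorHom P).app b a (tmul a' p (homElt f)) = P.act (𝟙 b) f p := by
  simp [leftUnitorHom]

@[simp] lemma leftUnitorInv_app (P : Hom A B) (b a p) :
    (leftUnitorInv P).app b a p = tmul a p (homElt (𝟙 a)) :=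
  rfl

@[simp] lemma rightUnitorHom_tmul (P : Hom A B) (b b' a p) (g : b ⟶ b') :
    (rightUnitorHom P).app b a (tmul b' (homElt g) p) = P.act g (𝟙 a) p := by
  simp [rightUnitorHom]

@[simp] lemma rightUnitorInv_app (P : Hom A B) (b a p) :
    (rightUnitorInv P).app b a p = tmul b (homElt (𝟙 b)) p :=
  rfl

end

/-- The 2-category of small linear categories, bimodules and maps of bimodules. -/
instance : Bicategory (SmallCat k) where
  Hom := Hom
  id := one
  comp := comp
  whiskerLeft := whiskerLeft
  whiskerRight := whiskerRight
  associator P Q R :=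
    { hom := associatorHom P Q R
      inv := associatorInv P Q R
      hom_inv_id := by apply hom_ext_comp_comp; intros; simp
      inv_hom_id := by apply hom_ext_comp_comp'; intros; simp }
  leftUnitor P :=
    { hom := leftUnitorHom P
      inv := leftUnitorInv P
      hom_inv_id := by apply hom_ext_one_comp; intros; simp
      inv_hom_id := by ext; simp }
  rightUnitor P :=
    { hom := rightUnitorHom P
      inv := rightUnitorInv P
      hom_inv_id := by apply hom_ext_comp_one; intros; simp
      inv_hom_id := by ext; simp }
  whiskerLeft_id := by intros; apply hom_ext_comp; intros; simp
  whiskerLeft_comp := by intros; apply hom_ext_comp; intros; simp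
  id_whiskerLeft := by intros; apply hom_ext_one_comp; intros; simp
  comp_whiskerLeft := by intros; apply hom_ext_comp_comp; intros; simp
  id_whiskerRight := by intros; apply hom_ext_comp; intros; simp
  comp_whiskerRight := by intros; apply hom_ext_comp; intros; simp
  whiskerRight_id := by intros; apply hom_ext_comp_one; intros; simp
  whiskerRight_comp := by intros; apply hom_ext_comp_comp'; intros; simp
  whisker_assoc := by intros; apply hom_ext_comp_comp; intros; simp
  whisker_exchange := by intros; apply hom_ext_comp; intros; simp
  pentagon := by
    intros
    apply hom_ext_comp_comp
    intro _ _ _ _ _ _ x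
    induction x using comp_induction with
    | h0 => simp only [map_zero]
    | hadd x y hx hy => simp only [map_add, hx, hy]
    | htmul => simp
  triangle := by
    intro _ _ _ P Q
    apply hom_ext_comp_comp
    intro d a c b r q p
    obtain ⟨q, rfl⟩ := homElt.surjective q
    simp [act_tmul]

end SmallCat

end Bim

/-! ### Tensor products of bimodules -/

section BimTensor

namespace SmallCat

variable {k : Type u} [Field k] {A B A' B' C : SmallCat k}

/-- The tensor product of linear categories. -/
abbrev tensorObj (A B : SmallCat k) : SmallCat k := ⟨LinTensor k A B⟩

/-- A `k`-algebra, as a linear category with one object. -/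
abbrev star (k : Type u) [Field k] (A : Type u) [Ring A] [Algebra k A] : SmallCat k := ⟨Star A⟩

/-- The action on a tensor product of bimodules. -/
def tensorAct (P : Hom A A') (Q : Hom B B') {d d' : LinTensor k A' B'} {c c' : LinTensor k A B} :
    (d' ⟶ d) →ₗ[k] (c ⟶ c') →ₗ[k] (P.obj d.fst c.fst ⊗[k] Q.obj d.snd c.snd) →ₗ[k]
      (P.obj d'.fst c'.fst ⊗[k] Q.obj d'.snd c'.snd) :=
  (TensorProduct.map₂ (P.act (d := d.fst) (d' := d'.fst) (c := c.fst) (c' := c'.fst))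
    (Q.act (d := d.snd) (d' := d'.snd) (c := c.snd) (c' := c'.snd))).compr₂
      (TensorProduct.homTensorHomMap (RingHom.id k)
        (P.obj d.fst c.fst) (Q.obj d.snd c.snd)
        (P.obj d'.fst c'.fst) (Q.obj d'.snd c'.snd))

@[simp]
lemma tensorAct_tmul (P : Hom A A') (Q : Hom B B') {d d' : LinTensor k A' B'}
    {c c' : LinTensor k A B} (g₁ : d'.fst ⟶ d.fst) (g₂ : d'.snd ⟶ d.snd) (f₁ : c.fst ⟶ c'.fst)
    (f₂ : c.snd ⟶ c'.snd) (x : P.obj d.fst c.fst) (y : Q.obj d.snd c.snd) :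
    tensorAct P Q (LinTensor.tmul k g₁ g₂) (LinTensor.tmul k f₁ f₂) (x ⊗ₜ y) =
      P.act g₁ f₁ x ⊗ₜ Q.act g₂ f₂ y :=
  rfl

lemma tensorAct_comp (P : Hom A A') (Q : Hom B B') {d d' d'' : LinTensor k A' B'}
    {c c' c'' : LinTensor k A B} (g : d' ⟶ d) (g' : d'' ⟶ d') (f : c ⟶ c') (f' : c' ⟶ c'')
    (x : P.obj d.fst c.fst ⊗[k] Q.obj d.snd c.snd) :
    tensorAct P Q g' f' (tensorAct P Q g f x) = tensorAct P Q (g' ≫ g) (f ≫ f') x := by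
  induction g using LinTensor.hom_induction with
  | h0 => simp only [Limits.comp_zero, map_zero, LinearMap.zero_apply]
  | hadd x y hx hy => simp only [map_add, LinearMap.add_apply, Preadditive.comp_add, hx, hy]
  | htmul g₁ g₂ =>
  induction g' using LinTensor.hom_induction with
  | h0 => simp only [Limits.zero_comp, map_zero, LinearMap.zero_apply]
  | hadd x y hx hy => simp only [map_add, LinearMap.add_apply, Preadditive.add_comp, hx, hy]
  | htmul g₁' g₂' =>
  induction f using LinTensor.hom_induction with
  | h0 => simp only [Limits.zero_comp, map_zero, LinearMap.zero_apply]
  | hadd x y hx hy => simp only [map_add, LinearMap.add_apply, Preadditive.add_comp, hx, hy]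
  | htmul f₁ f₂ =>
  induction f' using LinTensor.hom_induction with
  | h0 => simp only [Limits.comp_zero, map_zero, LinearMap.zero_apply]
  | hadd x y hx hy => simp only [map_add, LinearMap.add_apply, Preadditive.comp_add, hx, hy]
  | htmul f₁' f₂' =>
  induction x using TensorProduct.induction_on with
  | zero => simp only [map_zero]
  | add x y hx hy => simp only [map_add, hx, hy]
  | tmul x y => simp

/-- The tensor product of bimodules. -/
def tensorHom (P : Hom A A') (Q : Hom B B') : Hom (tensorObj A B) (tensorObj A' B') where
  obj d c := ModuleCat.of k (P.obj d.fst c.fst ⊗[k] Q.obj d.snd c.snd)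
  act := tensorAct P Q
  act_id {d c} x := by
    change tensorAct P Q (LinTensor.tmul k (𝟙 _) (𝟙 _)) (LinTensor.tmul k (𝟙 _) (𝟙 _)) x = x
    induction x using TensorProduct.induction_on with
    | zero => exact map_zero _
    | add x y hx hy => exact (map_add _ _ _).trans (congrArg₂ (· + ·) hx hy)
    | tmul x y => simp
  act_act := tensorAct_comp P Q

/-- The bimodule represented by a linear functor between unbundled linear categories. -/
def ofFunctor' {X : Type u} [Category.{u} X] [Preadditive X] [CategoryTheory.Linear k X]
    {Y : Type u} [Category.{u} Y] [Preadditive Y] [CategoryTheory.Linear k Y] (F : X ⥤ Y)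
    [h : F.Additive] [h' : F.Linear k] : Hom (⟨X⟩ : SmallCat k) (⟨Y⟩ : SmallCat k) :=
  @ofFunctor k _ ⟨X⟩ ⟨Y⟩ F h h'

/-- The tensor product of linear categories and of bimodules; the structure morphisms are
represented by functors. -/
def tensorData (k : Type u) [Field k] : TensorData (SmallCat k) where
  unit := star k k
  tensorObj := tensorObj
  tensorHom := tensorHom
  assoc A B C := (ofFunctor' (k := k) (LinTensor.assocFunctor k A B C) :)
  assocInv A B C := (ofFunctor' (k := k) (LinTensor.assocInvFunctor k A B C) :)
  leftUnitor A := (ofFunctor' (k := k) (LinTensor.leftUnitorFunctor k A) :)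
  rightUnitor A := (ofFunctor' (k := k) (LinTensor.rightUnitorFunctor k A) :)
  braiding A B := (ofFunctor' (k := k) (LinTensor.braidingFunctor k A B) :)

/-- The action of `k × ... × k` on the rows and on the columns of a matrix. -/
def matrixAct {m n : ℕ} (E : Fin m → Fin n → Type u) [∀ i j, AddCommGroup (E i j)]
    [∀ i j, Module k (E i j)] :
    (Fin n → k) →ₗ[k] (Fin m → k) →ₗ[k] (∀ i j, E i j) →ₗ[k] (∀ i j, E i j) :=
  (LinearMap.llcomp k _ _ _).compl₁₂ (ALG.colSmul E).flip (ALG.rowSmul E)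

lemma matrixAct_apply {m n : ℕ} (E : Fin m → Fin n → Type u) [∀ i j, AddCommGroup (E i j)]
    [∀ i j, Module k (E i j)] (s : Fin n → k) (r : Fin m → k) (x i j) :
    matrixAct E s r x i j = s j • r i • x i j :=
  rfl

/-- The direct sum of the entries of a matrix of vector spaces, as a bimodule. -/
def ofMatrix {a b : KV k} (M : a ⟶ b) : Hom (star k (Fin a.n → k)) (star k (Fin b.n → k)) where
  obj _ _ := ModuleCat.of k (∀ i j, KV.Hom.entry M i j)
  act := matrixAct fun i j => KV.Hom.entry M i j
  act_id x := funext fun i => funext fun j => (one_smul k _).trans (one_smul k (x i j))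
  act_act g g' f f' x := by
    refine funext fun i => funext fun j => ?_
    change g' j • f' i • g j • f i • x i j = (g' j * g j) • (f i * f' i) • x i j
    simp only [smul_smul]
    congr 1
    ring

/-- The natural inclusion of the Kapranov–Voevodsky 2-category into the 2-category of linear
categories and bimodules: `n` is sent to the one-object category with endomorphism algebra the
`n`-fold product `k × ... × k`, a matrix of vector spaces is sent to the direct
sum of its entries. -/
def incl (k : Type u) [Field k] : PrelaxFunctor (KV k) (SmallCat k) where
  obj a := star k (Fin a.n → k)
  map M := ofMatrix M
  map₂ {a b M N} η := Hom₂.mk (P := ofMatrix M) (Q := ofMatrix N)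
    (fun _ _ => LinearMap.pi fun i => LinearMap.pi fun j =>
      KV.Hom₂.entry η i j ∘ₗ LinearMap.proj j ∘ₗ LinearMap.proj i)
    (by
      intro _ _ _ _ g f x
      refine funext fun i => funext fun j => ?_
      change KV.Hom₂.entry η i j (g j • f i • x i j) = g j • f i • KV.Hom₂.entry η i j (x i j)
      simp only [map_smul])
  map₂_id _ := rfl
  map₂_comp _ _ := rfl

end SmallCat

end BimTensor

/-! ### Additive linear categories and linear functors -/

section Add

/-- Additive `k`-linear categories: `k`-linear categories with finite direct sums (including the
empty one, a zero object). -/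
structure AddCat (k : Type u) [Field k] : Type (u + 2) where
  carrier : Type (u + 1)
  [category : Category.{u} carrier]
  [preadditive : Preadditive carrier]
  [linear : CategoryTheory.Linear k carrier]
  [hasFiniteBiproducts : HasFiniteBiproducts carrier]

namespace AddCat

variable {k : Type u} [Field k]

instance : CoeSort (AddCat k) (Type (u + 1)) := ⟨AddCat.carrier⟩

instance (C : AddCat k) : Category.{u} C := C.category
instance (C : AddCat k) : Preadditive C := C.preadditive
instance (C : AddCat k) : CategoryTheory.Linear k C := C.linear
instance (C : AddCat k) : HasFiniteBiproducts C := C.hasFiniteBiproducts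

/-- Linear functors. -/
structure Hom (C D : AddCat k) where
  functor : C ⥤ D
  [additive : functor.Additive]
  [linear : functor.Linear k]

/-- Natural transformations. -/
@[ext]
structure Hom₂ {C D : AddCat k} (F G : Hom C D) where
  natTrans : F.functor ⟶ G.functor

instance {C D : AddCat k} (F : Hom C D) : F.functor.Additive := F.additive
instance {C D : AddCat k} (F : Hom C D) : F.functor.Linear k := F.linear

instance : CategoryStruct (AddCat k) where
  Hom := Hom
  id C := ⟨𝟭 C⟩
  comp F G := ⟨F.functor ⋙ G.functor⟩

instance (C D : AddCat k) : Category (C ⟶ D) where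
  Hom F G := Hom₂ F G
  id F := ⟨𝟙 F.functor⟩
  comp η θ := ⟨η.natTrans ≫ θ.natTrans⟩

section

variable {A B C D : AddCat k}

@[ext]
lemma hom₂_ext {F G : C ⟶ D} {η θ : F ⟶ G}
    (h : ∀ X, η.natTrans.app X = θ.natTrans.app X) : η = θ :=
  Hom₂.ext (NatTrans.ext (funext h))

@[simp] lemma id_functor (C : AddCat k) : Hom.functor (𝟙 C) = 𝟭 C := rfl

@[simp] lemma comp_functor (F : B ⟶ C) (G : C ⟶ D) :
    (F ≫ G).functor = F.functor ⋙ G.functor := rfl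

@[simp] lemma id_natTrans (F : C ⟶ D) : Hom₂.natTrans (𝟙 F) = 𝟙 F.functor := rfl

@[simp] lemma comp_natTrans {F G H : C ⟶ D} (η : F ⟶ G) (θ : G ⟶ H) :
    (η ≫ θ).natTrans = η.natTrans ≫ θ.natTrans := rfl

/-- Natural isomorphisms. -/
@[simps]
def isoMk {F G : C ⟶ D} (e : F.functor ≅ G.functor) : F ≅ G where
  hom := ⟨e.hom⟩
  inv := ⟨e.inv⟩

end

/-- The 2-category of additive linear categories, linear functors and natural transformations. -/
instance : Bicategory (AddCat k) where
  homCategory C D := inferInstanceAs (Category (C ⟶ D))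
  whiskerLeft F _ _ η := Hom₂.mk (Functor.whiskerLeft F.functor (Hom₂.natTrans η))
  whiskerRight η H := Hom₂.mk (Functor.whiskerRight (Hom₂.natTrans η) H.functor)
  associator F G H := isoMk (Functor.associator F.functor G.functor H.functor)
  leftUnitor F := isoMk (F := 𝟙 _ ≫ F) (Functor.leftUnitor F.functor)
  rightUnitor F := isoMk (F := F ≫ 𝟙 _) (Functor.rightUnitor F.functor)

end AddCat

end Add

/-! ### The targets of linear categories -/

section LinTargets

variable (k : Type u) [Field k]

section

variable {k} {C : Type u₁} [Category.{u} C] [Preadditive C] [CategoryTheory.Linear k C]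

instance (M N : Mat_ C) : Module k (M ⟶ N) :=
  inferInstanceAs (Module k (∀ i j, M.X i ⟶ N.X j))

lemma mat_smul_apply {M N : Mat_ C} (r : k) (f : M ⟶ N) (i j) : (r • f) i j = r • f i j := rfl

instance : CategoryTheory.Linear k (Mat_ C) where
  smul_comp M N K r f g := by
    refine Mat_.hom_ext _ _ fun i j => ?_
    simp only [Mat_.comp_apply, mat_smul_apply, Linear.smul_comp, Finset.smul_sum]
  comp_smul M N K f r g := by
    refine Mat_.hom_ext _ _ fun i j => ?_
    simp only [Mat_.comp_apply, mat_smul_apply, Linear.comp_smul, Finset.smul_sum]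

instance (P Q : Idempotents.Karoubi C) : SMul k (P ⟶ Q) where
  smul r f := ⟨r • f.f, by rw [Linear.smul_comp, Linear.comp_smul, f.comm]⟩

lemma karoubi_smul_f {P Q : Idempotents.Karoubi C} (r : k) (f : P ⟶ Q) : (r • f).f = r • f.f := rfl

instance (P Q : Idempotents.Karoubi C) : Module k (P ⟶ Q) where
  one_smul f := Idempotents.Karoubi.Hom.ext (one_smul k f.f)
  mul_smul r s f := Idempotents.Karoubi.Hom.ext (mul_smul r s f.f)
  smul_zero r := Idempotents.Karoubi.Hom.ext (smul_zero r)
  smul_add r f g := Idempotents.Karoubi.Hom.ext (smul_add r f.f g.f)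
  add_smul r s f := Idempotents.Karoubi.Hom.ext (add_smul r s f.f)
  zero_smul f := Idempotents.Karoubi.Hom.ext (zero_smul k f.f)

instance : CategoryTheory.Linear k (Idempotents.Karoubi C) where
  smul_comp _ _ _ r f g := Idempotents.Karoubi.Hom.ext (Linear.smul_comp _ _ _ r f.f g.f)
  comp_smul _ _ _ f r g := Idempotents.Karoubi.Hom.ext (Linear.comp_smul _ _ _ f.f r g.f)

end

instance : HasFiniteBiproducts (FGModuleCat.{u} k) := HasFiniteBiproducts.of_hasFiniteProducts

/-- The category of `n`-tuples of finite-dimensional vector spaces. -/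
abbrev VectPow (n : ℕ) : Type (u + 1) := Fin n → FGModuleCat.{u} k

instance (n : ℕ) : Preadditive (VectPow k n) where
  homGroup v w := inferInstanceAs (AddCommGroup (∀ i, v i ⟶ w i))
  add_comp _ _ _ f f' g := funext fun i => Preadditive.add_comp _ _ _ (f i) (f' i) (g i)
  comp_add _ _ _ f g g' := funext fun i => Preadditive.comp_add _ _ _ (f i) (g i) (g' i)

instance (n : ℕ) : CategoryTheory.Linear k (VectPow k n) where
  homModule v w := inferInstanceAs (Module k (∀ i, v i ⟶ w i))
  smul_comp _ _ _ r f g := funext fun i => Linear.smul_comp _ _ _ r (f i) (g i)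
  comp_smul _ _ _ f r g := funext fun i => Linear.comp_smul _ _ _ (f i) r (g i)

instance (n : ℕ) : HasFiniteBiproducts (VectPow k n) where
  out m :=
    { has_biproduct F := hasBiproduct_of_total
        { pt := fun i => ⨁ fun j => F j i
          π := fun j i => biproduct.π (fun j => F j i) j
          ι := fun j i => biproduct.ι (fun j => F j i) j
          ι_π := fun j j' => by
            by_cases h : j = j'
            · subst h
              funext i
              simp
            · funext i
              simp only [h, dif_neg, not_false_iff]
              exact biproduct.ι_π_ne (fun j => F j i) h }
        (by
          funext i
          refine Eq.trans ?_ (biproduct.total (f := fun j => F j i))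
          exact Finset.sum_apply i _ _) }

/-- The functor of two variables `(c, d) ↦ c ⊠ d` to the tensor product of linear categories. -/
@[simps]
def LinTensor.pair (C : Type u₁) [Category.{u} C] [Preadditive C] [CategoryTheory.Linear k C]
    (D : Type u₂) [Category.{u} D] [Preadditive D] [CategoryTheory.Linear k D] :
    C ⥤ D ⥤ LinTensor k C D where
  obj c :=
    { obj d := ⟨c, d⟩
      map {d d'} g := LinTensor.tmul k (X := ⟨c, d⟩) (Y := ⟨c, d'⟩) (𝟙 c) g
      map_comp {d d' d''} g g' := by
        have := LinTensor.tmul_comp k (X := ⟨c, d⟩) (Y := ⟨c, d'⟩) (Z := ⟨c, d''⟩) (𝟙 c) g (𝟙 c) g'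
        rw [this, Category.id_comp] }
  map {c c'} f :=
    { app d := LinTensor.tmul k (X := ⟨c, d⟩) (Y := ⟨c', d⟩) f (𝟙 d)
      naturality {d d'} g := by
        have h := LinTensor.tmul_comp k (X := ⟨c, d⟩) (Y := ⟨c, d'⟩) (Z := ⟨c', d'⟩)
          (𝟙 c) g f (𝟙 d')
        have h' := LinTensor.tmul_comp k (X := ⟨c, d⟩) (Y := ⟨c', d⟩) (Z := ⟨c', d'⟩)
          f (𝟙 d) (𝟙 c') g
        exact h.trans (by simpa using h'.symm) }
  map_comp {c c' c''} f f' := by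
    ext d
    have := LinTensor.tmul_comp k (X := ⟨c, d⟩) (Y := ⟨c', d⟩) (Z := ⟨c'', d⟩) f (𝟙 d) f' (𝟙 d)
    exact (this.trans (by rw [Category.id_comp])).symm

namespace AddCat

variable {k}

/-- Abelian categories (among the additive ones): kernels and cokernels exist, monomorphisms are
kernels and epimorphisms are cokernels. -/
structure IsAbelian (C : AddCat k) : Prop where
  hasKernels : HasKernels C
  hasCokernels : HasCokernels C
  normalMono : IsNormalMonoCategory C
  normalEpi : IsNormalEpiCategory C

/-- Finite linear categories: abelian, with finite-dimensional spaces of morphisms, all objects of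
finite length, enough projectives, and finitely many isomorphism classes of simple objects. -/
structure IsFinite (C : AddCat k) : Prop where
  isAbelian : IsAbelian C
  finite_hom : ∀ X Y : C, Module.Finite k (X ⟶ Y)
  finite_length : ∀ X : C, IsArtinianObject X ∧ IsNoetherianObject X
  enoughProjectives : EnoughProjectives C
  finite_simples : ∃ (n : ℕ) (S : Fin n → C), ∀ X : C, Simple X → ∃ i, Nonempty (X ≅ S i)

variable (k)

/-- The sub-2-category `LinCat` of finite linear categories and right exact linear functors. -/
def linCat : SubBicat (AddCat k) where
  obj := IsFinite
  hom F := PreservesFiniteColimits F.functor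
  id_mem {C} _ := inferInstanceAs (PreservesFiniteColimits (𝟭 C))
  comp_mem {_ _ _ F G} hF hG :=
    haveI : PreservesFiniteColimits F.functor := hF
    haveI : PreservesFiniteColimits G.functor := hG
    comp_preservesFiniteColimits F.functor G.functor

/-- The sub-2-category `2Vect` of Cauchy complete small linear categories (i.e. idempotent complete
additive ones, equivalent to a small category) and all linear functors. -/
def twoVect : SubBicat (AddCat k) where
  obj C := IsIdempotentComplete C ∧ EssentiallySmall.{u} C
  hom _ := True
  id_mem _ := trivial
  comp_mem _ _ := trivial

variable {k}

/-- The zero functor. -/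
instance (C D : AddCat k) : Nonempty (C ⟶ D) := by
  obtain ⟨Z, hZ⟩ := HasZeroObject.zero (C := D)
  exact ⟨@Hom.mk k _ C D ((Functor.const C).obj Z) ⟨fun {_ _ _ _} => hZ.eq_of_src _ _⟩
    ⟨fun _ _ => hZ.eq_of_src _ _⟩⟩

/-- A category `target` with a functor of two variables `pair` from `C` and `D` to it; for a
tensor product of `C` and `D`, this is the functor `(c, d) ↦ c ⊠ d`. -/
structure Pairing (C D : AddCat k) where
  target : AddCat k
  pair : C ⥤ D ⥤ target

namespace Pairing

variable {C D : AddCat k}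

/-- The functor of two variables `(c, d) ↦ F (pair c d)`. -/
def after (T : Pairing C D) {E : AddCat k} (F : T.target ⟶ E) : C ⥤ D ⥤ E :=
  T.pair ⋙ (Functor.whiskeringRight D T.target E).obj F.functor

/-- Linearity in each variable. -/
structure IsBilinear (T : Pairing C D) : Prop where
  left_additive : ∀ d, (T.pair.flip.obj d).Additive
  left_linear : ∀ d, (T.pair.flip.obj d).Linear k
  right_additive : ∀ c, (T.pair.obj c).Additive
  right_linear : ∀ c, (T.pair.obj c).Linear k

/-- Right exactness in each variable. -/
structure IsRightExact (T : Pairing C D) : Prop where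
  left : ∀ d, PreservesFiniteColimits (T.pair.flip.obj d)
  right : ∀ c, PreservesFiniteColimits (T.pair.obj c)

/-- The Deligne tensor product of finite linear categories: a finite linear category `C ⊠ D` with a
functor of two variables, linear and right exact in each of them, such that, for all abelian linear
categories `E`, right exact linear functors `C ⊠ D ⥤ E` are the same as functors
of two variables from `C` and `D` to `E`, linear and right exact in each of them. -/
structure IsDeligne (T : Pairing C D) : Prop where
  isFinite : T.target.IsFinite
  isBilinear : T.IsBilinear
  isRightExact : T.IsRightExact
  exists_lift : ∀ P : Pairing C D, P.target.IsAbelian → P.IsBilinear → P.IsRightExact →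
    ∃ H : T.target ⟶ P.target, PreservesFiniteColimits H.functor ∧ Nonempty (T.after H ≅ P.pair)
  bijective : ∀ E : AddCat k, E.IsAbelian → ∀ H H' : T.target ⟶ E,
    PreservesFiniteColimits H.functor → PreservesFiniteColimits H'.functor →
    Function.Bijective fun η : H.functor ⟶ H'.functor =>
      (Functor.whiskerLeft T.pair ((Functor.whiskeringRight D T.target E).map η) :
        T.after H ⟶ T.after H')

end Pairing

/-- The Cauchy completion (formal direct summands of formal finite direct sums) of the tensor
product `C ⊠ D` of linear categories. -/
def cauchyTensor (C D : AddCat k) : Pairing C D where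
  target := ⟨Idempotents.Karoubi (Mat_ (LinTensor k C D))⟩
  pair := LinTensor.pair k C D ⋙ (Functor.whiskeringRight D (LinTensor k C D) _).obj
    (Mat_.embedding (LinTensor k C D) ⋙ Idempotents.toKaroubi (Mat_ (LinTensor k C D)))

instance (C D : AddCat k) : Nonempty (Pairing C D) := ⟨cauchyTensor C D⟩

/-- The Deligne tensor product of finite linear categories, chosen by its universal property. -/
def deligneTensor (C D : AddCat k) : Pairing C D := Classical.epsilon Pairing.IsDeligne

variable (k)

/-- The category of finite-dimensional vector spaces. -/
abbrev vect : AddCat k := ⟨FGModuleCat.{u} k⟩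

/-- The one-dimensional vector space. -/
def vectOne : vect k := FGModuleCat.of k k

variable {k}

/-- The tensor product of linear categories given by functors of two variables `(c, d) ↦ c ⊠ d`.
The tensor product of functors and the structure morphisms are the 1-morphisms of `S` which are
given (up to natural isomorphism, and then uniquely up to natural isomorphism) on objects of the
form `c ⊠ d` by the expected formulas: `c ⊠ d ↦ F c ⊠ G d` for the tensor product of `F` and `G`,
`(a ⊠ b) ⊠ c ↦ a ⊠ (b ⊠ c)` for the associator, `a ⊠ (b ⊠ c) ↦ (a ⊠ b) ⊠ c` for its inverse,
`k ⊠ a ↦ a` and `a ⊠ k ↦ a` for the unitors, and `a ⊠ b ↦ b ⊠ a` for the braiding. -/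
def tensorDataOf (S : SubBicat (AddCat k)) (tens : ∀ C D : AddCat k, Pairing C D) :
    TensorData (AddCat k) where
  unit := vect k
  tensorObj C D := (tens C D).target
  tensorHom {A A' B B'} F G := Classical.epsilon fun H => S.hom H ∧
    Nonempty ((tens A B).after H ≅
      F.functor ⋙ (tens A' B').pair ⋙ (Functor.whiskeringLeft B B' _).obj G.functor)
  assoc A B C := Classical.epsilon fun H => S.hom H ∧
    Nonempty (bifunctorComp₁₂ (tens A B).pair ((tens (tens A B).target C).after H) ≅
      bifunctorComp₂₃ (tens A (tens B C).target).pair (tens B C).pair)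
  assocInv A B C := Classical.epsilon fun H => S.hom H ∧
    Nonempty (bifunctorComp₂₃ ((tens A (tens B C).target).after H) (tens B C).pair ≅
      bifunctorComp₁₂ (tens A B).pair (tens (tens A B).target C).pair)
  leftUnitor A := Classical.epsilon fun H => S.hom H ∧
    Nonempty (((tens (vect k) A).after H).obj (vectOne k) ≅ 𝟭 A)
  rightUnitor A := Classical.epsilon fun H => S.hom H ∧
    Nonempty (((tens A (vect k)).after H).flip.obj (vectOne k) ≅ 𝟭 A)
  braiding A B := Classical.epsilon fun H => S.hom H ∧
    Nonempty ((tens A B).after H ≅ (tens B A).pair.flip)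

variable (k)

/-- The tensor structure of `LinCat`: the Deligne tensor product. -/
def linCatTensorData : TensorData (AddCat k) := tensorDataOf (linCat k) deligneTensor

/-- The tensor structure of `2Vect`: the Cauchy completion of the tensor product of linear
categories. -/
def twoVectTensorData : TensorData (AddCat k) := tensorDataOf (twoVect k) cauchyTensor

variable {k}

lemma vectPow_hom_ext {n : ℕ} {v w : VectPow k n} {f g : v ⟶ w}
    (h : ∀ i (x : v i), (f i).hom.hom x = (g i).hom.hom x) : f = g :=
  funext fun i => ObjectProperty.hom_ext _ (ModuleCat.hom_ext (LinearMap.ext (h i)))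

/-- The linear functor `v ↦ (⨁ i, v i ⊗ M i j)_j` given by a matrix of vector spaces. -/
def matrixFunctor {a b : KV k} (M : a ⟶ b) : VectPow k a.n ⥤ VectPow k b.n where
  obj v j := FGModuleCat.of k (∀ i, v i ⊗[k] KV.Hom.entry M i j)
  map f j := FGModuleCat.ofHom (LinearMap.pi fun i =>
    LinearMap.rTensor (KV.Hom.entry M i j) (f i).hom.hom ∘ₗ LinearMap.proj i)
  map_id v := vectPow_hom_ext fun j _ => funext fun i =>
    LinearMap.congr_fun (LinearMap.rTensor_id (KV.Hom.entry M i j) (v i)) _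
  map_comp f g := vectPow_hom_ext fun j _ => funext fun i =>
    LinearMap.congr_fun (LinearMap.rTensor_comp (KV.Hom.entry M i j) (g i).hom.hom (f i).hom.hom) _

instance {a b : KV k} (M : a ⟶ b) : (matrixFunctor M).Additive where
  map_add {_ _ f g} := vectPow_hom_ext fun j _ => funext fun i =>
    LinearMap.congr_fun (LinearMap.rTensor_add (KV.Hom.entry M i j) (f i).hom.hom (g i).hom.hom) _

instance {a b : KV k} (M : a ⟶ b) : (matrixFunctor M).Linear k where
  map_smul f r := vectPow_hom_ext fun j _ => funext fun i =>
    LinearMap.congr_fun (LinearMap.rTensor_smul (KV.Hom.entry M i j) r (f i).hom.hom) _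

/-- The natural transformation given by a matrix of linear maps. -/
def matrixNatTrans {a b : KV k} {M N : a ⟶ b} (η : M ⟶ N) : matrixFunctor M ⟶ matrixFunctor N where
  app v j := FGModuleCat.ofHom (LinearMap.pi fun i =>
    LinearMap.lTensor (v i) (KV.Hom₂.entry η i j) ∘ₗ LinearMap.proj i)
  naturality v _ f := vectPow_hom_ext fun j (x : ∀ i, v i ⊗[k] KV.Hom.entry M i j) => funext fun i =>
    LinearMap.congr_fun ((LinearMap.lTensor_comp_rTensor (v i) (f i).hom.hom
      (KV.Hom₂.entry η i j)).trans (LinearMap.rTensor_comp_lTensor (v i) (f i).hom.hom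
      (KV.Hom₂.entry η i j)).symm) (x i)

/-- The natural inclusion of the Kapranov–Voevodsky 2-category into the 2-category of additive
linear categories: `n` is sent to the category of `n`-tuples of finite-dimensional vector spaces,
and matrices of vector spaces and of linear maps act on such tuples. -/
def incl (k : Type u) [Field k] : PrelaxFunctor (KV k) (AddCat k) where
  obj a := ⟨VectPow k a.n⟩
  map {a b} M := @Hom.mk k _ ⟨VectPow k a.n⟩ ⟨VectPow k b.n⟩ (matrixFunctor M)
    (inferInstanceAs (matrixFunctor M).Additive) (inferInstanceAs ((matrixFunctor M).Linear k))
  map₂ η := Hom₂.mk (matrixNatTrans η)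
  map₂_id M := hom₂_ext fun v => vectPow_hom_ext fun j _ => funext fun i =>
    LinearMap.congr_fun (LinearMap.lTensor_id (v i) (KV.Hom.entry M i j)) _
  map₂_comp {_ _ M _ _} η θ := hom₂_ext fun v =>
    vectPow_hom_ext fun j (x : ∀ i, v i ⊗[k] KV.Hom.entry M i j) => funext fun i =>
    LinearMap.congr_fun (LinearMap.lTensor_comp (v i) (KV.Hom₂.entry θ i j)
      (KV.Hom₂.entry η i j)) (x i)

end AddCat

end LinTargets

end TwoVec

end

universe w₃ v₃ u₃

noncomputable section

open CategoryTheory Category Limits MonoidalCategory TensorProduct Preadditive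
open Finset (sum_congr sum_eq_single sum_eq_zero sum_add_distrib sum_comm smul_sum)
open Module (finrank finBasis)
open CategoryTheory.Functor (whiskeringRight whiskeringLeft isoWhiskerRight isoWhiskerLeft)
open CategoryTheory.Linear (rightComp leftComp smul_comp comp_smul)
open LinearMap (toSpanSingleton)
open CategoryTheory.Idempotents (toKaroubi Karoubi)
open TwoVec.LinTensor (hom_induction leftUnitorFunctor rightUnitorFunctor assocFunctor assocInvFunctor braidingFunctor)
open scoped Bicategory

namespace TwoVec
variable {k : Type u} [Field k]

/-! ### The category of isomorphism classes of 1-morphisms -/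

section Abstract
variable {B : Type u₁} [Bicategory.{w₁, v₁} B]

/-- The category with the objects of a 2-category and the isomorphism classes of its 1-morphisms. -/
structure Ho (B : Type u₁) where
  of : B

namespace Ho
instance : Category (Ho B) where
  Hom a b := Quotient (isIsomorphicSetoid (a.of ⟶ b.of))
  id a := Quotient.mk _ (𝟙 a.of)
  comp f g := Quotient.map₂ (· ≫ ·) (fun _ _ (h : Nonempty _) _ _ (h' : Nonempty _) => h.elim fun e => h'.elim fun e' =>
    ⟨Bicategory.whiskerRightIso e _ ≪≫ Bicategory.whiskerLeftIso _ e'⟩) f g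
  id_comp f := Quotient.inductionOn f fun f => Quotient.sound ⟨Bicategory.leftUnitor f⟩
  comp_id f := Quotient.inductionOn f fun f => Quotient.sound ⟨Bicategory.rightUnitor f⟩
  assoc f g h := Quotient.inductionOn₃ f g h fun f g h => Quotient.sound ⟨Bicategory.associator f g h⟩

def cls {a b : B} (f : a ⟶ b) : (Ho.mk a : Ho B) ⟶ Ho.mk b := Quotient.mk _ f

lemma cls_eq_iff {a b : B} {f g : a ⟶ b} : cls f = cls g ↔ Nonempty (f ≅ g) := Quotient.eq (r := isIsomorphicSetoid (a ⟶ b))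

lemma cls_eq {a b : B} {f g : a ⟶ b} (e : f ≅ g) : cls f = cls g := cls_eq_iff.2 ⟨e⟩

lemma cls_comp {a b c : B} (f : a ⟶ b) (g : b ⟶ c) : cls (f ≫ g) = cls f ≫ cls g := rfl

lemma cls_id (a : B) : cls (𝟙 a) = 𝟙 (Ho.mk a) := rfl

@[simps]
def iso {a b : B} (e : a ≌ b) : Ho.mk a ≅ Ho.mk b where
  hom := cls e.hom
  inv := cls e.inv
  hom_inv_id := (cls_eq e.unit).symm
  inv_hom_id := cls_eq e.counit

lemma exists_equivalence {a b : B} (f : a ⟶ b) (g : b ⟶ a) (h : cls f ≫ cls g = 𝟙 _) (h' : cls g ≫ cls f = 𝟙 _) : ∃ e : a ≌ b,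
  e.hom = f ∧ e.inv = g := by
  rw [← cls_comp, ← cls_id, cls_eq_iff] at h h'
  obtain ⟨h⟩ := h
  obtain ⟨h'⟩ := h'
  exact ⟨Bicategory.Equivalence.mkOfAdjointifyCounit h.symm h', rfl, rfl⟩

variable {A : Type u₂} [Bicategory.{w₂, v₂} A]

lemma cls_map_eq (ι : Pseudofunctor A B) {a b : A} {f g : a ⟶ b} (h : cls f = cls g) : cls (ι.map f) = cls (ι.map g) := by
  obtain ⟨e⟩ := cls_eq_iff.1 h
  exact cls_eq (ι.map₂Iso e)

lemma cls_map_comp (ι : Pseudofunctor A B) {a b c : A} (f : a ⟶ b) (g : b ⟶ c) : cls (ι.map (f ≫ g)) = cls (ι.map f) ≫ cls (ι.map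
  g) := cls_eq (ι.mapComp f g)

lemma cls_map_id (ι : Pseudofunctor A B) (a : A) : cls (ι.map (𝟙 a)) = 𝟙 _ := cls_eq (ι.mapId a)
end Ho

def equivSymm {a b : B} (e : a ≌ b) : b ≌ a := Bicategory.Equivalence.mkOfAdjointifyCounit e.counit.symm e.unit.symm

lemma exists_equivTrans {a b c : B} (e : a ≌ b) (e' : b ≌ c) : ∃ e'' : a ≌ c, e''.hom = e.hom ≫ e'.hom ∧ e''.inv = e'.inv ≫ e.inv
  := Ho.exists_equivalence _ _ (((Ho.iso e).trans (Ho.iso e')).hom_inv_id) (((Ho.iso e).trans (Ho.iso e')).inv_hom_id)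

def equivAdj {a b : B} (e : a ≌ b) : Bicategory.Adjunction e.hom e.inv where
  unit := e.unit.hom
  counit := e.counit.hom
  left_triangle := e.left_triangle_hom
  right_triangle := e.right_triangle_hom

/-! ### Infinite chains of adjoints -/

namespace SubBicat
variable (S : SubBicat B)

lemma obj_iterate_L (n : ℕ) : (L^[n] S).obj = S.obj := by
  induction n generalizing S with
  | zero => rfl
  | succ n ih => exact ih S.L

lemma obj_iterate_R (n : ℕ) : (R^[n] S).obj = S.obj := by
  induction n generalizing S with
  | zero => rfl
  | succ n ih => exact ih S.R

lemma obj_d₁ {x : B} : S.d₁.obj x ↔ S.obj x := by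
  have h : ∀ x, S.LInf.obj x ↔ S.obj x := fun x => ⟨fun h => h 0, fun h n => by rw [obj_iterate_L]; exact h⟩
  exact ⟨fun h' => (h x).1 (h' 0), fun h' n => by rw [obj_iterate_R]; exact (h x).2 h'⟩

variable {S}

lemma hom_of_d₁ {a b : B} {f : a ⟶ b} (h : S.d₁.hom f) : S.hom f := h 0 0

lemma rightAdjoint_of_d₁ {a b : B} {f : a ⟶ b} (h : S.d₁.hom f) : ∃ g, S.hom g ∧ Nonempty (Bicategory.Adjunction f g) := (h 0 1).2

lemma d₁_of_closed (K : ∀ {a b : B}, (a ⟶ b) → Prop) (hK : ∀ {a b : B} {f : a ⟶ b}, K f → S.hom f) (hr : ∀ {a b : B} {f : a ⟶ b},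
  K f → ∃ g, K g ∧ Nonempty (Bicategory.Adjunction f g)) (hl : ∀ {a b : B} {f : a ⟶ b}, K f → ∃ g, K g ∧ Nonempty
  (Bicategory.Adjunction g f)) {a b : B} {f : a ⟶ b} (hf : K f) : S.d₁.hom f := by
  have h₁ : ∀ (n : ℕ) (S : SubBicat B), (∀ {a b : B} {f : a ⟶ b}, K f → S.hom f) → ∀ {a b : B} {f : a ⟶ b}, K f → (L^[n] S).hom f
    := by
    intro n
    induction n with
    | zero => exact fun S h _ _ _ hf => h hf
    | succ n ih =>
      refine fun S h _ _ _ hf => ih S.L (fun hf => ⟨h hf, ?_⟩) hf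
      obtain ⟨g, hg, adj⟩ := hr hf
      exact ⟨g, h hg, adj⟩
  have h₂ : ∀ (n : ℕ) (S : SubBicat B), (∀ {a b : B} {f : a ⟶ b}, K f → S.hom f) → ∀ {a b : B} {f : a ⟶ b}, K f → (R^[n] S).hom f
    := by
    intro n
    induction n with
    | zero => exact fun S h _ _ _ hf => h hf
    | succ n ih =>
      refine fun S h _ _ _ hf => ih S.R (fun hf => ⟨h hf, ?_⟩) hf
      obtain ⟨g, hg, adj⟩ := hl hf
      exact ⟨g, h hg, adj⟩
  exact fun n => h₂ n S.LInf (fun hf m => h₁ m S hK hf) hf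

lemma d₁_equivalence {a b : B} (e : a ≌ b) (h : S.hom e.hom) (h' : S.hom e.inv) : S.d₁.hom e.hom := by
  refine d₁_of_closed (fun {a b} f => ∃ e : a ≌ b, e.hom = f ∧ S.hom e.hom ∧ S.hom e.inv) ?_ ?_ ?_ ⟨e, rfl, h, h'⟩
  · rintro a b _ ⟨e, rfl, h, h'⟩
    exact h
  · rintro a b _ ⟨e, rfl, h, h'⟩
    exact ⟨e.inv, ⟨equivSymm e, rfl, h', h⟩, ⟨equivAdj e⟩⟩
  · rintro a b _ ⟨e, rfl, h, h'⟩
    exact ⟨e.inv, ⟨equivSymm e, rfl, h', h⟩, ⟨equivAdj (equivSymm e)⟩⟩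

/-- A pseudofunctor landing in a sub-2-category, restricted to it. -/
def liftPseudofunctor {A : Type u₂} [Bicategory.{w₂, v₂} A] (S : SubBicat B) (ι : Pseudofunctor A B) (hobj : ∀ a, S.obj (ι.obj a))
  (hmap : ∀ {a b : A} (f : a ⟶ b), S.hom (ι.map f)) : Pseudofunctor A S.Carrier where
  toPrelaxFunctor := S.lift ι.toPrelaxFunctor hobj hmap
  mapId a := isoMk (ι.mapId a)
  mapComp f g := isoMk (ι.mapComp f g)
  map₂_whisker_left f _ _ η := hom₂_ext (ι.map₂_whisker_left f η)
  map₂_whisker_right η h := hom₂_ext (ι.map₂_whisker_right η h)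
  map₂_associator f g h := hom₂_ext (ι.map₂_associator f g h)
  map₂_left_unitor f := hom₂_ext (ι.map₂_left_unitor f)
  map₂_right_unitor f := hom₂_ext (ι.map₂_right_unitor f)

lemma nonempty_carrier_equivalence (S : SubBicat B) {a b : S.Carrier} (e : a.of ≌ b.of) (h : S.hom e.hom) (h' : S.hom e.inv) :
  Nonempty (a ≌ b) := by
  let f : a ⟶ b := Hom.mk e.hom h
  let g : b ⟶ a := Hom.mk e.inv h'
  exact ⟨Bicategory.Equivalence.mkOfAdjointifyCounit (f := f) (g := g) (isoMk e.unit) (isoMk e.counit)⟩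
end SubBicat

/-! ### Functorial tensor products -/

/-- Functoriality, up to isomorphism, of the tensor product on a sub-2-category. -/
structure TensorData.IsFunctorial (T : TensorData B) (S : SubBicat B) : Prop where
  obj_unit : S.obj T.unit
  obj_tensor {a b : B} : S.obj a → S.obj b → S.obj (T.tensorObj a b)
  congr {a a' b b' : B} {f f' : a ⟶ a'} {g g' : b ⟶ b'} : S.obj a → S.obj a' → S.obj b → S.obj b' → S.hom f → S.hom f' → S.hom g →
    S.hom g' → Nonempty (f ≅ f') → Nonempty (g ≅ g') → Nonempty (T.tensorHom f g ≅ T.tensorHom f' g')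
  id {a b : B} : S.obj a → S.obj b → Nonempty (T.tensorHom (𝟙 a) (𝟙 b) ≅ 𝟙 _)
  comp {a a' a'' b b' b'' : B} {f : a ⟶ a'} {f' : a' ⟶ a''} {g : b ⟶ b'} {g' : b' ⟶ b''} : S.obj a → S.obj a' → S.obj a'' → S.obj
    b → S.obj b' → S.obj b'' → S.hom f → S.hom f' → S.hom g → S.hom g' → Nonempty (T.tensorHom (f ≫ f') (g ≫ g') ≅ T.tensorHom f g
    ≫ T.tensorHom f' g')
  assocInv_assoc {a b c : B} : S.obj a → S.obj b → S.obj c → Nonempty (T.assocInv a b c ≫ T.assoc a b c ≅ 𝟙 _)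

namespace TensorData
open Ho

namespace IsFunctorial
variable {T : TensorData B} {S : SubBicat B} (hT : T.IsFunctorial S)

include hT

lemma cls_congr {a a' b b' : B} {f f' : a ⟶ a'} {g g' : b ⟶ b'} (ha : S.obj a) (ha' : S.obj a') (hb : S.obj b) (hb' : S.obj b')
  (hf : S.hom f) (hf' : S.hom f') (hg : S.hom g) (hg' : S.hom g') (h : cls f = cls f') (h' : cls g = cls g') : cls (T.tensorHom f
  g) = cls (T.tensorHom f' g') := cls_eq_iff.2 (hT.congr ha ha' hb hb' hf hf' hg hg' (cls_eq_iff.1 h) (cls_eq_iff.1 h'))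

lemma cls_id_comp {a b b' b'' : B} {g : b ⟶ b'} {g' : b' ⟶ b''} (ha : S.obj a) (hb : S.obj b) (hb' : S.obj b') (hb'' : S.obj b'')
  (hg : S.hom g) (hg' : S.hom g') : cls (T.tensorHom (𝟙 a) (g ≫ g')) = cls (T.tensorHom (𝟙 a) g) ≫ cls (T.tensorHom (𝟙 a) g') :=
  by
  have h := S.id_mem ha
  refine (hT.cls_congr ha ha hb hb'' h (S.comp_mem h h) (S.comp_mem hg hg') (S.comp_mem hg hg') (id_comp (𝟙 (Ho.mk a))).symm
    rfl).trans ?_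
  exact cls_eq_iff.2 (hT.comp ha ha ha hb hb' hb'' h h hg hg')

lemma cls_comp_id {a b b' b'' : B} {g : b ⟶ b'} {g' : b' ⟶ b''} (ha : S.obj a) (hb : S.obj b) (hb' : S.obj b') (hb'' : S.obj b'')
  (hg : S.hom g) (hg' : S.hom g') : cls (T.tensorHom (g ≫ g') (𝟙 a)) = cls (T.tensorHom g (𝟙 a)) ≫ cls (T.tensorHom g' (𝟙 a)) :=
  by
  have h := S.id_mem ha
  refine (hT.cls_congr hb hb'' ha ha (S.comp_mem hg hg') (S.comp_mem hg hg') h (S.comp_mem h h) rfl (id_comp (𝟙 (Ho.mk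
    a))).symm).trans ?_
  exact cls_eq_iff.2 (hT.comp hb hb' hb'' ha ha ha hg hg' h h)

lemma cls_id_inv_hom {a b b' : B} (ha : S.obj a) (e : b ≌ b') (hb : S.obj b) (hb' : S.obj b') (h : S.hom e.hom) (h' : S.hom e.inv)
  : cls (T.tensorHom (𝟙 a) e.inv) ≫ cls (T.tensorHom (𝟙 a) e.hom) = 𝟙 _ := by
  rw [← hT.cls_id_comp ha hb' hb hb' h' h, ← cls_id, ← cls_eq_iff.2 (hT.id ha hb')]
  have h₁ := S.id_mem ha
  exact hT.cls_congr ha ha hb' hb' h₁ h₁ (S.comp_mem h' h) (S.id_mem hb') rfl (iso e).inv_hom_id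

lemma cls_inv_hom_id {a b b' : B} (ha : S.obj a) (e : b ≌ b') (hb : S.obj b) (hb' : S.obj b') (h : S.hom e.hom) (h' : S.hom e.inv)
  : cls (T.tensorHom e.inv (𝟙 a)) ≫ cls (T.tensorHom e.hom (𝟙 a)) = 𝟙 _ := by
  rw [← hT.cls_comp_id ha hb' hb hb' h' h, ← cls_id, ← cls_eq_iff.2 (hT.id hb' ha)]
  have h₁ := S.id_mem ha
  exact hT.cls_congr hb' hb' ha ha (S.comp_mem h' h) (S.id_mem hb') h₁ h₁ (iso e).inv_hom_id rfl
end IsFunctorial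

variable {A : Type u₂} [Bicategory.{w₂, v₂} A] {T' : TensorData A} {T : TensorData B} {ι : Pseudofunctor A B} {χ₀ : T.unit ≌ ι.obj
  T'.unit} {χ : ∀ a b, T.tensorObj (ι.obj a) (ι.obj b) ≌ ι.obj (T'.tensorObj a b)}

lemma Preserves.isDual (hι : Preserves T' T ι.toPrelaxFunctor χ₀ χ) {S : SubBicat B} (hT : T.IsFunctorial S) (hT' : ∀ a b c,
  Nonempty (T'.assoc a b c ≫ T'.assocInv a b c ≅ 𝟙 _)) (hobj : ∀ a, S.obj (ι.obj a)) (hmap : ∀ {a b : A} (f : a ⟶ b), S.hom (ι.map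
  f)) (hχ₀ : S.hom χ₀.hom) (hχ₀' : S.hom χ₀.inv) (hχ : ∀ a b, S.hom (χ a b).hom) (hχ' : ∀ a b, S.hom (χ a b).inv) {a b : A} {e :
  T'.tensorObj a b ⟶ T'.unit} {c : T'.unit ⟶ T'.tensorObj b a} (h : T'.IsDual e c) : T.IsDual ((χ a b).hom ≫ ι.map e ≫ χ₀.inv)
  (χ₀.hom ≫ ι.map c ≫ (χ b a).inv) := by
  have hI := hT.obj_unit
  have h₁ : ∀ a, S.hom (𝟙 (ι.obj a)) := fun a => S.id_mem (hobj a)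
  have ho : ∀ a b, S.obj (T.tensorObj (ι.obj a) (ι.obj b)) := fun a b => hT.obj_tensor (hobj a) (hobj b)
  have nat₁ {a b b' : A} (g : b ⟶ b') : cls (T.tensorHom (𝟙 (ι.obj a)) (ι.map g)) ≫ cls (χ a b').hom = cls (χ a b).hom ≫ cls
    (ι.map (T'.tensorHom (𝟙 a) g)) := by
    rw [hT.cls_congr (hobj a) (hobj a) (hobj b) (hobj b') (h₁ a) (hmap (𝟙 a)) (hmap g) (hmap g) (cls_map_id ι a).symm rfl]
    exact cls_eq_iff.2 (hι.naturality (𝟙 a) g)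
  have nat₂ {a a' b : A} (g : a ⟶ a') : cls (T.tensorHom (ι.map g) (𝟙 (ι.obj b))) ≫ cls (χ a' b).hom = cls (χ a b).hom ≫ cls
    (ι.map (T'.tensorHom g (𝟙 b))) := by
    rw [hT.cls_congr (hobj a) (hobj a') (hobj b) (hobj b) (hmap g) (hmap g) (h₁ b) (hmap (𝟙 b)) rfl (cls_map_id ι b).symm]
    exact cls_eq_iff.2 (hι.naturality g (𝟙 b))
  have nat₂' {a a' b : A} (g : a ⟶ a') : cls (χ a b).inv ≫ cls (T.tensorHom (ι.map g) (𝟙 (ι.obj b))) = cls (ι.map (T'.tensorHom g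
    (𝟙 b))) ≫ cls (χ a' b).inv := by
    rw [← cancel_mono (iso (χ a' b)).hom, ← cancel_epi (iso (χ a b)).hom]
    simp only [Category.assoc, iso_hom, nat₂]
    rw [← iso_hom, ← iso_inv, ← iso_inv, ← iso_hom, Iso.hom_inv_id_assoc, Iso.inv_hom_id, comp_id]
  have nat₁' {a b b' : A} (g : b ⟶ b') : cls (χ a b).inv ≫ cls (T.tensorHom (𝟙 (ι.obj a)) (ι.map g)) = cls (ι.map (T'.tensorHom (𝟙
    a) g)) ≫ cls (χ a b').inv := by
    rw [← cancel_mono (iso (χ a b')).hom, ← cancel_epi (iso (χ a b)).hom]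
    simp only [Category.assoc, iso_hom, nat₁]
    rw [← iso_hom, ← iso_inv, ← iso_inv, ← iso_hom, Iso.hom_inv_id_assoc, Iso.inv_hom_id, comp_id]
  have hassoc (a b c : A) : cls (T.tensorHom (χ a b).hom (𝟙 (ι.obj c))) ≫ cls (χ (T'.tensorObj a b) c).hom ≫ cls (ι.map (T'.assoc
    a b c)) = cls (T.assoc (ι.obj a) (ι.obj b) (ι.obj c)) ≫ cls (T.tensorHom (𝟙 (ι.obj a)) (χ b c).hom) ≫ cls (χ a (T'.tensorObj b
    c)).hom := cls_eq_iff.2 (hι.associativity a b c)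
  have k₁ (a b c : A) : cls (T.tensorHom (𝟙 (ι.obj a)) (χ b c).inv) ≫ cls (T.assocInv (ι.obj a) (ι.obj b) (ι.obj c)) ≫ cls
    (T.tensorHom (χ a b).hom (𝟙 (ι.obj c))) = cls (χ a (T'.tensorObj b c)).hom ≫ cls (ι.map (T'.assocInv a b c)) ≫ cls (χ
    (T'.tensorObj a b) c).inv := by
    have hinv : cls (ι.map (T'.assoc a b c)) ≫ cls (ι.map (T'.assocInv a b c)) = 𝟙 _ := by
      rw [← cls_map_comp, ← cls_map_id]
      exact cls_map_eq ι (cls_eq_iff.2 (hT' a b c))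
    have hinv' : cls (T.assocInv (ι.obj a) (ι.obj b) (ι.obj c)) ≫ cls (T.assoc (ι.obj a) (ι.obj b) (ι.obj c)) = 𝟙 _ :=
      cls_eq_iff.2 (hT.assocInv_assoc (hobj a) (hobj b) (hobj c))
    have h := hassoc a b c =≫ cls (ι.map (T'.assocInv a b c))
    simp only [Category.assoc, hinv, comp_id] at h
    rw [← cancel_mono (iso (χ (T'.tensorObj a b) c)).hom]
    simp only [Category.assoc, iso_hom, h]
    have e₁ := (iso (χ (T'.tensorObj a b) c)).inv_hom_id
    simp only [iso_hom, iso_inv] at e₁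
    rw [reassoc_of% hinv', reassoc_of% (hT.cls_id_inv_hom (hobj _) (χ b c) (ho b c) (hobj _) (hχ b c) (hχ' b c)), e₁, comp_id]
  have k₂ (a b c : A) : cls (T.tensorHom (χ a b).inv (𝟙 (ι.obj c))) ≫ cls (T.assoc (ι.obj a) (ι.obj b) (ι.obj c)) ≫ cls
    (T.tensorHom (𝟙 (ι.obj a)) (χ b c).hom) = cls (χ (T'.tensorObj a b) c).hom ≫ cls (ι.map (T'.assoc a b c)) ≫ cls (χ a
    (T'.tensorObj b c)).inv := by
    rw [← cancel_mono (iso (χ a (T'.tensorObj b c))).hom]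
    simp only [Category.assoc, iso_hom, ← hassoc a b c]
    have e₁ := (iso (χ a (T'.tensorObj b c))).inv_hom_id
    simp only [iso_hom, iso_inv] at e₁
    rw [reassoc_of% (hT.cls_inv_hom_id (hobj _) (χ a b) (ho a b) (hobj _) (hχ a b) (hχ' a b)), e₁, comp_id]
  have hleft (a : A) : cls (χ T'.unit a).inv ≫ cls (T.tensorHom χ₀.inv (𝟙 (ι.obj a))) ≫ cls (T.leftUnitor (ι.obj a)) = cls (ι.map
    (T'.leftUnitor a)) := by
    have h := cls_eq_iff.2 (hι.left_unitality a)
    simp only [cls_comp] at h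
    rw [← h, reassoc_of% (hT.cls_inv_hom_id (hobj _) χ₀ hI (hobj _) hχ₀ hχ₀')]
    exact (iso (χ T'.unit a)).inv_hom_id_assoc _
  have hright (a : A) : cls (χ a T'.unit).inv ≫ cls (T.tensorHom (𝟙 (ι.obj a)) χ₀.inv) ≫ cls (T.rightUnitor (ι.obj a)) = cls
    (ι.map (T'.rightUnitor a)) := by
    have h := cls_eq_iff.2 (hι.right_unitality a)
    simp only [cls_comp] at h
    rw [← h, reassoc_of% (hT.cls_id_inv_hom (hobj _) χ₀ hI (hobj _) hχ₀ hχ₀')]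
    exact (iso (χ a T'.unit)).inv_hom_id_assoc _
  refine ⟨cls_eq_iff.1 ?_, cls_eq_iff.1 ?_⟩
  · have h' := cls_map_eq ι (cls_eq_iff.2 h.zigzag₁)
    simp only [cls_map_comp] at h'
    have h'' := cls_eq_iff.2 (hι.right_unitality a)
    simp only [cls_comp] at h'' ⊢
    rw [hT.cls_id_comp (hobj a) hI (hobj _) (ho b a) hχ₀ (S.comp_mem (hmap c) (hχ' b a)), hT.cls_id_comp (hobj a) (hobj _) (hobj
      _) (ho b a) (hmap c) (hχ' b a), hT.cls_comp_id (hobj a) (ho a b) (hobj _) hI (hχ a b) (S.comp_mem (hmap e) hχ₀'),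
      hT.cls_comp_id (hobj a) (hobj _) (hobj _) hI (hmap e) hχ₀']
    simp only [Category.assoc]
    rw [reassoc_of% (k₁ a b a), reassoc_of% (nat₂' (b := a) e), hleft, reassoc_of% (nat₁ (a := a) c), h', h'']
  · have h' := cls_map_eq ι (cls_eq_iff.2 h.zigzag₂)
    simp only [cls_map_comp] at h'
    have h'' := cls_eq_iff.2 (hι.left_unitality b)
    simp only [cls_comp] at h'' ⊢
    rw [hT.cls_comp_id (hobj b) hI (hobj _) (ho b a) hχ₀ (S.comp_mem (hmap c) (hχ' b a)), hT.cls_comp_id (hobj b) (hobj _) (hobj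
      _) (ho b a) (hmap c) (hχ' b a), hT.cls_id_comp (hobj b) (ho a b) (hobj _) hI (hχ a b) (S.comp_mem (hmap e) hχ₀'),
      hT.cls_id_comp (hobj b) (hobj _) (hobj _) hI (hmap e) hχ₀']
    simp only [Category.assoc]
    rw [reassoc_of% (k₂ b a b), reassoc_of% (nat₁' (a := b) e), hright, reassoc_of% (nat₂ (b := b) c), h', h'']
end TensorData

/-- The 1-morphisms in the image of a functor. -/
inductive IsMap {A : Type u₂} [Bicategory.{w₂, v₂} A] (ι : Pseudofunctor A B) : ∀ {x y : B}, (x ⟶ y) → Prop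
  | mk {a b : A} (f : a ⟶ b) : IsMap ι (ι.map f)

/-- A criterion for a locally fully faithful functor to induce an equivalence with the
fully-dualizable sub-2-category. -/
theorem inducesEquivalence_of {A : Type u₂} [Bicategory.{w₂, v₂} A] {T' : TensorData A} {T : TensorData B} (ι : Pseudofunctor A B)
  (S S₀ : SubBicat B) (hS₀ : ∀ a, S₀.obj (ι.obj a)) (hShom : ∀ {x y : B} {f : x ⟶ y}, S.hom f → S₀.hom f) (hT : T.IsFunctorial S₀)
  (hT' : ∀ a b c, Nonempty (T'.assoc a b c ≫ T'.assocInv a b c ≅ 𝟙 _)) (hfull : ∀ a b, (ι.mapFunctor a b).Full) (hfaithful : ∀ a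
  b, (ι.mapFunctor a b).Faithful) (hobj : ∀ a, S.obj (ι.obj a)) (hmap : ∀ {a b : A} (f : a ⟶ b), S.hom (ι.map f)) (hadj : ∀ {a b :
  A} (f : a ⟶ b), ∃ g, Nonempty (Bicategory.Adjunction f g) ∧ Nonempty (Bicategory.Adjunction g f)) (hdual : ∀ a : A, ∃ (b : A) (e
  : T'.tensorObj a b ⟶ T'.unit) (c : T'.unit ⟶ T'.tensorObj b a), T'.IsDual e c) (hess : ∀ {a b : A} (f : ι.obj a ⟶ ι.obj b),
  S.hom f → (∃ g, S.hom g ∧ Nonempty (Bicategory.Adjunction f g)) → ∃ M, Nonempty (ι.map M ≅ f)) (hfd : ∀ {x y : B} {e :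
  T.tensorObj x y ⟶ T.unit} {c : T.unit ⟶ T.tensorObj y x}, S.obj x → S.obj y → S.hom e → S.hom c → (∃ g, S.hom g ∧ Nonempty
  (Bicategory.Adjunction e g)) → (∃ g, S.hom g ∧ Nonempty (Bicategory.Adjunction c g)) → T.IsDual e c → ∃ (a : A) (i : ι.obj a ≌
  x), S.hom i.hom ∧ S.hom i.inv) {χ₀ : T.unit ≌ ι.obj T'.unit} {χ : ∀ a b, T.tensorObj (ι.obj a) (ι.obj b) ≌ ι.obj (T'.tensorObj a
  b)} (hι : TensorData.Preserves T' T ι.toPrelaxFunctor χ₀ χ) (hχ₀ : S.hom χ₀.hom) (hχ₀' : S.hom χ₀.inv) (hχ : ∀ a b, S.hom (χ a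
  b).hom) (hχ' : ∀ a b, S.hom (χ a b).inv) : InducesEquivalence T' T S ι.toPrelaxFunctor := by
  have hmap' {a b : A} (f : a ⟶ b) : S.d₁.hom (ι.map f) := by
    refine SubBicat.d₁_of_closed (IsMap ι) ?_ ?_ ?_ ⟨f⟩
    · rintro _ _ _ ⟨f⟩
      exact hmap f
    · rintro _ _ _ ⟨f⟩
      obtain ⟨g, ⟨adj⟩, -⟩ := hadj f
      exact ⟨ι.map g, ⟨g⟩, ⟨ι.mapAdjunction adj⟩⟩
    · rintro _ _ _ ⟨f⟩
      obtain ⟨g, -, ⟨adj⟩⟩ := hadj f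
      exact ⟨ι.map g, ⟨g⟩, ⟨ι.mapAdjunction adj⟩⟩
  have hobj' (a : A) : (T.fd S).obj (ι.obj a) := by
    obtain ⟨b, e, c, h⟩ := hdual a
    refine ⟨S.obj_d₁.2 (hobj a), ι.obj b, (χ a b).hom ≫ ι.map e ≫ χ₀.inv, χ₀.hom ≫ ι.map c ≫ (χ b a).inv, S.obj_d₁.2 (hobj b), ?_,
      ?_, hι.isDual hT hT' hS₀ (fun f => hShom (hmap f)) (hShom hχ₀) (hShom hχ₀') (fun a b => hShom (hχ a b)) (fun a b => hShom
      (hχ' a b)) h⟩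
    · exact S.d₁.comp_mem (SubBicat.d₁_equivalence _ (hχ a b) (hχ' a b)) (S.d₁.comp_mem (hmap' e) (SubBicat.d₁_equivalence
        (equivSymm χ₀) hχ₀' hχ₀))
    · exact S.d₁.comp_mem (SubBicat.d₁_equivalence _ hχ₀ hχ₀') (S.d₁.comp_mem (hmap' c) (SubBicat.d₁_equivalence (equivSymm (χ b
        a)) (hχ' b a) (hχ b a)))
  refine ⟨⟨hobj', fun f => hmap' f, (T.fd S).liftPseudofunctor ι hobj' (fun f => hmap' f), rfl, ?_⟩, χ₀, χ, hι⟩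
  constructor
  · rintro ⟨x, hx, y, e, c, hy, he, hc, h⟩
    obtain ⟨a, i, hi, hi'⟩ := hfd (S.obj_d₁.1 hx) (S.obj_d₁.1 hy) (SubBicat.hom_of_d₁ he) (SubBicat.hom_of_d₁ hc)
      (SubBicat.rightAdjoint_of_d₁ he) (SubBicat.rightAdjoint_of_d₁ hc) h
    exact ⟨a, SubBicat.nonempty_carrier_equivalence _ i (SubBicat.d₁_equivalence i hi hi') (SubBicat.d₁_equivalence (equivSymm i)
      hi' hi)⟩
  · intro a b
    have := hfull a b
    have := hfaithful a b
    refine { faithful := ⟨fun {f g η θ} h => ?_⟩, full := ⟨fun {f g} η => ?_⟩, essSurj := ⟨fun f => ?_⟩ }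
    · exact (ι.mapFunctor a b).map_injective (congrArg SubBicat.Hom₂.of h)
    · obtain ⟨θ, hθ⟩ := (ι.mapFunctor a b).map_surjective (SubBicat.Hom₂.of η)
      exact ⟨θ, SubBicat.hom₂_ext hθ⟩
    · obtain ⟨M, ⟨i⟩⟩ := hess (SubBicat.Hom.of f) (SubBicat.hom_of_d₁ (SubBicat.Hom.mem f)) (SubBicat.rightAdjoint_of_d₁
        (SubBicat.Hom.mem f))
      exact ⟨M, ⟨SubBicat.isoMk i⟩⟩
end Abstract

namespace KV
variable {a b c d : KV k}

open Module

/-! ### Ranks of matrices of vector spaces -/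

def rank (M : a ⟶ b) (i : Fin a.n) (j : Fin b.n) : ℕ := finrank k (Hom.entry M i j)

lemma nonempty_iso_of_rank {M N : a ⟶ b} (h : ∀ i j, rank M i j = rank N i j) : Nonempty (M ≅ N) := by
  have e (i j) : Hom.entry M i j ≃ₗ[k] Hom.entry N i j := LinearEquiv.ofFinrankEq _ _ (h i j)
  exact ⟨⟨Hom₂.mk fun i j => (e i j).toLinearMap, Hom₂.mk fun i j => (e i j).symm.toLinearMap, hom₂_ext fun i j x => (e i
    j).symm_apply_apply x, hom₂_ext fun i j x => (e i j).apply_symm_apply x⟩⟩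

lemma rank_comp (M : a ⟶ b) (N : b ⟶ c) (i l) : rank (M ≫ N) i l = ∑ j, rank M i j * rank N j l := by
  refine (finrank_directSum (R := k) (fun j => (Hom.entry M i j ⊗[k] Hom.entry N j l))).trans ?_
  exact sum_congr rfl fun j _ => finrank_tensorProduct

lemma rank_of_pi (p : Prop) [Decidable p] : finrank k (PLift p → k) = if p then 1 else 0 := by
  rw [finrank_fintype_fun_eq_card]
  split_ifs with h
  · have : Unique (PLift p) := ⟨⟨⟨h⟩⟩, fun _ => rfl⟩
    exact Fintype.card_unique
  · have : IsEmpty (PLift p) := ⟨fun x => h x.down⟩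
    exact Fintype.card_eq_zero

lemma rank_perm (σ : Fin a.n ≃ Fin b.n) (i j) :
    rank (k := k) (a := a) (b := b) (perm σ) i j = if σ i = j then 1 else 0 :=
  rank_of_pi _

lemma rank_id (i j) : rank (𝟙 a) i j = if i = j then 1 else 0 := rank_of_pi _

lemma rank_perm_comp (σ : Fin a.n ≃ Fin b.n) (M : b ⟶ c) (i l) : rank ((perm σ : a ⟶ b) ≫ M) i l = rank M (σ i) l := by
  simp [rank_comp, rank_perm]

lemma rank_comp_perm (σ : Fin b.n ≃ Fin c.n) (M : a ⟶ b) (i l) : rank (M ≫ (perm σ : b ⟶ c)) i l = rank M i (σ.symm l) := by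
  simp [rank_comp, rank_perm, ← Equiv.eq_symm_apply]

lemma rank_tensorHom {a' b' : KV k} (M : a ⟶ a') (N : b ⟶ b') (i j) : rank ((tensorData k).tensorHom M N) i j = rank M
  (finProdFinEquiv.symm i).1 (finProdFinEquiv.symm j).1 * rank N (finProdFinEquiv.symm i).2 (finProdFinEquiv.symm j).2 :=
  finrank_tensorProduct

lemma assoc_assocInv (a b c : KV k) : Nonempty ((tensorData k).assoc a b c ≫ (tensorData k).assocInv a b c ≅ 𝟙 _) := by
  refine nonempty_iso_of_rank fun i j => ?_
  refine (rank_perm_comp _ _ _ _).trans ((rank_perm _ _ _).trans ?_)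
  exact (rank_id i j).symm

/-! ### Duals of objects -/

def ev (a : KV k) : (tensorData k).tensorObj a a ⟶ (tensorData k).unit := Hom.mk fun i _ => FGModuleCat.of k (PLift
  ((finProdFinEquiv.symm i).1 = (finProdFinEquiv.symm i).2) → k)

def coev (a : KV k) : (tensorData k).unit ⟶ (tensorData k).tensorObj a a := Hom.mk fun _ i => FGModuleCat.of k (PLift
  ((finProdFinEquiv.symm i).1 = (finProdFinEquiv.symm i).2) → k)

lemma rank_ev (i j) : rank (ev a) i j =
    if (finProdFinEquiv.symm i).1 = (finProdFinEquiv.symm i).2 then 1 else 0 := rank_of_pi _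

lemma rank_coev (i j) : rank (coev a) i j =
    if (finProdFinEquiv.symm j).1 = (finProdFinEquiv.symm j).2 then 1 else 0 := rank_of_pi _

lemma finCongr_assoc {l m n : ℕ} (p : Fin l) (q : Fin m) (r : Fin n) : finCongr (mul_assoc l m n) (finProdFinEquiv
  (finProdFinEquiv (p, q), r)) = finProdFinEquiv (p, finProdFinEquiv (q, r)) := by
  ext
  simp
  ring

lemma finCongr_assoc_symm {l m n : ℕ} (p : Fin l) (q : Fin m) (r : Fin n) : finCongr (mul_assoc l m n).symm (finProdFinEquiv (p,
  finProdFinEquiv (q, r))) = finProdFinEquiv (finProdFinEquiv (p, q), r) := by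
  rw [← finCongr_assoc]
  rfl

lemma finCongr_one_mul {m : ℕ} (p : Fin 1) (q : Fin m) : finCongr (one_mul m) (finProdFinEquiv (p, q)) = q := by
  ext
  simp

lemma finCongr_mul_one {m : ℕ} (p : Fin m) (q : Fin 1) : finCongr (mul_one m) (finProdFinEquiv (p, q)) = p := by
  ext
  simp

lemma finCongr_one_mul_symm {m : ℕ} (q : Fin m) : (finCongr (one_mul m)).symm q = finProdFinEquiv (0, q) := by
  rw [Equiv.symm_apply_eq, finCongr_one_mul]

lemma finCongr_mul_one_symm {m : ℕ} (q : Fin m) : (finCongr (mul_one m)).symm q = finProdFinEquiv (q, 0) := by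
  rw [Equiv.symm_apply_eq, finCongr_mul_one]

lemma sum_fin_mul {m n : ℕ} (f : Fin (m * n) → ℕ) : ∑ q, f q = ∑ p : Fin m, ∑ r : Fin n, f (finProdFinEquiv (p, r)) := by
  rw [← Fintype.sum_prod_type', ← Equiv.sum_comp finProdFinEquiv]

lemma rank_tensorHom_apply {a' b' : KV k} (M : a ⟶ a') (N : b ⟶ b') (i j i' j') : rank ((tensorData k).tensorHom M N)
  (finProdFinEquiv (i, j) : Fin (a.n * b.n)) (finProdFinEquiv (i', j') : Fin (a'.n * b'.n)) = rank M i i' * rank N j j' := by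
  refine (rank_tensorHom M N _ _).trans ?_
  rw [Equiv.symm_apply_apply, Equiv.symm_apply_apply]

lemma rank_ev_apply (i j z) : rank (ev a) (finProdFinEquiv (i, j) : Fin (a.n * a.n)) z =
    if i = j then 1 else 0 := by
  refine (rank_ev _ _).trans ?_
  rw [Equiv.symm_apply_apply]

lemma rank_coev_apply (i j z) : rank (coev a) z (finProdFinEquiv (i, j) : Fin (a.n * a.n)) =
    if i = j then 1 else 0 := by
  refine (rank_coev _ _).trans ?_
  rw [Equiv.symm_apply_apply]

lemma isDual_self (a : KV k) : (tensorData k).IsDual (ev a) (coev a) := by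
  constructor
  · refine nonempty_iso_of_rank fun i l => ?_
    obtain ⟨⟨i, z⟩, rfl⟩ := (finProdFinEquiv).surjective i
    have key : ∑ p : Fin a.n, ∑ q : Fin a.n, ∑ r : Fin a.n, ((if i = p then 1 else 0) * (if q = r then 1 else 0)) *
      ((if p = q then 1 else 0) * (if r = l then 1 else 0)) = if i = l then 1 else 0 := by
      simp
    refine (rank_comp _ _ _ _).trans (((sum_fin_mul _).trans (sum_congr rfl fun p _ => (sum_fin_mul _).trans (sum_congr rfl fun q
      _ => sum_congr rfl fun r _ => congrArg₂ (· * ·) ((rank_tensorHom_apply _ _ _ _ _ _).trans (congrArg₂ (· * ·) (rank_id _ _)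
      (rank_coev_apply _ _ _))) ?_))).trans (key.trans ?_))
    · refine ((rank_perm_comp (finCongr (mul_assoc a.n a.n a.n).symm) _ _ _).trans (rank_comp_perm (finCongr (one_mul a.n)) _ _
        _)).trans ?_
      rw [finCongr_one_mul_symm, finCongr_assoc_symm]
      exact (rank_tensorHom_apply _ _ _ _ _ _).trans (congrArg₂ (· * ·) (rank_ev_apply _ _ _) (rank_id _ _))
    · refine ((rank_perm _ _ _).trans ?_).symm
      exact if_congr (Eq.congr_left (finCongr_mul_one i z)) rfl rfl
  · refine nonempty_iso_of_rank fun i l => ?_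
    obtain ⟨⟨z, i⟩, rfl⟩ := (finProdFinEquiv (m := 1)).surjective i
    have key : ∑ p : Fin a.n, ∑ q : Fin a.n, ∑ r : Fin a.n, ((if p = q then 1 else 0) * (if i = r then 1 else 0)) *
      ((if p = l then 1 else 0) * (if q = r then 1 else 0)) = if i = l then 1 else 0 := by
      simp [eq_comm]
    refine (rank_comp _ _ _ _).trans (((sum_fin_mul _).trans ((sum_fin_mul _).trans (sum_congr rfl fun p _ => sum_congr rfl fun q
      _ => sum_congr rfl fun r _ => congrArg₂ (· * ·) ((rank_tensorHom_apply _ _ _ _ _ _).trans (congrArg₂ (· * ·)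
      (rank_coev_apply _ _ _) (rank_id _ _))) ?_))).trans (key.trans ?_))
    · refine ((rank_perm_comp (finCongr (mul_assoc a.n a.n a.n)) _ _ _).trans (rank_comp_perm (finCongr (mul_one a.n)) _ _
        _)).trans ?_
      rw [finCongr_mul_one_symm, finCongr_assoc]
      exact (rank_tensorHom_apply _ _ _ _ _ _).trans (congrArg₂ (· * ·) (rank_id _ _) (rank_ev_apply _ _ _))
    · refine ((rank_perm _ _ _).trans ?_).symm
      exact if_congr (Eq.congr_left (finCongr_one_mul z i)) rfl rfl

/-! ### Adjoints of matrices -/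

/-- Perfect pairings between the entries of a matrix and of a matrix of the transposed shape. -/
structure Pairing (M : a ⟶ b) (N : b ⟶ a) where
  form (i j) : Hom.entry M i j →ₗ[k] Hom.entry N j i →ₗ[k] k
  card (i : Fin a.n) (j : Fin b.n) : ℕ
  left (i j) : Fin (card i j) → Hom.entry M i j
  right (i j) : Fin (card i j) → Hom.entry N j i
  sum_left (i j m) : ∑ s, form i j m (right i j s) • left i j s = m
  sum_right (i j n) : ∑ s, form i j (left i j s) n • right i j s = n

namespace Pairing
variable {M : a ⟶ b} {N : b ⟶ a}

def symm (P : Pairing M N) : Pairing N M where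
  form i j := (P.form j i).flip
  card i j := P.card j i
  left i j := P.right j i
  right i j := P.left j i
  sum_left i j := P.sum_right j i
  sum_right i j := P.sum_left j i

def unit (P : Pairing M N) : 𝟙 a ⟶ M ≫ N := Hom₂.mk fun i i' => if h : i = i' then by
      subst h
      exact (LinearMap.proj ⟨rfl⟩).smulRight (∑ j, ∑ s, tmul j (P.left i j s) (P.right i j s))
    else 0

lemma unit_oneElt (P : Pairing M N) (i) : P.unit.entry i i (oneElt i) = ∑ j, ∑ s, tmul (M := M) (N := N) (i := i) (l := i) j
  (P.left i j s) (P.right i j s) := by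
  exact (LinearMap.congr_fun (dif_pos rfl) _).trans (one_smul k _)

def counit (P : Pairing M N) : N ≫ M ⟶ 𝟙 b := Hom₂.mk fun j l => if h : j = l then by
      subst h
      exact desc fun i => (P.form i j).flip.compr₂ (toSpanSingleton k _ (oneElt j))
    else 0

lemma counit_tmul (P : Pairing M N) (j i n m) : P.counit.entry j j (tmul i n m) = P.form i j m n • oneElt j := by
  exact (LinearMap.congr_fun (dif_pos rfl) _).trans (desc_tmul _ _ _ _)

lemma counit_ne (P : Pairing M N) {j l} (h : j ≠ l) : P.counit.entry j l = 0 := dif_neg h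

def adjunction (P : Pairing M N) : Bicategory.Adjunction M N where
  unit := P.unit
  counit := P.counit
  left_triangle := by
    simp [Bicategory.leftZigzag, bicategoricalComp]
    refine hom_ext_one_mul fun i l m => ?_
    change (whiskerLeft M P.counit).entry i l ((associatorHom M N M).entry i l ((whiskerRight P.unit M).entry i l (tmul i (oneElt
      i) m))) = (rightUnitorInv M).entry i l ((leftUnitorHom M).entry i l (tmul i (oneElt i) m))
    rw [whiskerRight_tmul, leftUnitorHom_tmul, rightUnitorInv_apply, unit_oneElt]
    simp only [map_sum, LinearMap.sum_apply]
    refine (sum_congr rfl fun j _ => sum_congr rfl fun s _ => (congrArg _ (associatorHom_tmul M N M l j i _ _ _)).trans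
      (whiskerLeft_tmul M P.counit _ _ _ _)).trans ?_
    rw [sum_eq_single l]
    · simp only [counit_tmul, map_smul]
      conv_rhs => rw [← P.sum_left i l m]
      simp
    · intro j _ hj
      simp [counit_ne P hj]
    · simp
  right_triangle := by
    simp [Bicategory.rightZigzag, bicategoricalComp]
    refine hom_ext_mul_one fun i l m => ?_
    change (whiskerRight P.counit N).entry i l ((associatorInv N M N).entry i l ((whiskerLeft N P.unit).entry i l (tmul l m
      (oneElt l)))) = (leftUnitorInv N).entry i l ((rightUnitorHom N).entry i l (tmul l m (oneElt l)))
    rw [whiskerLeft_tmul, rightUnitorHom_tmul, leftUnitorInv_apply, unit_oneElt]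
    simp only [map_sum]
    refine (sum_congr rfl fun j _ => sum_congr rfl fun s _ => (congrArg _ (associatorInv_tmul N M N l l j _ _ _)).trans
      (whiskerRight_tmul P.counit N _ _ _ _)).trans ?_
    rw [sum_eq_single i]
    · simp only [counit_tmul, map_smul, LinearMap.smul_apply]
      conv_rhs => rw [← P.sum_right l i m]
      simp
    · intro j _ hj
      simp [counit_ne P hj.symm]
    · simp
end Pairing

lemma exists_pairing (M : a ⟶ b) : ∃ N : b ⟶ a, Nonempty (Pairing M N) := by
  refine ⟨Hom.mk fun j i => FGModuleCat.of k (Dual k (Hom.entry M i j)), ⟨?_⟩⟩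
  exact {
    form i j := Dual.eval k (Hom.entry M i j)
    card i j := finrank k (Hom.entry M i j)
    left i j := finBasis k (Hom.entry M i j)
    right i j s := (finBasis k (Hom.entry M i j)).coord s
    sum_left i j m := (finBasis k (Hom.entry M i j)).sum_repr m
    sum_right i j n := (finBasis k (Hom.entry M i j)).sum_dual_apply_smul_coord n }

lemma exists_adjoint (M : a ⟶ b) : ∃ N, Nonempty (Bicategory.Adjunction M N) ∧ Nonempty (Bicategory.Adjunction N M) := by
  obtain ⟨N, ⟨P⟩⟩ := exists_pairing M
  exact ⟨N, ⟨P.adjunction⟩, ⟨P.symm.adjunction⟩⟩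
end KV

/-! ### Semisimple linear categories -/

section Split
/-- Objects with one-dimensional endomorphism algebras and without nonzero morphisms between
different ones, such that every object is a finite direct sum of them. -/
structure SplitBasis (k : Type u) [Field k] (X : Type u₁) [Category.{v₁} X] [Preadditive X] [Linear k X] (ι : Type) where
  S : ι → X
  scalar (i) (f : S i ⟶ S i) : ∃ r : k, f = r • 𝟙 (S i)
  orth {i j} (h : i ≠ j) (f : S i ⟶ S j) : f = 0
  nonzero (i) : 𝟙 (S i) ≠ 0
  gen (x : X) : ∃ (J : Type) (_ : Fintype J) (_ : DecidableEq J) (idx : J → ι) (f : ∀ a, x ⟶ S (idx a)) (g : ∀ a, S (idx a) ⟶ x),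
    ∑ a, f a ≫ g a = 𝟙 x ∧ (∀ a, g a ≫ f a = 𝟙 _) ∧ ∀ a b, a ≠ b → g a ≫ f b = 0

namespace SplitBasis
variable {X : Type u₁} [Category.{v₁} X] [Preadditive X] [Linear k X] {ι : Type} (B : SplitBasis k X ι)

/-! #### Natural transformations -/

section NatTrans
variable {E : Type u₂} [Category.{v₂} E] [Preadditive E] [Linear k E] {F G H : X ⥤ E} [F.Additive] [F.Linear k] [G.Additive]
  [G.Linear k] [H.Additive] [H.Linear k]

lemma map_comm (θ : ∀ i, F.obj (B.S i) ⟶ G.obj (B.S i)) {i j} (h : B.S i ⟶ B.S j) : F.map h ≫ θ j = θ i ≫ G.map h := by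
  by_cases hij : i = j
  · subst hij
    obtain ⟨r, rfl⟩ := B.scalar i h
    simp
  · simp [B.orth hij h]

lemma exists_natTrans (θ : ∀ i, F.obj (B.S i) ⟶ G.obj (B.S i)) : ∃ η : F ⟶ G, ∀ i, η.app (B.S i) = θ i := by
  choose J _ _ idx f g h₁ h₂ h₃ using B.gen
  refine ⟨{ app x := ∑ a, F.map (f x a) ≫ θ (idx x a) ≫ G.map (g x a), naturality x y h := ?_ }, fun i => ?_⟩
  · have e₁ : ∀ b, F.map h ≫ F.map (f y b) = ∑ a, F.map (f x a) ≫ F.map (g x a ≫ h ≫ f y b) := by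
      intro b
      rw [← F.map_comp]
      conv_lhs => rw [← id_comp (h ≫ f y b), ← h₁ x, sum_comp, F.map_sum]
      simp
    have e₂ : ∀ a, G.map (g x a) ≫ G.map h = ∑ b, G.map (g x a ≫ h ≫ f y b) ≫ G.map (g y b) := by
      intro a
      rw [← G.map_comp]
      conv_lhs => rw [← comp_id (g x a ≫ h), ← h₁ y, comp_sum, G.map_sum]
      simp
    rw [comp_sum, sum_comp]
    simp only [assoc, e₂, reassoc_of% e₁, sum_comp, comp_sum]
    rw [sum_comm]
    refine sum_congr rfl fun a _ => sum_congr rfl fun b _ => ?_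
    have := B.map_comm θ (g x a ≫ h ≫ f y b)
    rw [reassoc_of% this]
  · have : ∀ a, F.map (f (B.S i) a) ≫ θ (idx (B.S i) a) ≫ G.map (g (B.S i) a) = θ i ≫ G.map (f (B.S i) a ≫ g (B.S i) a) := by
      intro a
      have := B.map_comm θ (f (B.S i) a)
      rw [reassoc_of% this, G.map_comp]
    simp only [this]
    rw [← comp_sum, ← G.map_sum, h₁, G.map_id, comp_id]

include B in
lemma natTrans_ext {η θ : F ⟶ G} (h : ∀ i, η.app (B.S i) = θ.app (B.S i)) : η = θ := by
  ext x
  obtain ⟨J, _, _, idx, f, g, h₁, -, -⟩ := B.gen x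
  rw [← id_comp (η.app x), ← id_comp (θ.app x), ← F.map_id, ← h₁]
  simp [sum_comp, h]

include B in
lemma nonempty_iso (h : ∀ i, Nonempty (F.obj (B.S i) ≅ G.obj (B.S i))) : Nonempty (F ≅ G) := by
  have e i := (h i).some
  obtain ⟨η, hη⟩ := B.exists_natTrans fun i => (e i).hom
  obtain ⟨θ, hθ⟩ := B.exists_natTrans fun i => (e i).inv
  exact ⟨⟨η, θ, B.natTrans_ext fun i => by simp [hη, hθ], B.natTrans_ext fun i => by simp [hη, hθ]⟩⟩
end NatTrans

/-! #### The existence of functors -/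

section Functors
lemma exists_coeff {i j} (f : B.S i ⟶ B.S j) : ∃ r : k, (∀ h : i = j, f = r • eqToHom (h ▸ rfl)) ∧ (i ≠ j → r = 0) := by
  by_cases h : i = j
  · subst h
    obtain ⟨r, rfl⟩ := B.scalar i f
    exact ⟨r, fun _ => rfl, fun h => (h rfl).elim⟩
  · exact ⟨0, fun h' => (h h').elim, fun _ => rfl⟩

def coeff {i j} (f : B.S i ⟶ B.S j) : k := (B.exists_coeff f).choose

lemma coeff_self {i} (f : B.S i ⟶ B.S i) : f = B.coeff f • 𝟙 _ := (B.exists_coeff f).choose_spec.1 rfl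

lemma coeff_ne {i j} (h : i ≠ j) (f : B.S i ⟶ B.S j) : B.coeff f = 0 := (B.exists_coeff f).choose_spec.2 h

lemma coeff_unique {i} {f : B.S i ⟶ B.S i} {r : k} (h : f = r • 𝟙 _) : B.coeff f = r := by
  have h' := (B.coeff_self f).symm.trans h
  by_contra hr
  have : (B.coeff f - r) • 𝟙 (B.S i) = 0 := by rw [sub_smul, h', sub_self]
  exact B.nonzero i ((smul_eq_zero.1 this).resolve_left (sub_ne_zero.2 hr))

lemma coeff_add {i j} (f g : B.S i ⟶ B.S j) : B.coeff (f + g) = B.coeff f + B.coeff g := by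
  by_cases h : i = j
  · subst h
    refine B.coeff_unique ?_
    rw [add_smul, ← coeff_self, ← coeff_self]
  · simp [B.coeff_ne h]

lemma coeff_smul {i j} (r : k) (f : B.S i ⟶ B.S j) : B.coeff (r • f) = r * B.coeff f := by
  by_cases h : i = j
  · subst h
    refine B.coeff_unique ?_
    rw [mul_smul, ← coeff_self]
  · simp [B.coeff_ne h]

lemma coeff_id (i) : B.coeff (𝟙 (B.S i)) = 1 := B.coeff_unique (one_smul _ _).symm

variable {E : Type u₂} [Category.{v₂} E] [Preadditive E] [Linear k E] (Z : ι → E)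

open Classical in
/-- The effect on morphisms of the functor sending the basic objects to given objects. -/
def trans {i j} : (B.S i ⟶ B.S j) →ₗ[k] (Z i ⟶ Z j) where
  toFun f := B.coeff f • if h : i = j then eqToHom (h ▸ rfl) else 0
  map_add' f g := by rw [coeff_add, add_smul]
  map_smul' r f := by rw [coeff_smul, mul_smul]; rfl

lemma trans_self {i} (f : B.S i ⟶ B.S i) : B.trans Z f = B.coeff f • 𝟙 _ := by simp [trans]

lemma trans_id (i) : B.trans Z (𝟙 (B.S i)) = 𝟙 _ := by simp [trans_self, coeff_id]

lemma trans_comp {i j l} (f : B.S i ⟶ B.S j) (g : B.S j ⟶ B.S l) : B.trans Z (f ≫ g) = B.trans Z f ≫ B.trans Z g := by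
  by_cases h : i = j
  · subst h
    rw [B.coeff_self f, smul_comp, id_comp, map_smul, map_smul, trans_id, smul_comp, id_comp]
  · simp [B.orth h f]

variable [HasFiniteBiproducts E]

include B in
lemma exists_functor : ∃ L : X ⥤ E, L.Additive ∧ L.Linear k ∧ ∀ i, Nonempty (L.obj (B.S i) ≅ Z i) := by
  choose J _ _ idx f g h₁ h₂ h₃ using B.gen
  have key {x y z : X} {i j} (p : B.S i ⟶ x) (q : x ⟶ B.S j) : ∑ a, B.trans Z (p ≫ f x a) ≫ B.trans Z (g x a ≫ q) = B.trans Z (p ≫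
    q) := by
    simp only [← trans_comp, assoc]
    rw [← map_sum, ← comp_sum]
    conv_rhs => rw [← id_comp q, ← h₁ x, sum_comp]
    simp only [assoc]
  let L : X ⥤ E :=
    { obj x := ⨁ fun a => Z (idx x a)
      map {x y} h := biproduct.matrix fun a b => B.trans Z (g x a ≫ h ≫ f y b)
      map_id x := by
        ext b a
        by_cases h : a = b
        · subst h
          simp [h₂, trans_id]
        · simp [h₃ x a b h, biproduct.ι_π_ne _ h]
      map_comp {x y z} h h' := by
        ext b a
        simp only [biproduct.matrix_π, biproduct.ι_desc, biproduct.ι_matrix_assoc, assoc]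
        rw [biproduct.lift_eq, sum_comp]
        simp only [assoc, biproduct.matrix_π, biproduct.ι_desc]
        have := @key y y y _ _ (g x a ≫ h) (h' ≫ f z b)
        simp only [assoc] at this
        rw [this] }
  refine ⟨L, ⟨fun {x y h h'} => ?_⟩, ⟨fun {x y} h r => ?_⟩, fun i => ⟨?_⟩⟩
  · dsimp only [L]
    ext b a
    simp
  · dsimp only [L]
    ext b a
    simp
  · refine ⟨biproduct.desc fun a => B.trans Z (g (B.S i) a), biproduct.lift fun a => B.trans Z (f (B.S i) a), ?_, ?_⟩
    · dsimp only [L]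
      ext b a
      simp only [biproduct.ι_desc_assoc, assoc, biproduct.lift_π, comp_id]
      rw [← trans_comp]
      by_cases h : a = b
      · subst h
        simp [h₂, trans_id]
      · simp [h₃ _ a b h, biproduct.ι_π_ne _ h]
    · rw [biproduct.lift_desc]
      simp only [← trans_comp]
      rw [← map_sum, h₁, trans_id]
end Functors
end SplitBasis
end Split

section Recognition
/-- Every morphism has a generalized inverse. -/
def Regular (X : Type u₁) [Category.{v₁} X] : Prop := ∀ ⦃x y : X⦄ (f : x ⟶ y), ∃ g : y ⟶ x, f ≫ g ≫ f = f

lemma exists_linearMap_inverse {V W : Type*} [AddCommGroup V] [Module k V] [AddCommGroup W] [Module k W] (f : V →ₗ[k] W) : ∃ g : W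
  →ₗ[k] V, f ∘ₗ g ∘ₗ f = f := by
  obtain ⟨g₀, hg₀⟩ := f.rangeRestrict.exists_rightInverse_of_surjective f.range_rangeRestrict
  obtain ⟨g, hg⟩ := LinearMap.exists_extend g₀
  refine ⟨g, LinearMap.ext fun v => ?_⟩
  have h₁ := LinearMap.congr_fun hg (f.rangeRestrict v)
  have h₂ := congrArg Subtype.val (LinearMap.congr_fun hg₀ (f.rangeRestrict v))
  simp at h₁ h₂ ⊢
  rw [h₁]
  exact h₂

lemma regular_fgModuleCat : Regular (FGModuleCat.{u} k) := fun V W f => by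
  obtain ⟨g, hg⟩ := exists_linearMap_inverse f.hom.hom
  refine ⟨FGModuleCat.ofHom g, ?_⟩
  ext x
  exact LinearMap.congr_fun hg x

variable {X : Type u₁} [Category.{v₁} X] [Preadditive X] [Linear k X]

namespace SplitBasis
def ofGen {ι : Type} [Fintype ι] (S : ι → X) (scalar : ∀ (i) (f : S i ⟶ S i), ∃ r : k, f = r • 𝟙 (S i)) (orth : ∀ {i j}, i ≠ j → ∀
  f : S i ⟶ S j, f = 0) (nonzero : ∀ i, 𝟙 (S i) ≠ 0) (gen : ∀ x : X, ∃ (J : Type) (_ : Fintype J) (idx : J → ι) (f : ∀ a, x ⟶ S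
  (idx a)) (g : ∀ a, S (idx a) ⟶ x), ∑ a, f a ≫ g a = 𝟙 x) : SplitBasis k X ι where
  S := S
  scalar := scalar
  orth := orth
  nonzero := nonzero
  gen x := by
    classical
    obtain ⟨J, _, idx, f, g, h⟩ := gen x
    have hfin (i j) : Module.Finite k (S i ⟶ S j) := by
      by_cases hij : i = j
      · subst hij
        refine Module.Finite.of_surjective (toSpanSingleton k _ (𝟙 (S i))) fun f => ?_
        obtain ⟨r, rfl⟩ := scalar i f
        exact ⟨r, rfl⟩
      · have : Subsingleton (S i ⟶ S j) := ⟨fun f g => (orth hij f).trans (orth hij g).symm⟩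
        infer_instance
    have hfin' (i) : Module.Finite k (S i ⟶ x) := by
      refine Module.Finite.of_surjective (M := ∀ a, S i ⟶ S (idx a)) (∑ a, rightComp k (S i) (g a) ∘ₗ LinearMap.proj a) fun p =>
        ⟨fun a => p ≫ f a, ?_⟩
      simp only [LinearMap.sum_apply, LinearMap.comp_apply, LinearMap.proj_apply, Linear.rightComp_apply, assoc]
      rw [← comp_sum, h, comp_id]
    have dual (i) (φ : (S i ⟶ x) →ₗ[k] k) : ∃ q : x ⟶ S i, ∀ p, p ≫ q = φ p • 𝟙 _ := by
      let t (j) (q : S j ⟶ x) : S j ⟶ S i :=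
        if h : j = i then φ (eqToHom (h ▸ rfl) ≫ q) • eqToHom (h ▸ rfl) else 0
      have ht (j) (p : S i ⟶ S j) (q : S j ⟶ x) : p ≫ t j q = φ (p ≫ q) • 𝟙 _ := by
        by_cases hij : j = i
        · subst hij
          obtain ⟨r, rfl⟩ := scalar j p
          simp only [t, dif_pos, eqToHom_refl, id_comp, smul_comp, map_smul, smul_assoc, comp_smul]
          rw [smul_comm]
        · simp [orth (Ne.symm hij) p]
      refine ⟨∑ a, f a ≫ t _ (g a), fun p => ?_⟩
      rw [comp_sum]
      simp only [← assoc, ht]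
      rw [← Finset.sum_smul, ← map_sum]
      simp only [assoc]
      rw [← comp_sum, h, comp_id]
    let b (i) := finBasis k (S i ⟶ x)
    choose q hq using fun i (s : Fin (finrank k (S i ⟶ x))) => dual i ((b i).coord s)
    have key (i) (p : S i ⟶ x) : p ≫ (∑ a : Σ i, Fin (finrank k (S i ⟶ x)), q a.1 a.2 ≫ b a.1 a.2) = p := by
      rw [Fintype.sum_sigma, comp_sum, sum_eq_single i]
      · simp only [comp_sum, ← assoc, hq, smul_comp, id_comp]
        exact (b i).sum_repr p
      · intro j _ hj
        simp only [comp_sum, ← assoc, orth hj.symm (p ≫ _), zero_comp, Finset.sum_const_zero]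
      · simp
    refine ⟨Σ i, Fin (finrank k (S i ⟶ x)), inferInstance, inferInstance, fun a => a.1, fun a => q a.1 a.2, fun a => b a.1 a.2,
      ?_, fun a => ?_, ?_⟩
    · rw [← id_comp (∑ a : Σ i, Fin (finrank k (S i ⟶ x)), q a.1 a.2 ≫ b a.1 a.2), ← h, sum_comp]
      simp only [assoc, key]
    · simp [hq]
    · rintro ⟨i, s⟩ ⟨j, t⟩ hne
      by_cases hij : i = j
      · subst hij
        have : s ≠ t := fun h => hne (by rw [h])
        simp [hq, Finsupp.single_eq_of_ne this.symm]
      · exact orth hij _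

def reindex {ι ι' : Type} (B : SplitBasis k X ι) (e : ι' ≃ ι) : SplitBasis k X ι' where
  S i := B.S (e i)
  scalar i := B.scalar (e i)
  orth h := B.orth (e.injective.ne h)
  nonzero i := B.nonzero (e i)
  gen x := by
    obtain ⟨J, hJ, hJ', idx, f, g, h₁, h₂, h₃⟩ := B.gen x
    obtain ⟨idx', rfl⟩ : ∃ idx', idx = e ∘ idx' := ⟨e.symm ∘ idx, by ext; simp⟩
    exact ⟨J, hJ, hJ', idx', f, g, h₁, h₂, h₃⟩
end SplitBasis

section
variable (hfin : ∀ x y : X, Module.Finite k (x ⟶ y)) (hreg : Regular X)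

def IsPrimitive (x : X) : Prop := 𝟙 x ≠ 0 ∧ ∀ p : x ⟶ x, p ≫ p = p → p = 0 ∨ p = 𝟙 x

include hreg in
lemma IsPrimitive.exists_retraction {x y : X} (hx : IsPrimitive x) {f : x ⟶ y} (hf : f ≠ 0) : ∃ g : y ⟶ x, f ≫ g = 𝟙 x := by
  obtain ⟨g, hg⟩ := hreg f
  refine ⟨g, (hx.2 (f ≫ g) ?_).resolve_left fun h => hf ?_⟩
  · rw [assoc, ← assoc g, ← assoc f, hg]
  · rw [← hg, ← assoc, h, zero_comp]

include hreg in
lemma IsPrimitive.isIso {x y : X} (hx : IsPrimitive x) (hy : IsPrimitive y) {f : x ⟶ y} (hf : f ≠ 0) : IsIso f := by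
  obtain ⟨g, hg⟩ := hx.exists_retraction hreg hf
  refine ⟨g, hg, (hy.2 (g ≫ f) ?_).resolve_left fun h => hx.1 ?_⟩
  · rw [assoc, ← assoc f, hg, id_comp]
  · rw [← id_comp (𝟙 x), ← hg, assoc, ← assoc g, h, zero_comp, comp_zero]

include hfin hreg in
lemma IsPrimitive.scalar [IsAlgClosed k] {x : X} (hx : IsPrimitive x) (f : x ⟶ x) : ∃ r : k, f = r • 𝟙 x := by
  have := hfin x x
  have : Nontrivial (x ⟶ x) := ⟨_, _, hx.1⟩
  obtain ⟨r, hr⟩ := Module.End.exists_eigenvalue (leftComp k x f)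
  obtain ⟨h, hh, h0⟩ := hr.exists_hasEigenvector
  refine ⟨r, ?_⟩
  by_contra hne
  have := hx.isIso hreg hx (sub_ne_zero.2 hne)
  refine h0 ?_
  rw [← cancel_epi (f - r • 𝟙 x), comp_zero, sub_comp, smul_comp, id_comp, sub_eq_zero]
  exact Module.End.mem_eigenspace_iff.1 hh

include hfin in
lemma exists_primitives [IsIdempotentComplete X] (x : X) : ∃ (n : ℕ) (P : Fin n → X) (f : ∀ a, x ⟶ P a) (g : ∀ a, P a ⟶ x), (∀ a,
  IsPrimitive (P a)) ∧ ∑ a, f a ≫ g a = 𝟙 x := by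
  obtain ⟨d, hd⟩ : ∃ d, finrank k (x ⟶ x) < d := ⟨_, Nat.lt_succ_self _⟩
  induction d generalizing x with
  | zero => exact absurd hd (Nat.not_lt_zero _)
  | succ d ih =>
    by_cases hx : IsPrimitive x
    · exact ⟨1, fun _ => x, fun _ => 𝟙 x, fun _ => 𝟙 x, fun _ => hx, by simp⟩
    by_cases h0 : 𝟙 x = 0
    · exact ⟨0, Fin.elim0, fun a => a.elim0, fun a => a.elim0, fun a => a.elim0, by simp [h0]⟩
    simp only [IsPrimitive, not_and, not_forall, not_or] at hx
    obtain ⟨p, hp, hp0, hp1⟩ := hx h0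
    have step (p : x ⟶ x) (hp : p ≫ p = p) (hp1 : p ≠ 𝟙 x) : ∃ (n : ℕ) (P : Fin n → X) (f : ∀ a, x ⟶ P a) (g : ∀ a, P a ⟶ x), (∀
      a, IsPrimitive (P a)) ∧ ∑ a, f a ≫ g a = p := by
      obtain ⟨y, i, e, hie, hei⟩ := IsIdempotentComplete.idempotents_split x p hp
      have := hfin x x
      let T : (y ⟶ y) →ₗ[k] (x ⟶ x) := leftComp k x e ∘ₗ rightComp k y i
      have hT (h : y ⟶ y) : T h = e ≫ h ≫ i := rfl
      have hinj : Function.Injective T := fun h h' hh => by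
        have := congrArg (fun q => i ≫ q ≫ e) hh
        simpa [hT, hie, reassoc_of% hie] using this
      have hlt : finrank k (y ⟶ y) < finrank k (x ⟶ x) := by
        refine lt_of_le_of_ne (LinearMap.finrank_le_finrank_of_injective hinj) fun heq => hp1 ?_
        have := hfin y y
        have hsurj := (LinearMap.injective_iff_surjective_of_finrank_eq_finrank heq).1 hinj
        obtain ⟨h, hh⟩ := hsurj (𝟙 x - p)
        have h1 : T h ≫ p = T h := by
          rw [hT, ← hei]
          simp [reassoc_of% hie]
        rw [hh, sub_comp, id_comp, hp, sub_self] at h1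
        exact (sub_eq_zero.1 h1.symm).symm
      obtain ⟨n, P, f, g, hP, h⟩ := ih y (lt_of_lt_of_le hlt (Nat.lt_succ_iff.1 hd))
      refine ⟨n, P, fun a => e ≫ f a, fun a => g a ≫ i, hP, ?_⟩
      have := congrArg (fun q => e ≫ q ≫ i) h
      simp only [sum_comp, comp_sum, id_comp, hei] at this
      simpa only [assoc] using this
    obtain ⟨n, P, f, g, hP, h⟩ := step p hp hp1
    obtain ⟨n', P', f', g', hP', h'⟩ := step (𝟙 x - p) (by simp [sub_comp, comp_sub, hp]) (by simpa using hp0)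
    refine ⟨n + n', Fin.append P P', fun a => a.addCases (fun a => f a ≫ eqToHom (by simp)) (fun a => f' a ≫ eqToHom (by simp)),
      fun a => a.addCases (fun a => eqToHom (by simp) ≫ g a) (fun a => eqToHom (by simp) ≫ g' a), fun a => ?_, ?_⟩
    · induction a using Fin.addCases with
      | left a => simpa using hP a
      | right a => simpa using hP' a
    · rw [Fin.sum_univ_add]
      simp [h, h']

include hfin hreg in
/-- Idempotent complete finitely generated regular categories are semisimple. -/
theorem exists_splitBasis [IsAlgClosed k] [IsIdempotentComplete X] {J : Type} [Fintype J] (G : J → X) (hG : ∀ x : X, ∃ (I : Type)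
  (_ : Fintype I) (idx : I → J) (f : ∀ a, x ⟶ G (idx a)) (g : ∀ a, G (idx a) ⟶ x), ∑ a, f a ≫ g a = 𝟙 x) : ∃ n, Nonempty
  (SplitBasis k X (Fin n)) := by
  classical
  choose n P p q hP hpq using fun j => exists_primitives hfin (G j)
  let s : Setoid (Σ j, Fin (n j)) :=
    { r a b := Nonempty (P a.1 a.2 ≅ P b.1 b.2)
      iseqv := ⟨fun _ => ⟨Iso.refl _⟩, fun ⟨e⟩ => ⟨e.symm⟩, fun ⟨e⟩ ⟨e'⟩ => ⟨e ≪≫ e'⟩⟩ }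
  let S (c : Quotient s) : X := P c.out.1 c.out.2
  have hS (c) : IsPrimitive (S c) := hP _ _
  let e (a : Σ j, Fin (n j)) : P a.1 a.2 ≅ S (Quotient.mk s a) := (Quotient.exact (Quotient.out_eq (Quotient.mk s a))).some.symm
  have B : SplitBasis k X (Quotient s) := by
    refine SplitBasis.ofGen S (fun c => (hS c).scalar hfin hreg) (fun {c d} h f => ?_) (fun c => (hS c).1) fun x => ?_
    · by_contra hf
      have := (hS c).isIso hreg (hS d) hf
      refine h ?_
      rw [← Quotient.out_eq c, ← Quotient.out_eq d]
      exact Quotient.sound ⟨asIso f⟩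
    · obtain ⟨I, _, idx, f, g, h⟩ := hG x
      refine ⟨Σ a : I, Fin (n (idx a)), inferInstance, fun a => Quotient.mk s ⟨idx a.1, a.2⟩, fun a => f a.1 ≫ p _ a.2 ≫ (e ⟨idx
        a.1, a.2⟩).hom, fun a => (e ⟨idx a.1, a.2⟩).inv ≫ q _ a.2 ≫ g a.1, ?_⟩
      rw [Fintype.sum_sigma, ← h]
      refine sum_congr rfl fun a _ => ?_
      simp
      have := congrArg (fun q => f a ≫ q ≫ g a) (hpq (idx a))
      simp only [sum_comp, comp_sum, id_comp] at this
      simpa only [assoc] using this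
  exact ⟨_, ⟨B.reindex (Fintype.equivFin _).symm⟩⟩
end
end Recognition

/-! ### Right exact functors -/

section RightExact
variable {C : Type u₁} [Category.{v₁} C] [Preadditive C] {E : Type u₂} [Category.{v₂} E] [Preadditive E]

/-- `g` is a cokernel of `f`. -/
structure IsCok {a b c : C} (f : a ⟶ b) (g : b ⟶ c) : Prop where
  w : f ≫ g = 0
  exists_desc : ∀ ⦃z : C⦄ (t : b ⟶ z), f ≫ t = 0 → ∃ s, g ≫ s = t
  epi : ∀ ⦃z : C⦄ (s s' : c ⟶ z), g ≫ s = g ≫ s' → s = s'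

lemma isCok_of_isColimit {a b c : C} {f : a ⟶ b} {g : b ⟶ c} {w : f ≫ g = 0} (h : IsColimit (CokernelCofork.ofπ g w)) : IsCok f g
  where
  w := w
  exists_desc _ t ht := ⟨h.desc (CokernelCofork.ofπ t ht), h.fac _ WalkingParallelPair.one⟩
  epi _ _ _ hs := Cofork.IsColimit.hom_ext h hs

lemma isCok_cokernel {a b : C} (f : a ⟶ b) [HasCokernel f] : IsCok f (cokernel.π f) := isCok_of_isColimit (w := cokernel.condition
  f) (cokernelIsCokernel f)

lemma IsCok.nonempty_isColimit {a b c : C} {f : a ⟶ b} {g : b ⟶ c} (h : IsCok f g) : Nonempty (IsColimit (CokernelCofork.ofπ g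
  h.w)) := ⟨CokernelCofork.IsColimit.ofπ g h.w (fun t ht => (h.exists_desc t ht).choose) (fun t ht => (h.exists_desc t
  ht).choose_spec) (fun t ht _ hs => h.epi _ _ (hs.trans (h.exists_desc t ht).choose_spec.symm))⟩

/-- Preservation of cokernels. -/
def RightExact (F : C ⥤ E) : Prop := ∀ ⦃a b c : C⦄ ⦃f : a ⟶ b⦄ ⦃g : b ⟶ c⦄, IsCok f g → IsCok (F.map f) (F.map g)

lemma rightExact_of_preservesFiniteColimits (F : C ⥤ E) [F.Additive] [PreservesFiniteColimits F] : RightExact F := fun a b c f g h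
  => by
  obtain ⟨h'⟩ := h.nonempty_isColimit
  exact isCok_of_isColimit (w := by rw [← F.map_comp, h.w, F.map_zero]) (CokernelCofork.mapIsColimit _ h' F)

lemma RightExact.preservesFiniteColimits [HasFiniteBiproducts C] [HasCokernels C] [HasZeroObject E] {F : C ⥤ E} [F.Additive] (h :
  RightExact F) : PreservesFiniteColimits F := by
  have (X Y : C) (f : X ⟶ Y) : PreservesColimit (parallelPair f 0) F := by
    refine preservesColimit_of_preserves_colimit_cocone (cokernelIsCokernel f) ?_
    refine (CokernelCofork.isColimitMapCoconeEquiv _ F).symm ?_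
    exact (h (isCok_cokernel f)).nonempty_isColimit.some
  have := HasBinaryBiproducts.of_hasBinaryProducts (C := C)
  have := hasCoequalizers_of_hasCokernels (C := C)
  exact Functor.preservesFiniteColimits_of_preservesCokernels F

lemma preservesFiniteColimits_iff_rightExact [HasFiniteBiproducts C] [HasCokernels C] [HasZeroObject E] {F : C ⥤ E} [F.Additive] :
  PreservesFiniteColimits F ↔ RightExact F := ⟨fun _ => rightExact_of_preservesFiniteColimits F, fun h =>
  h.preservesFiniteColimits⟩

lemma rightExact_of_sum {J : Type*} [Fintype J] {F : C ⥤ E} (G : J → C ⥤ E) (hG : ∀ j, RightExact (G j)) (s : ∀ j, F ⟶ G j) (r : ∀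
  j, G j ⟶ F) (h : ∀ x, ∑ j, (s j).app x ≫ (r j).app x = 𝟙 (F.obj x)) : RightExact F := by
  intro a b c f g hfg
  have hsum {x : C} {z : E} (t : F.obj x ⟶ z) : ∑ j, (s j).app x ≫ (r j).app x ≫ t = t := by
    simp only [← assoc]
    rw [← sum_comp, h, id_comp]
  refine ⟨?_, fun z t ht => ?_, fun z t t' htt' => ?_⟩
  · rw [← hsum (F.map f ≫ F.map g)]
    refine sum_eq_zero fun j _ => ?_
    rw [← (r j).naturality_assoc, ← (r j).naturality, reassoc_of% (hG j hfg).w, zero_comp, comp_zero]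
  · have key (j : J) : ∃ t', (G j).map g ≫ t' = (r j).app b ≫ t := by
      refine (hG j hfg).exists_desc _ ?_
      rw [(r j).naturality_assoc, ht, comp_zero]
    choose t' ht' using key
    refine ⟨∑ j, (s j).app c ≫ t' j, ?_⟩
    rw [comp_sum]
    simp only [NatTrans.naturality_assoc, ht', hsum]
  · rw [← hsum t, ← hsum t']
    refine sum_congr rfl fun j _ => congrArg _ ?_
    refine (hG j hfg).epi _ _ ?_
    rw [(r j).naturality_assoc, (r j).naturality_assoc, htt']

lemma rightExact_of_isCok {F₁ F₀ F : C ⥤ E} {α : F₁ ⟶ F₀} {β : F₀ ⟶ F} (h₁ : RightExact F₁) (h₀ : RightExact F₀) (h : ∀ x, IsCok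
  (α.app x) (β.app x)) : RightExact F := by
  intro a b c f g hfg
  refine ⟨?_, fun z t ht => ?_, fun z t t' htt' => ?_⟩
  · refine (h a).epi _ _ ?_
    rw [← β.naturality_assoc, ← β.naturality, ← assoc, (h₀ hfg).w, zero_comp, comp_zero]
  · obtain ⟨t₀, ht₀⟩ := (h₀ hfg).exists_desc (β.app b ≫ t) (by
      rw [β.naturality_assoc, ht, comp_zero])
    obtain ⟨t', ht'⟩ := (h c).exists_desc t₀ (by
      refine (h₁ hfg).epi _ _ ?_
      rw [α.naturality_assoc, ht₀, ← assoc, (h b).w, zero_comp, comp_zero])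
    refine ⟨t', (h b).epi _ _ ?_⟩
    rw [← β.naturality_assoc, ht', ht₀]
  · refine (h c).epi _ _ ((h₀ hfg).epi _ _ ?_)
    rw [β.naturality_assoc, β.naturality_assoc, htt']

lemma RightExact.comp {D : Type u₃} [Category.{v₃} D] [Preadditive D] {F : C ⥤ D} {G : D ⥤ E} (hF : RightExact F) (hG : RightExact
  G) : RightExact (F ⋙ G) := fun _ _ _ _ _ h => hG (hF h)
end RightExact

/-! ### Regular categories -/

section Regular
section
variable {X : Type u₁} [Category.{v₁} X] [Preadditive X]

lemma Regular.isCok_retraction (hreg : Regular X) {a b c : X} {f : a ⟶ b} {g : b ⟶ c} (h : IsCok f g) : ∃ (s : c ⟶ b) (r : b ⟶ a),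
  s ≫ g = 𝟙 c ∧ g ≫ s + r ≫ f = 𝟙 b := by
  obtain ⟨r, hr⟩ := hreg f
  obtain ⟨s, hs⟩ := h.exists_desc (𝟙 b - r ≫ f) (by
    rw [comp_sub, hr, comp_id, sub_self])
  refine ⟨s, r, h.epi _ _ ?_, by rw [hs, sub_add_cancel]⟩
  rw [reassoc_of% hs, sub_comp, assoc, h.w, comp_zero, sub_zero, id_comp, comp_id]

lemma Regular.rightExact (hreg : Regular X) {E : Type u₂} [Category.{v₂} E] [Preadditive E] (F : X ⥤ E) [F.Additive] : RightExact
  F := by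
  intro a b c f g h
  obtain ⟨s, r, hs, hr⟩ := hreg.isCok_retraction h
  have hr' : F.map g ≫ F.map s + F.map r ≫ F.map f = 𝟙 _ := by
    rw [← F.map_comp, ← F.map_comp, ← F.map_add, hr, F.map_id]
  refine ⟨by rw [← F.map_comp, h.w, F.map_zero], fun z t ht => ⟨F.map s ≫ t, ?_⟩,
    fun z t t' htt' => ?_⟩
  · have := hr' =≫ t
    simpa [add_comp, ht] using this
  · rw [← id_comp t, ← id_comp t', ← F.map_id, ← hs, F.map_comp, assoc, assoc, htt']

lemma Regular.hasCokernels (hreg : Regular X) [IsIdempotentComplete X] : HasCokernels X where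
  has_colimit {a b} f := by
    obtain ⟨g, hg⟩ := hreg f
    obtain ⟨c, i, e, hie, hei⟩ := IsIdempotentComplete.idempotents_split b (𝟙 b - g ≫ f) (by
      simp [sub_comp, comp_sub, hg])
    have h : IsCok f e := by
      refine ⟨?_, fun z t ht => ⟨i ≫ t, ?_⟩, fun z t t' h => ?_⟩
      · rw [← comp_id e, ← hie, reassoc_of% hei]
        simp [sub_comp, comp_sub, reassoc_of% hg]
      · rw [reassoc_of% hei, sub_comp, assoc, ht, comp_zero, sub_zero, id_comp]
      · rw [← id_comp t, ← id_comp t', ← hie, assoc, assoc, h]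
    exact ⟨⟨_, h.nonempty_isColimit.some⟩⟩

lemma Regular.hasKernels (hreg : Regular X) [IsIdempotentComplete X] : HasKernels X where
  has_limit {a b} f := by
    obtain ⟨g, hg⟩ := hreg f
    obtain ⟨c, i, e, hie, hei⟩ := IsIdempotentComplete.idempotents_split a (𝟙 a - f ≫ g) (by
      simp [sub_comp, comp_sub, reassoc_of% hg])
    have w : i ≫ f = 0 := by
      rw [← id_comp i, ← hie, assoc, assoc, reassoc_of% hei]
      simp [sub_comp, comp_sub, hg]
    exact ⟨⟨_, KernelFork.IsLimit.ofι i w (fun t _ => t ≫ e) (fun t ht => by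
        rw [assoc, hei, comp_sub, reassoc_of% ht, zero_comp, sub_zero,
          comp_id])
      (fun t _ m hm => by rw [← hm, assoc, hie, comp_id])⟩⟩

lemma Regular.exists_retraction (hreg : Regular X) {a b : X} (f : a ⟶ b) [Mono f] : ∃ g : b ⟶ a, f ≫ g = 𝟙 a := by
  obtain ⟨g, hg⟩ := hreg f
  exact ⟨g, by rw [← cancel_mono f, assoc, hg, id_comp]⟩

lemma Regular.exists_section (hreg : Regular X) {a b : X} (f : a ⟶ b) [Epi f] : ∃ g : b ⟶ a, g ≫ f = 𝟙 b := by
  obtain ⟨g, hg⟩ := hreg f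
  exact ⟨g, by rw [← cancel_epi f, hg, comp_id]⟩

lemma Regular.isNormalMonoCategory (hreg : Regular X) : IsNormalMonoCategory X where
  normalMonoOfMono {a b} f _ := by
    obtain ⟨g, hg⟩ := hreg.exists_retraction f
    refine ⟨⟨b, 𝟙 b - g ≫ f, by simp [comp_sub, reassoc_of% hg], ?_⟩⟩
    refine KernelFork.IsLimit.ofι f _ (fun t _ => t ≫ g) (fun t ht => ?_) (fun t _ m hm => ?_)
    · rw [comp_sub, comp_id, sub_eq_zero] at ht
      rw [assoc, ← ht]
    · rw [← hm, assoc, hg, comp_id]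

lemma Regular.isNormalEpiCategory (hreg : Regular X) : IsNormalEpiCategory X where
  normalEpiOfEpi {a b} f _ := by
    obtain ⟨g, hg⟩ := hreg.exists_section f
    refine ⟨⟨a, 𝟙 a - f ≫ g, by simp [sub_comp, hg], ?_⟩⟩
    refine CokernelCofork.IsColimit.ofπ f _ (fun t _ => g ≫ t) (fun t ht => ?_) (fun t _ m hm => ?_)
    · rw [sub_comp, id_comp, sub_eq_zero, assoc] at ht
      exact ht.symm
    · rw [← hm, reassoc_of% hg]

lemma Regular.projective (hreg : Regular X) (x : X) : Projective x where
  factors f e _ := by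
    obtain ⟨g, hg⟩ := hreg.exists_section e
    exact ⟨f ≫ g, by rw [assoc, hg, comp_id]⟩
end

section
variable {X : Type u₁} [Category.{v₁} X] [Preadditive X] [Linear k X] {J : Type} [Fintype J]

/-- The identity functor is a retract of a finite sum of functors `x ↦ G j x ⊗ P j`. -/
structure Retract (k : Type u) [Field k] (X : Type u₁) [Category.{v₁} X] [Preadditive X] [Linear k X] (J : Type) [Fintype J] where
  G : J → X ⥤ FGModuleCat.{u} k
  additive (j) : (G j).Additive
  linear (j) : (G j).Linear k
  P : J → X
  r (j) (x : X) : (G j).obj x →ₗ[k] (P j ⟶ x)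
  r_nat (j) {x y : X} (f : x ⟶ y) (v) : r j y (((G j).map f).hom.hom v) = r j x v ≫ f
  s (j) (x : X) : (x ⟶ P j) ⊗[k] (G j).obj x
  s_nat (j) {x y : X} (f : x ⟶ y) : (leftComp k (P j) f).rTensor _ (s j y) = ((G j).map f).hom.hom.lTensor _ (s j x)
  retract (x : X) : ∑ j, TensorProduct.lift ((Linear.comp x (P j) x).compl₂ (r j x)) (s j x) = 𝟙 x

namespace Retract
variable (R : Retract k X J)

def eval {x y : X} {W : Type u} [AddCommGroup W] [Module k W] (j : J) (φ : W →ₗ[k] (R.G j).obj y) : ((x ⟶ R.P j) ⊗[k] W) →ₗ[k] (x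
  ⟶ y) := TensorProduct.lift ((Linear.comp x (R.P j) y).compl₂ (R.r j y ∘ₗ φ))

lemma sum_eval_map {x y : X} (f : x ⟶ y) : ∑ j, R.eval j ((R.G j).map f).hom.hom (R.s j x) = f := by
  conv_rhs => rw [← id_comp f, ← R.retract x, sum_comp]
  refine sum_congr rfl fun j _ => ?_
  generalize R.s j x = t
  induction t using TensorProduct.induction_on with
  | zero => simp
  | add t t' h h' => rw [map_add, map_add, h, h', add_comp]
  | tmul a v => simp [eval, R.r_nat]

include R in
lemma finite_hom (x y : X) : Module.Finite k (x ⟶ y) := by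
  let T : (∀ j, (R.G j).obj x →ₗ[k] (R.G j).obj y) →ₗ[k] (x ⟶ y) :=
    { toFun φ := ∑ j, R.eval j (φ j) (R.s j x)
      map_add' φ ψ := by
        rw [← sum_add_distrib]
        refine sum_congr rfl fun j _ => ?_
        generalize R.s j x = t
        induction t using TensorProduct.induction_on with
        | zero => simp
        | add t t' h h' => simp only [map_add, h, h']; abel
        | tmul a v => simp [eval]
      map_smul' c φ := by
        rw [RingHom.id_apply, smul_sum]
        refine sum_congr rfl fun j _ => ?_
        generalize R.s j x = t
        induction t using TensorProduct.induction_on with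
        | zero => simp
        | add t t' h h' => simp only [map_add, h, h', smul_add]
        | tmul a v => simp [eval] }
  exact Module.Finite.of_surjective T fun f => ⟨fun j => ((R.G j).map f).hom.hom, R.sum_eval_map f⟩

include R in
lemma regular : Regular X := fun x y f => by
  choose h hh using fun j => exists_linearMap_inverse ((R.G j).map f).hom.hom
  refine ⟨∑ j, R.eval j (h j) (R.s j y), ?_⟩
  rw [sum_comp, comp_sum]
  conv_rhs => rw [← R.sum_eval_map f]
  refine sum_congr rfl fun j _ => ?_
  have h₁ : ∀ t, f ≫ R.eval j (h j) t ≫ f = R.eval j (((R.G j).map f).hom.hom ∘ₗ h j) ((leftComp k (R.P j) f).rTensor _ t) := by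
    intro t
    induction t using TensorProduct.induction_on with
    | zero => simp
    | add t t' h h' => simp only [map_add, add_comp, comp_add, h, h']
    | tmul a v => simp [eval, R.r_nat]
  rw [h₁, R.s_nat]
  generalize R.s j x = t
  induction t using TensorProduct.induction_on with
  | zero => simp
  | add t t' h h' => simp only [map_add, h, h']
  | tmul a v =>
    simpa [eval] using congrArg (fun w => a ≫ R.r j y w) (LinearMap.congr_fun (hh j) v)

include R in
lemma gen (x : X) : ∃ (I : Type) (_ : Fintype I) (idx : I → J) (f : ∀ a, x ⟶ R.P (idx a)) (g : ∀ a, R.P (idx a) ⟶ x), ∑ a, f a ≫ g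
  a = 𝟙 x := by
  have key (j) (t : (x ⟶ R.P j) ⊗[k] (R.G j).obj x) : ∃ (n : ℕ) (f : Fin n → (x ⟶ R.P j)) (g : Fin n → (R.P j ⟶ x)), ∑ a, f a ≫ g
    a = R.eval j LinearMap.id t := by
    induction t using TensorProduct.induction_on with
    | zero => exact ⟨0, Fin.elim0, Fin.elim0, by simp⟩
    | add t t' h h' =>
      obtain ⟨n, f, g, h⟩ := h
      obtain ⟨n', f', g', h'⟩ := h'
      exact ⟨n + n', Fin.append f f', Fin.append g g', by simp [Fin.sum_univ_add, h, h']⟩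
    | tmul a v => exact ⟨1, fun _ => a, fun _ => R.r j x v, by simp [eval]⟩
  choose n f g h using fun j => key j (R.s j x)
  refine ⟨Σ j, Fin (n j), inferInstance, fun a => a.1, fun a => f a.1 a.2, fun a => g a.1 a.2, ?_⟩
  rw [Fintype.sum_sigma]
  simp only [h]
  exact R.retract x

include R in
theorem exists_splitBasis [IsAlgClosed k] [IsIdempotentComplete X] : ∃ n, Nonempty (SplitBasis k X (Fin n)) :=
  TwoVec.exists_splitBasis R.finite_hom R.regular R.P R.gen
end Retract
end
end Regular

/-! ### Cauchy completion -/

section Generates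
variable {C : Type u₁} [Category.{v₁} C] [Preadditive C] [Linear k C] {X : Type u₂} [Category.{v₂} X] [Preadditive X] [Linear k X]
  {E : Type u₃} [Category.{v₃} E] [Preadditive E] [Linear k E]

/-- Every object is a direct summand of a finite direct sum of objects in the image of `K`. -/
def Generates (K : C ⥤ X) : Prop := ∀ x : X, ∃ (J : Type) (_ : Fintype J) (idx : J → C) (f : ∀ a, x ⟶ K.obj (idx a)) (g : ∀ a,
  K.obj (idx a) ⟶ x), ∑ a, f a ≫ g a = 𝟙 x

namespace Generates
variable {K : C ⥤ X} (hK : Generates K)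

section
variable {F G : X ⥤ E} [F.Additive] [G.Additive]

include hK in
lemma exists_natTrans [K.Full] (θ : K ⋙ F ⟶ K ⋙ G) : ∃ η : F ⟶ G, ∀ c, η.app (K.obj c) = θ.app c := by
  choose J _ idx f g h using hK
  have nat {c d : C} (q : K.obj c ⟶ K.obj d) : F.map q ≫ θ.app d = θ.app c ≫ G.map q := by
    obtain ⟨q, rfl⟩ := K.map_surjective q
    exact θ.naturality q
  have key {x : X} {c : C} (q : x ⟶ K.obj c) : F.map q ≫ θ.app c = ∑ a, F.map (f x a) ≫ θ.app (idx x a) ≫ G.map (g x a ≫ q) := by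
    conv_lhs => rw [← id_comp q, ← h x, sum_comp, F.map_sum, sum_comp]
    refine sum_congr rfl fun a _ => ?_
    rw [assoc, F.map_comp, assoc, nat]
  refine ⟨{ app x := ∑ a, F.map (f x a) ≫ θ.app (idx x a) ≫ G.map (g x a),
            naturality x y q := ?_ }, fun c => ?_⟩
  · rw [comp_sum, sum_comp]
    have e₁ (b) : F.map q ≫ F.map (f y b) ≫ θ.app (idx y b) ≫ G.map (g y b) = ∑ a, F.map (f x a) ≫ θ.app (idx x a) ≫ G.map (g x a
      ≫ q ≫ f y b ≫ g y b) := by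
      rw [← assoc, ← F.map_comp, ← assoc, key, sum_comp]
      simp
    simp only [e₁]
    rw [sum_comm]
    refine sum_congr rfl fun a _ => ?_
    rw [← comp_sum, ← comp_sum, ← G.map_sum, ← comp_sum, ← comp_sum, h]
    simp
  · have := key (𝟙 (K.obj c))
    simpa using this.symm

include hK in
lemma natTrans_ext {η θ : F ⟶ G} (h : ∀ c, η.app (K.obj c) = θ.app (K.obj c)) : η = θ := by
  ext x
  obtain ⟨J, _, idx, f, g, hx⟩ := hK x
  have e (η : F ⟶ G) : η.app x = ∑ a, F.map (f a) ≫ η.app (K.obj (idx a)) ≫ G.map (g a) := by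
    conv_lhs => rw [← id_comp (η.app x), ← F.map_id, ← hx, F.map_sum, sum_comp]
    simp
  rw [e η, e θ]
  simp only [h]
end

section
variable [K.Full] [K.Faithful] [K.Additive] [K.Linear k] [HasFiniteBiproducts E] [IsIdempotentComplete E] (F : C ⥤ E) [F.Additive]
  [F.Linear k]

include hK in
/-- Linear functors extend to the Cauchy completion. -/
theorem exists_extension : ∃ H : X ⥤ E, H.Additive ∧ H.Linear k ∧ Nonempty (K ⋙ H ≅ F) := by
  choose J _ idx f g h using hK
  let P {c d : C} (q : K.obj c ⟶ K.obj d) : F.obj c ⟶ F.obj d := F.map (K.preimage q)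
  have P_map {c d : C} (q : c ⟶ d) : P (K.map q) = F.map q := by simp [P]
  have P_add {c d : C} (q q' : K.obj c ⟶ K.obj d) : P (q + q') = P q + P q' := by
    obtain ⟨q, rfl⟩ := K.map_surjective q
    obtain ⟨q', rfl⟩ := K.map_surjective q'
    rw [← K.map_add, P_map, P_map, P_map, F.map_add]
  have P_smul {c d : C} (r : k) (q : K.obj c ⟶ K.obj d) : P (r • q) = r • P q := by
    obtain ⟨q, rfl⟩ := K.map_surjective q
    rw [← K.map_smul, P_map, P_map, F.map_smul]
  have P_comp {c d e : C} (q : K.obj c ⟶ K.obj d) (q' : K.obj d ⟶ K.obj e) : P (q ≫ q') = P q ≫ P q' := by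
    obtain ⟨q, rfl⟩ := K.map_surjective q
    obtain ⟨q', rfl⟩ := K.map_surjective q'
    rw [← K.map_comp, P_map, P_map, P_map, F.map_comp]
  have P_sum {c d : C} {I : Type} [Fintype I] (q : I → (K.obj c ⟶ K.obj d)) : P (∑ a, q a) = ∑ a, P (q a) := map_sum
    (AddMonoidHom.mk' P P_add) q Finset.univ
  have key {c d : C} (x : X) (q : K.obj c ⟶ x) (q' : x ⟶ K.obj d) : ∑ a, P (q ≫ f x a) ≫ P (g x a ≫ q') = P (q ≫ q') := by
    simp only [← P_comp, assoc]
    rw [← P_sum, ← comp_sum]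
    conv_rhs => rw [← id_comp q', ← h x, sum_comp]
    simp only [assoc]
  let Y (x : X) : E := ⨁ fun a => F.obj (idx x a)
  let M {x y : X} (q : x ⟶ y) : Y x ⟶ Y y := biproduct.matrix fun a b => P (g x a ≫ q ≫ f y b)
  have M_comp {x y z : X} (q : x ⟶ y) (q' : y ⟶ z) : M q ≫ M q' = M (q ≫ q') := by
    ext b a
    simp only [M, biproduct.matrix_π, biproduct.ι_desc, biproduct.ι_matrix_assoc, assoc]
    rw [biproduct.lift_eq, sum_comp]
    simp only [assoc, biproduct.matrix_π, biproduct.ι_desc]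
    have := key y (g x a ≫ q) (q' ≫ f z b)
    simp only [assoc] at this
    rw [this]
  have M_add {x y : X} (q q' : x ⟶ y) : M (q + q') = M q + M q' := by
    ext b a
    simp [M, add_comp, comp_add, P_add]
  have M_smul {x y : X} (r : k) (q : x ⟶ y) : M (r • q) = r • M q := by
    ext b a
    simp [M, P_smul]
  choose Z i e hie hei using fun x => IsIdempotentComplete.idempotents_split (Y x) (M (𝟙 x)) (by rw [M_comp, comp_id])
  have i_M {x y : X} (q : x ⟶ y) : i x ≫ M (𝟙 x) ≫ M q = i x ≫ M q := by
    rw [M_comp, id_comp]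
  have M_e {x : X} : M (𝟙 x) ≫ e x = e x := by
    rw [← hei, assoc, hie, comp_id]
  have hp (c : C) : (biproduct.desc fun a => P (g (K.obj c) a)) ≫ (biproduct.lift fun a => P (f (K.obj c) a)) = M (𝟙 (K.obj c)) :=
    by
    ext b a
    simp [M, ← P_comp]
  have hq (c : C) : (biproduct.lift fun a => P (f (K.obj c) a)) ≫ (biproduct.desc fun a => P (g (K.obj c) a)) = 𝟙 (F.obj c) := by
    rw [biproduct.lift_desc]
    have := key (K.obj c) (𝟙 _) (𝟙 _)
    rw [id_comp, ← K.map_id, P_map, F.map_id] at this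
    simpa using this
  have hM (c d : C) (q : c ⟶ d) : M (K.map q) ≫ (biproduct.desc fun a => P (g (K.obj d) a)) = (biproduct.desc fun a => P (g (K.obj
    c) a)) ≫ F.map q := by
    ext a
    simp only [M, biproduct.ι_matrix_assoc, biproduct.lift_desc, biproduct.ι_desc_assoc]
    rw [← P_map, ← P_comp]
    have := key (K.obj d) (g _ a ≫ K.map q) (𝟙 _)
    simpa using this
  let H : X ⥤ E :=
    { obj := Z
      map {x y} q := i x ≫ M q ≫ e y
      map_id x := by rw [M_e, hie]
      map_comp {x y z} q q' := by
        simp only [assoc]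
        rw [reassoc_of% (hei y), ← assoc (M q), M_comp, ← assoc (M _), M_comp,
          comp_id] }
  refine ⟨H, ⟨fun {x y q q'} => ?_⟩, ⟨fun {x y} q r => ?_⟩, ⟨NatIso.ofComponents (fun c =>
    { hom := i (K.obj c) ≫ biproduct.desc fun a => P (g (K.obj c) a)
      inv := (biproduct.lift fun a => P (f (K.obj c) a)) ≫ e (K.obj c)
      hom_inv_id := ?_
      inv_hom_id := ?_ }) fun {c d} q => ?_⟩⟩
  · simp [H, M_add, add_comp, comp_add]
  · simp [H, M_smul]
  · rw [assoc, ← assoc (biproduct.desc _), hp, M_e]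
    exact hie _
  · rw [assoc, reassoc_of% (hei (K.obj c)), ← hp, assoc, hq, comp_id, hq]
  · change (i _ ≫ M (K.map q) ≫ e _) ≫ i _ ≫ _ = (i _ ≫ _) ≫ F.map q
    simp only [assoc]
    rw [reassoc_of% (hei (K.obj d)), ← hM, ← assoc (M _), M_comp, comp_id]
end
end Generates
end Generates

section Hat
variable (C : Type u₁) [Category.{u} C] [Preadditive C] [Linear k C]

/-- The Cauchy completion of a linear category. -/
abbrev Hat : Type _ := Karoubi (Mat_ C)

abbrev toHat : C ⥤ Hat C := Mat_.embedding C ⋙ toKaroubi (Mat_ C)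

instance : (Mat_.embedding C).Linear k where
  map_smul _ _ := rfl

instance : (toKaroubi (Mat_ C)).Linear k where
  map_smul _ _ := rfl

instance toHat_linear : (toHat C).Linear k := inferInstanceAs ((Mat_.embedding C ⋙ toKaroubi (Mat_ C)).Linear k)

lemma toHat_generates : Generates (toHat C) := fun x => by
  let π (a : x.X.ι) : x.X ⟶ (Mat_.embedding C).obj (x.X.X a) := x.X.isoBiproductEmbedding.hom ≫ biproduct.π _ a
  let ι (a : x.X.ι) : (Mat_.embedding C).obj (x.X.X a) ⟶ x.X := biproduct.ι (fun a => (Mat_.embedding C).obj (x.X.X a)) a ≫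
    x.X.isoBiproductEmbedding.inv
  have h : ∑ a, π a ≫ ι a = 𝟙 x.X := by
    have := congrArg (fun t => x.X.isoBiproductEmbedding.hom ≫ t ≫ x.X.isoBiproductEmbedding.inv) (biproduct.total)
    simp only [sum_comp, comp_sum, id_comp, Iso.hom_inv_id, assoc] at this
    simpa only [π, ι, assoc] using this
  refine ⟨x.X.ι, inferInstance, x.X.X, fun a => ⟨x.p ≫ π a, ?_⟩, fun a => ⟨ι a ≫ x.p, ?_⟩, ?_⟩
  · have : x.p ≫ (x.p ≫ π a) ≫ 𝟙 _ = x.p ≫ π a := by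
      rw [comp_id, x.idem_assoc]
    exact this
  · have : 𝟙 _ ≫ (ι a ≫ x.p) ≫ x.p = ι a ≫ x.p := by
      rw [id_comp, assoc, x.idem]
    exact this
  · ext1
    rw [Karoubi.sum_hom]
    have := congrArg (fun t => x.p ≫ t ≫ x.p) h
    simp only [sum_comp, comp_sum, id_comp, x.idem] at this
    simpa only [Karoubi.comp_f, assoc, Karoubi.id_f] using this

instance : HasFiniteBiproducts (Hat C) := inferInstance

instance : IsIdempotentComplete (Hat C) := inferInstance

instance : (toHat C).Full := inferInstance

instance : (toHat C).Faithful := inferInstance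

instance : (toHat C).Additive := inferInstance
end Hat

/-! ### Tuples of vector spaces -/

section VectPow
def VectPow.ofHom {n : ℕ} {v w : VectPow k n} (f : ∀ i, v i →ₗ[k] w i) : v ⟶ w := fun i => FGModuleCat.ofHom (f i)

@[simp] lemma VectPow.ofHom_apply {n : ℕ} {v w : VectPow k n} (f : ∀ i, v i →ₗ[k] w i) (i) (x : v i) : (VectPow.ofHom f i).hom.hom
  x = f i x := rfl

@[simp] lemma VectPow.comp_apply {n : ℕ} {u v w : VectPow k n} (f : u ⟶ v) (g : v ⟶ w) (i) (x : u i) : ((f ≫ g) i).hom.hom x = (g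
  i).hom.hom ((f i).hom.hom x) := rfl

lemma VectPow.nonempty_iso {n : ℕ} {v w : VectPow k n} (h : ∀ i, finrank k (v i) = finrank k (w i)) : Nonempty (v ≅ w) := by
  have e (i) : v i ≃ₗ[k] w i := (FiniteDimensional.nonempty_linearEquiv_of_finrank_eq (h i)).some
  exact ⟨⟨VectPow.ofHom fun i => (e i).toLinearMap, VectPow.ofHom fun i => (e i).symm.toLinearMap, AddCat.vectPow_hom_ext fun i x
    => (e i).symm_apply_apply x, AddCat.vectPow_hom_ext fun i x => (e i).apply_symm_apply x⟩⟩

lemma VectPow.finrank_eq {n : ℕ} {v w : VectPow k n} (e : v ≅ w) (i) : finrank k (v i) = finrank k (w i) := LinearEquiv.finrank_eq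
  (FGModuleCat.isoToLinearEquiv (Pi.isoApp e i))

lemma VectPow.regular (n : ℕ) : Regular (VectPow k n) := fun v w f => by
  choose g hg using fun i => exists_linearMap_inverse (f i).hom.hom
  exact ⟨VectPow.ofHom g, AddCat.vectPow_hom_ext fun i x => LinearMap.congr_fun (hg i) x⟩

instance : IsIdempotentComplete (FGModuleCat.{u} k) := inferInstance

instance (n : ℕ) : IsIdempotentComplete (VectPow k n) where
  idempotents_split v p hp := by
    choose y i e hie hei using fun j => IsIdempotentComplete.idempotents_split (v j) (p j) (congrFun hp j)
    exact ⟨y, i, e, funext hie, funext hei⟩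

instance (n : ℕ) : EssentiallySmall.{u} (VectPow k n) := by
  rw [essentiallySmall_iff]
  refine ⟨?_, inferInstance⟩
  refine small_of_injective (β := Fin n → ℕ) (f := fun x : Skeleton (VectPow k n) => fun i => finrank k ((fromSkeleton _).obj x
    i)) fun x y h => ?_
  obtain ⟨e⟩ := VectPow.nonempty_iso fun i => congrFun h i
  exact skeleton_skeletal _ ⟨(fromSkeleton _).preimageIso e⟩

def vectBasis (k : Type u) [Field k] : SplitBasis k (FGModuleCat.{u} k) Unit := SplitBasis.ofGen (fun _ => FGModuleCat.of k k)
  (fun _ f => ⟨f.hom.hom (1 : k), by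
      ext
      change f.hom.hom (1 : k) = f.hom.hom (1 : k) • (1 : k)
      simp⟩) (fun h => (h rfl).elim)
    (fun _ h => one_ne_zero (α := k) (congrArg (fun f => f.hom.hom (1 : k)) h)) (fun x => by
    let b := finBasis k x
    refine ⟨Fin (finrank k x), inferInstance, fun _ => (), fun a => FGModuleCat.ofHom (b.coord a), fun a => FGModuleCat.ofHom
      (toSpanSingleton k x (b a)), ?_⟩
    ext v
    have hs (f : Fin (finrank k x) → (x ⟶ x)) : (∑ a, f a).hom.hom v = ∑ a, (f a).hom.hom v := map_sum (AddMonoidHom.mk' (fun f :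
      x ⟶ x => f.hom.hom v) fun _ _ => rfl) f _
    rw [hs]
    exact b.sum_repr v)

def delta (k : Type u) [Field k] {n : ℕ} (i : Fin n) : VectPow k n := fun j => FGModuleCat.of k (PLift (i = j) → k)

lemma finrank_delta {n : ℕ} (i j : Fin n) :
    finrank k (delta k i j) = if i = j then 1 else 0 := KV.rank_of_pi _

def deltaOne {n : ℕ} (i : Fin n) : delta k i i := fun _ => (1 : k)

lemma delta_ext {n : ℕ} {i j : Fin n} {x y : delta k i j} (h : ∀ t, x t = y t) : x = y := funext h

lemma delta_hom_ext {n : ℕ} {i : Fin n} {v : VectPow k n} {f g : delta k i ⟶ v} (h : (f i).hom.hom (deltaOne i) = (g i).hom.hom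
  (deltaOne i)) : f = g := AddCat.vectPow_hom_ext fun j x => by
    by_cases hij : i = j
    · subst hij
      have : x = (show k from x ⟨rfl⟩) • deltaOne i := by
        refine delta_ext fun t => ?_
        obtain ⟨_⟩ := t
        exact (mul_one _).symm
      rw [this, map_smul, map_smul, h]
    · have : x = 0 := delta_ext fun t => (hij t.down).elim
      rw [this, map_zero, map_zero]

/-- Vectors, as morphisms from the basic tuples. -/
def deltaVec {n : ℕ} {v : VectPow k n} (i : Fin n) (x : v i) : delta k i ⟶ v :=
  VectPow.ofHom fun j => if h : i = j then
    toSpanSingleton k (v j) (h ▸ x) ∘ₗ LinearMap.proj (φ := fun _ : PLift (i = j) => k) ⟨h⟩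
    else 0

@[simp] lemma deltaVec_deltaOne {n : ℕ} {v : VectPow k n} (i : Fin n) (x : v i) : (deltaVec i x i).hom.hom (deltaOne i) = x := by
  simp only [deltaVec, VectPow.ofHom_apply, dif_pos]
  exact one_smul k x

def deltaCovec {n : ℕ} {v : VectPow k n} (i : Fin n) (φ : v i →ₗ[k] k) : v ⟶ delta k i := VectPow.ofHom fun j => LinearMap.pi fun
  h => φ ∘ₗ (show v j →ₗ[k] v i from h.down ▸ LinearMap.id)

lemma deltaCovec_apply {n : ℕ} {v : VectPow k n} (i : Fin n) (φ : v i →ₗ[k] k) (x : v i) : (deltaCovec i φ i).hom.hom x = φ x •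
  deltaOne i := delta_ext fun _ => (mul_one _).symm

lemma deltaCovec_ne {n : ℕ} {v : VectPow k n} {i j : Fin n} (h : i ≠ j) (φ : v i →ₗ[k] k) (x : v j) : (deltaCovec i φ j).hom.hom x
  = 0 := delta_ext fun t => (h t.down).elim

def vectPowBasis (k : Type u) [Field k] (n : ℕ) : SplitBasis k (VectPow k n) (Fin n) := SplitBasis.ofGen (fun i => delta k i) (fun
  i f => ⟨(f i).hom.hom (deltaOne i) ⟨rfl⟩, delta_hom_ext (delta_ext fun t => by
      obtain ⟨_⟩ := t
      exact (mul_one _).symm)⟩)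
    (fun h f => delta_hom_ext (delta_ext fun t => (h t.down.symm).elim))
    (fun i h => one_ne_zero (α := k) (congrArg (fun f : delta k i ⟶ delta k i => (f i).hom.hom (deltaOne i) ⟨rfl⟩) h))
    (fun v => by
      let b (i) := finBasis k (v i)
      refine ⟨Σ i, Fin (finrank k (v i)), inferInstance, fun a => a.1, fun a => deltaCovec a.1 ((b a.1).coord a.2), fun a =>
        deltaVec a.1 (b a.1 a.2), ?_⟩
      refine AddCat.vectPow_hom_ext fun i x => ?_
      have hs (f : (Σ i, Fin (finrank k (v i))) → (v ⟶ v)) : ((∑ a, f a) i).hom.hom x = ∑ a, ((f a) i).hom.hom x := map_sum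
        (AddMonoidHom.mk' (fun f : v ⟶ v => (f i).hom.hom x) fun _ _ => rfl) f _
      rw [hs, Fintype.sum_sigma, sum_eq_single i]
      · refine Eq.trans ?_ ((b i).sum_repr x)
        refine sum_congr rfl fun a _ => ?_
        rw [VectPow.comp_apply, deltaCovec_apply, map_smul, deltaVec_deltaOne]
        rfl
      · intro j _ hj
        refine sum_eq_zero fun a _ => ?_
        rw [VectPow.comp_apply, deltaCovec_ne hj, map_zero]
      · simp)
end VectPow

namespace AddCat
/-! ### The inclusion into additive categories, as a pseudofunctor -/

section MatrixFunctor
variable {a b c d : KV k}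

def mtmul {M : a ⟶ b} {v : VectPow k a.n} {j : Fin b.n} (i : Fin a.n) : v i →ₗ[k] KV.Hom.entry M i j →ₗ[k] (matrixFunctor M).obj v
  j := (TensorProduct.mk k _ _).compr₂ (LinearMap.single k (fun i => v i ⊗[k] KV.Hom.entry M i j) i)

def mdesc {M : a ⟶ b} {v : VectPow k a.n} {j : Fin b.n} {X : Type u} [AddCommGroup X] [Module k X] (φ : ∀ i, v i →ₗ[k]
  KV.Hom.entry M i j →ₗ[k] X) : (matrixFunctor M).obj v j →ₗ[k] X := ∑ i, TensorProduct.lift (φ i) ∘ₗ LinearMap.proj i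

@[simp]
lemma mdesc_mtmul {M : a ⟶ b} {v : VectPow k a.n} {j : Fin b.n} {X : Type u} [AddCommGroup X] [Module k X] (φ : ∀ i, v i →ₗ[k]
  KV.Hom.entry M i j →ₗ[k] X) (i x m) : mdesc φ (mtmul i x m) = φ i x m := by
  rw [mdesc, LinearMap.sum_apply, sum_eq_single i]
  · change TensorProduct.lift (φ i) ((Pi.single i (x ⊗ₜ[k] m) : ∀ i, v i ⊗[k] KV.Hom.entry M i j) i) = _
    rw [Pi.single_eq_same, TensorProduct.lift.tmul]
  · intro i' _ h
    change TensorProduct.lift (φ i') ((Pi.single i (x ⊗ₜ[k] m) : ∀ i, v i ⊗[k] KV.Hom.entry M i j) i') = 0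
    rw [Pi.single_eq_of_ne h, map_zero]
  · simp

lemma mlinear_ext {M : a ⟶ b} {v : VectPow k a.n} {j : Fin b.n} {X : Type u} [AddCommGroup X] [Module k X] {φ ψ : (matrixFunctor
  M).obj v j →ₗ[k] X} (h : ∀ i x m, φ (mtmul i x m) = ψ (mtmul i x m)) : φ = ψ := by
  refine LinearMap.pi_ext' fun i => TensorProduct.ext' fun x m => h i x m

lemma matrixFunctor_map_mtmul {M : a ⟶ b} {v w : VectPow k a.n} (f : v ⟶ w) {j : Fin b.n} (i x m) : ((matrixFunctor M).map f
  j).hom.hom (mtmul i x m) = mtmul i ((f i).hom.hom x) m := by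
  funext i'
  change LinearMap.rTensor _ (f i').hom.hom ((Pi.single i (x ⊗ₜ[k] m) : ∀ i, v i ⊗[k] KV.Hom.entry M i j) i') = (Pi.single i ((f
    i).hom.hom x ⊗ₜ[k] m) : ∀ i, w i ⊗[k] KV.Hom.entry M i j) i'
  by_cases h : i = i'
  · subst h
    simp only [Pi.single_eq_same]
    rfl
  · rw [Pi.single_eq_of_ne' h, Pi.single_eq_of_ne' h, map_zero]

lemma natTrans_mtmul {M N : a ⟶ b} (η : M ⟶ N) {v : VectPow k a.n} {j : Fin b.n} (i x m) : ((matrixNatTrans η).app v j).hom.hom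
  (mtmul i x m) = mtmul i x (KV.Hom₂.entry η i j m) := by
  funext i'
  change LinearMap.lTensor _ (KV.Hom₂.entry η i' j) ((Pi.single i (x ⊗ₜ[k] m) : ∀ i, v i ⊗[k] KV.Hom.entry M i j) i') = (Pi.single
    i (x ⊗ₜ[k] (KV.Hom₂.entry η i j m)) : ∀ i, v i ⊗[k] KV.Hom.entry N i j) i'
  by_cases h : i = i'
  · subst h
    simp only [Pi.single_eq_same]
    rfl
  · rw [Pi.single_eq_of_ne' h, Pi.single_eq_of_ne' h, map_zero]

def compApp (M : a ⟶ b) (N : b ⟶ c) (v : VectPow k a.n) (l : Fin c.n) : (matrixFunctor N).obj ((matrixFunctor M).obj v) l →ₗ[k]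
  (matrixFunctor (M ≫ N)).obj v l := mdesc fun j => mdesc fun i => (LinearMap.llcomp k _ _ _).compl₁₂ (mtmul i) (KV.tmul j)

def compInvApp (M : a ⟶ b) (N : b ⟶ c) (v : VectPow k a.n) (l : Fin c.n) : (matrixFunctor (M ≫ N)).obj v l →ₗ[k] (matrixFunctor
  N).obj ((matrixFunctor M).obj v) l := mdesc fun i => LinearMap.flip (KV.desc fun j => LinearMap.lflip.toLinearMap ∘ₗ ((mtmul
  i).compr₂ (mtmul j)).flip)

lemma compApp_mtmul (M : a ⟶ b) (N : b ⟶ c) (v : VectPow k a.n) (l : Fin c.n) (i j x m n) : compApp M N v l (mtmul j (mtmul i x m)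
  n) = mtmul (M := M ≫ N) i x (KV.tmul (M := M) (N := N) j m n) := by
  simp [compApp]

lemma compInvApp_mtmul (M : a ⟶ b) (N : b ⟶ c) (v : VectPow k a.n) (l : Fin c.n) (i j x m n) : compInvApp M N v l (mtmul (M := M ≫
  N) i x (KV.tmul (M := M) (N := N) j m n)) = mtmul j (mtmul i x m) n := by
  refine (mdesc_mtmul _ _ _ _).trans ?_
  exact LinearMap.congr_fun (KV.desc_tmul _ j m n) x

lemma mcomp_ext {M : a ⟶ b} {N : b ⟶ c} {v : VectPow k a.n} {l : Fin c.n} {X : Type u} [AddCommGroup X] [Module k X] {φ ψ :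
  (matrixFunctor N).obj ((matrixFunctor M).obj v) l →ₗ[k] X} (h : ∀ i j x m n, φ (mtmul j (mtmul i x m) n) = ψ (mtmul j (mtmul i x
  m) n)) : φ = ψ := by
  refine mlinear_ext fun j y n => ?_
  have : (φ ∘ₗ (mtmul j).flip n) = (ψ ∘ₗ (mtmul j).flip n) := mlinear_ext fun i x m => h i j x m n
  exact LinearMap.congr_fun this y

lemma mcomp_ext₃ {M : a ⟶ b} {N : b ⟶ c} {P : c ⟶ d} {v : VectPow k a.n} {l : Fin d.n} {X : Type u} [AddCommGroup X] [Module k X]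
  {φ ψ : (matrixFunctor P).obj ((matrixFunctor N).obj ((matrixFunctor M).obj v)) l →ₗ[k] X} (h : ∀ i j j' x m n p, φ (mtmul j'
  (mtmul j (mtmul i x m) n) p) = ψ (mtmul j' (mtmul j (mtmul i x m) n) p)) : φ = ψ := by
  refine mlinear_ext fun j' y p => ?_
  have : (φ ∘ₗ (mtmul j').flip p) = (ψ ∘ₗ (mtmul j').flip p) := mcomp_ext fun i j x m n => h i j j' x m n p
  exact LinearMap.congr_fun this y

lemma mcomp_ext' {M : a ⟶ b} {N : b ⟶ c} {v : VectPow k a.n} {l : Fin c.n} {X : Type u} [AddCommGroup X] [Module k X] {φ ψ :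
  (matrixFunctor (M ≫ N)).obj v l →ₗ[k] X} (h : ∀ i j x m n, φ (mtmul (M := M ≫ N) i x (KV.tmul (M := M) (N := N) j m n)) = ψ
  (mtmul (M := M ≫ N) i x (KV.tmul (M := M) (N := N) j m n))) : φ = ψ := by
  refine mlinear_ext fun i x y => ?_
  induction y using KV.mul_induction with
  | h0 | hadd => simp [*]
  | htmul j m n => exact h i j x m n

lemma compInvApp_compApp (M : a ⟶ b) (N : b ⟶ c) (v : VectPow k a.n) (l : Fin c.n) (y) : compInvApp M N v l (compApp M N v l y) =
  y := by
  have : compInvApp M N v l ∘ₗ compApp M N v l = LinearMap.id := mcomp_ext fun i j x m n => by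
    rw [LinearMap.comp_apply, compApp_mtmul, compInvApp_mtmul]
    rfl
  exact LinearMap.congr_fun this y

lemma compApp_compInvApp (M : a ⟶ b) (N : b ⟶ c) (v : VectPow k a.n) (l : Fin c.n) (y) : compApp M N v l (compInvApp M N v l y) =
  y := by
  have : compApp M N v l ∘ₗ compInvApp M N v l = LinearMap.id := mcomp_ext' fun i j x m n => by
    rw [LinearMap.comp_apply, compInvApp_mtmul, compApp_mtmul]
    rfl
  exact LinearMap.congr_fun this y

lemma comp_matrixFunctor_map (M : a ⟶ b) (N : b ⟶ c) {v w : VectPow k a.n} (f : v ⟶ w) {l : Fin c.n} (i j x m n) : ((matrixFunctor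
  N).map ((matrixFunctor M).map f) l).hom.hom (mtmul j (mtmul i x m) n) = mtmul j (mtmul i ((f i).hom.hom x) m) n := by
  rw [matrixFunctor_map_mtmul, matrixFunctor_map_mtmul]

/-- The comparison of a composite of matrix functors with the functor of the product. -/
def compIso (M : a ⟶ b) (N : b ⟶ c) : (incl k).map M ≫ (incl k).map N ≅ (incl k).map (M ≫ N) := isoMk (NatIso.ofComponents (fun v
  =>
        { hom := VectPow.ofHom (compApp M N v)
          inv := VectPow.ofHom (compInvApp M N v)
          hom_inv_id := vectPow_hom_ext fun l => compInvApp_compApp M N v l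
          inv_hom_id := vectPow_hom_ext fun l => compApp_compInvApp M N v l })
      fun {v w} f => vectPow_hom_ext fun l => LinearMap.congr_fun <| mcomp_ext fun i j x m n => by
        have h₁ := (congrArg (compApp M N w l) (comp_matrixFunctor_map M N f i j x m n)).trans (compApp_mtmul M N w l i j _ m n)
        have h₂ := (congrArg (((matrixFunctor (M ≫ N)).map f l).hom.hom) (compApp_mtmul M N v l i j x m n)).trans
          (matrixFunctor_map_mtmul f i x _)
        exact h₁.trans h₂.symm)

lemma moneElt_ext {v : VectPow k a.n} {j : Fin a.n} {X : Type u} [AddCommGroup X] [Module k X] {φ ψ : (matrixFunctor (𝟙 a)).obj v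
  j →ₗ[k] X} (h : ∀ x, φ (mtmul (M := 𝟙 a) j x (KV.oneElt j)) = ψ (mtmul (M := 𝟙 a) j x (KV.oneElt j))) : φ = ψ := by
  refine mlinear_ext fun i x m => ?_
  by_cases hij : i = j
  · subst hij
    rw [KV.one_ext m]
    simp only [map_smul, h]
  · rw [KV.one_zero hij m, map_zero, map_zero, map_zero]

def idInvApp (v : VectPow k a.n) (j : Fin a.n) : (matrixFunctor (𝟙 a)).obj v j →ₗ[k] v j := mdesc fun i => if h : i = j then by
    subst h
    exact (LinearMap.lsmul k _ ∘ₗ (LinearMap.proj ⟨rfl⟩)).flip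
  else 0

lemma idInvApp_mtmul (v : VectPow k a.n) (j : Fin a.n) (x) : idInvApp v j (mtmul (M := 𝟙 a) j x (KV.oneElt j)) = x := by
  refine (mdesc_mtmul _ _ _ _).trans ?_
  rw [dif_pos rfl]
  exact one_smul k x

def idIso (a : KV k) : 𝟙 ((incl k).obj a) ≅ (incl k).map (𝟙 a) := isoMk (NatIso.ofComponents (fun v =>
        { hom := VectPow.ofHom fun j => (mtmul j).flip (KV.oneElt j)
          inv := VectPow.ofHom (idInvApp v)
          hom_inv_id := vectPow_hom_ext fun l x => idInvApp_mtmul v l x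
          inv_hom_id := vectPow_hom_ext fun l => LinearMap.congr_fun <| moneElt_ext fun x =>
            congrArg (fun y => mtmul l y (KV.oneElt l)) (idInvApp_mtmul v l x) })
      fun {v w} f => vectPow_hom_ext fun l x =>
        (matrixFunctor_map_mtmul f l x (KV.oneElt l)).symm)

lemma natTrans_ext {n : ℕ} {v w : VectPow k n} {f g : v ⟶ w} (h : ∀ j, (f j).hom.hom = (g j).hom.hom) : f = g := vectPow_hom_ext
  fun j => LinearMap.congr_fun (h j)

def inclLax (k : Type u) [Field k] : LaxFunctor (KV k) (AddCat k) where
  toPrelaxFunctor := incl k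
  mapId a := (idIso a).hom
  mapComp M N := (compIso M N).hom
  mapComp_naturality_left {a b c M M'} η N := hom₂_ext fun v => natTrans_ext fun l => mcomp_ext fun i j x m n => by
      have h₁ := (congrArg (((matrixNatTrans (η ▷ N)).app v l).hom.hom) (compApp_mtmul M N v l i j x m n)).trans ((natTrans_mtmul
        (η ▷ N) i x _).trans (congrArg _ (KV.whiskerRight_tmul η N l j m n)))
      have h₂ := (congrArg (compApp M' N v l) ((matrixFunctor_map_mtmul ((matrixNatTrans η).app v) j (mtmul i x m) n).trans
        (congrArg (fun y => mtmul j y n) (natTrans_mtmul η i x m)))).trans (compApp_mtmul M' N v l i j x _ n)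
      exact h₁.trans h₂.symm
  mapComp_naturality_right {a b c} M {N N'} η := hom₂_ext fun v => natTrans_ext fun l => mcomp_ext fun i j x m n => by
      have h₁ := (congrArg (((matrixNatTrans (M ◁ η)).app v l).hom.hom) (compApp_mtmul M N v l i j x m n)).trans ((natTrans_mtmul
        (M ◁ η) i x _).trans (congrArg _ (KV.whiskerLeft_tmul M η l j m n)))
      have h₂ := (congrArg (compApp M N' v l) (natTrans_mtmul η j (mtmul i x m) n)).trans (compApp_mtmul M N' v l i j x m _)
      exact h₁.trans h₂.symm
  map₂_associator {a b c d} M N P := hom₂_ext fun v => natTrans_ext fun l => by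
    refine mcomp_ext₃ fun i j j' x m n p => ?_
    have h₁ := (congrArg (fun z => ((matrixNatTrans (α_ M N P).hom).app v l).hom.hom (compApp (M ≫ N) P v l z))
      ((matrixFunctor_map_mtmul (VectPow.ofHom (compApp M N v)) j' (mtmul j (mtmul i x m) n) p).trans (congrArg (fun z => mtmul j'
      z p) (compApp_mtmul M N v j' i j x m n))))
    have h₂ := congrArg (fun z => ((matrixNatTrans (α_ M N P).hom).app v l).hom.hom z) (compApp_mtmul (M ≫ N) P v l i j' x
      (KV.tmul j m n) p)
    have h₃ := (natTrans_mtmul (α_ M N P).hom i x _).trans (congrArg (mtmul i x) (KV.associatorHom_tmul M N P l j j' m n p))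
    have h₄ := congrArg (fun z => compApp M (N ≫ P) v l z) (compApp_mtmul N P ((matrixFunctor M).obj v) l j j' (mtmul i x m) n p)
    have h₅ := compApp_mtmul M (N ≫ P) v l i j x m (KV.tmul j' n p)
    exact (h₁.trans (h₂.trans h₃)).trans (h₄.trans h₅).symm
  map₂_leftUnitor {a b} M := hom₂_ext fun v => natTrans_ext fun l => mlinear_ext fun i x m => by
    have h₁ := natTrans_mtmul (Bicategory.leftUnitor M).inv i x m
    have h₂ := congrArg (fun z => compApp (𝟙 a) M v l z) (matrixFunctor_map_mtmul ((idIso a).hom.natTrans.app v) i x m)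
    have h₃ := compApp_mtmul (𝟙 a) M v l i i x (KV.oneElt i) m
    exact h₁.trans (h₂.trans h₃).symm
  map₂_rightUnitor {a b} M := hom₂_ext fun v => natTrans_ext fun l => mlinear_ext fun i x m => by
    have h₁ := natTrans_mtmul (Bicategory.rightUnitor M).inv i x m
    have h₃ := compApp_mtmul M (𝟙 b) v l i l x m (KV.oneElt l)
    exact h₁.trans h₃.symm

instance (a : KV k) : IsIso ((inclLax k).mapId a) := inferInstanceAs (IsIso (idIso a).hom)

instance {a b c : KV k} (M : a ⟶ b) (N : b ⟶ c) : IsIso ((inclLax k).mapComp M N) := inferInstanceAs (IsIso (compIso M N).hom)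

/-- The inclusion of the Kapranov–Voevodsky 2-category, as a pseudofunctor. -/
def inclPseudo (k : Type u) [Field k] : Pseudofunctor (KV k) (AddCat k) := Pseudofunctor.mkOfLax' (inclLax k)
end MatrixFunctor

section MatrixFunctorFull
variable {a b c d : KV k}

lemma finrank_matrixFunctor_obj (M : a ⟶ b) (v : VectPow k a.n) (j : Fin b.n) : finrank k ((matrixFunctor M).obj v j) = ∑ i,
  finrank k (v i) * KV.rank M i j := by
  refine (Module.finrank_pi_fintype (M := fun i => v i ⊗[k] KV.Hom.entry M i j) k).trans ?_
  exact sum_congr rfl fun i _ => Module.finrank_tensorProduct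

lemma finrank_map_delta (M : a ⟶ b) (i : Fin a.n) (j : Fin b.n) : finrank k ((matrixFunctor M).obj (delta k i) j) = KV.rank M i j
  := by
  simp [finrank_matrixFunctor_obj, finrank_delta]

lemma exists_matrixFunctor_iso (F : VectPow k a.n ⥤ VectPow k b.n) [F.Additive] [F.Linear k] : ∃ M : a ⟶ b, Nonempty
  (matrixFunctor M ≅ F) := by
  let M : KV.Hom a b := ⟨fun i j => F.obj (delta k i) j⟩
  refine ⟨M, (vectPowBasis k a.n).nonempty_iso fun i => VectPow.nonempty_iso fun j => ?_⟩
  exact finrank_map_delta (a := a) (b := b) M i j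

lemma mtmul_bijective (M : a ⟶ b) (i : Fin a.n) (j : Fin b.n) : Function.Bijective (mtmul (M := M) (v := delta k i) (j := j) i
  (deltaOne i)) := by
  have hs : Function.Surjective (mtmul (M := M) (v := delta k i) (j := j) i (deltaOne i)) := by
    rw [← LinearMap.range_eq_top]
    set p := LinearMap.range (mtmul (M := M) (v := delta k i) (j := j) i (deltaOne i))
    have : p.mkQ = 0 := mlinear_ext fun i' x m => by
      rw [LinearMap.zero_apply, Submodule.mkQ_apply, Submodule.Quotient.mk_eq_zero]
      by_cases h : i = i'
      · subst h
        have hx : x = (show PLift (i = i) → k from x) ⟨rfl⟩ • deltaOne i := delta_ext fun t => (mul_one _).symm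
        rw [hx, map_smul, LinearMap.smul_apply]
        exact p.smul_mem _ ⟨m, rfl⟩
      · have hx : x = 0 := delta_ext fun t => (h t.down).elim
        rw [hx, map_zero, LinearMap.zero_apply]
        exact p.zero_mem
    rw [← Submodule.ker_mkQ p, this, LinearMap.ker_zero]
  exact ⟨(LinearMap.injective_iff_surjective_of_finrank_eq_finrank (finrank_map_delta M i j).symm).2 hs, hs⟩

lemma inclPseudo_full (a b : KV k) : ((inclPseudo k).mapFunctor a b).Full where
  map_surjective {M N} θ := by
    let θ' : matrixFunctor M ⟶ matrixFunctor N := Hom₂.natTrans θ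
    let e (i j) := LinearEquiv.ofBijective _ (mtmul_bijective N i j)
    let η : KV.Hom₂ M N := ⟨fun i j => (e i j).symm.toLinearMap ∘ₗ (θ'.app (delta k i) j).hom.hom ∘ₗ mtmul (M := M) (v := delta k
      i) (j := j) i (deltaOne i)⟩
    have : matrixNatTrans (M := M) (N := N) η = θ' := (vectPowBasis k a.n).natTrans_ext fun i => vectPow_hom_ext fun j y => by
        obtain ⟨m, rfl⟩ := (mtmul_bijective M i j).2 y
        refine (natTrans_mtmul (M := M) (N := N) η (v := delta k i) i (deltaOne i) m).trans ?_
        exact (e i j).apply_symm_apply _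
    exact ⟨η, Hom₂.ext this⟩

lemma inclPseudo_faithful (a b : KV k) : ((inclPseudo k).mapFunctor a b).Faithful where
  map_injective {M N} η η' h := KV.hom₂_ext fun i j m => by
    have h' : matrixNatTrans η = matrixNatTrans η' := congrArg Hom₂.natTrans h
    refine (mtmul_bijective N i j).1 ?_
    rw [← natTrans_mtmul η, ← natTrans_mtmul η', h']
end MatrixFunctorFull
end AddCat

/-! ### Functors of two variables -/

section Bilin
variable {C : Type u₁} [Category.{v₁} C] [Preadditive C] [Linear k C] {D : Type u₂} [Category.{v₂} D] [Preadditive D] [Linear k D]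
  {E : Type u₃} [Category.{v₃} E] [Preadditive E] [Linear k E]

lemma additive_of_iso {F G : C ⥤ E} (e : F ≅ G) (hF : F.Additive) : G.Additive := Functor.additive_of_iso e

lemma linear_of_iso {F G : C ⥤ E} (e : F ≅ G) (hF : F.Linear k) : G.Linear k where
  map_smul {x y} f r := by
    have h (g : x ⟶ y) : G.map g = e.inv.app x ≫ F.map g ≫ e.hom.app y := by simp
    rw [h, h, F.map_smul, smul_comp, comp_smul]

lemma additive_of_sum {J : Type*} [Fintype J] {F : C ⥤ E} (G : J → C ⥤ E) (hG : ∀ j, (G j).Additive) (s : ∀ j, F ⟶ G j) (r : ∀ j,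
  G j ⟶ F) (h : ∀ x, ∑ j, (s j).app x ≫ (r j).app x = 𝟙 (F.obj x)) : F.Additive where
  map_add {x y f g} := by
    have e (f : x ⟶ y) : F.map f = ∑ j, (s j).app x ≫ (G j).map f ≫ (r j).app y := by
      rw [← id_comp (F.map f), ← h, sum_comp]
      simp
    rw [e, e f, e g, ← sum_add_distrib]
    simp [(hG _).map_add]

lemma linear_of_sum {J : Type*} [Fintype J] {F : C ⥤ E} (G : J → C ⥤ E) (hG : ∀ j, (G j).Linear k) (s : ∀ j, F ⟶ G j) (r : ∀ j, G
  j ⟶ F) (h : ∀ x, ∑ j, (s j).app x ≫ (r j).app x = 𝟙 (F.obj x)) : F.Linear k where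
  map_smul {x y} f c := by
    have e (f : x ⟶ y) : F.map f = ∑ j, (s j).app x ≫ (G j).map f ≫ (r j).app y := by
      rw [← id_comp (F.map f), ← h, sum_comp]
      simp
    rw [e, e f, smul_sum]
    simp [(hG _).map_smul]

/-- Linearity in each of two variables. -/
structure Bilin (k : Type u) [Field k] {C : Type u₁} [Category.{v₁} C] [Preadditive C] [Linear k C] {D : Type u₂} [Category.{v₂}
  D] [Preadditive D] [Linear k D] {E : Type u₃} [Category.{v₃} E] [Preadditive E] [Linear k E] (P : C ⥤ D ⥤ E) : Prop where
  additive : P.Additive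
  linear : P.Linear k
  obj_additive (c) : (P.obj c).Additive
  obj_linear (c) : (P.obj c).Linear k

namespace Bilin
variable {P Q : C ⥤ D ⥤ E}

lemma flip_additive (h : Bilin k P) (d : D) : (P.flip.obj d).Additive where
  map_add {x y f g} := congrArg (fun t => t.app d) (h.additive.map_add (f := f) (g := g))

lemma flip_linear (h : Bilin k P) (d : D) : (P.flip.obj d).Linear k where
  map_smul f r := congrArg (fun t => t.app d) (h.linear.map_smul f r)

lemma of_flip (h₁ : ∀ d, (P.flip.obj d).Additive) (h₂ : ∀ d, (P.flip.obj d).Linear k) (h₃ : ∀ c, (P.obj c).Additive) (h₄ : ∀ c,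
  (P.obj c).Linear k) : Bilin k P where
  additive := ⟨fun {x y f g} => by ext d; exact (h₁ d).map_add (f := f) (g := g)⟩
  linear := ⟨fun f r => by ext d; exact (h₂ d).map_smul f r⟩
  obj_additive := h₃
  obj_linear := h₄

lemma flip (h : Bilin k P) : Bilin k P.flip := of_flip h.obj_additive h.obj_linear h.flip_additive h.flip_linear

lemma of_iso (h : Bilin k P) (e : P ≅ Q) : Bilin k Q where
  additive := additive_of_iso e h.additive
  linear := linear_of_iso e h.linear
  obj_additive c := additive_of_iso (e.app c) (h.obj_additive c)
  obj_linear c := linear_of_iso (e.app c) (h.obj_linear c)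

variable {C' : Type*} [Category C'] [Preadditive C'] [Linear k C'] {D' : Type*} [Category D'] [Preadditive D'] [Linear k D'] {E' :
  Type*} [Category E'] [Preadditive E'] [Linear k E']

lemma postcomp (h : Bilin k P) (F : E ⥤ E') [F.Additive] [F.Linear k] : Bilin k (P ⋙ (whiskeringRight D E E').obj F) := by
  refine of_flip (fun d => ?_) (fun d => ?_) (fun c => ?_) (fun c => ?_)
  · have := h.flip_additive d
    exact inferInstanceAs (P.flip.obj d ⋙ F).Additive
  · have := h.flip_linear d
    exact inferInstanceAs ((P.flip.obj d ⋙ F).Linear k)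
  · have := h.obj_additive c
    exact inferInstanceAs (P.obj c ⋙ F).Additive
  · have := h.obj_linear c
    exact inferInstanceAs ((P.obj c ⋙ F).Linear k)

lemma precomp (h : Bilin k P) (F : C' ⥤ C) [F.Additive] [F.Linear k] (G : D' ⥤ D) [G.Additive] [G.Linear k] : Bilin k (F ⋙ P ⋙
  (whiskeringLeft D' D E).obj G) := by
  refine of_flip (fun d => ?_) (fun d => ?_) (fun c => ?_) (fun c => ?_)
  · have := h.flip_additive (G.obj d)
    exact inferInstanceAs (F ⋙ P.flip.obj (G.obj d)).Additive
  · have := h.flip_linear (G.obj d)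
    exact inferInstanceAs ((F ⋙ P.flip.obj (G.obj d)).Linear k)
  · have := h.obj_additive (F.obj c)
    exact inferInstanceAs (G ⋙ P.obj (F.obj c)).Additive
  · have := h.obj_linear (F.obj c)
    exact inferInstanceAs ((G ⋙ P.obj (F.obj c)).Linear k)

variable {A : Type*} [Category A] [Preadditive A] [Linear k A] {M : Type*} [Category M] [Preadditive M] [Linear k M]

lemma comp₁₂_additive {P : A ⥤ C ⥤ M} {Q : M ⥤ D ⥤ E} (hP : Bilin k P) (hQ : Bilin k Q) : (bifunctorComp₁₂ P Q).Additive ∧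
  (bifunctorComp₁₂ P Q).Linear k := by
  refine ⟨⟨fun {x y f g} => ?_⟩, ⟨fun {x y} f r => ?_⟩⟩
  · ext c d
    have := hP.flip_additive c
    have := hQ.flip_additive d
    exact (P.flip.obj c ⋙ Q.flip.obj d).map_add (f := f) (g := g)
  · ext c d
    have := hP.flip_linear c
    have := hQ.flip_linear d
    exact (inferInstance : (P.flip.obj c ⋙ Q.flip.obj d).Linear k).map_smul f r

lemma comp₁₂_obj {P : A ⥤ C ⥤ M} {Q : M ⥤ D ⥤ E} (hP : Bilin k P) (hQ : Bilin k Q) (a : A) : Bilin k ((bifunctorComp₁₂ P Q).obj a)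
  := by
  refine of_flip (fun d => ?_) (fun d => ?_) (fun c => ?_) (fun c => ?_)
  · have := hP.obj_additive a
    have := hQ.flip_additive d
    exact inferInstanceAs (P.obj a ⋙ Q.flip.obj d).Additive
  · have := hP.obj_linear a
    have := hQ.flip_linear d
    exact inferInstanceAs ((P.obj a ⋙ Q.flip.obj d).Linear k)
  · exact hQ.obj_additive _
  · exact hQ.obj_linear _

lemma comp₂₃_additive {P : A ⥤ M ⥤ E} {Q : C ⥤ D ⥤ M} (hP : Bilin k P) : (bifunctorComp₂₃ P Q).Additive ∧ (bifunctorComp₂₃ P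
  Q).Linear k := by
  refine ⟨⟨fun {x y f g} => ?_⟩, ⟨fun {x y} f r => ?_⟩⟩
  · ext c d
    exact (hP.flip_additive ((Q.obj c).obj d)).map_add (f := f) (g := g)
  · ext c d
    exact (hP.flip_linear ((Q.obj c).obj d)).map_smul f r

lemma comp₂₃_obj {P : A ⥤ M ⥤ E} {Q : C ⥤ D ⥤ M} (hP : Bilin k P) (hQ : Bilin k Q) (a : A) : Bilin k ((bifunctorComp₂₃ P Q).obj a)
  := by
  have := hP.obj_additive a
  have := hP.obj_linear a
  exact hQ.postcomp (P.obj a)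
end Bilin
end Bilin

section
lemma Regular.of_iso {X : Type u₁} [Category.{v₁} X] {Y : Type u₂} [Category.{v₂} Y] {F : X ⥤ Y} {G : Y ⥤ X} (e : F ⋙ G ≅ 𝟭 X) (h
  : Regular Y) : Regular X := fun x y f => by
  obtain ⟨g, hg⟩ := h (F.map f)
  have h₁ : f ≫ e.inv.app y = e.inv.app x ≫ G.map (F.map f) := e.inv.naturality f
  have h₂ : e.hom.app x ≫ f = G.map (F.map f) ≫ e.hom.app y := (e.hom.naturality f).symm
  refine ⟨e.inv.app y ≫ G.map g ≫ e.hom.app x, ?_⟩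
  rw [assoc, assoc, h₂, reassoc_of% h₁, ← G.map_comp_assoc, ← G.map_comp_assoc, assoc, hg, ← h₂]
  exact e.inv_hom_id_app_assoc x f

namespace SplitBasis
variable {X : Type u₁} [Category.{v₁} X] [Preadditive X] [Linear k X] {ι : Type} (B : SplitBasis k X ι) {Y : Type u₂}
  [Category.{v₂} Y] [Preadditive Y] [Linear k Y] {E : Type u₃} [Category.{v₃} E] [Preadditive E] [Linear k E]

include B in
lemma nonempty_iso₂ {κ : Type} (B' : SplitBasis k Y κ) {F G : X ⥤ Y ⥤ E} (hF : Bilin k F) (hG : Bilin k G) (h : ∀ i j, Nonempty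
  ((F.obj (B.S i)).obj (B'.S j) ≅ (G.obj (B.S i)).obj (B'.S j))) : Nonempty (F ≅ G) := by
  have := hF.additive
  have := hF.linear
  have := hG.additive
  have := hG.linear
  have := hF.obj_additive
  have := hF.obj_linear
  have := hG.obj_additive
  have := hG.obj_linear
  exact B.nonempty_iso fun i => B'.nonempty_iso fun j => h i j

include B in
lemma nonempty_iso₃ {κ κ' : Type} (B' : SplitBasis k Y κ) {Z : Type*} [Category Z] [Preadditive Z] [Linear k Z] (B'' : SplitBasis
  k Z κ') {F G : X ⥤ Y ⥤ Z ⥤ E} (hF : F.Additive ∧ F.Linear k) (hF' : ∀ x, Bilin k (F.obj x)) (hG : G.Additive ∧ G.Linear k) (hG'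
  : ∀ x, Bilin k (G.obj x)) (h : ∀ i j l, Nonempty (((F.obj (B.S i)).obj (B'.S j)).obj (B''.S l) ≅ ((G.obj (B.S i)).obj (B'.S
  j)).obj (B''.S l))) : Nonempty (F ≅ G) := by
  have := hF.1
  have := hF.2
  have := hG.1
  have := hG.2
  exact B.nonempty_iso fun i => B'.nonempty_iso₂ B'' (hF' _) (hG' _) (h i)

include B in
lemma exists_retract {F : X ⥤ E} [F.Additive] (x : X) : ∃ (J : Type) (_ : Fintype J) (idx : J → ι) (s : ∀ a, F.obj x ⟶ F.obj (B.S
  (idx a))) (r : ∀ a, F.obj (B.S (idx a)) ⟶ F.obj x), ∑ a, s a ≫ r a = 𝟙 _ := by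
  obtain ⟨J, _, _, idx, f, g, h, -, -⟩ := B.gen x
  refine ⟨J, inferInstance, idx, fun a => F.map (f a), fun a => F.map (g a), ?_⟩
  simp only [← F.map_comp]
  rw [← F.map_sum, h, F.map_id]

include B in
lemma exists_bifunctor [HasFiniteBiproducts E] (Z : ι → Y ⥤ E) (hZ : ∀ i, (Z i).Additive) (hZ' : ∀ i, (Z i).Linear k) : ∃ F : X ⥤
  Y ⥤ E, Bilin k F ∧ (∀ i, Nonempty (F.obj (B.S i) ≅ Z i)) ∧ ∀ x, ∃ (J : Type) (_ : Fintype J) (idx : J → ι) (s : ∀ a, F.obj x ⟶ Z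
  (idx a)) (r : ∀ a, Z (idx a) ⟶ F.obj x), ∑ a, s a ≫ r a = 𝟙 _ := by
  have : HasFiniteBiproducts (Y ⥤ E) := HasFiniteBiproducts.of_hasFiniteProducts
  obtain ⟨F, h₁, h₂, h₃⟩ := B.exists_functor (E := Y ⥤ E) Z
  have e i := (h₃ i).some
  have h (x : X) : ∃ (J : Type) (_ : Fintype J) (idx : J → ι) (s : ∀ a, F.obj x ⟶ Z (idx a)) (r : ∀ a, Z (idx a) ⟶ F.obj x), ∑ a,
    s a ≫ r a = 𝟙 _ := by
    obtain ⟨J, _, idx, s, r, h⟩ := B.exists_retract (F := F) x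
    exact ⟨J, inferInstance, idx, fun a => s a ≫ (e _).hom, fun a => (e _).inv ≫ r a, by simpa⟩
  have happ {x : X} {J : Type} [Fintype J] {idx : J → ι} {s : ∀ a, F.obj x ⟶ Z (idx a)} {r : ∀ a, Z (idx a) ⟶ F.obj x} (h : ∑ a, s
    a ≫ r a = 𝟙 _) (y : Y) : ∑ a, (s a).app y ≫ (r a).app y = 𝟙 _ := by
    have := congrArg (fun t => t.app y) h
    simpa using this
  refine ⟨F, ⟨h₁, h₂, fun x => ?_, fun x => ?_⟩, h₃, h⟩
  · obtain ⟨J, _, idx, s, r, h⟩ := h x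
    exact additive_of_sum (fun a => Z (idx a)) (fun a => hZ _) s r (happ h)
  · obtain ⟨J, _, idx, s, r, h⟩ := h x
    exact linear_of_sum (fun a => Z (idx a)) (fun a => hZ' _) s r (happ h)

def transport {F : X ⥤ Y} {G : Y ⥤ X} [F.Additive] [F.Linear k] (e : F ⋙ G ≅ 𝟭 X) (e' : G ⋙ F ≅ 𝟭 Y) (S : ι → Y) (i : ∀ j, F.obj
  (B.S j) ≅ S j) : SplitBasis k Y ι := by
  have hfull : F.FullyFaithful := (CategoryTheory.Equivalence.mk F G e.symm e').fullyFaithfulFunctor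
  have := hfull.full
  have := hfull.faithful
  have hmap {j l} (f : S j ⟶ S l) : ∃ g, f = (i j).inv ≫ F.map g ≫ (i l).hom := ⟨F.preimage ((i j).hom ≫ f ≫ (i l).inv), by simp⟩
  refine ⟨S, fun j f => ?_, fun {j l} h f => ?_, fun j h => ?_, fun y => ?_⟩
  · obtain ⟨g, rfl⟩ := hmap f
    obtain ⟨r, rfl⟩ := B.scalar j g
    exact ⟨r, by simp [F.map_smul]⟩
  · obtain ⟨g, rfl⟩ := hmap f
    rw [B.orth h g]
    simp
  · refine B.nonzero j (F.map_injective ?_)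
    have := congrArg (fun t => (i j).hom ≫ t ≫ (i j).inv) h
    simpa using this
  · obtain ⟨J, _, _, idx, f, g, h₁, h₂, h₃⟩ := B.gen (G.obj y)
    refine ⟨J, inferInstance, inferInstance, idx, fun a => e'.inv.app y ≫ F.map (f a) ≫ (i _).hom, fun a => (i _).inv ≫ F.map (g
      a) ≫ e'.hom.app y, ?_, fun a => ?_, fun a b h => ?_⟩
    · have := congrArg F.map h₁
      simp only [F.map_sum, F.map_comp, F.map_id] at this
      simp only [assoc, Iso.hom_inv_id_assoc]
      rw [← comp_sum]
      simp only [← assoc]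
      rw [← sum_comp, this]
      simp
    · simp only [assoc]
      have hh := e'.hom_inv_id_app_assoc y (F.map (f a) ≫ (i _).hom)
      refine (congrArg (fun t => (i _).inv ≫ F.map (g a) ≫ t) hh).trans ?_
      rw [← F.map_comp_assoc, h₂]
      simp
    · simp only [assoc]
      have hh := e'.hom_inv_id_app_assoc y (F.map (f b) ≫ (i _).hom)
      refine (congrArg (fun t => (i _).inv ≫ F.map (g a) ≫ t) hh).trans ?_
      rw [← F.map_comp_assoc, h₃ a b h]
      simp

lemma exists_equivalence (B' : SplitBasis k Y ι) [HasFiniteBiproducts X] [HasFiniteBiproducts Y] : ∃ (F : X ⥤ Y) (G : Y ⥤ X),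
  F.Additive ∧ F.Linear k ∧ G.Additive ∧ G.Linear k ∧ Nonempty (F ⋙ G ≅ 𝟭 X) ∧ Nonempty (G ⋙ F ≅ 𝟭 Y) ∧ (∀ i, Nonempty (F.obj (B.S
  i) ≅ B'.S i)) ∧ ∀ i, Nonempty (G.obj (B'.S i) ≅ B.S i) := by
  obtain ⟨F, h₁, h₂, h₃⟩ := B.exists_functor B'.S
  obtain ⟨G, h₁', h₂', h₃'⟩ := B'.exists_functor B.S
  refine ⟨F, G, h₁, h₂, h₁', h₂', B.nonempty_iso fun i => ?_, B'.nonempty_iso fun i => ?_, h₃, h₃'⟩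
  · exact ⟨G.mapIso (h₃ i).some ≪≫ (h₃' i).some⟩
  · exact ⟨F.mapIso (h₃' i).some ≪≫ (h₃ i).some⟩

lemma regular {n : ℕ} (B : SplitBasis k X (Fin n)) [HasFiniteBiproducts X] : Regular X := by
  obtain ⟨F, G, _, _, _, _, ⟨e⟩, -⟩ := B.exists_equivalence (vectPowBasis k n)
  exact Regular.of_iso e (VectPow.regular n)

lemma finite_hom {n : ℕ} (B : SplitBasis k X (Fin n)) [HasFiniteBiproducts X] (x y : X) : Module.Finite k (x ⟶ y) := by
  obtain ⟨F, G, _, _, _, _, ⟨e⟩, -⟩ := B.exists_equivalence (vectPowBasis k n)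
  have : Module.Finite k (F.obj x ⟶ F.obj y) := Module.Finite.of_injective (LinearMap.pi fun i => (
      { toFun f := (f i).hom.hom
        map_add' _ _ := rfl
        map_smul' _ _ := rfl } : (F.obj x ⟶ F.obj y) →ₗ[k] ((F.obj x) i →ₗ[k] (F.obj y) i))) 
      fun f g h => AddCat.vectPow_hom_ext fun i => LinearMap.congr_fun (congrFun h i)
  refine Module.Finite.of_surjective ( (leftComp k _ (e.inv.app x)) ∘ₗ (rightComp k _ (e.hom.app y)) ∘ₗ G.mapLinearMap k : (F.obj
    x ⟶ F.obj y) →ₗ[k] (x ⟶ y)) fun f => ⟨F.map f, ?_⟩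
  have := e.hom.naturality f
  simp only [Functor.comp_map, Functor.id_map] at this
  simp [this]
end SplitBasis
end

namespace AddCat
/-! ### Tensor products of linear categories with a universal property -/

section Setup
/-- A class of categories `obj` and a class of functors `K` between them for which the pairings
`tens` have the universal property of tensor products. -/
structure TensorSetup (S : SubBicat (AddCat k)) (tens : ∀ C D : AddCat k, Pairing C D) where
  obj : AddCat k → Prop
  K : ∀ {C D : AddCat k}, (C ⥤ D) → Prop
  hom_iff {C D : AddCat k} (F : C ⟶ D) : S.hom F ↔ K F.functor
  obj_of {C : AddCat k} : S.obj C → obj C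
  obj_vectPow (n : ℕ) : S.obj ⟨VectPow k n⟩
  obj_vect : obj (vect k)
  idem {C : AddCat k} : obj C → IsIdempotentComplete C
  K_iso {C D : AddCat k} {F G : C ⥤ D} : (F ≅ G) → K F → K G
  K_id (C : AddCat k) : K (𝟭 C)
  K_comp {C D E : AddCat k} {F : C ⥤ D} {G : D ⥤ E} : K F → K G → K (F ⋙ G)
  K_sum {C D : AddCat k} (hC : obj C) {F : C ⥤ D} {J : Type} [Fintype J] (G : J → C ⥤ D) (hF : F.Additive) (hG : ∀ j, (G
    j).Additive) (hK : ∀ j, K (G j)) (s : ∀ j, F ⟶ G j) (r : ∀ j, G j ⟶ F) (h : ∑ j, s j ≫ r j = 𝟙 F) : K F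
  K_regular {C D : AddCat k} (hC : obj C) (h : Regular C) (F : C ⥤ D) (hF : F.Additive) : K F
  target {C D : AddCat k} : obj C → obj D → obj (tens C D).target
  bilin {C D : AddCat k} : obj C → obj D → Bilin k (tens C D).pair
  pair_right {C D : AddCat k} : obj C → obj D → ∀ c, K ((tens C D).pair.obj c)
  pair_left {C D : AddCat k} : obj C → obj D → ∀ d, K ((tens C D).pair.flip.obj d)
  exists_lift {C D E : AddCat k} : obj C → obj D → obj E → ∀ P : C ⥤ D ⥤ E, Bilin k P → (∀ c, K (P.obj c)) → (∀ d, K (P.flip.obj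
    d)) → ∃ H : (tens C D).target ⟶ E, K H.functor ∧ Nonempty ((tens C D).after H ≅ P)
  bijective {C D E : AddCat k} : obj C → obj D → obj E → ∀ H H' : (tens C D).target ⟶ E, K H.functor → K H'.functor →
    Function.Bijective fun η : H.functor ⟶ H'.functor => (Functor.whiskerLeft (tens C D).pair ((whiskeringRight D (tens C
    D).target E).map η) : (tens C D).after H ⟶ (tens C D).after H')
  param {A C D E : AddCat k} : obj A → obj C → obj D → obj E → ∀ L : A ⥤ (tens C D).target ⥤ E, Bilin k L → (∀ a, K (L.obj a)) →
    (∀ c d, K (L.flip.obj (((tens C D).pair.obj c).obj d))) → ∀ t, K (L.flip.obj t)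
  coev_gen {X Y : AddCat k} : obj X → obj Y → ∀ (c : vect k ⟶ (tens Y X).target) (g : (tens Y X).target ⟶ vect k), K c.functor → K
    g.functor → Nonempty (Bicategory.Adjunction c g) → ∃ (J : Type) (_ : Fintype J) (y : J → Y) (x : J → X) (s : ∀ j,
    c.functor.obj (vectOne k) ⟶ ((tens Y X).pair.obj (y j)).obj (x j)) (r : ∀ j, ((tens Y X).pair.obj (y j)).obj (x j) ⟶
    c.functor.obj (vectOne k)), ∑ j, s j ≫ r j = 𝟙 _

namespace TensorSetup
variable {S : SubBicat (AddCat k)} {tens : ∀ C D : AddCat k, Pairing C D} (M : TensorSetup S tens) {A A' B B' C D E X Y : AddCat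
  k}

include M in
lemma iso_of_after (hC : M.obj C) (hD : M.obj D) (hE : M.obj E) {H H' : (tens C D).target ⟶ E} (hH : M.K H.functor) (hH' : M.K
  H'.functor) (e : (tens C D).after H ≅ (tens C D).after H') : Nonempty (H ≅ H') := by
  obtain ⟨η, hη⟩ := (M.bijective hC hD hE H H' hH hH').2 e.hom
  obtain ⟨θ, hθ⟩ := (M.bijective hC hD hE H' H hH' hH).2 e.inv
  refine ⟨isoMk ⟨η, θ, (M.bijective hC hD hE H H hH hH).1 ?_, (M.bijective hC hD hE H' H' hH' hH').1 ?_⟩⟩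
  · dsimp only at hη hθ ⊢
    rw [Functor.map_comp, Functor.whiskerLeft_comp, hη, hθ]
    exact (e.hom_inv_id).trans (by rw [CategoryTheory.Functor.map_id]; rfl)
  · dsimp only at hη hθ ⊢
    rw [Functor.map_comp, Functor.whiskerLeft_comp, hη, hθ]
    exact (e.inv_hom_id).trans (by rw [CategoryTheory.Functor.map_id]; rfl)

include M in
lemma bilin_after (hC : M.obj C) (hD : M.obj D) (H : (tens C D).target ⟶ E) : Bilin k ((tens C D).after H) := (M.bilin hC
  hD).postcomp H.functor

/-! #### The structure morphisms -/

lemma tensorHom_spec (hA : M.obj A) (hA' : M.obj A') (hB : M.obj B) (hB' : M.obj B') {F : A ⟶ A'} {G : B ⟶ B'} (hF : M.K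
  F.functor) (hG : M.K G.functor) : M.K ((tensorDataOf S tens).tensorHom F G).functor ∧ Nonempty ((tens A B).after ((tensorDataOf
  S tens).tensorHom F G) ≅ F.functor ⋙ (tens A' B').pair ⋙ (whiskeringLeft B B' _).obj G.functor) := by
  obtain ⟨H, hH, e⟩ := M.exists_lift hA hB (M.target hA' hB') (F.functor ⋙ (tens A' B').pair ⋙ (whiskeringLeft B B' _).obj
    G.functor) ((M.bilin hA' hB').precomp F.functor G.functor) (fun c => M.K_comp hG (M.pair_right hA' hB' _)) (fun d => M.K_comp
    hF (M.pair_left hA' hB' _))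
  have := Classical.epsilon_spec (p := fun H => S.hom H ∧ Nonempty ((tens A B).after H ≅ F.functor ⋙ (tens A' B').pair ⋙
    (whiskeringLeft B B' _).obj G.functor)) ⟨H, (M.hom_iff H).2 hH, e⟩
  exact ⟨(M.hom_iff _).1 this.1, this.2⟩

lemma braiding_spec (hA : M.obj A) (hB : M.obj B) : M.K ((tensorDataOf S tens).braiding A B).functor ∧ Nonempty ((tens A B).after
  ((tensorDataOf S tens).braiding A B) ≅ (tens B A).pair.flip) := by
  obtain ⟨H, hH, e⟩ := M.exists_lift hA hB (M.target hB hA) (tens B A).pair.flip (M.bilin hB hA).flip (M.pair_left hB hA)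
    (M.pair_right hB hA)
  have := Classical.epsilon_spec (p := fun H => S.hom H ∧ Nonempty ((tens A B).after H ≅ (tens B A).pair.flip)) ⟨H, (M.hom_iff
    H).2 hH, e⟩
  exact ⟨(M.hom_iff _).1 this.1, this.2⟩

lemma regular_vect : Regular (vect k) := regular_fgModuleCat

lemma exists_copower (hA : M.obj A) : ∃ F : vect k ⥤ A ⥤ A, Bilin k F ∧ Nonempty (F.obj (vectOne k) ≅ 𝟭 A) ∧ (∀ v, M.K (F.obj v))
  ∧ ∀ a, M.K (F.flip.obj a) := by
  obtain ⟨F, h₁, h₂, h₃⟩ := (vectBasis k).exists_bifunctor (fun _ => 𝟭 A) (fun _ => inferInstance) (fun _ => inferInstance)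
  refine ⟨F, h₁, h₂ (), fun v => ?_, fun a => M.K_regular M.obj_vect regular_vect _ (h₁.flip_additive a)⟩
  obtain ⟨J, _, idx, s, r, h⟩ := h₃ v
  exact M.K_sum hA (fun _ => 𝟭 A) (h₁.obj_additive v) (fun _ => inferInstance) (fun _ => M.K_id A) s r h

lemma leftUnitor_spec (hA : M.obj A) : M.K ((tensorDataOf S tens).leftUnitor A).functor ∧ Nonempty (((tens (vect k) A).after
  ((tensorDataOf S tens).leftUnitor A)).obj (vectOne k) ≅ 𝟭 A) := by
  obtain ⟨F, h₁, ⟨e₂⟩, h₃, h₄⟩ := M.exists_copower hA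
  obtain ⟨H, hH, ⟨e⟩⟩ := M.exists_lift M.obj_vect hA hA F h₁ h₃ h₄
  have := Classical.epsilon_spec (p := fun H => S.hom H ∧ Nonempty (((tens (vect k) A).after H).obj (vectOne k) ≅ 𝟭 A)) ⟨H,
    (M.hom_iff H).2 hH, ⟨e.app _ ≪≫ e₂⟩⟩
  exact ⟨(M.hom_iff _).1 this.1, this.2⟩

lemma rightUnitor_spec (hA : M.obj A) : M.K ((tensorDataOf S tens).rightUnitor A).functor ∧ Nonempty (((tens A (vect k)).after
  ((tensorDataOf S tens).rightUnitor A)).flip.obj (vectOne k) ≅ 𝟭 A) := by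
  obtain ⟨F, h₁, ⟨e₂⟩, h₃, h₄⟩ := M.exists_copower hA
  obtain ⟨H, hH, ⟨e⟩⟩ := M.exists_lift hA M.obj_vect hA F.flip h₁.flip h₄ h₃
  have := Classical.epsilon_spec (p := fun H => S.hom H ∧ Nonempty (((tens A (vect k)).after H).flip.obj (vectOne k) ≅ 𝟭 A)) ⟨H,
    (M.hom_iff H).2 hH, ⟨((flipFunctor _ _ _).mapIso e).app _ ≪≫ e₂⟩⟩
  exact ⟨(M.hom_iff _).1 this.1, this.2⟩

abbrev restr (T : Pairing C D) (E : AddCat k) : (T.target ⥤ E) ⥤ (C ⥤ D ⥤ E) := whiskeringRight D T.target E ⋙ (whiskeringLeft C _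
  _).obj T.pair

lemma exists_lift₂₃ (hA : M.obj A) (hC : M.obj C) (hD : M.obj D) (hE : M.obj E) (Q : A ⥤ C ⥤ D ⥤ E) (hQ : Q.Additive ∧ Q.Linear k)
  (hQ' : ∀ a, Bilin k (Q.obj a)) (h₁ : ∀ a c, M.K ((Q.obj a).obj c)) (h₂ : ∀ a d, M.K ((Q.obj a).flip.obj d)) (h₃ : ∀ c d, M.K
  ((Q.flip.obj c).flip.obj d)) : ∃ H : (tens A (tens C D).target).target ⟶ E, M.K H.functor ∧ Nonempty (bifunctorComp₂₃ ((tens A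
  (tens C D).target).after H) (tens C D).pair ≅ Q) := by
  let P : ObjectProperty ((tens C D).target ⥤ E) := fun F => F.Additive ∧ F.Linear k ∧ M.K F
  let R : P.FullSubcategory ⥤ (C ⥤ D ⥤ E) := P.ι ⋙ restr (tens C D) E
  have hbij (F G : P.FullSubcategory) : Function.Bijective (R.map : (F ⟶ G) → _) := by
    have h := M.bijective hC hD hE (@Hom.mk _ _ _ _ F.obj F.property.1 F.property.2.1) (@Hom.mk _ _ _ _ G.obj G.property.1
      G.property.2.1) F.property.2.2 G.property.2.2
    exact h.comp (P.fullyFaithfulι.map_bijective _ _)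
  have : R.Faithful := ⟨fun h => (hbij _ _).1 h⟩
  have : R.Full := ⟨fun f => (hbij _ _).2 f⟩
  have hess (a : A) : R.essImage (Q.obj a) := by
    obtain ⟨H, hH, ⟨e⟩⟩ := M.exists_lift hC hD hE (Q.obj a) (hQ' a) (h₁ a) (h₂ a)
    exact ⟨⟨H.functor, H.additive, H.linear, hH⟩, ⟨e⟩⟩
  let L := Functor.essImage.liftFunctor Q R hess ⋙ P.ι
  let e : L ⋙ restr (tens C D) E ≅ Q := Functor.essImage.liftFunctorCompIso Q R hess
  have hadd : (L ⋙ restr (tens C D) E).Additive := additive_of_iso e.symm hQ.1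
  have hlin : (L ⋙ restr (tens C D) E).Linear k := linear_of_iso e.symm hQ.2
  have hfaith {a a' : A} {η θ : L.obj a ⟶ L.obj a'} (h : (restr (tens C D) E).map η = (restr (tens C D) E).map θ) : η = θ := by
    have h' := (hbij (Functor.essImage.liftFunctor Q R hess |>.obj a) (Functor.essImage.liftFunctor Q R hess |>.obj a')).1 h
    exact congrArg (fun t => t.hom) h'
  have hL : Bilin k L := by
    refine ⟨⟨fun {x y f g} => hfaith ?_⟩, ⟨fun {x y} f r => hfaith ?_⟩, fun a => (Functor.essImage.liftFunctor Q R hess |>.obj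
      a).property.1, fun a => (Functor.essImage.liftFunctor Q R hess |>.obj a).property.2.1⟩
    · exact hadd.map_add
    · exact hlin.map_smul f r
  have hK (a : A) : M.K (L.obj a) := (Functor.essImage.liftFunctor Q R hess |>.obj a).property.2.2
  have hK' := M.param hA hC hD hE L hL hK fun c d => M.K_iso (show (Q.flip.obj c).flip.obj d ≅ L.flip.obj (((tens C D).pair.obj
    c).obj d) from NatIso.ofComponents (fun a => ((e.symm.app a).app c).app d) (fun {a a'} f => by
        have := e.inv.naturality f
        exact congrArg (fun t => (t.app c).app d) this)) (h₃ c d)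
  obtain ⟨H, hH, ⟨e'⟩⟩ := M.exists_lift hA (M.target hC hD) hE L hL hK hK'
  exact ⟨H, hH, ⟨(show bifunctorComp₂₃ ((tens A (tens C D).target).after H) (tens C D).pair ≅ L ⋙ restr (tens C D) E from
    NatIso.ofComponents (fun a => NatIso.ofComponents (fun c => NatIso.ofComponents (fun d => (e'.app a).app _) (fun {d d'} g =>
    ((e'.app a).hom.naturality _))) (fun {c c'} g => by ext d; exact ((e'.app a).hom.naturality _))) (fun {a a'} f => by
          ext c d
          exact congrArg (fun t => t.app (((tens C D).pair.obj c).obj d)) (e'.hom.naturality f))) ≪≫ e⟩⟩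

lemma assocInv_spec (hA : M.obj A) (hB : M.obj B) (hC : M.obj C) : M.K ((tensorDataOf S tens).assocInv A B C).functor ∧ Nonempty
  (bifunctorComp₂₃ ((tens A (tens B C).target).after ((tensorDataOf S tens).assocInv A B C)) (tens B C).pair ≅ bifunctorComp₁₂
  (tens A B).pair (tens (tens A B).target C).pair) := by
  have hAB := M.target hA hB
  obtain ⟨H, hH, e⟩ := M.exists_lift₂₃ hA hB hC (M.target hAB hC) (bifunctorComp₁₂ (tens A B).pair (tens (tens A B).target
    C).pair) (Bilin.comp₁₂_additive (M.bilin hA hB) (M.bilin hAB hC)) (Bilin.comp₁₂_obj (M.bilin hA hB) (M.bilin hAB hC)) (fun a c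
    => M.pair_right hAB hC _) (fun a d => M.K_comp (M.pair_right hA hB a) (M.pair_left hAB hC d)) (fun c d => M.K_comp
    (M.pair_left hA hB c) (M.pair_left hAB hC d))
  have := Classical.epsilon_spec (p := fun H => S.hom H ∧ Nonempty (bifunctorComp₂₃ ((tens A (tens B C).target).after H) (tens B
    C).pair ≅ bifunctorComp₁₂ (tens A B).pair (tens (tens A B).target C).pair)) ⟨H, (M.hom_iff H).2 hH, e⟩
  exact ⟨(M.hom_iff _).1 this.1, this.2⟩
end TensorSetup
end Setup

/-! ### Tensor products of semisimple linear categories -/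

section Split
abbrev Pairing.pr {C D : AddCat k} (T : Pairing C D) (c : C) (d : D) : T.target := (T.pair.obj c).obj d

def Pairing.prIso {C D : AddCat k} (T : Pairing C D) {c c' : C} {d d' : D} (e : c ≅ c') (e' : d ≅ d') : T.pr c d ≅ T.pr c' d' :=
  (T.pair.mapIso e).app d ≪≫ (T.pair.obj c').mapIso e'

def isoFunctor {X Y : AddCat k} {F G : X ⟶ Y} (e : F ≅ G) : F.functor ≅ G.functor where
  hom := e.hom.natTrans
  inv := e.inv.natTrans
  hom_inv_id := congrArg Hom₂.natTrans e.hom_inv_id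
  inv_hom_id := congrArg Hom₂.natTrans e.inv_hom_id

lemma hom_iso_of_basis {X E : AddCat k} {ι : Type} (B : SplitBasis k X ι) {F G : X ⟶ E} (h : ∀ i, Nonempty (F.functor.obj (B.S i)
  ≅ G.functor.obj (B.S i))) : Nonempty (F ≅ G) := by
  obtain ⟨e⟩ := B.nonempty_iso (F := F.functor) (G := G.functor) h
  exact ⟨isoMk e⟩

lemma exists_equivalence_of_basis {X Y : AddCat k} {ι : Type} (B : SplitBasis k X ι) (B' : SplitBasis k Y ι) : ∃ e :
  Bicategory.Equivalence X Y, ∀ i, Nonempty (e.hom.functor.obj (B.S i) ≅ B'.S i) := by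
  obtain ⟨F, G, h₁, h₂, h₃, h₄, ⟨e⟩, ⟨e'⟩, h, h'⟩ := B.exists_equivalence B'
  let f : X ⟶ Y := @Hom.mk _ _ X Y F h₁ h₂
  let g : Y ⟶ X := @Hom.mk _ _ Y X G h₃ h₄
  obtain ⟨i, hi, -⟩ := Ho.exists_equivalence f g (Ho.cls_eq (f := f ≫ g) (g := 𝟙 X) (isoMk e)) (Ho.cls_eq (f := g ≫ f) (g := 𝟙 Y)
    (isoMk e'))
  exact ⟨i, fun j => by rw [hi]; exact h j⟩

namespace TensorSetup
variable {S : SubBicat (AddCat k)} {tens : ∀ C D : AddCat k, Pairing C D} (M : TensorSetup S tens) {A A' A'' B B' B'' C D E X Y :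
  AddCat k} {l m n : ℕ}

/-- The categories with a basis of simple objects. -/
def split : SubBicat (AddCat k) where
  obj x := M.obj x ∧ ∃ n, Nonempty (SplitBasis k x (Fin n))
  hom F := M.K F.functor
  id_mem _ := M.K_id _
  comp_mem hF hG := M.K_comp hF hG

lemma K_of_basis (hX : M.obj X) (B : SplitBasis k X (Fin n)) (F : X ⟶ Y) : M.K F.functor := M.K_regular hX B.regular F.functor
  inferInstance

lemma obj_pow (n : ℕ) : M.obj ⟨VectPow k n⟩ := M.obj_of (M.obj_vectPow n)

include M in
lemma exists_tensorBasis (hX : M.obj X) (hY : M.obj Y) (BX : SplitBasis k X (Fin m)) (BY : SplitBasis k Y (Fin n)) : ∃ B :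
  SplitBasis k (tens X Y).target (Fin (m * n)), ∀ p, B.S p = (tens X Y).pr (BX.S (finProdFinEquiv.symm p).1) (BY.S
  (finProdFinEquiv.symm p).2) := by
  let V : AddCat k := ⟨VectPow k (m * n)⟩
  have hV : M.obj V := M.obj_pow (m * n)
  choose Z hZ hZ' hZ'' using fun i => BY.exists_functor fun j => (delta k (finProdFinEquiv (i, j)) : VectPow k (m * n))
  obtain ⟨P, hP, hPZ, -⟩ := BX.exists_bifunctor (E := VectPow k (m * n)) Z hZ hZ'
  obtain ⟨F, hF, ⟨eF⟩⟩ := M.exists_lift hX hY hV P hP (fun c => M.K_regular hY BY.regular _ (hP.obj_additive c)) (fun d =>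
    M.K_regular hX BX.regular _ (hP.flip_additive d))
  obtain ⟨G, hG, hG', hGS⟩ := (vectPowBasis k (m * n)).exists_functor fun p => (tens X Y).pr (BX.S (finProdFinEquiv.symm p).1)
    (BY.S (finProdFinEquiv.symm p).2)
  let G' : V ⟶ (tens X Y).target := @Hom.mk _ _ V (tens X Y).target G hG hG'
  have hGK : M.K G'.functor := M.K_of_basis hV (vectPowBasis k (m * n)) G'
  have iF (i j) : Nonempty (F.functor.obj ((tens X Y).pr (BX.S i) (BY.S j)) ≅ (delta k (finProdFinEquiv (i, j)) : VectPow k (m *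
    n))) := ⟨(eF.app _).app _ ≪≫ (hPZ i).some.app _ ≪≫ (hZ'' i j).some⟩
  have iG (i j) : Nonempty (G.obj (delta k (finProdFinEquiv (i, j)) : VectPow k (m * n)) ≅ (tens X Y).pr (BX.S i) (BY.S j)) := by
    have := hGS (finProdFinEquiv (i, j))
    rw [Equiv.symm_apply_apply] at this
    exact this
  obtain ⟨e₁⟩ := BX.nonempty_iso₂ BY (M.bilin_after hX hY (F ≫ G')) (M.bilin_after hX hY (𝟙 (tens X Y).target)) fun i j => by
    obtain ⟨e⟩ := iF i j
    obtain ⟨e'⟩ := iG i j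
    exact ⟨G.mapIso e ≪≫ e'⟩
  obtain ⟨e₂⟩ := M.iso_of_after hX hY (M.target hX hY) (M.K_comp hF hGK) (M.K_id _) e₁
  obtain ⟨e₃⟩ := hom_iso_of_basis (X := V) (E := V) (F := G' ≫ F) (G := 𝟙 V) (vectPowBasis k (m * n)) fun p => by
      obtain ⟨⟨i, j⟩, rfl⟩ := finProdFinEquiv.surjective p
      obtain ⟨e⟩ := iF i j
      obtain ⟨e'⟩ := iG i j
      exact ⟨F.functor.mapIso e' ≪≫ e⟩
  exact ⟨(vectPowBasis k (m * n)).transport (isoFunctor e₃) (isoFunctor e₂) (fun p => (tens X Y).pr (BX.S (finProdFinEquiv.symm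
    p).1) (BY.S (finProdFinEquiv.symm p).2)) fun p => (hGS p).some, fun _ => rfl⟩

def tensorBasis (hX : M.obj X) (hY : M.obj Y) (BX : SplitBasis k X (Fin m)) (BY : SplitBasis k Y (Fin n)) : SplitBasis k (tens X
  Y).target (Fin (m * n)) := (M.exists_tensorBasis hX hY BX BY).choose

lemma tensorBasis_S (hX : M.obj X) (hY : M.obj Y) (BX : SplitBasis k X (Fin m)) (BY : SplitBasis k Y (Fin n)) (i j) :
  (M.tensorBasis hX hY BX BY).S (finProdFinEquiv (i, j)) = (tens X Y).pr (BX.S i) (BY.S j) := by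
  refine ((M.exists_tensorBasis hX hY BX BY).choose_spec _).trans ?_
  rw [Equiv.symm_apply_apply]

include M in
lemma iso_of_basis₂ (hX : M.obj X) (hY : M.obj Y) (BX : SplitBasis k X (Fin m)) (BY : SplitBasis k Y (Fin n)) {F G : (tens X
  Y).target ⟶ E} (h : ∀ i j, Nonempty (F.functor.obj ((tens X Y).pr (BX.S i) (BY.S j)) ≅ G.functor.obj ((tens X Y).pr (BX.S i)
  (BY.S j)))) : Nonempty (F ≅ G) := hom_iso_of_basis (M.tensorBasis hX hY BX BY) fun p => by
    obtain ⟨⟨i, j⟩, rfl⟩ := finProdFinEquiv.surjective p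
    rw [M.tensorBasis_S]
    exact h i j

/-! #### The structure morphisms on objects -/

lemma tensorHom_obj (hA : M.obj A) (hA' : M.obj A') (hB : M.obj B) (hB' : M.obj B') {F : A ⟶ A'} {G : B ⟶ B'} (hF : M.K F.functor)
  (hG : M.K G.functor) (a : A) (b : B) : Nonempty (((tensorDataOf S tens).tensorHom F G).functor.obj ((tens A B).pr a b) ≅ (tens
  A' B').pr (F.functor.obj a) (G.functor.obj b)) := by
  obtain ⟨-, ⟨e⟩⟩ := M.tensorHom_spec hA hA' hB hB' hF hG
  exact ⟨(e.app a).app b⟩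

lemma assocInv_obj (hA : M.obj A) (hB : M.obj B) (hC : M.obj C) (a : A) (b : B) (c : C) : Nonempty (((tensorDataOf S
  tens).assocInv A B C).functor.obj ((tens A (tens B C).target).pr a ((tens B C).pr b c)) ≅ (tens (tens A B).target C).pr ((tens A
  B).pr a b) c) := by
  obtain ⟨-, ⟨e⟩⟩ := M.assocInv_spec hA hB hC
  exact ⟨((e.app a).app b).app c⟩

lemma leftUnitor_obj (hA : M.obj A) (a : A) : Nonempty (((tensorDataOf S tens).leftUnitor A).functor.obj ((tens (vect k) A).pr
  (vectOne k) a) ≅ a) := by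
  obtain ⟨-, ⟨e⟩⟩ := M.leftUnitor_spec hA
  exact ⟨e.app a⟩

lemma rightUnitor_obj (hA : M.obj A) (a : A) : Nonempty (((tensorDataOf S tens).rightUnitor A).functor.obj ((tens A (vect k)).pr a
  (vectOne k)) ≅ a) := by
  obtain ⟨-, ⟨e⟩⟩ := M.rightUnitor_spec hA
  exact ⟨e.app a⟩

lemma braiding_obj (hA : M.obj A) (hB : M.obj B) (a : A) (b : B) : Nonempty (((tensorDataOf S tens).braiding A B).functor.obj
  ((tens A B).pr a b) ≅ (tens B A).pr b a) := by
  obtain ⟨-, ⟨e⟩⟩ := M.braiding_spec hA hB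
  exact ⟨(e.app a).app b⟩

lemma assoc_obj (hA : M.obj A) (hB : M.obj B) (hC : M.obj C) (BA : SplitBasis k A (Fin l)) (BB : SplitBasis k B (Fin m)) (BC :
  SplitBasis k C (Fin n)) (i j p) : Nonempty (((tensorDataOf S tens).assoc A B C).functor.obj ((tens (tens A B).target C).pr
  ((tens A B).pr (BA.S i) (BB.S j)) (BC.S p)) ≅ (tens A (tens B C).target).pr (BA.S i) ((tens B C).pr (BB.S j) (BC.S p))) := by
  have hAB := M.target hA hB
  have hBC := M.target hB hC
  let R := M.tensorBasis hAB hC (M.tensorBasis hA hB BA BB) BC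
  have hR (i j p) : R.S (finProdFinEquiv (finProdFinEquiv (i, j), p)) = (tens (tens A B).target C).pr ((tens A B).pr (BA.S i)
    (BB.S j)) (BC.S p) := by
    rw [M.tensorBasis_S, M.tensorBasis_S]
  obtain ⟨H, h₁, h₂, h₃⟩ := R.exists_functor fun q => (tens A (tens B C).target).pr (BA.S (finProdFinEquiv.symm
    (finProdFinEquiv.symm q).1).1) ((tens B C).pr (BB.S (finProdFinEquiv.symm (finProdFinEquiv.symm q).1).2) (BC.S
    (finProdFinEquiv.symm q).2))
  let H' : (tens (tens A B).target C).target ⟶ (tens A (tens B C).target).target := @Hom.mk _ _ (tens (tens A B).target C).target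
    (tens A (tens B C).target).target H h₁ h₂
  have h₄ (i j p) : Nonempty (H.obj ((tens (tens A B).target C).pr ((tens A B).pr (BA.S i) (BB.S j)) (BC.S p)) ≅ (tens A (tens B
    C).target).pr (BA.S i) ((tens B C).pr (BB.S j) (BC.S p))) := by
    have := h₃ (finProdFinEquiv (finProdFinEquiv (i, j), p))
    rw [hR] at this
    simpa only [Equiv.symm_apply_apply] using this
  have e : Nonempty (bifunctorComp₁₂ (tens A B).pair ((tens (tens A B).target C).after H') ≅ bifunctorComp₂₃ (tens A (tens B
    C).target).pair (tens B C).pair) := by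
    refine BA.nonempty_iso₃ BB BC (Bilin.comp₁₂_additive (M.bilin hA hB) (M.bilin_after hAB hC H')) (Bilin.comp₁₂_obj (M.bilin hA
      hB) (M.bilin_after hAB hC H')) (Bilin.comp₂₃_additive (M.bilin hA hBC)) (Bilin.comp₂₃_obj (M.bilin hA hBC) (M.bilin hB hC))
      h₄
  have := Classical.epsilon_spec (p := fun H => S.hom H ∧ Nonempty (bifunctorComp₁₂ (tens A B).pair ((tens (tens A B).target
    C).after H) ≅ bifunctorComp₂₃ (tens A (tens B C).target).pair (tens B C).pair)) ⟨H', (M.hom_iff H').2 (M.K_of_basis (M.target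
    hAB hC) R H'), e⟩
  obtain ⟨-, ⟨e⟩⟩ := this
  exact ⟨((e.app _).app _).app _⟩

lemma isFunctorial : (tensorDataOf S tens).IsFunctorial M.split where
  obj_unit := ⟨M.obj_vect, 1, ⟨(vectBasis k).reindex (Equiv.ofUnique _ _)⟩⟩
  obj_tensor := by
    rintro a b ⟨ha, m, ⟨Ba⟩⟩ ⟨hb, n, ⟨Bb⟩⟩
    exact ⟨M.target ha hb, _, ⟨M.tensorBasis ha hb Ba Bb⟩⟩
  congr := by
    rintro a a' b b' f f' g g' ⟨ha, m, ⟨Ba⟩⟩ ⟨ha', -⟩ ⟨hb, n, ⟨Bb⟩⟩ ⟨hb', -⟩ hf hf' hg hg' ⟨e⟩ ⟨e'⟩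
    refine M.iso_of_basis₂ ha hb Ba Bb fun i j => ?_
    obtain ⟨i₁⟩ := M.tensorHom_obj ha ha' hb hb' hf hg (Ba.S i) (Bb.S j)
    obtain ⟨i₂⟩ := M.tensorHom_obj ha ha' hb hb' hf' hg' (Ba.S i) (Bb.S j)
    exact ⟨i₁ ≪≫ (tens a' b').prIso ((isoFunctor e).app _) ((isoFunctor e').app _) ≪≫ i₂.symm⟩
  id := by
    rintro a b ⟨ha, m, ⟨Ba⟩⟩ ⟨hb, n, ⟨Bb⟩⟩
    exact M.iso_of_basis₂ ha hb Ba Bb fun i j => M.tensorHom_obj ha ha hb hb (M.K_id _) (M.K_id _) _ _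
  comp := by
    rintro a a' a'' b b' b'' f f' g g' ⟨ha, m, ⟨Ba⟩⟩ ⟨ha', -⟩ ⟨ha'', -⟩ ⟨hb, n, ⟨Bb⟩⟩ ⟨hb', -⟩ ⟨hb'', -⟩ hf hf' hg hg'
    refine M.iso_of_basis₂ ha hb Ba Bb fun i j => ?_
    obtain ⟨i₁⟩ := M.tensorHom_obj ha ha'' hb hb'' (F := f ≫ f') (G := g ≫ g') (M.K_comp hf hf') (M.K_comp hg hg') (Ba.S i) (Bb.S
      j)
    obtain ⟨i₂⟩ := M.tensorHom_obj ha ha' hb hb' hf hg (Ba.S i) (Bb.S j)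
    obtain ⟨i₃⟩ := M.tensorHom_obj ha' ha'' hb' hb'' hf' hg' (f.functor.obj (Ba.S i)) (g.functor.obj (Bb.S j))
    exact ⟨i₁ ≪≫ i₃.symm ≪≫ (((tensorDataOf S tens).tensorHom f' g').functor.mapIso i₂).symm⟩
  assocInv_assoc := by
    rintro a b c ⟨ha, l, ⟨Ba⟩⟩ ⟨hb, m, ⟨Bb⟩⟩ ⟨hc, n, ⟨Bc⟩⟩
    refine M.iso_of_basis₂ ha (M.target hb hc) Ba (M.tensorBasis hb hc Bb Bc) fun i q => ?_
    obtain ⟨⟨j, p⟩, rfl⟩ := finProdFinEquiv.surjective q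
    rw [M.tensorBasis_S]
    obtain ⟨i₁⟩ := M.assocInv_obj ha hb hc (Ba.S i) (Bb.S j) (Bc.S p)
    obtain ⟨i₂⟩ := M.assoc_obj ha hb hc Ba Bb Bc i j p
    exact ⟨((tensorDataOf S tens).assoc a b c).functor.mapIso i₁ ≪≫ i₂⟩
end TensorSetup
end Split

section PowTensor
/-- The category of tuples of vector spaces, as an object of the 2-category. -/
abbrev pow (k : Type u) [Field k] (n : ℕ) : AddCat k := ⟨VectPow k n⟩

lemma finrank_obj {m n : ℕ} (F : pow k m ⟶ pow k n) (v : VectPow k m) (j : Fin n) : finrank k ((F.functor.obj v : VectPow k n) j)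
  = ∑ i, finrank k (v i) * finrank k ((F.functor.obj (delta k i) : VectPow k n) j) := by
  have h₁ : Functor.Additive F.functor := F.additive
  have h₂ : Functor.Linear k F.functor := F.linear
  obtain ⟨N, ⟨e⟩⟩ := exists_matrixFunctor_iso F.functor
  refine (VectPow.finrank_eq (e.app v) j).symm.trans ((finrank_matrixFunctor_obj N v j).trans ?_)
  refine sum_congr rfl fun i _ => congrArg _ ?_
  exact (finrank_map_delta N i j).symm.trans (VectPow.finrank_eq (e.app (delta k i)) j)

lemma matrixFunctor_perm {m n : ℕ} (σ : Fin m ≃ Fin n) (i : Fin m) : Nonempty (((incl k).map (KV.perm σ : (⟨m⟩ : KV k) ⟶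
  ⟨n⟩)).functor.obj (delta k i : VectPow k m) ≅ (delta k (σ i) : VectPow k n)) := VectPow.nonempty_iso fun j => (finrank_map_delta
  _ i j).trans ((KV.rank_perm σ i j).trans (finrank_delta _ _).symm)

namespace TensorSetup
variable {S : SubBicat (AddCat k)} {tens : ∀ C D : AddCat k, Pairing C D} (M : TensorSetup S tens)

include M in
lemma exists_powTensor (m n : ℕ) : ∃ e : Bicategory.Equivalence (tens (pow k m) (pow k n)).target (pow k (m * n)), ∀ (v : VectPow
  k m) (w : VectPow k n) (i : Fin m) (j : Fin n), finrank k ((e.hom.functor.obj ((tens (pow k m) (pow k n)).pr v w) : VectPow k (m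
  * n)) (finProdFinEquiv (i, j))) = finrank k (v i) * finrank k (w j) := by
  have hm := M.obj_pow m
  have hn := M.obj_pow n
  let Bm := vectPowBasis k m
  let Bn := vectPowBasis k n
  obtain ⟨e, he⟩ := exists_equivalence_of_basis (Y := pow k (m * n)) (M.tensorBasis hm hn Bm Bn) (vectPowBasis k (m * n))
  refine ⟨e, fun v w i j => ?_⟩
  have hb := M.bilin hm hn
  have he' (i' : Fin m) (j' : Fin n) : finrank k ((e.hom.functor.obj ((tens (pow k m) (pow k n)).pr (delta k i' : VectPow k m)
    (delta k j' : VectPow k n)) : VectPow k (m * n)) (finProdFinEquiv (i, j))) =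
      if i' = i ∧ j' = j then 1 else 0 := by
    obtain ⟨t⟩ := he (finProdFinEquiv (i', j'))
    rw [M.tensorBasis_S] at t
    refine (VectPow.finrank_eq t _).trans ((finrank_delta _ _).trans ?_)
    simp
  have h₁ (i' : Fin m) : finrank k ((e.hom.functor.obj ((tens (pow k m) (pow k n)).pr (delta k i' : VectPow k m) w) : VectPow k (m
    * n)) (finProdFinEquiv (i, j))) =
      if i' = i then finrank k (w j) else 0 := by
    have := finrank_obj (@Hom.mk _ _ (pow k n) (tens (pow k m) (pow k n)).target _ (hb.obj_additive (delta k i')) (hb.obj_linear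
      (delta k i')) ≫ e.hom) w (finProdFinEquiv (i, j))
    refine this.trans ((sum_congr rfl fun j' _ => congrArg _ (he' i' j')).trans ?_)
    by_cases h : i' = i <;> simp [h]
  have := finrank_obj (@Hom.mk _ _ (pow k m) (tens (pow k m) (pow k n)).target _ (hb.flip_additive w) (hb.flip_linear w) ≫ e.hom)
    v (finProdFinEquiv (i, j))
  refine this.trans ((sum_congr rfl fun i' _ => congrArg _ (h₁ i')).trans ?_)
  simp

/-- The equivalence of a tensor product of categories of tuples with a category of tuples. -/
def powTensor (m n : ℕ) : Bicategory.Equivalence (tens (pow k m) (pow k n)).target (pow k (m * n)) := (M.exists_powTensor m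
  n).choose

lemma finrank_powTensor (m n : ℕ) (v : VectPow k m) (w : VectPow k n) (i : Fin m) (j : Fin n) : finrank k (((M.powTensor m
  n).hom.functor.obj ((tens (pow k m) (pow k n)).pr v w) : VectPow k (m * n)) (finProdFinEquiv (i, j))) = finrank k (v i) *
  finrank k (w j) := (M.exists_powTensor m n).choose_spec v w i j

lemma powTensor_delta (m n : ℕ) (i : Fin m) (j : Fin n) : Nonempty ((M.powTensor m n).hom.functor.obj ((tens (pow k m) (pow k
  n)).pr (delta k i : VectPow k m) (delta k j : VectPow k n)) ≅ (delta k (finProdFinEquiv (i, j)) : VectPow k (m * n))) :=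
  VectPow.nonempty_iso fun p => by
    obtain ⟨⟨i', j'⟩, rfl⟩ := finProdFinEquiv.surjective p
    refine (M.finrank_powTensor m n _ _ i' j').trans ?_
    rw [finrank_delta, finrank_delta, finrank_delta]
    by_cases h : i = i' <;> by_cases h' : j = j' <;> simp [h, h']

lemma exists_vectEquivalence : ∃ e : Bicategory.Equivalence (vect k) (pow k 1), Nonempty (e.hom.functor.obj (vectOne k) ≅ (delta k
  0 : VectPow k 1)) := by
  obtain ⟨e, he⟩ := exists_equivalence_of_basis (X := vect k) (Y := pow k 1) ((vectBasis k).reindex (Equiv.ofUnique (Fin 1) Unit))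
    (vectPowBasis k 1)
  exact ⟨e, he 0⟩

def vectEquivalence (k : Type u) [Field k] : Bicategory.Equivalence (vect k) (pow k 1) := exists_vectEquivalence.choose

lemma K_pow {m : ℕ} {E : AddCat k} (F : pow k m ⟶ E) : M.K F.functor := M.K_of_basis (M.obj_pow m) (vectPowBasis k m) F

lemma K_id' (X : AddCat k) : M.K (Hom.functor (𝟙 X)) := M.K_id X

lemma K_powTensor (m n : ℕ) : M.K (M.powTensor m n).hom.functor := M.K_of_basis (M.target (M.obj_pow m) (M.obj_pow n))
  (M.tensorBasis (M.obj_pow m) (M.obj_pow n) (vectPowBasis k m) (vectPowBasis k n)) _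

lemma K_vect {E : AddCat k} (F : vect k ⟶ E) : M.K F.functor := M.K_regular M.obj_vect regular_vect _ F.additive

/-- The inclusion of the Kapranov–Voevodsky 2-category preserves tensor products. -/
theorem preserves : TensorData.Preserves (KV.tensorData k) (tensorDataOf S tens) (incl k) (vectEquivalence k) (fun a b =>
  M.powTensor a.n b.n) where
  naturality {a a' b b'} f g := by
    refine M.iso_of_basis₂ (M.obj_pow a.n) (M.obj_pow b.n) (vectPowBasis k a.n) (vectPowBasis k b.n) fun i j => ?_
    obtain ⟨e₁⟩ := M.tensorHom_obj (M.obj_pow a.n) (M.obj_pow a'.n) (M.obj_pow b.n) (M.obj_pow b'.n) (F := (incl k).map f) (G :=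
      (incl k).map g) (M.K_pow _) (M.K_pow _) (delta k i) (delta k j)
    obtain ⟨e₂⟩ := M.powTensor_delta a.n b.n i j
    have h : Nonempty ((M.powTensor a'.n b'.n).hom.functor.obj ((tens (pow k a'.n) (pow k b'.n)).pr (((incl k).map f).functor.obj
      (delta k i : VectPow k a.n)) (((incl k).map g).functor.obj (delta k j : VectPow k b.n))) ≅ ((incl k).map ((KV.tensorData
      k).tensorHom f g)).functor.obj (delta k (finProdFinEquiv (i, j)) : VectPow k (a.n * b.n))) := VectPow.nonempty_iso fun p =>
      by
        obtain ⟨⟨i', j'⟩, rfl⟩ := finProdFinEquiv.surjective p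
        refine (M.finrank_powTensor a'.n b'.n _ _ i' j').trans ?_
        refine (congrArg₂ (· * ·) (finrank_map_delta f i i') (finrank_map_delta g j j')).trans ?_
        exact ((finrank_map_delta _ _ _).trans (KV.rank_tensorHom_apply f g i j i' j')).symm
    obtain ⟨e₃⟩ := h
    exact ⟨(M.powTensor a'.n b'.n).hom.functor.mapIso e₁ ≪≫ e₃ ≪≫ (((incl k).map ((KV.tensorData k).tensorHom f g)).functor.mapIso
      e₂).symm⟩
  associativity a b c := by
    refine M.iso_of_basis₂ (M.target (M.obj_pow a.n) (M.obj_pow b.n)) (M.obj_pow c.n) (M.tensorBasis (M.obj_pow a.n) (M.obj_pow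
      b.n) (vectPowBasis k a.n) (vectPowBasis k b.n)) (vectPowBasis k c.n) fun q l => ?_
    obtain ⟨⟨i, j⟩, rfl⟩ := finProdFinEquiv.surjective q
    rw [M.tensorBasis_S]
    obtain ⟨e₁⟩ := M.tensorHom_obj (M.target (M.obj_pow a.n) (M.obj_pow b.n)) (M.obj_pow (a.n * b.n)) (M.obj_pow c.n) (M.obj_pow
      c.n) (F := (M.powTensor a.n b.n).hom) (G := 𝟙 (pow k c.n)) (M.K_powTensor _ _) (M.K_id' _) ((tens (pow k a.n) (pow k
      b.n)).pr (delta k i : VectPow k a.n) (delta k j : VectPow k b.n)) (delta k l)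
    obtain ⟨e₂⟩ := M.powTensor_delta a.n b.n i j
    obtain ⟨e₃⟩ := M.powTensor_delta (a.n * b.n) c.n (finProdFinEquiv (i, j)) l
    obtain ⟨e₄⟩ := matrixFunctor_perm (k := k) (finCongr (mul_assoc a.n b.n c.n)) (finProdFinEquiv (finProdFinEquiv (i, j), l))
    rw [KV.finCongr_assoc] at e₄
    obtain ⟨f₁⟩ := M.assoc_obj (M.obj_pow a.n) (M.obj_pow b.n) (M.obj_pow c.n) (vectPowBasis k a.n) (vectPowBasis k b.n)
      (vectPowBasis k c.n) i j l
    obtain ⟨f₂⟩ := M.tensorHom_obj (M.obj_pow a.n) (M.obj_pow a.n) (M.target (M.obj_pow b.n) (M.obj_pow c.n)) (M.obj_pow (b.n *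
      c.n)) (F := 𝟙 (pow k a.n)) (G := (M.powTensor b.n c.n).hom) (M.K_id' _) (M.K_powTensor _ _) (delta k i) ((tens (pow k b.n)
      (pow k c.n)).pr (delta k j : VectPow k b.n) (delta k l : VectPow k c.n))
    obtain ⟨f₃⟩ := M.powTensor_delta b.n c.n j l
    obtain ⟨f₄⟩ := M.powTensor_delta a.n (b.n * c.n) i (finProdFinEquiv (j, l))
    let p := (M.powTensor (a.n * b.n) c.n).hom.functor
    let p' := (M.powTensor a.n (b.n * c.n)).hom.functor
    let α := ((incl k).map ((KV.tensorData k).assoc a b c)).functor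
    let t := ((tensorDataOf S tens).tensorHom (𝟙 (pow k a.n)) (M.powTensor b.n c.n).hom).functor
    exact ⟨α.mapIso (p.mapIso (e₁ ≪≫ (tens _ _).prIso e₂ (Iso.refl _)) ≪≫ e₃) ≪≫ e₄ ≪≫ (p'.mapIso (t.mapIso f₁ ≪≫ f₂ ≪≫ (tens _
      _).prIso (Iso.refl _) f₃) ≪≫ f₄).symm⟩
  left_unitality a := by
    refine M.iso_of_basis₂ M.obj_vect (M.obj_pow a.n) ((vectBasis k).reindex (Equiv.ofUnique (Fin 1) Unit)) (vectPowBasis k a.n)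
      fun z i => ?_
    obtain ⟨e₁⟩ := M.tensorHom_obj M.obj_vect (M.obj_pow 1) (M.obj_pow a.n) (M.obj_pow a.n) (F := (vectEquivalence k).hom) (G := 𝟙
      (pow k a.n)) (M.K_vect _) (M.K_id' _) (vectOne k) (delta k i)
    obtain ⟨e₂⟩ := (exists_vectEquivalence (k := k)).choose_spec
    obtain ⟨e₃⟩ := M.powTensor_delta 1 a.n 0 i
    obtain ⟨e₄⟩ := matrixFunctor_perm (k := k) (finCongr (one_mul a.n)) (finProdFinEquiv (0, i))
    rw [KV.finCongr_one_mul] at e₄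
    obtain ⟨f⟩ := M.leftUnitor_obj (M.obj_pow a.n) (delta k i)
    let p := (M.powTensor 1 a.n).hom.functor
    let α := ((incl k).map ((KV.tensorData k).leftUnitor a)).functor
    exact ⟨α.mapIso (p.mapIso (e₁ ≪≫ (tens _ _).prIso e₂ (Iso.refl _)) ≪≫ e₃) ≪≫ e₄ ≪≫ f.symm⟩
  right_unitality a := by
    refine M.iso_of_basis₂ (M.obj_pow a.n) M.obj_vect (vectPowBasis k a.n) ((vectBasis k).reindex (Equiv.ofUnique (Fin 1) Unit))
      fun i z => ?_
    obtain ⟨e₁⟩ := M.tensorHom_obj (M.obj_pow a.n) (M.obj_pow a.n) M.obj_vect (M.obj_pow 1) (F := 𝟙 (pow k a.n)) (G :=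
      (vectEquivalence k).hom) (M.K_id' _) (M.K_vect _) (delta k i) (vectOne k)
    obtain ⟨e₂⟩ := (exists_vectEquivalence (k := k)).choose_spec
    obtain ⟨e₃⟩ := M.powTensor_delta a.n 1 i 0
    obtain ⟨e₄⟩ := matrixFunctor_perm (k := k) (finCongr (mul_one a.n)) (finProdFinEquiv (i, 0))
    rw [KV.finCongr_mul_one] at e₄
    obtain ⟨f⟩ := M.rightUnitor_obj (M.obj_pow a.n) (delta k i)
    let p := (M.powTensor a.n 1).hom.functor
    let α := ((incl k).map ((KV.tensorData k).rightUnitor a)).functor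
    exact ⟨α.mapIso (p.mapIso (e₁ ≪≫ (tens _ _).prIso (Iso.refl _) e₂) ≪≫ e₃) ≪≫ e₄ ≪≫ f.symm⟩
  symmetry a b := by
    refine M.iso_of_basis₂ (M.obj_pow a.n) (M.obj_pow b.n) (vectPowBasis k a.n) (vectPowBasis k b.n) fun i j => ?_
    obtain ⟨e₂⟩ := M.powTensor_delta a.n b.n i j
    obtain ⟨e₄⟩ := matrixFunctor_perm (k := k) (finProdFinEquiv.symm.trans ((Equiv.prodComm (Fin a.n) (Fin b.n)).trans
      finProdFinEquiv)) (finProdFinEquiv (i, j))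
    simp only [Equiv.trans_apply, Equiv.symm_apply_apply, Equiv.prodComm_apply, Prod.swap_prod_mk] at e₄
    obtain ⟨f₁⟩ := M.braiding_obj (M.obj_pow a.n) (M.obj_pow b.n) (delta k i) (delta k j)
    obtain ⟨f₂⟩ := M.powTensor_delta b.n a.n j i
    let p := (M.powTensor b.n a.n).hom.functor
    let α := ((incl k).map ((KV.tensorData k).braiding a b)).functor
    exact ⟨α.mapIso e₂ ≪≫ e₄ ≪≫ (p.mapIso f₁ ≪≫ f₂).symm⟩
end TensorSetup
end PowTensor
end AddCat

section
variable {X : Type u₁} [Category.{u} X] [Preadditive X] [Linear k X]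

def vecHom {V : FGModuleCat.{u} k} (x : V) : FGModuleCat.of k k ⟶ V := FGModuleCat.ofHom (toSpanSingleton k V x)

lemma vecHom_comp {V W : FGModuleCat.{u} k} (x : V) (f : V ⟶ W) : vecHom x ≫ f = vecHom (f.hom.hom x) := by
  refine ObjectProperty.hom_ext _ (ModuleCat.hom_ext (LinearMap.ext fun r : k => ?_))
  exact f.hom.hom.map_smul r x

lemma vecHom_add {V : FGModuleCat.{u} k} (x y : V) : vecHom (x + y) = vecHom x + vecHom y := by
  refine ObjectProperty.hom_ext _ (ModuleCat.hom_ext (LinearMap.ext fun r : k => ?_))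
  exact smul_add r x y

lemma vecHom_smul {V : FGModuleCat.{u} k} (r : k) (x : V) : vecHom (r • x) = r • vecHom x := by
  refine ObjectProperty.hom_ext _ (ModuleCat.hom_ext (LinearMap.ext fun s : k => ?_))
  exact smul_comm s r x

lemma fgModuleCat_sum_apply {V W : FGModuleCat.{u} k} {J : Type*} (s : Finset J) (f : J → (V ⟶ W)) (x : V) : (∑ j ∈ s, f
  j).hom.hom x = ∑ j ∈ s, (f j).hom.hom x := map_sum (⟨⟨fun f : V ⟶ W => f.hom.hom x, rfl⟩, fun _ _ => rfl⟩ : (V ⟶ W) →+ W) f s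

def coordHom (V : FGModuleCat.{u} k) (a : Fin (finrank k V)) : V ⟶ FGModuleCat.of k k := FGModuleCat.ofHom ((finBasis k V).coord
  a)

lemma sum_coordHom (V : FGModuleCat.{u} k) : ∑ a, coordHom V a ≫ vecHom (finBasis k V a) = 𝟙 V := by
  refine ObjectProperty.hom_ext _ (ModuleCat.hom_ext (LinearMap.ext fun x => ?_))
  exact (fgModuleCat_sum_apply _ _ x).trans ((finBasis k V).sum_repr x)

variable (L : FGModuleCat.{u} k ⥤ X) [L.Additive] [L.Linear k]

/-- The isomorphism between morphisms to `L V` and the tensor product of `V` with morphisms to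
`L k`, in one direction. -/
def copowerMap {x : X} (V : FGModuleCat.{u} k) : (x ⟶ L.obj V) →ₗ[k] ((x ⟶ L.obj (FGModuleCat.of k k)) ⊗[k] V) := ∑ a,
  (TensorProduct.mk k _ V).flip (finBasis k V a) ∘ₗ rightComp k x (L.map (coordHom V a))

lemma copowerMap_apply {x : X} (V : FGModuleCat.{u} k) (f : x ⟶ L.obj V) : copowerMap L V f = ∑ a, (f ≫ L.map (coordHom V a))
  ⊗ₜ[k] finBasis k V a := by
  simp [copowerMap]

lemma copowerMap_comp {x : X} {V W : FGModuleCat.{u} k} (φ : V ⟶ W) (f : x ⟶ L.obj V) : copowerMap L W (f ≫ L.map φ) =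
  φ.hom.hom.lTensor _ (copowerMap L V f) := by
  rw [copowerMap_apply, copowerMap_apply, map_sum]
  have h (b) : φ ≫ coordHom W b = ∑ a, (finBasis k W).repr (φ.hom.hom (finBasis k V a)) b • coordHom V a := by
    refine ObjectProperty.hom_ext _ (ModuleCat.hom_ext ((finBasis k V).ext fun a => ?_))
    refine Eq.trans ?_ (fgModuleCat_sum_apply _ _ (finBasis k V a)).symm
    change (finBasis k W).repr (φ.hom.hom (finBasis k V a)) b = ∑ a', (finBasis k W).repr (φ.hom.hom (finBasis k V a')) b •
      (finBasis k V).repr (finBasis k V a) a'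
    simp [Finsupp.single_apply]
  have h₁ (b) : (f ≫ L.map φ) ≫ L.map (coordHom W b) = ∑ a, (finBasis k W).repr (φ.hom.hom (finBasis k V a)) b • (f ≫ L.map
    (coordHom V a)) := by
    rw [assoc, ← L.map_comp, h, L.map_sum, comp_sum]
    simp [L.map_smul]
  simp only [h₁, TensorProduct.sum_tmul, LinearMap.lTensor_tmul]
  rw [sum_comm]
  refine sum_congr rfl fun a _ => ?_
  conv_rhs => rw [← (finBasis k W).sum_repr (φ.hom.hom (finBasis k V a)), TensorProduct.tmul_sum]
  exact sum_congr rfl fun b _ => TensorProduct.smul_tmul _ _ _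

variable {L}

/-- A category is semisimple if its identity functor is a retract of a finite sum of functors which
factor through finite-dimensional vector spaces. -/
theorem exists_splitBasis_of_factor [IsAlgClosed k] [IsIdempotentComplete X] {J : Type} [Fintype J] (G : J → X ⥤ FGModuleCat.{u}
  k) (hG : ∀ j, (G j).Additive) (hG' : ∀ j, (G j).Linear k) (L : J → FGModuleCat.{u} k ⥤ X) (hL : ∀ j, (L j).Additive) (hL' : ∀ j,
  (L j).Linear k) (s : ∀ j, 𝟭 X ⟶ G j ⋙ L j) (r : ∀ j, G j ⋙ L j ⟶ 𝟭 X) (h : ∑ j, s j ≫ r j = 𝟙 _) : ∃ n, Nonempty (SplitBasis k X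
  (Fin n)) := by
  let R : Retract k X J :=
    { G := G
      additive := hG
      linear := hG'
      P j := (L j).obj (FGModuleCat.of k k)
      r j x :=
        { toFun v := (L j).map (vecHom v) ≫ (r j).app x
          map_add' v w := by rw [vecHom_add, (L j).map_add, add_comp]
          map_smul' c v := by rw [vecHom_smul, (L j).map_smul, smul_comp]; rfl }
      r_nat j x y f v := by
        have := (r j).naturality f
        simp only [Functor.comp_map, Functor.id_map] at this
        simp only [LinearMap.coe_mk, AddHom.coe_mk, assoc]
        rw [← vecHom_comp, (L j).map_comp, assoc, this]
      s j x := copowerMap (L j) _ ((s j).app x)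
      s_nat j x y f := by
        rw [← copowerMap_comp]
        have := (s j).naturality f
        simp only [Functor.comp_map, Functor.id_map] at this
        rw [← this, copowerMap_apply, copowerMap_apply, map_sum]
        simp only [LinearMap.rTensor_tmul, Linear.leftComp_apply, assoc]
      retract x := by
        have := congrArg (fun t => t.app x) h
        rw [NatTrans.app_sum] at this
        refine Eq.trans ?_ this
        refine sum_congr rfl fun j _ => ?_
        rw [copowerMap_apply, map_sum]
        refine (sum_congr rfl fun a _ => show _ = (s j).app x ≫ (L j).map (coordHom _ a ≫ vecHom (finBasis k _ a)) ≫ (r j).app x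
          from (assoc _ _ _).trans (by rw [(L j).map_comp, assoc]; rfl)).trans ?_
        rw [← comp_sum, ← sum_comp, ← (L j).map_sum, sum_coordHom]
        simp }
  exact R.exists_splitBasis
end

section
variable {C : Type u₁} [Category.{v₁} C] [Preadditive C] [Linear k C] {D : Type u₂} [Category.{v₂} D] [Preadditive D] [Linear k D]
  {E : Type u₃} [Category.{v₃} E] [Preadditive E] [Linear k E] {F : C ⥤ D} {G : D ⥤ E}

lemma comp_additive (hF : F.Additive) (hG : G.Additive) : (F ⋙ G).Additive := inferInstance

lemma comp_linear (hF : F.Linear k) (hG : G.Linear k) : (F ⋙ G).Linear k := inferInstance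
end

namespace AddCat.TensorSetup
variable {S : SubBicat (AddCat k)} {tens : ∀ C D : AddCat k, Pairing C D} (M : TensorSetup S tens) {x y : AddCat k}

include M in
lemma exists_basis_of_isDual [IsAlgClosed k] (hx : M.obj x) (hy : M.obj y) {e : (tens x y).target ⟶ vect k} {c : vect k ⟶ (tens y
  x).target} (he : M.K e.functor) (hc : M.K c.functor) {g : (tens y x).target ⟶ vect k} (hg : M.K g.functor) (adj : Nonempty
  (Bicategory.Adjunction c g)) (h : (tensorDataOf S tens).IsDual e c) : ∃ n, Nonempty (SplitBasis k x (Fin n)) := by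
  obtain ⟨J, _, yy, xx, s, r, hsr⟩ := M.coev_gen hx hy c g hc hg adj
  have := M.idem hx
  have hxy := M.target hx hy
  have hyx := M.target hy hx
  let T := tensorDataOf S tens
  obtain ⟨z⟩ := h.zigzag₁
  let Ψ : (tens x (tens y x).target).target ⟶ x := T.assocInv x y x ≫ T.tensorHom e (𝟙 x) ≫ T.leftUnitor x
  let W (t : (tens y x).target) : x ⥤ x := (tens x (tens y x).target).pair.flip.obj t ⋙ Ψ.functor
  let Wmap {t t' : (tens y x).target} (f : t ⟶ t') : W t ⟶ W t' := Functor.whiskerRight ((tens x (tens y x).target).pair.flip.map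
    f) Ψ.functor
  have Wmap_app {t t' : (tens y x).target} (f : t ⟶ t') (X : x) : (Wmap f).app X = Ψ.functor.map (((tens x (tens y
    x).target).pair.obj X).map f) := rfl
  obtain ⟨-, ⟨e₁⟩⟩ := M.tensorHom_spec hx hx M.obj_vect hyx (F := 𝟙 x) (M.K_id x) hc
  obtain ⟨-, ⟨e₂⟩⟩ := M.rightUnitor_spec hx
  let i₁ : 𝟭 x ≅ (tens x (vect k)).pair.flip.obj (vectOne k) ⋙ (T.rightUnitor x).functor := e₂.symm
  let i₂ : (tens x (vect k)).pair.flip.obj (vectOne k) ⋙ (T.rightUnitor x).functor ≅ (tens x (vect k)).pair.flip.obj (vectOne k) ⋙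
    (T.tensorHom (𝟙 x) c ≫ Ψ).functor := isoWhiskerLeft _ (isoFunctor z).symm
  let i₃ : (tens x (vect k)).pair.flip.obj (vectOne k) ⋙ (T.tensorHom (𝟙 x) c).functor ≅ (tens x (tens y x).target).pair.flip.obj
    (c.functor.obj (vectOne k)) := ((flipFunctor _ _ _).mapIso e₁).app (vectOne k)
  let i : 𝟭 x ≅ W (c.functor.obj (vectOne k)) := i₁ ≪≫ i₂ ≪≫ isoWhiskerRight i₃ Ψ.functor
  let G (j : J) : x ⥤ vect k := (tens x y).pair.flip.obj (yy j) ⋙ e.functor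
  let L (j : J) : vect k ⥤ x := (tens (vect k) x).pair.flip.obj (xx j) ⋙ (T.leftUnitor x).functor
  obtain ⟨-, ⟨e₃⟩⟩ := M.assocInv_spec hx hy hx
  obtain ⟨-, ⟨e₄⟩⟩ := M.tensorHom_spec hxy M.obj_vect hx hx (F := e) (G := 𝟙 x) he (M.K_id x)
  let j₁ (j : J) : (tens x (tens y x).target).pair.flip.obj ((tens y x).pr (yy j) (xx j)) ⋙ (T.assocInv x y x).functor ≅ (tens x
    y).pair.flip.obj (yy j) ⋙ (tens (tens x y).target x).pair.flip.obj (xx j) := NatIso.ofComponents (fun X => ((e₃.app X).app (yy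
    j)).app (xx j)) (fun {X X'} f => congrArg (fun t => (t.app (yy j)).app (xx j)) (e₃.hom.naturality f))
  let j₂ (j : J) : (tens (tens x y).target x).pair.flip.obj (xx j) ⋙ (T.tensorHom e (𝟙 x)).functor ≅ e.functor ⋙ (tens (vect k)
    x).pair.flip.obj (xx j) := ((flipFunctor _ _ _).mapIso e₄).app (xx j)
  let jj (j : J) : W ((tens y x).pr (yy j) (xx j)) ≅ G j ⋙ L j := isoWhiskerRight (j₁ j) ((T.tensorHom e (𝟙 x)).functor ⋙
    (T.leftUnitor x).functor) ≪≫ isoWhiskerLeft ((tens x y).pair.flip.obj (yy j)) (isoWhiskerRight (j₂ j) (T.leftUnitor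
    x).functor)
  have b₁ := M.bilin hx hy
  have b₂ := M.bilin M.obj_vect hx
  have b₃ := M.bilin hx hyx
  refine exists_splitBasis_of_factor G (fun j => ?_) (fun j => ?_) L (fun j => ?_) (fun j => ?_) (fun j => i.hom ≫ Wmap (s j) ≫
    (jj j).hom) (fun j => (jj j).inv ≫ Wmap (r j) ≫ i.inv) ?_
  · have := b₁.flip_additive (yy j)
    exact comp_additive ‹_› e.additive
  · have := b₁.flip_linear (yy j)
    exact comp_linear ‹_› e.linear
  · have := b₂.flip_additive (xx j)
    exact comp_additive ‹_› (T.leftUnitor x).additive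
  · have := b₂.flip_linear (xx j)
    exact (@Hom.mk _ _ (vect k) (tens (vect k) x).target _ (b₂.flip_additive (xx j)) (b₂.flip_linear (xx j)) ≫ T.leftUnitor
      x).linear
  · have hW : ∑ j, Wmap (s j) ≫ Wmap (r j) = 𝟙 (W (c.functor.obj (vectOne k))) := by
      ext X
      have := b₃.obj_additive X
      rw [NatTrans.app_sum]
      simp only [NatTrans.comp_app, Wmap_app, ← Functor.map_comp]
      rw [← Functor.map_sum, ← Functor.map_sum, hsr]
      simp [W]
    have : ∀ j, (i.hom ≫ Wmap (s j) ≫ (jj j).hom) ≫ (jj j).inv ≫ Wmap (r j) ≫ i.inv =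
        i.hom ≫ (Wmap (s j) ≫ Wmap (r j)) ≫ i.inv := fun j => by simp
    simp only [this]
    rw [← comp_sum, ← sum_comp, hW]
    simp

include M in
/-- The inclusion of the Kapranov–Voevodsky 2-category induces an equivalence with the
fully-dualizable part. -/
theorem inducesEquivalence [IsAlgClosed k] : InducesEquivalence (KV.tensorData k) (tensorDataOf S tens) S (incl k) := by
  refine inducesEquivalence_of (inclPseudo k) S M.split (fun a => ⟨M.obj_pow a.n, a.n, ⟨vectPowBasis k a.n⟩⟩) (fun hf =>
    (M.hom_iff _).1 hf) M.isFunctorial KV.assoc_assocInv inclPseudo_full inclPseudo_faithful (fun a => M.obj_vectPow a.n) (fun f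
    => (M.hom_iff _).2 (M.K_pow _)) KV.exists_adjoint (fun a => ⟨a, KV.ev a, KV.coev a, KV.isDual_self a⟩) ?_ ?_ M.preserves
    ((M.hom_iff _).2 (M.K_vect _)) ((M.hom_iff _).2 (M.K_pow _)) (fun a b => (M.hom_iff _).2 (M.K_powTensor _ _)) (fun a b =>
    (M.hom_iff _).2 (M.K_pow _))
  · intro a b f _ _
    let f : pow k a.n ⟶ pow k b.n := f
    have h₁ : Functor.Additive (C := VectPow k a.n) (D := VectPow k b.n) f.functor := f.additive
    have h₂ : Functor.Linear k (C := VectPow k a.n) (D := VectPow k b.n) f.functor := f.linear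
    obtain ⟨N, ⟨e⟩⟩ := exists_matrixFunctor_iso (a := a) (b := b) f.functor
    exact ⟨N, ⟨isoMk e⟩⟩
  · rintro x y e c hx hy he hc - ⟨g, hg, adj⟩ h
    obtain ⟨n, ⟨B⟩⟩ := M.exists_basis_of_isDual (M.obj_of hx) (M.obj_of hy) ((M.hom_iff _).1 he) ((M.hom_iff _).1 hc) ((M.hom_iff
      _).1 hg) adj h
    obtain ⟨i, -⟩ := exists_equivalence_of_basis (X := pow k n) (vectPowBasis k n) B
    exact ⟨⟨n⟩, i, (M.hom_iff _).2 (M.K_pow _), (M.hom_iff _).2 (M.K_of_basis (M.obj_of hx) B _)⟩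
end AddCat.TensorSetup

/-! ### The universal property of the tensor product of linear categories -/

section
variable {C : Type u₁} [Category.{u} C] [Preadditive C] [Linear k C] {D : Type u₂} [Category.{u} D] [Preadditive D] [Linear k D]
  {E : Type u₃} [Category.{v₃} E] [Preadditive E] [Linear k E]

namespace LinTensor
def liftMap {P : C ⥤ D ⥤ E} (hP : Bilin k P) (X Y : LinTensor k C D) : (X ⟶ Y) →ₗ[k] ((P.obj X.fst).obj X.snd ⟶ (P.obj Y.fst).obj
  Y.snd) := TensorProduct.lift (LinearMap.mk₂ k (fun f g => (P.map f).app X.snd ≫ (P.obj Y.fst).map g) (fun f f' g => by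
      have := hP.additive
      rw [P.map_add, NatTrans.app_add, add_comp])
    (fun r f g => by
      have := hP.linear
      rw [P.map_smul, NatTrans.app_smul, smul_comp])
    (fun f g g' => by
      have := hP.obj_additive Y.fst
      rw [Functor.map_add, comp_add])
    (fun r f g => by
      have := hP.obj_linear Y.fst
      rw [Functor.map_smul, comp_smul]))

lemma liftMap_tmul {P : C ⥤ D ⥤ E} (hP : Bilin k P) {X Y : LinTensor k C D} (f : X.fst ⟶ Y.fst) (g : X.snd ⟶ Y.snd) : liftMap hP X
  Y (tmul k f g) = (P.map f).app X.snd ≫ (P.obj Y.fst).map g := TensorProduct.lift.tmul _ _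

def lift {P : C ⥤ D ⥤ E} (hP : Bilin k P) : LinTensor k C D ⥤ E where
  obj X := (P.obj X.fst).obj X.snd
  map f := liftMap hP _ _ f
  map_id X := by
    rw [id_eq, liftMap_tmul]
    simp
  map_comp {X Y Z} f g := by
    induction f using hom_induction with
    | h0 | hadd => simp [*]
    | htmul f₁ f₂ =>
      induction g using hom_induction with
      | h0 | hadd => simp [*]
      | htmul g₁ g₂ =>
        rw [tmul_comp, liftMap_tmul, liftMap_tmul, liftMap_tmul]
        simp

lemma lift_additive {P : C ⥤ D ⥤ E} (hP : Bilin k P) : (lift hP).Additive where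
  map_add {_ _ f g} := map_add (liftMap hP _ _) f g

lemma lift_linear {P : C ⥤ D ⥤ E} (hP : Bilin k P) : (lift hP).Linear k where
  map_smul f r := map_smul (liftMap hP _ _) r f

lemma pair_bilin : Bilin k (LinTensor.pair k C D) := by
  refine Bilin.of_flip (fun d => ⟨fun {x y f g} => ?_⟩) (fun d => ⟨fun {x y} f r => ?_⟩) (fun c => ⟨fun {x y f g} => ?_⟩) (fun c
    => ⟨fun {x y} f r => ?_⟩)
  · exact LinearMap.map_add₂ (tmul k (X := ⟨x, d⟩) (Y := ⟨y, d⟩)) f g (𝟙 d)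
  · exact LinearMap.map_smul₂ (tmul k (X := ⟨x, d⟩) (Y := ⟨y, d⟩)) r f (𝟙 d)
  · exact map_add (tmul k (X := ⟨c, x⟩) (Y := ⟨c, y⟩) (𝟙 c)) f g
  · exact map_smul (tmul k (X := ⟨c, x⟩) (Y := ⟨c, y⟩) (𝟙 c)) r f

def pairLiftIso {P : C ⥤ D ⥤ E} (hP : Bilin k P) : LinTensor.pair k C D ⋙ (whiskeringRight D _ E).obj (lift hP) ≅ P :=
  NatIso.ofComponents (fun c => NatIso.ofComponents (fun d => Iso.refl _) (fun {d d'} g => by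
    refine (comp_id _).trans ((liftMap_tmul hP (X := ⟨c, d⟩) (Y := ⟨c, d'⟩) (𝟙 c) g).trans ?_)
    rw [P.map_id]
    rfl)) (fun {c c'} f => by
    ext d
    refine (comp_id _).trans ((liftMap_tmul hP (X := ⟨c, d⟩) (Y := ⟨c', d⟩) f (𝟙 d)).trans ?_)
    rw [CategoryTheory.Functor.map_id]
    exact (comp_id _).trans (id_comp _).symm)

lemma tmul_eq {X Y : LinTensor k C D} (f : X.fst ⟶ Y.fst) (g : X.snd ⟶ Y.snd) : (tmul k f g : X ⟶ Y) = ((LinTensor.pair k C D).map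
  f).app X.snd ≫ ((LinTensor.pair k C D).obj Y.fst).map g := (congrArg₂ (fun s t => (tmul k s t : X ⟶ Y)) (comp_id f) (id_comp
  g)).symm.trans (tmul_comp k (X := X) (Y := ⟨Y.fst, X.snd⟩) (Z := Y) f (𝟙 _) (𝟙 _) g).symm

lemma exists_natTrans {F G : LinTensor k C D ⥤ E} (hF : F.Additive) (hG : G.Additive) (θ : LinTensor.pair k C D ⋙ (whiskeringRight
  D _ E).obj F ⟶ LinTensor.pair k C D ⋙ (whiskeringRight D _ E).obj G) : ∃ η : F ⟶ G, ∀ X, η.app X = (θ.app X.fst).app X.snd := by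
  let α (X : LinTensor k C D) : F.obj X ⟶ G.obj X := (θ.app X.fst).app X.snd
  have nat {X Y : LinTensor k C D} (f : X ⟶ Y) : F.map f ≫ α Y = α X ≫ G.map f := by
    induction f using hom_induction with
    | h0 => rw [F.map_zero, G.map_zero, zero_comp, comp_zero]
    | hadd x y hx hy =>
      rw [F.map_add, G.map_add, add_comp, comp_add, hx, hy]
    | htmul f g =>
      let m : LinTensor k C D := ⟨Y.fst, X.snd⟩
      let p : X ⟶ m := ((LinTensor.pair k C D).map f).app X.snd
      let q : m ⟶ Y := ((LinTensor.pair k C D).obj Y.fst).map g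
      have e (H : LinTensor k C D ⥤ E) : H.map (tmul k f g : X ⟶ Y) = H.map p ≫ H.map q := (congrArg H.map (tmul_eq f g)).trans
        (H.map_comp p q)
      have h₁ : F.map p ≫ α m = α X ≫ G.map p := congrArg (fun t => t.app X.snd) (θ.naturality f)
      have h₂ : F.map q ≫ α Y = α m ≫ G.map q := (θ.app Y.fst).naturality g
      rw [e F, e G, assoc, h₂, ← assoc, h₁, assoc]
  exact ⟨{ app := α, naturality := fun _ _ f => nat f }, fun _ => rfl⟩

lemma hat_bijective {F G : Hat (LinTensor k C D) ⥤ E} (hF : F.Additive) (hG : G.Additive) : Function.Bijective fun η : F ⟶ G =>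
  (Functor.whiskerLeft (LinTensor.pair k C D ⋙ (whiskeringRight D (LinTensor k C D) _).obj (toHat (LinTensor k C D)))
  ((whiskeringRight D _ E).map η)) := by
  let K := toHat (LinTensor k C D)
  have hK : Generates K := toHat_generates (LinTensor k C D)
  refine ⟨fun η θ h => ?_, fun θ => ?_⟩
  · refine hK.natTrans_ext fun X => ?_
    exact congrArg (fun t => (t.app X.fst).app X.snd) h
  · obtain ⟨η, hη⟩ := LinTensor.exists_natTrans (F := K ⋙ F) (G := K ⋙ G) inferInstance inferInstance θ
    obtain ⟨ζ, hε⟩ := hK.exists_natTrans (F := F) (G := G) η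
    refine ⟨ζ, ?_⟩
    ext c d
    exact (hε ⟨c, d⟩).trans (hη ⟨c, d⟩)
end LinTensor
end

namespace AddCat
lemma cauchyTensor_bilin (C D : AddCat k) : Bilin k (cauchyTensor C D).pair := LinTensor.pair_bilin.postcomp (toHat (LinTensor k C
  D))

lemma cauchyTensor_exists_lift {C D E : AddCat k} [IsIdempotentComplete E] {P : C ⥤ D ⥤ E} (hP : Bilin k P) : ∃ H : (cauchyTensor
  C D).target ⟶ E, Nonempty ((cauchyTensor C D).after H ≅ P) := by
  have := LinTensor.lift_additive hP
  have := LinTensor.lift_linear hP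
  obtain ⟨H, h₁, h₂, ⟨e⟩⟩ := (toHat_generates (LinTensor k C D)).exists_extension (k := k) (LinTensor.lift hP)
  refine ⟨@Hom.mk _ _ (cauchyTensor C D).target E H h₁ h₂, ⟨?_ ≪≫ LinTensor.pairLiftIso hP⟩⟩
  exact isoWhiskerLeft (LinTensor.pair k C D) ((whiskeringRight D _ E).mapIso e)

lemma cauchyTensor_bijective {C D E : AddCat k} (H H' : (cauchyTensor C D).target ⟶ E) : Function.Bijective fun η : H.functor ⟶
  H'.functor => (Functor.whiskerLeft (cauchyTensor C D).pair ((whiskeringRight D (cauchyTensor C D).target E).map η) :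
  (cauchyTensor C D).after H ⟶ (cauchyTensor C D).after H') := LinTensor.hat_bijective H.additive H'.additive

/-- The Cauchy completed tensor product has the universal property of a tensor product. -/
def twoVectSetup (k : Type u) [Field k] : TensorSetup (twoVect k) cauchyTensor where
  obj C := IsIdempotentComplete C
  K _ := True
  hom_iff _ := Iff.rfl
  obj_of h := h.1
  obj_vectPow n := ⟨inferInstanceAs (IsIdempotentComplete (VectPow k n)), inferInstanceAs (EssentiallySmall.{u} (VectPow k n))⟩
  obj_vect := inferInstanceAs (IsIdempotentComplete (FGModuleCat.{u} k))
  idem h := h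
  K_iso _ _ := trivial
  K_id _ := trivial
  K_comp _ _ := trivial
  K_sum := by
    intros
    trivial
  K_regular _ _ _ _ := trivial
  target {C D} _ _ := inferInstanceAs (IsIdempotentComplete (Hat (LinTensor k C D)))
  bilin _ _ := cauchyTensor_bilin _ _
  pair_right _ _ _ := trivial
  pair_left _ _ _ := trivial
  exists_lift {C D E} _ _ hE P hP _ _ := by
    have : IsIdempotentComplete E := hE
    obtain ⟨H, h⟩ := cauchyTensor_exists_lift hP
    exact ⟨H, trivial, h⟩
  bijective _ _ _ H H' _ _ := cauchyTensor_bijective H H'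
  param _ _ _ _ _ _ _ _ _ := trivial
  coev_gen {X Y} _ _ c _ _ _ _ := by
    obtain ⟨J, _, idx, f, g, h⟩ := toHat_generates (LinTensor k Y X) (c.functor.obj (vectOne k))
    exact ⟨J, inferInstance, fun j => (idx j).fst, fun j => (idx j).snd, f, g, h⟩
end AddCat

/-! ### Projective generators -/

section Generator
/-- A projective generator of a category with finite-dimensional spaces of morphisms. -/
structure IsGen (k : Type u) [Field k] {C : Type u₁} [Category.{v₁} C] [Preadditive C] [Linear k C] (G : C) : Prop where
  finite_hom : ∀ X Y : C, Module.Finite k (X ⟶ Y)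
  projective : Projective G
  sep : ∀ ⦃X Y : C⦄ (t : X ⟶ Y), (∀ f : G ⟶ X, f ≫ t = 0) → t = 0

lemma isCok_of_epi {C : Type u₁} [Category.{v₁} C] [Preadditive C] [IsNormalEpiCategory C] {b c : C} (g : b ⟶ c) [Epi g] : ∃ (a :
  C) (f : a ⟶ b), IsCok f g := by
  obtain ⟨⟨a, f, w, h⟩⟩ := IsNormalEpiCategory.normalEpiOfEpi g
  exact ⟨a, f, isCok_of_isColimit h⟩

lemma IsCok.precomp {C : Type u₁} [Category.{v₁} C] [Preadditive C] {a a' b c : C} {f : a ⟶ b} {g : b ⟶ c} (h : IsCok f g) (p : a'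
  ⟶ a) [Epi p] : IsCok (p ≫ f) g where
  w := by rw [assoc, h.w, comp_zero]
  exists_desc z t ht := h.exists_desc t (by rwa [← cancel_epi p, ← assoc, comp_zero])
  epi := h.epi

section
variable {C : Type u₁} [Category.{v₁} C] [Preadditive C] [Linear k C] {E : Type u₂} [Category.{v₂} E] [Preadditive E]

lemma exists_epi_of_sep [HasFiniteBiproducts C] {G : C} (hfin : ∀ X Y : C, Module.Finite k (X ⟶ Y)) (hsep : ∀ ⦃X Y : C⦄ (t : X ⟶
  Y), (∀ f : G ⟶ X, f ≫ t = 0) → t = 0) (X : C) : ∃ (n : ℕ) (p : (⨁ fun _ : Fin n => G) ⟶ X), Epi p := by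
  have := hfin G X
  let b := finBasis k (G ⟶ X)
  refine ⟨_, biproduct.desc fun j => b j, epi_of_cancel_zero _ fun t ht => hsep t fun f => ?_⟩
  rw [← b.sum_repr f, sum_comp]
  refine sum_eq_zero fun j _ => ?_
  have := biproduct.ι (fun _ => G) j ≫= ht
  rw [biproduct.ι_desc_assoc, comp_zero] at this
  rw [smul_comp, this, smul_zero]

lemma exists_presentation_of_sep [HasFiniteBiproducts C] [IsNormalEpiCategory C] {G : C} (hfin : ∀ X Y : C, Module.Finite k (X ⟶
  Y)) (hsep : ∀ ⦃X Y : C⦄ (t : X ⟶ Y), (∀ f : G ⟶ X, f ≫ t = 0) → t = 0) (X : C) : ∃ (m n : ℕ) (f : (⨁ fun _ : Fin m => G) ⟶ ⨁ fun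
  _ : Fin n => G) (p : (⨁ fun _ : Fin n => G) ⟶ X), IsCok f p := by
  obtain ⟨n, p, _⟩ := exists_epi_of_sep hfin hsep X
  obtain ⟨W, w, hw⟩ := isCok_of_epi p
  obtain ⟨m, q, _⟩ := exists_epi_of_sep hfin hsep W
  exact ⟨m, n, q ≫ w, p, hw.precomp q⟩

namespace IsGen
variable {G : C} (hG : IsGen k G)

include hG in
lemma exists_lift {b c : C} (p : b ⟶ c) [Epi p] (h : G ⟶ c) : ∃ h', h' ≫ p = h :=
  have := hG.projective
  ⟨Projective.factorThru h p, Projective.factorThru_comp h p⟩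

variable [HasFiniteBiproducts C] [IsNormalEpiCategory C]

include hG in
lemma map_ext {F : C ⥤ E} [F.Additive] (hF : RightExact F) {t : C} {Y : E} {s s' : F.obj t ⟶ Y} (h : ∀ g : G ⟶ t, F.map g ≫ s =
  F.map g ≫ s') : s = s' := by
  obtain ⟨m, n, f, p, hp⟩ := exists_presentation_of_sep hG.finite_hom hG.sep t
  refine (hF hp).epi _ _ ?_
  have e (s : F.obj t ⟶ Y) : F.map p ≫ s = ∑ j, F.map (biproduct.π _ j) ≫ F.map (biproduct.ι _ j ≫ p) ≫ s := by
    conv_lhs => rw [← id_comp p, ← biproduct.total, F.map_comp, F.map_sum, sum_comp, sum_comp]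
    simp only [Functor.map_comp, assoc]
  rw [e, e]
  simp only [h]

include hG in
lemma exists_desc {F : C ⥤ E} [F.Additive] (hF : RightExact F) {t : C} {Y : E} (σ : (G ⟶ t) →+ (F.obj G ⟶ Y)) (hσ : ∀ (e : G ⟶ G)
  (g : G ⟶ t), σ (e ≫ g) = F.map e ≫ σ g) : ∃ s : F.obj t ⟶ Y, ∀ g, F.map g ≫ s = σ g := by
  obtain ⟨m, n, f, p, hp⟩ := exists_presentation_of_sep hG.finite_hom hG.sep t
  let τ : F.obj (⨁ fun _ : Fin n => G) ⟶ Y := ∑ j, F.map (biproduct.π _ j) ≫ σ (biproduct.ι (fun _ => G) j ≫ p)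
  have hτ (h : G ⟶ ⨁ fun _ : Fin n => G) : F.map h ≫ τ = σ (h ≫ p) := by
    have : h ≫ p = ∑ j, (h ≫ biproduct.π _ j) ≫ biproduct.ι (fun _ => G) j ≫ p := by
      conv_lhs => rw [← id_comp p, ← biproduct.total, sum_comp, comp_sum]
      simp only [assoc]
    rw [this, map_sum, comp_sum]
    refine sum_congr rfl fun j _ => ?_
    rw [hσ, F.map_comp, assoc]
  obtain ⟨s, hs⟩ := (hF hp).exists_desc τ (by
    have : F.map f ≫ τ = ∑ i, F.map (biproduct.π _ i) ≫ F.map (biproduct.ι _ i ≫ f) ≫ τ := by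
      conv_lhs => rw [← id_comp f, ← biproduct.total, F.map_comp, F.map_sum, sum_comp, sum_comp]
      simp only [Functor.map_comp, assoc]
    rw [this]
    refine sum_eq_zero fun i _ => ?_
    rw [hτ, assoc, hp.w, comp_zero, map_zero, comp_zero])
  refine ⟨s, fun g => ?_⟩
  have := (hp.precomp (𝟙 _)).nonempty_isColimit
  have : Epi p := ⟨fun _ _ h => hp.epi _ _ h⟩
  obtain ⟨h, rfl⟩ := hG.exists_lift p g
  rw [F.map_comp, assoc, hs, hτ]

include hG in
lemma natTrans_ext {F F' : C ⥤ E} [F.Additive] (hF : RightExact F) {η θ : F ⟶ F'} (h : η.app G = θ.app G) : η = θ := by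
  ext t
  refine hG.map_ext hF fun g => ?_
  rw [η.naturality, θ.naturality, h]

include hG in
lemma exists_natTrans {F F' : C ⥤ E} [F.Additive] [F'.Additive] (hF : RightExact F) (θ : F.obj G ⟶ F'.obj G) (hθ : ∀ e : G ⟶ G,
  F.map e ≫ θ = θ ≫ F'.map e) : ∃ η : F ⟶ F', η.app G = θ := by
  let σ (t : C) : (G ⟶ t) →+ (F.obj G ⟶ F'.obj t) := (leftComp _ θ).comp F'.mapAddHom
  have h (t : C) (g : G ⟶ t) : σ t g = θ ≫ F'.map g := rfl
  choose s hs using fun t => hG.exists_desc hF (σ t) fun e g => by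
    rw [h, h, F'.map_comp, reassoc_of% hθ]
  refine ⟨{ app := s, naturality := fun x y f => hG.map_ext hF fun g => ?_ }, ?_⟩
  · rw [← assoc, ← F.map_comp, hs, ← assoc, hs, h, h, F'.map_comp, assoc]
  · have := hs G (𝟙 G)
    rwa [h, F.map_id, F'.map_id, id_comp, comp_id] at this
end IsGen
end

/-! ### Right exact functors with a given value at the generator -/

section
variable {C : Type u₁} [Category.{v₁} C] [Preadditive C] [Linear k C] {E : Type u₂} [Category.{v₂} E] [Preadditive E] [Linear k E]

/-- `σ` is the universal equivariant linear map from morphisms out of `G` to morphisms out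
of `X`. -/
structure IsUniv {G : C} {X : E} (ρ : (G ⟶ G) →ₗ[k] (X ⟶ X)) {t : C} {Y : E} (σ : (G ⟶ t) →ₗ[k] (X ⟶ Y)) : Prop where
  equivariant : ∀ e g, σ (e ≫ g) = ρ e ≫ σ g
  exists_desc : ∀ ⦃Z : E⦄ (τ : (G ⟶ t) →ₗ[k] (X ⟶ Z)), (∀ e g, τ (e ≫ g) = ρ e ≫ τ g) → ∃ s : Y ⟶ Z, ∀ g, σ g ≫ s = τ g
  ext : ∀ ⦃Z : E⦄ (s s' : Y ⟶ Z), (∀ g, σ g ≫ s = σ g ≫ s') → s = s'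

lemma exists_isUniv [HasFiniteBiproducts E] [HasCokernels E] {G : C} (hfin : ∀ X Y : C, Module.Finite k (X ⟶ Y)) {X : E} (ρ : (G ⟶
  G) →ₗ[k] (X ⟶ X)) (t : C) : ∃ (Y : E) (σ : (G ⟶ t) →ₗ[k] (X ⟶ Y)), IsUniv ρ σ := by
  have := hfin G t
  have := hfin G G
  let b := finBasis k (G ⟶ t)
  let a := finBasis k (G ⟶ G)
  let I := Fin (finrank k (G ⟶ t))
  let A := Fin (finrank k (G ⟶ G))
  let τ₀ : (G ⟶ t) →ₗ[k] (X ⟶ ⨁ fun _ : I => X) := b.constr k fun i => biproduct.ι (fun _ => X) i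
  have h₀ (i) : τ₀ (b i) = biproduct.ι (fun _ => X) i := b.constr_basis k _ i
  let f : (⨁ fun _ : A × I => X) ⟶ ⨁ fun _ : I => X := biproduct.desc fun x => τ₀ (a x.1 ≫ b x.2) - ρ (a x.1) ≫ τ₀ (b x.2)
  have hf {Z : E} (s : (⨁ fun _ : I => X) ⟶ Z) : f ≫ s = 0 ↔ ∀ e g, τ₀ (e ≫ g) ≫ s = ρ e ≫ τ₀ g ≫ s := by
    constructor
    · intro h
      let T₁ : (G ⟶ G) →ₗ[k] (G ⟶ t) →ₗ[k] (X ⟶ Z) := (Linear.comp G G t).compr₂ (rightComp k X s ∘ₗ τ₀)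
      let T₂ : (G ⟶ G) →ₗ[k] (G ⟶ t) →ₗ[k] (X ⟶ Z) := (Linear.comp X X Z).compl₁₂ ρ (rightComp k X s ∘ₗ τ₀)
      have : T₁ = T₂ := a.ext fun i => b.ext fun j => by
        have := biproduct.ι (fun _ => X) (i, j) ≫= h
        rw [biproduct.ι_desc_assoc, comp_zero, sub_comp, sub_eq_zero, assoc] at this
        exact this
      exact fun e g => LinearMap.congr_fun (LinearMap.congr_fun this e) g
    · intro h
      refine biproduct.hom_ext' _ _ fun x => ?_
      rw [biproduct.ι_desc_assoc, comp_zero, sub_comp, sub_eq_zero, h, assoc]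
  refine ⟨cokernel f, rightComp k X (cokernel.π f) ∘ₗ τ₀, (hf _).1 (cokernel.condition f), fun Z τ hτ => ?_, fun Z s s' h => ?_⟩
  · let s₀ : (⨁ fun _ : I => X) ⟶ Z := biproduct.desc fun i => τ (b i)
    have hs₀ (g : G ⟶ t) : τ₀ g ≫ s₀ = τ g := by
      have : rightComp k X s₀ ∘ₗ τ₀ = τ := b.ext fun i => by
        change τ₀ (b i) ≫ s₀ = τ (b i)
        rw [h₀, biproduct.ι_desc]
      exact LinearMap.congr_fun this g
    refine ⟨cokernel.desc f s₀ ((hf _).2 fun e g => by rw [hs₀, hs₀, hτ]), fun g => ?_⟩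
    change (τ₀ g ≫ cokernel.π f) ≫ _ = _
    rw [assoc, cokernel.π_desc, hs₀]
  · refine coequalizer.hom_ext (biproduct.hom_ext' _ _ fun i => ?_)
    have : (τ₀ (b i) ≫ cokernel.π f) ≫ s = (τ₀ (b i) ≫ cokernel.π f) ≫ s' := h (b i)
    rw [h₀, assoc, assoc] at this
    exact this

lemma IsCok.exists_lift_of_projective {C : Type u₁} [Category.{v₁} C] [Abelian C] {G a b c : C} [Projective G] {f : a ⟶ b} {g : b
  ⟶ c} (h : IsCok f g) (s : G ⟶ b) (hs : s ≫ g = 0) : ∃ s', s' ≫ f = s := by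
  have hS : (ShortComplex.mk f g h.w).Exact := ShortComplex.exact_of_g_is_cokernel _ h.nonempty_isColimit.some
  exact ⟨hS.liftFromProjective s hs, hS.liftFromProjective_comp s hs⟩
end

/-- There is a right exact functor whose value at a projective generator is a given object with
an action of the endomorphisms of the generator. -/
theorem IsGen.exists_functor {k : Type u} [Field k] {C : Type u₁} [Category.{v₁} C] [Abelian C] [Linear k C] {E : Type u₂}
  [Category.{v₂} E] [Preadditive E] [Linear k E] [HasFiniteBiproducts E] [HasCokernels E] {G : C} (hG : IsGen k G) {X : E} (ρ : (G
  ⟶ G) →ₗ[k] (X ⟶ X)) (hρ : ρ (𝟙 G) = 𝟙 X) (hρ' : ∀ e e', ρ (e ≫ e') = ρ e ≫ ρ e') : ∃ H : C ⥤ E, H.Additive ∧ H.Linear k ∧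
  RightExact H ∧ ∃ i : H.obj G ≅ X, ∀ e, H.map e ≫ i.hom = i.hom ≫ ρ e := by
  have := hG.projective
  choose Y σ hσ using fun t : C => exists_isUniv hG.finite_hom ρ t
  choose m hm using fun (t t' : C) (f : t ⟶ t') => (hσ t).exists_desc (σ t' ∘ₗ rightComp k G f) fun e g => by
      change σ t' ((e ≫ g) ≫ f) = ρ e ≫ σ t' (g ≫ f)
      rw [assoc, (hσ t').equivariant]
  replace hm {t t' : C} (f : t ⟶ t') (g : G ⟶ t) : σ t g ≫ m t t' f = σ t' (g ≫ f) := hm t t' f g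
  let H : C ⥤ E :=
    { obj := Y
      map {t t'} f := m t t' f
      map_id t := (hσ t).ext _ _ fun g => by rw [hm, comp_id, comp_id]
      map_comp f f' := (hσ _).ext _ _ fun g => by
        rw [hm, reassoc_of% hm, hm, assoc] }
  obtain ⟨j, hj⟩ := (hσ G).exists_desc ρ hρ'
  have hij : σ G (𝟙 G) ≫ j = 𝟙 X := by rw [hj, hρ]
  have hi (e : G ⟶ G) : ρ e ≫ σ G (𝟙 G) = σ G e := by
    rw [← (hσ G).equivariant, comp_id]
  refine ⟨H, ⟨fun {x y f f'} => (hσ x).ext _ _ fun g => ?_⟩, ⟨fun {x y} f r => (hσ x).ext _ _ fun g => ?_⟩, ?_, ⟨j, σ G (𝟙 G), (hσ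
    G).ext _ _ fun e => ?_, hij⟩, fun e => (hσ G).ext _ _ fun g => ?_⟩
  · change _ ≫ m _ _ _ = _ ≫ (m _ _ _ + m _ _ _)
    rw [hm, comp_add, comp_add, map_add, hm, hm]
  · change _ ≫ m _ _ _ = _ ≫ (r • m _ _ _)
    rw [hm, comp_smul, comp_smul, map_smul, hm]
  · intro a b c f g hfg
    have : Epi g := ⟨fun _ _ h => hfg.epi _ _ h⟩
    change IsCok (m _ _ f) (m _ _ g)
    refine ⟨(hσ a).ext _ _ fun h => ?_, fun Z s hs => ?_, fun Z s s' h => (hσ c).ext _ _ fun x => ?_⟩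
    · rw [reassoc_of% hm, hm, assoc, hfg.w, comp_zero, map_zero, comp_zero]
    · have hker (x : G ⟶ b) (hx : x ≫ g = 0) : σ b x ≫ s = 0 := by
        obtain ⟨y, rfl⟩ := hfg.exists_lift_of_projective x hx
        rw [← hm, assoc, hs, comp_zero]
      let l (x : G ⟶ c) : G ⟶ b := Projective.factorThru x g
      have hl (x : G ⟶ c) : l x ≫ g = x := Projective.factorThru_comp x g
      have hl' {x x' : G ⟶ b} (hx : x ≫ g = x' ≫ g) : σ b x ≫ s = σ b x' ≫ s := by
        rw [← sub_eq_zero, ← sub_comp, ← map_sub]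
        exact hker _ (by rw [sub_comp, hx, sub_self])
      obtain ⟨s', hs'⟩ := (hσ c).exists_desc (Z := Z)
        { toFun x := σ b (l x) ≫ s
          map_add' x y := by
            rw [← add_comp, ← map_add]
            exact hl' (by rw [add_comp, hl, hl, hl])
          map_smul' r x := by
            rw [RingHom.id_apply, ← smul_comp, ← map_smul]
            exact hl' (by rw [smul_comp, hl, hl]) } (fun e x => by
          change σ b (l (e ≫ x)) ≫ s = ρ e ≫ σ b (l x) ≫ s
          rw [← assoc, ← (hσ b).equivariant]
          exact hl' (by rw [assoc, hl, hl]))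
      refine ⟨s', (hσ b).ext _ _ fun x => ?_⟩
      rw [reassoc_of% hm, hs']
      exact hl' (hl _)
    · obtain ⟨y, rfl⟩ := hG.exists_lift g x
      rw [← hm, assoc, assoc, h]
  · rw [reassoc_of% hj, hi]
    exact (comp_id _).symm
  · change _ ≫ m _ _ _ ≫ j = _ ≫ j ≫ _
    rw [reassoc_of% hm, hj, reassoc_of% hj, hρ']
end Generator

/-! ### Finite linear categories and projective generators -/

section
lemma projective_biproduct {C : Type u₁} [Category.{v₁} C] [Preadditive C] {n : ℕ} (P : Fin n → C) [HasBiproduct P] (h : ∀ i,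
  Projective (P i)) : Projective (⨁ P) where
  factors f e _ := ⟨biproduct.desc fun i => Projective.factorThru (biproduct.ι P i ≫ f) e, biproduct.hom_ext' _ _ fun i =>
    by simp⟩

variable {C : Type u₁} [Category.{v₁} C] [Abelian C] [Linear k C] {G : C}

lemma exists_iso_of_common_kernel {X : C} [Simple X] {n : ℕ} : ∀ {A : C} (S : Fin n → C) (q : ∀ i, A ⟶ S i) (r : A ⟶ X), (∀ i,
  Simple (S i)) → r ≠ 0 → (∀ ⦃T : C⦄ (t : T ⟶ A), (∀ i, t ≫ q i = 0) → t ≫ r = 0) → ∃ i, Nonempty (X ≅ S i) := by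
  induction n with
  | zero =>
    intro A S q r _ hr h
    exact absurd (by simpa using h (𝟙 A) (fun i => i.elim0)) hr
  | succ n ih =>
    intro A S q r hS hr h
    by_cases hκ : kernel.ι (q (Fin.last n)) ≫ r = 0
    · have := hS (Fin.last n)
      by_cases hq : q (Fin.last n) = 0
      · have hk : IsIso (kernel.ι (q (Fin.last n))) := by
          rw [hq]
          infer_instance
        exact absurd ((cancel_epi _).1 (hκ.trans comp_zero.symm)) hr
      · have := epi_of_nonzero_to_simple hq
        obtain ⟨W, w, hw⟩ := isCok_of_epi (q (Fin.last n))
        obtain ⟨s, hs⟩ := hw.exists_desc r (by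
          rw [← kernel.lift_ι (q (Fin.last n)) w hw.w, assoc, hκ, comp_zero])
        have hs' : s ≠ 0 := by
          rintro rfl
          exact hr (by rw [← hs, comp_zero])
        have := isIso_of_hom_simple hs'
        exact ⟨Fin.last n, ⟨(asIso s).symm⟩⟩
    · obtain ⟨i, hi⟩ := ih (fun i => S i.castSucc) (fun i => kernel.ι (q (Fin.last n)) ≫ q i.castSucc) (kernel.ι (q (Fin.last n))
        ≫ r) (fun i => hS _) hκ (fun T t ht => by
          rw [← assoc]
          refine h _ fun i => ?_
          refine Fin.lastCases ?_ (fun i => ?_) i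
          · rw [assoc, kernel.condition, comp_zero]
          · rw [assoc, ht])
      exact ⟨i.castSucc, hi⟩

namespace IsGen
variable (hG : IsGen k G)

include hG in
lemma exists_hom_ne_zero {X : C} [Simple X] : ∃ f : G ⟶ X, f ≠ 0 := by
  by_contra! h
  exact id_nonzero X (hG.sep _ fun f => by rw [h f, zero_comp])

include hG in
lemma finite_simples : ∃ (n : ℕ) (S : Fin n → C), ∀ X : C, Simple X → ∃ i, Nonempty (X ≅ S i) := by
  have := hG.finite_hom
  let L := Σ n : ℕ, Σ' S : Fin n → C, (∀ i, Simple (S i)) ×' (∀ i, G ⟶ S i)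
  let V (l : L) : Submodule k (G ⟶ G) := ⨅ i, LinearMap.ker (rightComp k G (l.2.2.2 i))
  have hV (l : L) (e : G ⟶ G) : e ∈ V l ↔ ∀ i, e ≫ l.2.2.2 i = 0 := by
    simp [V, Submodule.mem_iInf, LinearMap.mem_ker]
  let l₀ : L := ⟨0, Fin.elim0, fun i => i.elim0, fun i => i.elim0⟩
  have : Nonempty L := ⟨l₀⟩
  let l := Function.argmin fun l : L => finrank k (V l)
  have hmin (l' : L) : finrank k (V l) ≤ finrank k (V l') := Function.argmin_le (fun l : L => finrank k (V l)) l'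
  refine ⟨l.1, l.2.1, fun X hX => ?_⟩
  obtain ⟨r, hr⟩ := hG.exists_hom_ne_zero (X := X)
  refine exists_iso_of_common_kernel l.2.1 l.2.2.2 r l.2.2.1 hr fun T t ht => ?_
  let l' : L := ⟨l.1 + 1, Fin.snoc (α := fun _ => C) l.2.1 X, fun i => by
      refine Fin.lastCases ?_ (fun i => ?_) i
      · rw [Fin.snoc_last]
        exact hX
      · rw [Fin.snoc_castSucc]
        exact l.2.2.1 i, fun i =>
      Fin.lastCases (motive := fun i => G ⟶ Fin.snoc (α := fun _ => C) l.2.1 X i) (r ≫ eqToHom (Fin.snoc_last (α := fun _ => C) X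
        l.2.1).symm)
        (fun i => l.2.2.2 i ≫ eqToHom (Fin.snoc_castSucc (α := fun _ => C) X l.2.1 i).symm) i⟩
  have hl' (e : G ⟶ G) : e ∈ V l' ↔ e ∈ V l ∧ e ≫ r = 0 := by
    rw [hV, hV]
    have hz {Y Z : C} (h : Y = Z) (f : G ⟶ Y) : f ≫ eqToHom h = 0 ↔ f = 0 := by
      subst h
      simp
    constructor
    · refine fun h => ⟨fun i => ?_, ?_⟩
      · have := h i.castSucc
        simp only [l', Fin.lastCases_castSucc] at this
        rwa [← assoc, hz] at this
      · have := h (Fin.last _)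
        simp only [l', Fin.lastCases_last] at this
        rwa [← assoc, hz] at this
    · refine fun h i => Fin.lastCases ?_ (fun i => ?_) i
      · simp only [l', Fin.lastCases_last]
        rw [← assoc, hz]
        exact h.2
      · simp only [l', Fin.lastCases_castSucc]
        rw [← assoc, hz]
        exact h.1 i
  have heq : V l' = V l := Submodule.eq_of_le_of_finrank_le (fun e he => ((hl' e).1 he).1) (hmin l')
  refine hG.sep _ fun f => ?_
  by_contra hf
  have key (g : G ⟶ G) (hg : ∀ i, g ≫ l.2.2.2 i = 0) : g ≫ r = 0 := ((hl' g).1 (heq ▸ (hV l g).2 hg)).2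
  exact hf (by
    rw [← assoc]
    exact key _ fun i => by rw [assoc, ht, comp_zero])

def factors (k : Type u) [Field k] [Linear k C] (G : C) {X : C} (A : Subobject X) : Submodule k (G ⟶ X) := LinearMap.range
  (rightComp k G A.arrow)

include hG in
lemma factors_strictMono (X : C) : StrictMono (factors k G : Subobject X → _) := by
  have hle {A B : Subobject X} (h : A ≤ B) : factors k G A ≤ factors k G B := by
    rintro _ ⟨f, rfl⟩
    exact ⟨f ≫ Subobject.ofLE A B h, by simp⟩
  refine fun A B h => lt_of_le_of_ne (hle h.le) fun heq => h.not_ge ?_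
  have h₀ : B.arrow ≫ cokernel.π A.arrow = 0 := hG.sep _ fun f => by
    obtain ⟨g, hg⟩ : f ≫ B.arrow ∈ factors k G A := heq ▸ ⟨f, rfl⟩
    have hg : g ≫ A.arrow = f ≫ B.arrow := hg
    rw [← assoc, ← hg, assoc, cokernel.condition, comp_zero]
  exact Subobject.le_of_comm (Abelian.monoLift A.arrow B.arrow h₀) (Abelian.monoLift_comp _ _ _)

include hG in
lemma finite_length (X : C) : IsArtinianObject X ∧ IsNoetherianObject X := by
  have := hG.finite_hom G X
  exact ⟨⟨(hG.factors_strictMono X).wellFoundedLT⟩, ⟨(hG.factors_strictMono X).wellFoundedGT⟩⟩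

include hG in
lemma enoughProjectives : EnoughProjectives C where
  presentation X := by
    have := Abelian.hasFiniteBiproducts (C := C)
    obtain ⟨n, p, _⟩ := exists_epi_of_sep hG.finite_hom hG.sep X
    have := projective_biproduct (fun _ : Fin n => G) fun _ => hG.projective
    exact ⟨⟨_, p⟩⟩
end IsGen

lemma exists_isGen [EnoughProjectives C] (hfin : ∀ X Y : C, Module.Finite k (X ⟶ Y)) (hart : ∀ X : C, IsArtinianObject X) {n : ℕ}
  (S : Fin n → C) (hS : ∀ X : C, Simple X → ∃ i, Nonempty (X ≅ S i)) : ∃ G : C, IsGen k G := by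
  have := Abelian.hasFiniteBiproducts (C := C)
  refine ⟨⨁ fun i => Projective.over (S i), hfin, projective_biproduct _ fun i => inferInstance, fun X Y t ht => ?_⟩
  by_contra hne
  have hI : ¬IsZero (image t) := fun h => hne (by
    rw [← image.fac t, h.eq_of_src (image.ι t) 0, comp_zero])
  have := hart (image t)
  obtain ⟨i, ⟨e⟩⟩ := hS (simpleSubobject hI) inferInstance
  let f : Projective.over (S i) ⟶ image t := Projective.π (S i) ≫ e.inv ≫ simpleSubobjectArrow hI
  have h := ht (biproduct.π _ i ≫ Projective.factorThru f (factorThruImage t))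
  rw [assoc] at h
  have h' : biproduct.ι (fun i => Projective.over (S i)) i ≫ biproduct.π _ i ≫
      Projective.factorThru f (factorThruImage t) ≫ t = 0 := by rw [h, comp_zero]
  rw [biproduct.ι_π_self_assoc] at h'
  have hft : f ≫ image.ι t = 0 := by
    rw [← Projective.factorThru_comp f (factorThruImage t), assoc, image.fac, h']
  have h₁ : simpleSubobjectArrow hI = 0 := by
    have : f = 0 := by rwa [← cancel_mono (image.ι t), zero_comp]
    rwa [← cancel_epi e.inv, ← cancel_epi (Projective.π (S i)), comp_zero, comp_zero]
  exact id_nonzero (simpleSubobject hI) (by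
    rw [← cancel_mono (simpleSubobjectArrow hI), h₁, comp_zero, comp_zero])
end

namespace AddCat
abbrev IsAbelian.abelian {C : AddCat k} (h : C.IsAbelian) : Abelian C :=
  { C.preadditive with
    toIsNormalMonoCategory := h.normalMono
    toIsNormalEpiCategory := h.normalEpi
    has_finite_products := inferInstance
    has_kernels := h.hasKernels
    has_cokernels := h.hasCokernels }

lemma isFinite_of_isGen {C : AddCat k} (h : C.IsAbelian) {G : C} (hG : IsGen k G) : C.IsFinite :=
  letI := h.abelian
  { isAbelian := h
    finite_hom := hG.finite_hom
    finite_length := hG.finite_length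
    enoughProjectives := hG.enoughProjectives
    finite_simples := hG.finite_simples }

lemma IsFinite.exists_isGen {C : AddCat k} (h : C.IsFinite) : ∃ G : C, IsGen k G := by
  letI := h.isAbelian.abelian
  have := h.enoughProjectives
  obtain ⟨n, S, hS⟩ := h.finite_simples
  exact TwoVec.exists_isGen h.finite_hom (fun X => (h.finite_length X).1) S hS

lemma isAbelian_of_regular {C : AddCat k} (h : Regular C) [IsIdempotentComplete C] : C.IsAbelian where
  hasKernels := h.hasKernels
  hasCokernels := h.hasCokernels
  normalMono := h.isNormalMonoCategory
  normalEpi := h.isNormalEpiCategory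
end AddCat

/-! ### Natural transformations of right exact functors of two variables -/

section
variable {C : Type u₁} [Category.{v₁} C] [Preadditive C] [Linear k C] {D : Type u₂} [Category.{v₂} D] [Preadditive D] [Linear k D]
  {E : Type u₃} [Category.{v₃} E] [Preadditive E] [Linear k E]

lemma RightExact.of_flip {F : C ⥤ D ⥤ E} (h : ∀ d, RightExact (F.flip.obj d)) : RightExact F := by
  intro a b c f g hfg
  have hd (d : D) : IsCok ((F.map f).app d) ((F.map g).app d) := h d hfg
  refine ⟨?_, fun Z t ht => ?_, fun Z s s' hs => ?_⟩
  · ext d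
    exact (hd d).w
  · choose s hs using fun d => (hd d).exists_desc (t.app d) (congrArg (fun t => t.app d) ht)
    refine ⟨{ app := s, naturality := fun d d' m => (hd d).epi _ _ ?_ }, ?_⟩
    · rw [reassoc_of% hs, ← NatTrans.naturality_assoc, hs, t.naturality]
    · ext d
      exact hs d
  · ext d
    exact (hd d).epi _ _ (congrArg (fun t => t.app d) hs)

variable [HasFiniteBiproducts C] [IsNormalEpiCategory C] [HasFiniteBiproducts D] [IsNormalEpiCategory D] {P : C} {Q : D} {F F' : C
  ⥤ D ⥤ E}

lemma IsGen.natTrans_ext₂ (hP : IsGen k P) (hQ : IsGen k Q) (hF : Bilin k F) (h₁ : ∀ c, RightExact (F.obj c)) (h₂ : ∀ d,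
  RightExact (F.flip.obj d)) {η θ : F ⟶ F'} (h : (η.app P).app Q = (θ.app P).app Q) : η = θ := by
  have := hF.additive
  have := hF.obj_additive P
  exact hP.natTrans_ext (RightExact.of_flip h₂) (hQ.natTrans_ext (h₁ P) h)

lemma IsGen.exists_natTrans₂ (hP : IsGen k P) (hQ : IsGen k Q) (hF : Bilin k F) (hF' : Bilin k F') (h₁ : ∀ c, RightExact (F.obj
  c)) (h₂ : ∀ d, RightExact (F.flip.obj d)) (θ : (F.obj P).obj Q ⟶ (F'.obj P).obj Q) (hθ : ∀ e : P ⟶ P, (F.map e).app Q ≫ θ = θ ≫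
  (F'.map e).app Q) (hθ' : ∀ e : Q ⟶ Q, (F.obj P).map e ≫ θ = θ ≫ (F'.obj P).map e) : ∃ η : F ⟶ F', (η.app P).app Q = θ := by
  have := hF.additive
  have := hF.obj_additive P
  have := hF'.additive
  have := hF'.obj_additive P
  obtain ⟨ζ, hζ⟩ := hQ.exists_natTrans (h₁ P) θ hθ'
  obtain ⟨η, hη⟩ := hP.exists_natTrans (RightExact.of_flip h₂) ζ fun e => hQ.natTrans_ext (h₁ P)
    (by rw [NatTrans.comp_app, NatTrans.comp_app, hζ, hθ])
  exact ⟨η, by rw [hη, hζ]⟩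
end

/-! ### Finitely generated modules over finite-dimensional algebras -/

section FG
variable {A : Type u} [Ring A] [Algebra k A]

lemma isCok_of_exact {a b c : FGModuleCat.{u} A} (f : a ⟶ b) (g : b ⟶ c) (h : Function.Exact f.hom.hom g.hom.hom) (hg :
  Function.Surjective g.hom.hom) : IsCok f g where
  w := by
    ext x
    exact h.apply_apply_eq_zero x
  exists_desc z t ht := by
    have hk : LinearMap.ker g.hom.hom ≤ LinearMap.ker t.hom.hom := fun x hx => by
      obtain ⟨y, rfl⟩ := (h x).1 hx
      exact congrArg (fun s => s.hom.hom y) ht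
    refine ⟨FGModuleCat.ofHom (((LinearMap.ker g.hom.hom).liftQ t.hom.hom hk) ∘ₗ (g.hom.hom.quotKerEquivOfSurjective
      hg).symm.toLinearMap), ?_⟩
    ext x
    have : (g.hom.hom.quotKerEquivOfSurjective hg).symm (g.hom.hom x) = (LinearMap.ker g.hom.hom).mkQ x := by
      rw [LinearEquiv.symm_apply_eq]
      rfl
    change (LinearMap.ker g.hom.hom).liftQ t.hom.hom hk ((g.hom.hom.quotKerEquivOfSurjective hg).symm (g.hom.hom x)) = _
    rw [this]
    rfl
  epi z s s' hs := by
    ext x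
    obtain ⟨y, rfl⟩ := hg x
    exact congrArg (fun s => s.hom.hom y) hs

lemma fg_surjective [IsNoetherianRing A] {a b : FGModuleCat.{u} A} (f : a ⟶ b) [Epi f] : Function.Surjective f.hom.hom :=
  (ModuleCat.epi_iff_surjective ((forget₂ (FGModuleCat A) (ModuleCat A)).map f)).1 inferInstance

lemma fg_finite_hom [Module.Finite k A] (M N : FGModuleCat.{u} A) : Module.Finite k (M ⟶ N) := by
  letI := ModuleCat.moduleOfAlgebraModule (k := k) M.obj
  letI := ModuleCat.moduleOfAlgebraModule (k := k) N.obj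
  have := ModuleCat.isScalarTower_of_algebra_moduleCat (k := k) M.obj
  have := ModuleCat.isScalarTower_of_algebra_moduleCat (k := k) N.obj
  have : Module.Finite A M.obj := M.property
  have : Module.Finite A N.obj := N.property
  have : Module.Finite k M.obj := Module.Finite.trans A _
  have : Module.Finite k N.obj := Module.Finite.trans A _
  let T : (M ⟶ N) →ₗ[k] (M.obj →ₗ[k] N.obj) :=
    { toFun f := f.hom.hom.restrictScalars k
      map_add' _ _ := rfl
      map_smul' _ _ := rfl }
  exact Module.Finite.of_injective T fun f g h => by
    ext x
    exact LinearMap.congr_fun h x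

lemma isGen_of_bijective [Module.Finite k A] [IsNoetherianRing A] (M : FGModuleCat.{u} A) (x : M.obj) (hx : Function.Bijective fun
  a : A => a • x) : IsGen k M := by
  let e : A ≃ₗ[A] M.obj := LinearEquiv.ofBijective (toSpanSingleton A M.obj x) hx
  have he : e 1 = x := one_smul A x
  have hom (N : FGModuleCat.{u} A) (y : N.obj) : ∃ f : M ⟶ N, f.hom.hom x = y := by
    refine ⟨FGModuleCat.ofHom (toSpanSingleton A N.obj y ∘ₗ e.symm.toLinearMap), ?_⟩
    change e.symm x • y = y
    rw [← he, e.symm_apply_apply, one_smul]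
  have ext {N : FGModuleCat.{u} A} {f g : M ⟶ N} (h : f.hom.hom x = g.hom.hom x) : f = g := by
    ext y
    obtain ⟨a, rfl⟩ := hx.2 y
    exact (map_smul f.hom.hom a x).trans ((congrArg _ h).trans (map_smul g.hom.hom a x).symm)
  refine ⟨fg_finite_hom, ⟨fun {N N'} f p hp => ?_⟩, fun N N' t ht => ?_⟩
  · obtain ⟨y, hy⟩ := fg_surjective p (f.hom.hom x)
    obtain ⟨g, hg⟩ := hom N y
    exact ⟨g, ext ((congrArg p.hom.hom hg).trans hy)⟩
  · ext y
    obtain ⟨f, rfl⟩ := hom N y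
    exact congrArg (fun s => s.hom.hom x) (ht f)
end FG

/-! ### Modules of morphisms -/

section Coyoneda
variable {L : Type u₁} [Category.{u} L] [Preadditive L] [Linear k L]

lemma isNoetherianRing_end (hfin : ∀ Y Y' : L, Module.Finite k (Y ⟶ Y')) (X : L) : Module.Finite k (End X)ᵐᵒᵖ ∧ IsNoetherianRing
  (End X)ᵐᵒᵖ := by
  have : Module.Finite k (End X) := hfin X X
  have : Module.Finite k (End X)ᵐᵒᵖ := Module.Finite.equiv (MulOpposite.opLinearEquiv k)
  exact ⟨this, isNoetherian_of_tower k inferInstance⟩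

/-- The functor `Y ↦ (X ⟶ Y)` to right modules over the endomorphisms of `X`. -/
def coy (hfin : ∀ Y Y' : L, Module.Finite k (Y ⟶ Y')) (X : L) : L ⥤ FGModuleCat.{u} (End X)ᵐᵒᵖ := (ModuleCat.isFG (End X)ᵐᵒᵖ).lift
  (preadditiveCoyonedaObj X) fun Y => by
    have := hfin X Y
    have : IsScalarTower k (End X)ᵐᵒᵖ (X ⟶ Y) := ⟨fun r a f => smul_comp X X Y r a.unop f⟩
    exact Module.Finite.of_restrictScalars_finite k (End X)ᵐᵒᵖ (X ⟶ Y)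

variable (hfin : ∀ Y Y' : L, Module.Finite k (Y ⟶ Y')) (X : L)

lemma algebraMap_comp {Y : L} (r : k) (f : X ⟶ Y) : (algebraMap k (End X) r : X ⟶ X) ≫ f = r • f := by
  rw [Algebra.algebraMap_eq_smul_one]
  exact (smul_comp _ _ _ _ _ _).trans (congrArg _ (id_comp _))

instance : (coy hfin X).Additive where
  map_add {Y Z f g} := by
    ext x
    exact comp_add _ _ _ _ _ _

instance : (coy hfin X).Linear k where
  map_smul {Y Z} f r := by
    ext x
    exact (comp_smul _ _ _ (show X ⟶ Y from x) r f).trans (algebraMap_comp X r _).symm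

lemma coy_isGen : IsGen k ((coy hfin X).obj X) := by
  obtain ⟨_, _⟩ := isNoetherianRing_end hfin X
  refine isGen_of_bijective _ (𝟙 X) ⟨fun a b h => MulOpposite.unop_injective ?_, fun f => ⟨.op f, ?_⟩⟩
  · exact (comp_id a.unop).symm.trans (h.trans (comp_id b.unop))
  · exact comp_id f

def coyEnd : ((coy hfin X).obj X ⟶ (coy hfin X).obj X) →ₗ[k] (X ⟶ X) where
  toFun e := e.hom.hom (𝟙 X)
  map_add' _ _ := rfl
  map_smul' r e := algebraMap_comp X r (show X ⟶ X from e.hom.hom (𝟙 X))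

lemma map_coyEnd (e : (coy hfin X).obj X ⟶ (coy hfin X).obj X) : (coy hfin X).map (coyEnd hfin X e) = e := by
  refine FGModuleCat.hom_ext (LinearMap.ext fun f : X ⟶ X => ?_)
  have := map_smul e.hom.hom (MulOpposite.op (show End X from f)) (𝟙 X : X ⟶ X)
  have h : (MulOpposite.op (show End X from f)) • (𝟙 X : X ⟶ X) = f := comp_id f
  rw [h] at this
  exact this.symm

lemma coyEnd_map (f : X ⟶ X) : coyEnd hfin X ((coy hfin X).map f) = f := id_comp f

lemma coyEnd_comp (e e' : (coy hfin X).obj X ⟶ (coy hfin X).obj X) : coyEnd hfin X (e ≫ e') = coyEnd hfin X e ≫ coyEnd hfin X e'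
  := by
  conv_lhs => rw [← map_coyEnd hfin X e, ← map_coyEnd hfin X e', ← Functor.map_comp, coyEnd_map]
end Coyoneda

/-! ### Existence of the Deligne tensor product -/

section
variable {C : Type u₁} [Category.{u} C] [Preadditive C] [Linear k C] {D : Type u₂} [Category.{u} D] [Preadditive D] [Linear k D]

lemma LinTensor.finite_hom (hC : ∀ X Y : C, Module.Finite k (X ⟶ Y)) (hD : ∀ X Y : D, Module.Finite k (X ⟶ Y)) (X Y : LinTensor k
  C D) : Module.Finite k (X ⟶ Y) := by
  have := hC X.fst Y.fst
  have := hD X.snd Y.snd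
  exact inferInstanceAs (Module.Finite k ((X.fst ⟶ Y.fst) ⊗[k] (X.snd ⟶ Y.snd)))

lemma LinTensor.comp_tmul_id {P : C} {Q : D} {c c' : C} {d : D} (f : c ⟶ c') (x : (P ⟶ c) ⊗[k] (Q ⟶ d)) : (show (⟨P, Q⟩ :
  LinTensor k C D) ⟶ ⟨c, d⟩ from x) ≫ ((LinTensor.pair k C D).map f).app d = (rightComp k P f).rTensor (Q ⟶ d) x := by
  induction x using TensorProduct.induction_on with
  | zero => exact zero_comp.trans (map_zero _).symm
  | add x y hx hy =>
    exact (add_comp _ _ _ _ _ _).trans ((congrArg₂ _ hx hy).trans (map_add _ _ _).symm)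
  | tmul a b =>
    refine (LinTensor.tmul_comp k (X := ⟨P, Q⟩) (Y := ⟨c, d⟩) (Z := ⟨c', d⟩) a b f (𝟙 d)).trans ?_
    rw [comp_id]
    rfl

lemma LinTensor.comp_id_tmul {P : C} {Q : D} {c : C} {d d' : D} (g : d ⟶ d') (x : (P ⟶ c) ⊗[k] (Q ⟶ d)) : (show (⟨P, Q⟩ :
  LinTensor k C D) ⟶ ⟨c, d⟩ from x) ≫ ((LinTensor.pair k C D).obj c).map g = (rightComp k Q g).lTensor (P ⟶ c) x := by
  induction x using TensorProduct.induction_on with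
  | zero => exact zero_comp.trans (map_zero _).symm
  | add x y hx hy =>
    exact (add_comp _ _ _ _ _ _).trans ((congrArg₂ _ hx hy).trans (map_add _ _ _).symm)
  | tmul a b =>
    refine (LinTensor.tmul_comp k (X := ⟨P, Q⟩) (Y := ⟨c, d⟩) (Z := ⟨c, d'⟩) a b (𝟙 c) g).trans ?_
    rw [comp_id]
    rfl
end

lemma comp_inv_of_comp_hom {C : Type u₁} [Category.{v₁} C] {a b : C} {i : a ≅ b} {s : a ⟶ a} {t : b ⟶ b} (h : s ≫ i.hom = i.hom ≫
  t) : t ≫ i.inv = i.inv ≫ s := by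
  rw [Iso.comp_inv_eq, assoc, h, Iso.inv_hom_id_assoc]

lemma rightComp_exact {k : Type u} [Field k] {C : Type u₁} [Category.{u} C] [Abelian C] [Linear k C] {P a b c : C} [Projective P]
  {f : a ⟶ b} {g : b ⟶ c} (h : IsCok f g) : Function.Exact (rightComp k P f) (rightComp k P g) ∧ Function.Surjective (rightComp k
  P g) := by
  have : Epi g := ⟨fun _ _ h' => h.epi _ _ h'⟩
  refine ⟨fun x => ⟨fun hx => h.exists_lift_of_projective x hx, ?_⟩, fun x => ⟨Projective.factorThru x g,
    Projective.factorThru_comp x g⟩⟩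
  rintro ⟨y, rfl⟩
  change (y ≫ f) ≫ g = 0
  rw [assoc, h.w, comp_zero]

section
variable {C : Type u₁} [Category.{u} C] [Abelian C] [Linear k C] {D : Type u₂} [Category.{u} D] [Abelian D] [Linear k D] (hC : ∀ X
  Y : C, Module.Finite k (X ⟶ Y)) (hD : ∀ X Y : D, Module.Finite k (X ⟶ Y)) (P : C) (Q : D)

def coyPair : C ⥤ D ⥤ FGModuleCat.{u} (End (⟨P, Q⟩ : LinTensor k C D))ᵐᵒᵖ := LinTensor.pair k C D ⋙ (whiskeringRight D _ _).obj
  (coy (LinTensor.finite_hom hC hD) ⟨P, Q⟩)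

lemma coyPair_bilin : Bilin k (coyPair hC hD P Q) := LinTensor.pair_bilin.postcomp _

lemma coyPair_left [Projective P] (d : D) : RightExact ((coyPair hC hD P Q).flip.obj d) := by
  intro a b c f g h
  obtain ⟨h₁, h₂⟩ := rightComp_exact (k := k) (P := P) h
  refine isCok_of_exact _ _ ?_ ?_
  · intro (x : (P ⟶ b) ⊗[k] (Q ⟶ d))
    have := rTensor_exact (Q ⟶ d) h₁ h₂ x
    exact ⟨fun hx => (this.1 ((LinTensor.comp_tmul_id g x).symm.trans hx)).imp fun y hy => (LinTensor.comp_tmul_id f y).trans hy,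
      fun ⟨y, hy⟩ => (LinTensor.comp_tmul_id g x).trans (this.2 ⟨y, (LinTensor.comp_tmul_id f y).symm.trans hy⟩)⟩
  · intro (x : (P ⟶ c) ⊗[k] (Q ⟶ d))
    obtain ⟨y, hy⟩ := LinearMap.rTensor_surjective (Q ⟶ d) h₂ x
    exact ⟨y, (LinTensor.comp_tmul_id g y).trans hy⟩

lemma coyPair_right [Projective Q] (c : C) : RightExact ((coyPair hC hD P Q).obj c) := by
  intro a b d f g h
  obtain ⟨h₁, h₂⟩ := rightComp_exact (k := k) (P := Q) h
  refine isCok_of_exact _ _ ?_ ?_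
  · intro (x : (P ⟶ c) ⊗[k] (Q ⟶ b))
    have := lTensor_exact (P ⟶ c) h₁ h₂ x
    exact ⟨fun hx => (this.1 ((LinTensor.comp_id_tmul g x).symm.trans hx)).imp fun y hy => (LinTensor.comp_id_tmul f y).trans hy,
      fun ⟨y, hy⟩ => (LinTensor.comp_id_tmul g x).trans (this.2 ⟨y, (LinTensor.comp_id_tmul f y).symm.trans hy⟩)⟩
  · intro (x : (P ⟶ c) ⊗[k] (Q ⟶ d))
    obtain ⟨y, hy⟩ := LinearMap.lTensor_surjective (P ⟶ c) h₂ x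
    exact ⟨y, (LinTensor.comp_id_tmul g y).trans hy⟩

variable {P Q} {E : Type u₃} [Category.{v₃} E] [Preadditive E] [Linear k E]

lemma coyPair_bijective (hP : IsGen k P) (hQ : IsGen k Q) {H H' : FGModuleCat.{u} (End (⟨P, Q⟩ : LinTensor k C D))ᵐᵒᵖ ⥤ E}
  [H.Additive] [H.Linear k] [H'.Additive] (hH : RightExact H) : Function.Bijective fun η : H ⟶ H' => Functor.whiskerLeft (coyPair
  hC hD P Q) ((whiskeringRight D _ E).map η) := by
  have := hP.projective
  have := hQ.projective
  have := Abelian.hasFiniteBiproducts (C := C)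
  have := Abelian.hasFiniteBiproducts (C := D)
  let X : LinTensor k C D := ⟨P, Q⟩
  let Z := coy (LinTensor.finite_hom hC hD) X
  have hX : IsGen k (Z.obj X) := coy_isGen _ X
  obtain ⟨_, _⟩ := isNoetherianRing_end (LinTensor.finite_hom hC hD) X
  have : HasFiniteBiproducts (FGModuleCat.{u} (End X)ᵐᵒᵖ) := Abelian.hasFiniteBiproducts
  refine ⟨fun η θ h => hX.natTrans_ext hH (congrArg (fun t => (t.app P).app Q) h), fun θ => ?_⟩
  obtain ⟨ζ, hζ⟩ := LinTensor.exists_natTrans (F := Z ⋙ H) (G := Z ⋙ H') inferInstance inferInstance θ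
  obtain ⟨η, hη⟩ := hX.exists_natTrans (F' := H') hH (ζ.app X) fun e => by
    rw [← map_coyEnd _ X e]
    exact ζ.naturality _
  refine ⟨η, hP.natTrans_ext₂ hQ ((coyPair_bilin hC hD P Q).postcomp H) (fun c => (coyPair_right hC hD P Q c).comp hH) (fun d =>
    (coyPair_left hC hD P Q d).comp hH) ?_⟩
  exact hη.trans (hζ X)

lemma coyPair_exists_lift [HasFiniteBiproducts E] [HasCokernels E] (hP : IsGen k P) (hQ : IsGen k Q) {F : C ⥤ D ⥤ E} (hF : Bilin k
  F) (h₁ : ∀ c, RightExact (F.obj c)) (h₂ : ∀ d, RightExact (F.flip.obj d)) : ∃ H : FGModuleCat.{u} (End (⟨P, Q⟩ : LinTensor k C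
  D))ᵐᵒᵖ ⥤ E, H.Additive ∧ H.Linear k ∧ RightExact H ∧ Nonempty (coyPair hC hD P Q ⋙ (whiskeringRight D _ E).obj H ≅ F) := by
  have := hP.projective
  have := hQ.projective
  have := Abelian.hasFiniteBiproducts (C := C)
  have := Abelian.hasFiniteBiproducts (C := D)
  let X : LinTensor k C D := ⟨P, Q⟩
  let Z := coy (LinTensor.finite_hom hC hD) X
  have hX : IsGen k (Z.obj X) := coy_isGen _ X
  obtain ⟨_, _⟩ := isNoetherianRing_end (LinTensor.finite_hom hC hD) X
  obtain ⟨H, hadd, hlin, hH, i, hi⟩ := hX.exists_functor (LinTensor.liftMap hF X X ∘ₗ coyEnd (LinTensor.finite_hom hC hD) X)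
    ((LinTensor.lift hF).map_id X) (fun e e' => (congrArg _ (coyEnd_comp _ X e e')).trans ((LinTensor.lift hF).map_comp _ _))
  have hi' (r : X ⟶ X) : H.map (Z.map r) ≫ i.hom = i.hom ≫ LinTensor.liftMap hF X X r := (hi (Z.map r)).trans (congrArg (fun t =>
    i.hom ≫ LinTensor.liftMap hF X X t) (coyEnd_map _ X r))
  have hb := (coyPair_bilin hC hD P Q).postcomp H
  have hb₁ (c) := (coyPair_right hC hD P Q c).comp hH
  have hb₂ (d) := (coyPair_left hC hD P Q d).comp hH
  have e₁ (e : P ⟶ P) : LinTensor.liftMap hF X X (LinTensor.tmul k (X := X) (Y := X) e (𝟙 Q)) = (F.map e).app Q := by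
    rw [LinTensor.liftMap_tmul, CategoryTheory.Functor.map_id, comp_id]
  have e₂ (e : Q ⟶ Q) : LinTensor.liftMap hF X X (LinTensor.tmul k (X := X) (Y := X) (𝟙 P) e) = (F.obj P).map e := by
    rw [LinTensor.liftMap_tmul, CategoryTheory.Functor.map_id, NatTrans.id_app, id_comp]
  have n₁ (e : P ⟶ P) : H.map (((coyPair hC hD P Q).map e).app Q) ≫ i.hom = i.hom ≫ (F.map e).app Q := (hi' _).trans (congrArg _
    (e₁ e))
  have n₂ (e : Q ⟶ Q) : H.map (((coyPair hC hD P Q).obj P).map e) ≫ i.hom = i.hom ≫ (F.obj P).map e := (hi' _).trans (congrArg _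
    (e₂ e))
  obtain ⟨η, hη⟩ := hP.exists_natTrans₂ hQ hb hF hb₁ hb₂ i.hom n₁ n₂
  obtain ⟨θ, hθ⟩ := hP.exists_natTrans₂ hQ hF hb h₁ h₂ i.inv (fun e => comp_inv_of_comp_hom (n₁ e)) (fun e => comp_inv_of_comp_hom
    (n₂ e))
  exact ⟨H, hadd, hlin, hH, ⟨⟨η, θ, hP.natTrans_ext₂ hQ hb hb₁ hb₂ ((congrArg₂ (· ≫ ·) hη hθ).trans i.hom_inv_id),
    hP.natTrans_ext₂ hQ hF h₁ h₂ ((congrArg₂ (· ≫ ·) hθ hη).trans i.inv_hom_id)⟩⟩⟩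
end

lemma SplitBasis.isGen {k : Type u} [Field k] {X : Type (u + 1)} [Category.{u} X] [Preadditive X] [Linear k X]
  [HasFiniteBiproducts X] {n : ℕ} (B : SplitBasis k X (Fin n)) : IsGen k (⨁ B.S) where
  finite_hom := B.finite_hom
  projective := B.regular.projective _
  sep x y t ht := by
    obtain ⟨J, _, _, idx, f, g, h, -⟩ := B.gen x
    rw [← id_comp t, ← h, sum_comp]
    refine sum_eq_zero fun a _ => ?_
    have := biproduct.ι B.S (idx a) ≫= ht (biproduct.π B.S (idx a) ≫ g a)
    rw [assoc, biproduct.ι_π_self_assoc, comp_zero] at this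
    rw [assoc, this, comp_zero]

namespace AddCat
lemma Pairing.IsBilinear.bilin {C D : AddCat k} {T : Pairing C D} (h : T.IsBilinear) : Bilin k T.pair := .of_flip h.left_additive
  h.left_linear h.right_additive h.right_linear

lemma isBilinear_of_bilin {C D : AddCat k} {T : Pairing C D} (h : Bilin k T.pair) : T.IsBilinear := ⟨h.flip_additive,
  h.flip_linear, h.obj_additive, h.obj_linear⟩

lemma IsFinite.rightExact_iff {C E : AddCat k} (hC : C.IsFinite) {F : C ⥤ E} [F.Additive] : PreservesFiniteColimits F ↔ RightExact
  F :=
  have := hC.isAbelian.hasCokernels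
  preservesFiniteColimits_iff_rightExact

/-- Finite linear categories have a Deligne tensor product. -/
theorem exists_isDeligne {C D : AddCat k} (hC : C.IsFinite) (hD : D.IsFinite) : ∃ T : Pairing C D, T.IsDeligne ∧ ∃ P Q, IsGen k
  ((T.pair.obj P).obj Q) := by
  letI := hC.isAbelian.abelian
  letI := hD.isAbelian.abelian
  obtain ⟨P, hP⟩ := hC.exists_isGen
  obtain ⟨Q, hQ⟩ := hD.exists_isGen
  have := hP.projective
  have := hQ.projective
  obtain ⟨_, _⟩ := isNoetherianRing_end (LinTensor.finite_hom hC.finite_hom hD.finite_hom) (⟨P, Q⟩ : LinTensor k C D)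
  let T : Pairing C D :=
    { target := @AddCat.mk k _ (FGModuleCat.{u} (End (⟨P, Q⟩ : LinTensor k C D))ᵐᵒᵖ) _ _ _
        Abelian.hasFiniteBiproducts
      pair := coyPair hC.finite_hom hD.finite_hom P Q }
  have hT : T.target.IsAbelian := ⟨inferInstanceAs (HasKernels (FGModuleCat.{u} (End (⟨P, Q⟩ : LinTensor k C D))ᵐᵒᵖ)),
    inferInstanceAs (HasCokernels (FGModuleCat.{u} (End (⟨P, Q⟩ : LinTensor k C D))ᵐᵒᵖ)), inferInstanceAs (IsNormalMonoCategory
    (FGModuleCat.{u} (End (⟨P, Q⟩ : LinTensor k C D))ᵐᵒᵖ)), inferInstanceAs (IsNormalEpiCategory (FGModuleCat.{u} (End (⟨P, Q⟩ :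
    LinTensor k C D))ᵐᵒᵖ))⟩
  have := hT.hasCokernels
  have := hC.isAbelian.hasCokernels
  have := hD.isAbelian.hasCokernels
  have hb : T.IsBilinear := isBilinear_of_bilin (coyPair_bilin hC.finite_hom hD.finite_hom P Q)
  have hG : IsGen k ((T.pair.obj P).obj Q) := coy_isGen (LinTensor.finite_hom hC.finite_hom hD.finite_hom) ⟨P, Q⟩
  refine ⟨T, ⟨isFinite_of_isGen hT hG, hb, ⟨fun d => ?_, fun c => ?_⟩, fun F hF hF' hF'' => ?_, fun E hE H H' hH hH' => ?_⟩, P, Q,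
    hG⟩
  · have := hb.left_additive d
    exact RightExact.preservesFiniteColimits (coyPair_left hC.finite_hom hD.finite_hom P Q d)
  · have := hb.right_additive c
    exact RightExact.preservesFiniteColimits (coyPair_right hC.finite_hom hD.finite_hom P Q c)
  · have := hF.hasCokernels
    obtain ⟨H, _, _, hH, e⟩ := coyPair_exists_lift hC.finite_hom hD.finite_hom hP hQ hF'.bilin (fun c => by
        have := hF'.right_additive c
        have := hF''.right c
        exact rightExact_of_preservesFiniteColimits _)
      (fun d => by
        have := hF'.left_additive d
        have := hF''.left d
        exact rightExact_of_preservesFiniteColimits _)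
    exact ⟨@Hom.mk _ _ T.target F.target H ‹_› ‹_›, (@IsFinite.rightExact_iff k _ T.target F.target (isFinite_of_isGen hT hG) H
      ‹_›).2 hH, e⟩
  · have := H.additive
    have := H.linear
    have := H'.additive
    exact coyPair_bijective hC.finite_hom hD.finite_hom hP hQ (H := H.functor) (H' := H'.functor) ((isFinite_of_isGen hT
      hG).rightExact_iff.1 hH)

lemma deligneTensor_isDeligne {C D : AddCat k} (hC : C.IsFinite) (hD : D.IsFinite) : (deligneTensor C D).IsDeligne :=
  Classical.epsilon_spec (p := Pairing.IsDeligne) ((exists_isDeligne hC hD).imp fun _ h => h.1)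

lemma Pairing.IsDeligne.nonempty_iso {C D E : AddCat k} {T : Pairing C D} (h : T.IsDeligne) (hE : E.IsAbelian) {H H' : T.target ⟶
  E} (hH : PreservesFiniteColimits H.functor) (hH' : PreservesFiniteColimits H'.functor) (e : T.after H ≅ T.after H') : Nonempty
  (H.functor ≅ H'.functor) := by
  obtain ⟨η, hη⟩ := (h.bijective E hE H H' hH hH').2 e.hom
  obtain ⟨θ, hθ⟩ := (h.bijective E hE H' H hH' hH).2 e.inv
  refine ⟨⟨η, θ, (h.bijective E hE H H hH hH).1 ?_, (h.bijective E hE H' H' hH' hH').1 ?_⟩⟩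
  · dsimp only at hη hθ ⊢
    rw [Functor.map_comp, Functor.whiskerLeft_comp, hη, hθ]
    exact (e.hom_inv_id).trans (by rw [CategoryTheory.Functor.map_id]; rfl)
  · dsimp only at hη hθ ⊢
    rw [Functor.map_comp, Functor.whiskerLeft_comp, hη, hθ]
    exact (e.inv_hom_id).trans (by rw [CategoryTheory.Functor.map_id]; rfl)

lemma Pairing.IsDeligne.exists_sep {C D : AddCat k} (hC : C.IsFinite) (hD : D.IsFinite) {T : Pairing C D} (h : T.IsDeligne) : ∃ P
  Q, ∀ ⦃X Y : T.target⦄ (t : X ⟶ Y), (∀ f : (T.pair.obj P).obj Q ⟶ X, f ≫ t = 0) → t = 0 := by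
  obtain ⟨T₀, h₀, P, Q, hG⟩ := exists_isDeligne hC hD
  obtain ⟨Φ, hΦ, ⟨α⟩⟩ := h₀.exists_lift T h.isFinite.isAbelian h.isBilinear h.isRightExact
  obtain ⟨Ψ, hΨ, ⟨β⟩⟩ := h.exists_lift T₀ h₀.isFinite.isAbelian h₀.isBilinear h₀.isRightExact
  obtain ⟨e₀⟩ := h₀.nonempty_iso h₀.isFinite.isAbelian (H := Φ ≫ Ψ) (H' := 𝟙 _) (comp_preservesFiniteColimits Φ.functor Ψ.functor)
    (inferInstanceAs (PreservesFiniteColimits (𝟭 T₀.target))) (((whiskeringRight D _ _).obj Ψ.functor |> fun G => isoWhiskerRight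
    α G) ≪≫ β)
  obtain ⟨e⟩ := h.nonempty_iso h.isFinite.isAbelian (H := Ψ ≫ Φ) (H' := 𝟙 _) (comp_preservesFiniteColimits Ψ.functor Φ.functor)
    (inferInstanceAs (PreservesFiniteColimits (𝟭 T.target))) (((whiskeringRight D _ _).obj Φ.functor |> fun G => isoWhiskerRight β
    G) ≪≫ α)
  have faith {A B : AddCat k} {F : A ⥤ B} {G : B ⥤ A} [G.Additive] (e : F ⋙ G ≅ 𝟭 A) {X Y : A} {t : X ⟶ Y} (ht : F.map t = 0) : t
    = 0 := by
    have := e.hom.naturality t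
    rw [Functor.comp_map, ht, G.map_zero, zero_comp] at this
    exact (cancel_epi (e.hom.app X)).1 (this.symm.trans comp_zero.symm)
  refine ⟨P, Q, fun X Y t ht => faith (F := Ψ.functor) (G := Φ.functor) e (hG.sep _ fun g => faith (F := Φ.functor) (G :=
    Ψ.functor) e₀ ?_)⟩
  let a : (T.pair.obj P).obj Q ⟶ Φ.functor.obj ((T₀.pair.obj P).obj Q) := ((α.app P).app Q).inv
  have ha : IsIso a := inferInstanceAs (IsIso ((α.app P).app Q).inv)
  have hn : Φ.functor.map (Ψ.functor.map t) ≫ e.hom.app Y = e.hom.app X ≫ t := e.hom.naturality t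
  have hX : IsIso (e.hom.app Y) := inferInstance
  rw [Functor.map_comp, ← cancel_epi a, comp_zero, ← cancel_mono (e.hom.app Y), zero_comp]
  have := ht (a ≫ Φ.functor.map g ≫ e.hom.app X)
  simp only [assoc] at this ⊢
  exact ((congrArg (fun s => a ≫ Φ.functor.map g ≫ s) hn).trans this)

lemma isFinite_of_splitBasis {C : AddCat k} [IsIdempotentComplete C] {n : ℕ} (B : SplitBasis k C (Fin n)) : C.IsFinite :=
  isFinite_of_isGen (isAbelian_of_regular B.regular) B.isGen

lemma deligne_param {A C D E : AddCat k} (hA : A.IsFinite) (hC : C.IsFinite) (hD : D.IsFinite) {T : Pairing C D} (hT :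
  T.IsDeligne) {L : A ⥤ T.target ⥤ E} (hL : Bilin k L) (h₁ : ∀ a, PreservesFiniteColimits (L.obj a)) (h₂ : ∀ c d,
  PreservesFiniteColimits (L.flip.obj ((T.pair.obj c).obj d))) (t : T.target) : PreservesFiniteColimits (L.flip.obj t) := by
  obtain ⟨P, Q, hsep⟩ := hT.exists_sep hC hD
  have := hT.isFinite.isAbelian.normalEpi
  obtain ⟨m, n, f, p, hp⟩ := exists_presentation_of_sep hT.isFinite.finite_hom hsep t
  have := hL.flip_additive
  have hsum (n : ℕ) : RightExact (L.flip.obj (⨁ fun _ : Fin n => (T.pair.obj P).obj Q)) := by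
    refine rightExact_of_sum (J := Fin n) (fun _ => L.flip.obj ((T.pair.obj P).obj Q)) (fun _ => hA.rightExact_iff.1 (h₂ P Q))
      (fun j => L.flip.map (biproduct.π _ j)) (fun j => L.flip.map (biproduct.ι (fun _ => (T.pair.obj P).obj Q) j)) (fun x => ?_)
    have := hL.obj_additive x
    refine Eq.trans ?_ ((congrArg (L.obj x).map biproduct.total).trans ((L.obj x).map_id _))
    rw [Functor.map_sum]
    exact sum_congr rfl fun j _ => ((L.obj x).map_comp _ _).symm
  refine hA.rightExact_iff.2 (rightExact_of_isCok (α := L.flip.map f) (β := L.flip.map p) (hsum m) (hsum n) fun x => ?_)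
  have := hL.obj_additive x
  exact hT.isFinite.rightExact_iff.1 (h₁ x) hp

lemma projective_of_adjunction {E : AddCat k} (hE : E.IsFinite) (c : vect k ⟶ E) (g : E ⟶ vect k) (hg : PreservesFiniteColimits
  g.functor) (adj : Bicategory.Adjunction c g) (v : vect k) : Projective (c.functor.obj v) where
  factors {a b} h p _ := by
    have := hE.isAbelian.normalEpi
    have := g.additive
    obtain ⟨W, w, hw⟩ := isCok_of_epi p
    have hp : Epi (g.functor.map p) := ⟨fun _ _ => (hE.rightExact_iff.1 hg hw).epi _ _⟩
    obtain ⟨s, hs⟩ := TensorSetup.regular_vect.exists_section (g.functor.map p)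
    let η : v ⟶ g.functor.obj (c.functor.obj v) := adj.unit.natTrans.app v
    let ζ (x : E) : c.functor.obj (g.functor.obj x) ⟶ x := adj.counit.natTrans.app x
    have hζ {x y : E} (f : x ⟶ y) : c.functor.map (g.functor.map f) ≫ ζ y = ζ x ≫ f := adj.counit.natTrans.naturality f
    have htri : c.functor.map η ≫ ζ (c.functor.obj v) = 𝟙 (c.functor.obj v) := by
      have h : adj.unit ▷ c ≫ (α_ c g c).hom ≫ c ◁ adj.counit = (Bicategory.leftUnitor c).hom ≫ (Bicategory.rightUnitor c).inv :=
        by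
        simpa [Bicategory.leftZigzag, bicategoricalComp] using adj.left_triangle
      have h' : c.functor.map η ≫ 𝟙 _ ≫ ζ (c.functor.obj v) = 𝟙 _ ≫ 𝟙 (c.functor.obj v) := congrArg (fun t => (Hom₂.natTrans
        t).app v) h
      simpa using h'
    refine ⟨c.functor.map (η ≫ g.functor.map h ≫ s) ≫ ζ a, ?_⟩
    rw [assoc, ← hζ, ← c.functor.map_comp_assoc, assoc, assoc, hs, comp_id, c.functor.map_comp, assoc, hζ, reassoc_of% htri]

/-- The Deligne tensor product has the universal property of a tensor product. -/
def linCatSetup (k : Type u) [Field k] : TensorSetup (linCat k) deligneTensor where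
  obj := IsFinite
  K F := PreservesFiniteColimits F
  hom_iff _ := Iff.rfl
  obj_of h := h
  obj_vectPow n :=
    have : IsIdempotentComplete (VectPow k n) := inferInstance
    isFinite_of_splitBasis (C := ⟨VectPow k n⟩) (vectPowBasis k n)
  obj_vect :=
    have : IsIdempotentComplete (FGModuleCat.{u} k) := inferInstance
    isFinite_of_splitBasis (C := vect k) (n := 1) ((vectBasis k).reindex (Equiv.ofUnique _ _))
  idem {C} h :=
    letI := h.isAbelian.abelian
    inferInstance
  K_iso e h := preservesFiniteColimits_of_natIso e
  K_id C := inferInstanceAs (PreservesFiniteColimits (𝟭 C))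
  K_comp {C D E F G} hF hG := comp_preservesFiniteColimits F G
  K_sum {C D} hC F J _ G hF hG hK s r h := hC.rightExact_iff.2 (rightExact_of_sum G (fun j =>
    have := hG j; hC.rightExact_iff.1 (hK j)) s r fun x => by
        have := congrArg (fun t => t.app x) h
        simpa [NatTrans.app_sum] using this)
  K_regular hC h F hF := hC.rightExact_iff.2 (h.rightExact F)
  target hC hD := (deligneTensor_isDeligne hC hD).isFinite
  bilin hC hD := (deligneTensor_isDeligne hC hD).isBilinear.bilin
  pair_right hC hD := (deligneTensor_isDeligne hC hD).isRightExact.right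
  pair_left hC hD := (deligneTensor_isDeligne hC hD).isRightExact.left
  exists_lift hC hD hE P hP h₁ h₂ := (deligneTensor_isDeligne hC hD).exists_lift ⟨_, P⟩ hE.isAbelian (isBilinear_of_bilin hP) ⟨h₂,
    h₁⟩
  bijective hC hD hE := (deligneTensor_isDeligne hC hD).bijective _ hE.isAbelian
  param hA hC hD _ L hL h₁ h₂ := deligne_param hA hC hD (deligneTensor_isDeligne hC hD) hL h₁ h₂
  coev_gen {X Y} hX hY c g hc hg adj := by
    have hT := deligneTensor_isDeligne hY hX
    obtain ⟨P, Q, hsep⟩ := hT.exists_sep hY hX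
    obtain ⟨n, p, hp⟩ := exists_epi_of_sep hT.isFinite.finite_hom hsep (c.functor.obj (vectOne k))
    have := projective_of_adjunction hT.isFinite c g hg adj.some (vectOne k)
    let s := Projective.factorThru (𝟙 _) p
    refine ⟨Fin n, inferInstance, fun _ => P, fun _ => Q, fun j => s ≫ biproduct.π _ j, fun j => biproduct.ι (fun _ =>
      ((deligneTensor Y X).pair.obj P).obj Q) j ≫ p, ?_⟩
    calc _ = s ≫ (∑ j, biproduct.π _ j ≫
          biproduct.ι (fun _ => ((deligneTensor Y X).pair.obj P).obj Q) j) ≫ p := by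
          simp only [sum_comp, comp_sum, assoc]
      _ = 𝟙 _ := by
          rw [biproduct.total, id_comp]
          exact Projective.factorThru_comp _ _
end AddCat

/-! ### Bimodules over small linear categories -/

namespace SmallCat
variable {A A' B B' C C' D E : SmallCat k}

def isoMk {P Q : Hom C D} (e : ∀ d c, P.obj d c ≃ₗ[k] Q.obj d c) (h : ∀ {d d' c c'} (g : d' ⟶ d) (f : c ⟶ c') (x : P.obj d c), e
  d' c' (P.act g f x) = Q.act g f (e d c x)) : P ≅ Q where
  hom := Hom₂.mk (fun d c => (e d c).toLinearMap) h
  inv := Hom₂.mk (fun d c => (e d c).symm.toLinearMap) (by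
    intro d d' c c' g f x
    apply (e d' c').injective
    simp [h])
  hom_inv_id := by ext; simp
  inv_hom_id := by ext; simp

lemma hom_inv_app {P Q : Hom C D} (i : P ≅ Q) (d c x) : i.inv.app d c (i.hom.app d c x) = x := by
  rw [← comp_app, i.hom_inv_id, id_app]

lemma inv_hom_app {P Q : Hom C D} (i : P ≅ Q) (d c x) : i.hom.app d c (i.inv.app d c x) = x := hom_inv_app i.symm d c x

def appEquiv {P Q : Hom C D} (i : P ≅ Q) (d : D) (c : C) : P.obj d c ≃ₗ[k] Q.obj d c := LinearEquiv.ofLinear (i.hom.app d c)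
  (i.inv.app d c) (LinearMap.ext (inv_hom_app i d c)) (LinearMap.ext (hom_inv_app i d c))

lemma iso_of_bijective {P Q : Hom C D} (η : P ⟶ Q) (h : ∀ d c, Function.Bijective (η.app d c)) : Nonempty (P ≅ Q) := ⟨isoMk (fun d
  c => LinearEquiv.ofBijective (η.app d c) (h d c)) (η.app_act)⟩

/-! #### Bimodules represented by functors -/

def res (F : A ⥤ B) [F.Additive] [F.Linear k] (Q : Hom B C) : Hom A C where
  obj c a := Q.obj c (F.obj a)
  act := Q.act.compl₁₂ LinearMap.id (F.mapLinearMap k)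
  act_id x := by simp
  act_act g g' f f' x := by simp

/-- Morphisms, as elements of a bimodule represented by a functor. -/
def funElt (F : A ⥤ B) [F.Additive] [F.Linear k] {b : B} {a : A} : (b ⟶ F.obj a) ≃ₗ[k] (ofFunctor F).obj b a := LinearEquiv.refl k
  (b ⟶ F.obj a)

@[simp] lemma funElt_act (F : A ⥤ B) [F.Additive] [F.Linear k] {b b' : B} {a a' : A} (g : b' ⟶ b) (f : a ⟶ a') (x : b ⟶ F.obj a) :
    (ofFunctor F).act g f (funElt F x) = funElt F (g ≫ x ≫ F.map f) := by rfl

def descHom {P : Hom A B} {Q : Hom B C} {S : Hom A C} (φ : ∀ c a b, Q.obj c b →ₗ[k] P.obj b a →ₗ[k] S.obj c a) (h : ∀ {c a b b'}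
  (f : b ⟶ b') (q : Q.obj c b) (p : P.obj b' a), φ c a b' (Q.act (𝟙 c) f q) p = φ c a b q (P.act f (𝟙 a) p)) (h' : ∀ {c c' a a' b}
  (g : c' ⟶ c) (f : a ⟶ a') (q : Q.obj c b) (p : P.obj b a), φ c' a' b (Q.act g (𝟙 b) q) (P.act (𝟙 b) f p) = S.act g f (φ c a b q
  p)) : comp P Q ⟶ S :=
  Hom₂.mk (fun c a => desc (φ c a) h) (by
    intro c c' a a' g f x
    induction x using comp_induction with
    | h0 | hadd => simp [*]
    | htmul b q p => rw [comp_act_tmul, desc_tmul, desc_tmul, h'])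

@[simp]
lemma descHom_tmul {P : Hom A B} {Q : Hom B C} {S : Hom A C} (φ : ∀ c a b, Q.obj c b →ₗ[k] P.obj b a →ₗ[k] S.obj c a) (h h') (c a
  b q p) : (descHom φ h h').app c a (tmul b q p) = φ c a b q p := desc_tmul (φ c a) h b q p

def ofFunctorCompHom (F : A ⥤ B) [F.Additive] [F.Linear k] (Q : Hom B C) : comp (ofFunctor F) Q ⟶ res F Q := descHom (S := res F
  Q)
    (fun c a b => (Q.act (c := b) (c' := F.obj a) (𝟙 c) ∘ₗ (funElt F).symm.toLinearMap).flip) (by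
      intro c a b b' f q p
      obtain ⟨p, rfl⟩ := (funElt F).surjective p
      change Q.act (𝟙 c) p (Q.act (𝟙 c) f q) = Q.act (𝟙 c) (f ≫ p ≫ F.map (𝟙 a)) q
      simp) (by
      intro c c' a a' b g f q p
      obtain ⟨p, rfl⟩ := (funElt F).surjective p
      change Q.act (𝟙 c') (𝟙 b ≫ p ≫ F.map f) (Q.act g (𝟙 b) q) = Q.act g (F.map f) (Q.act (𝟙 c) p q)
      simp)

lemma ofFunctorCompHom_tmul (F : A ⥤ B) [F.Additive] [F.Linear k] (Q : Hom B C) {c a b} (q : Q.obj c b) (p : b ⟶ F.obj a) :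
  (ofFunctorCompHom F Q).app c a (tmul b q (funElt F p)) = Q.act (𝟙 c) p q := descHom_tmul (S := res F Q) _ _ _ _ _ _ _ _

def ofFunctorComp (F : A ⥤ B) [F.Additive] [F.Linear k] (Q : Hom B C) : comp (ofFunctor F) Q ≅ res F Q where
  hom := ofFunctorCompHom F Q
  inv := Hom₂.mk (P := res F Q)
    (fun c a => LinearMap.flip (tmul (Q := Q) (F.obj a)) (funElt F (𝟙 (F.obj a)))) (by
    intro c c' a a' g f (x : Q.obj c (F.obj a))
    have h := act_tmul (Q := Q) (F.map f) (Q.act g (𝟙 _) x) (funElt F (𝟙 (F.obj a')))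
    rw [Hom.act_act, funElt_act] at h
    refine (?_ : _ = _).trans (h.trans ?_)
    · simp; rfl
    · refine Eq.trans ?_ (comp_act_tmul _ _ _ _ _ _ _).symm
      rw [funElt_act]
      simp)
  hom_inv_id := by
    apply hom_ext_comp
    intro c a b q p
    obtain ⟨p, rfl⟩ := (funElt F).surjective p
    have h := act_tmul (Q := Q) p q (funElt F (𝟙 (F.obj a)))
    rw [comp_app, ofFunctorCompHom_tmul]
    refine h.trans ?_
    rw [funElt_act]
    simp
  inv_hom_id := by
    ext c a (x : Q.obj c (F.obj a))
    exact (ofFunctorCompHom_tmul F Q x (𝟙 _)).trans (Q.act_id x)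

lemma nonempty_iso_of_square (F : A ⥤ A') [F.Additive] [F.Linear k] (G : B ⥤ B') [G.Additive] [G.Linear k] [G.Full] (hG : ∀ d, ∃
  y, Nonempty (d ≅ G.obj y)) {P : Hom A B} {Q : Hom A' B'} (θ : ∀ b a, P.obj b a ≃ₗ[k] Q.obj (G.obj b) (F.obj a)) (hθ : ∀ {b b' a
  a'} (g : b' ⟶ b) (f : a ⟶ a') (x : P.obj b a), θ b' a' (P.act g f x) = Q.act (G.map g) (F.map f) (θ b a x)) : Nonempty (comp P
  (ofFunctor G) ≅ comp (ofFunctor F) Q) := by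
  let Θ : comp P (ofFunctor G) ⟶ res F Q := descHom (S := res F Q) (fun d a b => (Q.act.flip (𝟙 (F.obj a)) ∘ₗ
      (funElt G).symm.toLinearMap).compl₂ (θ b a).toLinearMap) (by
      intro d a b b' f q p
      obtain ⟨q, rfl⟩ := (funElt G).surjective q
      change Q.act (𝟙 d ≫ q ≫ G.map f) (𝟙 (F.obj a)) (θ b' a p) = Q.act q (𝟙 (F.obj a)) (θ b a (P.act f (𝟙 a) p))
      simp [hθ]) (by
      intro c c' a a' b g f q p
      obtain ⟨q, rfl⟩ := (funElt G).surjective q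
      change Q.act (g ≫ q ≫ G.map (𝟙 b)) (𝟙 (F.obj a')) (θ b a' (P.act (𝟙 b) f p)) = Q.act g (F.map f) (Q.act q (𝟙 (F.obj a)) (θ b
        a p))
      simp [hθ])
  have hΘ (d : B') (a : A) (b : B) (q : d ⟶ G.obj b) (p : P.obj b a) : Θ.app d a (tmul b (funElt G q) p) = Q.act q (𝟙 (F.obj a))
    (θ b a p) := descHom_tmul (S := res F Q) _ _ _ _ _ _ _ _
  obtain ⟨i⟩ := iso_of_bijective Θ fun d a => by
    obtain ⟨y, ⟨i⟩⟩ := hG d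
    have h (x : (comp P (ofFunctor G)).obj d a) : ∃ p, x = tmul y (funElt G i.hom) p := by
      induction x using comp_induction with
      | h0 => exact ⟨0, by simp⟩
      | hadd x x' hx hx' =>
        obtain ⟨p, rfl⟩ := hx
        obtain ⟨p', rfl⟩ := hx'
        exact ⟨p + p', by simp⟩
      | htmul b q p =>
        obtain ⟨q, rfl⟩ := (funElt G).surjective q
        obtain ⟨f, hf⟩ := G.map_surjective (i.inv ≫ q)
        refine ⟨P.act f (𝟙 a) p, ?_⟩
        rw [← act_tmul, funElt_act, hf]
        simp
    refine ⟨(injective_iff_map_eq_zero _).2 fun x hx => ?_, fun q => ?_⟩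
    · obtain ⟨p, rfl⟩ := h x
      rw [hΘ] at hx
      have := congrArg (Q.act i.inv (𝟙 _)) hx
      rw [Hom.act_act, i.inv_hom_id, id_comp, Hom.act_id] at this
      rw [(θ y a).map_eq_zero_iff.1 (this.trans (map_zero (Q.act i.inv (𝟙 (F.obj a))))), map_zero]
    · refine ⟨tmul y (funElt G i.hom) ((θ y a).symm (Q.act i.inv (𝟙 _) q)), ?_⟩
      rw [hΘ, LinearEquiv.apply_symm_apply]
      exact (Hom.act_act _ _ _ _ _ _).trans (by simpa using Q.act_id (d := d) (c := F.obj a) q)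
  exact ⟨i ≪≫ (ofFunctorComp F Q).symm⟩

lemma nonempty_ofFunctor_iso {F G : A ⥤ B} [F.Additive] [F.Linear k] [G.Additive] [G.Linear k] (i : F ≅ G) : Nonempty (ofFunctor F
  ≅ ofFunctor G) := ⟨isoMk (P := ofFunctor F) (Q := ofFunctor G) (fun b a => LinearEquiv.ofLinear (rightComp k b (i.hom.app a))
  (rightComp k b (i.inv.app a)) (LinearMap.ext fun (x : b ⟶ G.obj a) => show (x ≫ i.inv.app a) ≫ i.hom.app a = x by simp)
  (LinearMap.ext fun (x : b ⟶ F.obj a) => show (x ≫ i.hom.app a) ≫ i.inv.app a = x by simp)) (fun {d d' c c'} g f x => by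
      obtain ⟨x, rfl⟩ := (funElt F).surjective x
      change (g ≫ x ≫ F.map f) ≫ i.hom.app c' = g ≫ (x ≫ i.hom.app c) ≫ G.map f
      simp)⟩

lemma nonempty_ofFunctor_comp (F : A ⥤ B) [F.Additive] [F.Linear k] (G : B ⥤ C) [G.Additive] [G.Linear k] : Nonempty (comp
  (ofFunctor F) (ofFunctor G) ≅ ofFunctor (F ⋙ G)) := ⟨ofFunctorComp F (ofFunctor G) ≪≫ isoMk (fun _ _ => LinearEquiv.refl _ _)
  (fun _ _ _ => rfl)⟩

variable {A A' A'' B B' B'' C C' D E : SmallCat k}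

def res₂ (F : A ⥤ A') [F.Additive] [F.Linear k] (G : B ⥤ B') [G.Additive] [G.Linear k] (Q : Hom A' B') : Hom A B where
  obj b a := Q.obj (G.obj b) (F.obj a)
  act := Q.act.compl₁₂ (G.mapLinearMap k) (F.mapLinearMap k)
  act_id x := by simp
  act_act g g' f f' x := by simp

/-! #### Functoriality of the tensor product of bimodules -/

section
variable {P : Hom A A'} {Q : Hom B B'} {d : LinTensor k A' B'} {c : LinTensor k A B}

def ttmul : P.obj d.fst c.fst →ₗ[k] Q.obj d.snd c.snd →ₗ[k] (tensorHom P Q).obj d c := TensorProduct.mk k _ _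

@[elab_as_elim]
lemma tensor_induction {p : (tensorHom P Q).obj d c → Prop} (x : (tensorHom P Q).obj d c) (h0 : p 0) (hadd : ∀ x y, p x → p y → p
  (x + y)) (htmul : ∀ x y, p (ttmul x y)) : p x := TensorProduct.induction_on x h0 htmul hadd

def tdesc {X : Type u} [AddCommGroup X] [Module k X] (φ : P.obj d.fst c.fst →ₗ[k] Q.obj d.snd c.snd →ₗ[k] X) : (tensorHom P Q).obj
  d c →ₗ[k] X := TensorProduct.lift φ

@[simp]
lemma tdesc_ttmul {X : Type u} [AddCommGroup X] [Module k X] (φ : P.obj d.fst c.fst →ₗ[k] Q.obj d.snd c.snd →ₗ[k] X) (x y) : tdesc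
  φ (ttmul x y) = φ x y := TensorProduct.lift.tmul _ _
end

section
variable (P : Hom A A') (Q : Hom B B') {d d' : LinTensor k A' B'} {c c' : LinTensor k A B}

@[simp]
lemma tensorHom_act_ttmul (g₁ : d'.fst ⟶ d.fst) (g₂ : d'.snd ⟶ d.snd) (f₁ : c.fst ⟶ c'.fst) (f₂ : c.snd ⟶ c'.snd) (x y) :
  (tensorHom P Q).act (d := d) (d' := d') (c := c) (c' := c') (LinTensor.tmul k g₁ g₂) (LinTensor.tmul k f₁ f₂) (ttmul x y) =
  ttmul (P.act g₁ f₁ x) (Q.act g₂ f₂ y) := rfl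

@[simp]
lemma tensorHom_act_ttmul_left (g₁ : d'.fst ⟶ d.fst) (g₂ : d'.snd ⟶ d.snd) (x y) : (tensorHom P Q).act (d := d) (d' := d') (c :=
  c) (LinTensor.tmul k g₁ g₂) (𝟙 c) (ttmul x y) = ttmul (P.act g₁ (𝟙 _) x) (Q.act g₂ (𝟙 _) y) := rfl

@[simp]
lemma tensorHom_act_ttmul_right (f₁ : c.fst ⟶ c'.fst) (f₂ : c.snd ⟶ c'.snd) (x y) : (tensorHom P Q).act (d := d) (c := c) (c' :=
  c') (𝟙 d) (LinTensor.tmul k f₁ f₂) (ttmul x y) = ttmul (P.act (𝟙 _) f₁ x) (Q.act (𝟙 _) f₂ y) := rfl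

lemma act_tensor {P Q} {R : Hom (tensorObj A B) (tensorObj A' B')} (e : ∀ d c, (tensorHom P Q).obj d c →ₗ[k] R.obj d c) (h : ∀ {d
  d' : LinTensor k A' B'} {c c' : LinTensor k A B} (g₁ : d'.fst ⟶ d.fst) (g₂ : d'.snd ⟶ d.snd) (f₁ : c.fst ⟶ c'.fst) (f₂ : c.snd ⟶
  c'.snd) (x : P.obj d.fst c.fst) (y : Q.obj d.snd c.snd), e d' c' (ttmul (P.act g₁ f₁ x) (Q.act g₂ f₂ y)) = R.act (LinTensor.tmul
  k g₁ g₂) (LinTensor.tmul k f₁ f₂) (e d c (ttmul x y))) (g : d' ⟶ d) (f : c ⟶ c') (x : (tensorHom P Q).obj d c) : e d' c'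
  ((tensorHom P Q).act g f x) = R.act g f (e d c x) := by
  induction g using hom_induction with
  | h0 | hadd => simp [*]
  | htmul g₁ g₂ =>
  induction f using hom_induction with
  | h0 | hadd => simp [*]
  | htmul f₁ f₂ =>
  induction x using tensor_induction with
  | h0 | hadd => simp [*]
  | htmul x y => exact h g₁ g₂ f₁ f₂ x y
end

lemma nonempty_tensorHom_congr {P P' : Hom A A'} {Q Q' : Hom B B'} (h : Nonempty (P ≅ P')) (h' : Nonempty (Q ≅ Q')) : Nonempty
  (tensorHom P Q ≅ tensorHom P' Q') := by
  obtain ⟨i⟩ := h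
  obtain ⟨j⟩ := h'
  let e (d : LinTensor k A' B') (c : LinTensor k A B) : (tensorHom P Q).obj d c ≃ₗ[k] (tensorHom P' Q').obj d c :=
    TensorProduct.congr (appEquiv i d.fst c.fst) (appEquiv j d.snd c.snd)
  refine ⟨isoMk e (fun g f x => act_tensor (fun d c => (e d c).toLinearMap) ?_ g f x)⟩
  intro d d' c c' g₁ g₂ f₁ f₂ x y
  exact congrArg₂ (fun x y => ttmul x y) (Hom₂.app_act i.hom g₁ f₁ x) (Hom₂.app_act j.hom g₂ f₂ y)

section
variable (P : Hom A A') (P' : Hom A' A'') (Q : Hom B B') (Q' : Hom B' B'')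

def interchangeMul (c : LinTensor k A'' B'') (a : LinTensor k A B) (b : LinTensor k A' B') : (tensorHom P' Q').obj c b →ₗ[k]
  (tensorHom P Q).obj b a →ₗ[k] (tensorHom (comp P P') (comp Q Q')).obj c a := TensorProduct.map₂ (tmul b.fst : P'.obj c.fst b.fst
  →ₗ[k] _ →ₗ[k] (comp P P').obj c.fst a.fst) (tmul b.snd : Q'.obj c.snd b.snd →ₗ[k] _ →ₗ[k] (comp Q Q').obj c.snd a.snd)

@[simp]
lemma interchangeMul_ttmul (c a b p' q' p q) : interchangeMul P P' Q Q' c a b (ttmul p' q') (ttmul p q) = ttmul (P := comp P P')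
  (Q := comp Q Q') (tmul b.fst p' p) (tmul b.snd q' q) := rfl

def interchangeHom : comp (tensorHom P Q) (tensorHom P' Q') ⟶ tensorHom (comp P P') (comp Q Q') := descHom (interchangeMul P P' Q
  Q')
    (by
      intro c a b b' f x y
      induction f using hom_induction with
      | h0 => simp
      | hadd x y hx hy => simp only [map_add, LinearMap.add_apply, hx, hy]
      | htmul f₁ f₂ =>
      induction x using tensor_induction with
      | h0 => simp
      | hadd x y hx hy => simp only [map_add, LinearMap.add_apply, hx, hy]
      | htmul p' q' =>
      induction y using tensor_induction with
      | h0 => simp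
      | hadd x y hx hy => simp only [map_add, hx, hy]
      | htmul p q =>
      rw [tensorHom_act_ttmul_right, tensorHom_act_ttmul_left, interchangeMul_ttmul,
        interchangeMul_ttmul, act_tmul, act_tmul])
    (by
      intro c c' a a' b g f x y
      induction g using hom_induction with
      | h0 => simp
      | hadd x y hx hy => simp only [map_add, LinearMap.add_apply, hx, hy]
      | htmul g₁ g₂ =>
      induction f using hom_induction with
      | h0 => simp
      | hadd x y hx hy => simp only [map_add, LinearMap.add_apply, hx, hy]
      | htmul f₁ f₂ =>
      induction x using tensor_induction with
      | h0 => simp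
      | hadd x y hx hy => simp only [map_add, LinearMap.add_apply, hx, hy]
      | htmul p' q' =>
      induction y using tensor_induction with
      | h0 => simp
      | hadd x y hx hy => simp only [map_add, hx, hy]
      | htmul p q =>
      rw [tensorHom_act_ttmul_right, tensorHom_act_ttmul_left, interchangeMul_ttmul,
        interchangeMul_ttmul, tensorHom_act_ttmul, comp_act_tmul, comp_act_tmul])

@[simp]
lemma interchangeHom_tmul (c a) (b : LinTensor k A' B') (p' q' p q) : (interchangeHom P P' Q Q').app c a (tmul (P := tensorHom P
  Q) (Q := tensorHom P' Q') b (ttmul p' q') (ttmul p q)) = ttmul (P := comp P P') (Q := comp Q Q') (tmul b.fst p' p) (tmul b.snd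
  q' q) := descHom_tmul _ _ _ _ _ _ _ _

def interchangeMulLeft (c : LinTensor k A'' B'') (a : LinTensor k A B) {b₁ : A'} (p' : P'.obj c.fst b₁) (p : P.obj b₁ a.fst) :
  (comp Q Q').obj c.snd a.snd →ₗ[k] (comp (tensorHom P Q) (tensorHom P' Q')).obj c a := desc (fun b₂ => (tmul (⟨b₁, b₂⟩ :
  LinTensor k A' B')).compl₁₂ (ttmul (P := P') (Q := Q') (d := c) (c := (⟨b₁, b₂⟩ : LinTensor k A' B')) p')
        (ttmul (P := P) (Q := Q) (d := (⟨b₁, b₂⟩ : LinTensor k A' B')) (c := a) p)) (by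
    intro b₂ b₂' f q' q
    have := act_tmul (P := tensorHom P Q) (Q := tensorHom P' Q') (c := c) (a := a) (b := ⟨b₁, b₂⟩) (b' := ⟨b₁, b₂'⟩)
      (LinTensor.tmul k (𝟙 b₁) f) (ttmul p' q') (ttmul p q)
    rw [tensorHom_act_ttmul_right, tensorHom_act_ttmul_left, Hom.act_id, Hom.act_id] at this
    exact this)

@[simp]
lemma interchangeMulLeft_tmul (c : LinTensor k A'' B'') (a : LinTensor k A B) {b₁ : A'} (p' : P'.obj c.fst b₁) (p : P.obj b₁
  a.fst) (b₂ : B') (q' : Q'.obj c.snd b₂) (q : Q.obj b₂ a.snd) : interchangeMulLeft P P' Q Q' c a p' p (tmul b₂ q' q) = tmul (P :=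
  tensorHom P Q) (Q := tensorHom P' Q') (⟨b₁, b₂⟩ : LinTensor k A' B') (ttmul (P := P') (Q := Q') (d := c) (c := (⟨b₁, b₂⟩ :
  LinTensor k A' B')) p' q') (ttmul (P := P) (Q := Q) (d := (⟨b₁, b₂⟩ : LinTensor k A' B')) (c := a) p q) := desc_tmul (P := Q) (Q
  := Q') _ _ b₂ q' q

def interchangeDesc (c : LinTensor k A'' B'') (a : LinTensor k A B) (b₁ : A') : P'.obj c.fst b₁ →ₗ[k] P.obj b₁ a.fst →ₗ[k] (comp Q
  Q').obj c.snd a.snd →ₗ[k] (comp (tensorHom P Q) (tensorHom P' Q')).obj c a := LinearMap.mk₂ k (interchangeMulLeft P P' Q Q' c a)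
  (by intros; apply comp_linear_ext; intros; simp) (by intros; apply comp_linear_ext; intros; simp)
  (by intros; apply comp_linear_ext; intros; simp) (by intros; apply comp_linear_ext; intros; simp)

@[simp]
lemma interchangeDesc_apply (c : LinTensor k A'' B'') (a : LinTensor k A B) {b₁ : A'} (p' : P'.obj c.fst b₁) (p : P.obj b₁ a.fst)
  : interchangeDesc P P' Q Q' c a b₁ p' p = interchangeMulLeft P P' Q Q' c a p' p := rfl

def interchangeInvApp (c : LinTensor k A'' B'') (a : LinTensor k A B) : (tensorHom (comp P P') (comp Q Q')).obj c a →ₗ[k] (comp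
  (tensorHom P Q) (tensorHom P' Q')).obj c a :=
  tdesc (desc (interchangeDesc P P' Q Q' c a) (by
    intro b₁ b₁' f p' p
    apply comp_linear_ext
    intro b₂ q' q
    rw [interchangeDesc_apply, interchangeDesc_apply, interchangeMulLeft_tmul, interchangeMulLeft_tmul]
    have := act_tmul (P := tensorHom P Q) (b := ⟨b₁, b₂⟩) (b' := ⟨b₁', b₂⟩) (LinTensor.tmul k f (𝟙 b₂)) (ttmul p' q') (ttmul p q)
    rw [tensorHom_act_ttmul_right, tensorHom_act_ttmul_left, Hom.act_id, Hom.act_id] at this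
    exact this))

@[simp]
lemma interchangeInvApp_tmul (c : LinTensor k A'' B'') (a : LinTensor k A B) (b₁ : A') (b₂ : B') (p' : P'.obj c.fst b₁) (q' :
  Q'.obj c.snd b₂) (p : P.obj b₁ a.fst) (q : Q.obj b₂ a.snd) : interchangeInvApp P P' Q Q' c a (ttmul (P := comp P P') (Q := comp
  Q Q') (tmul b₁ p' p) (tmul b₂ q' q)) = tmul (P := tensorHom P Q) (Q := tensorHom P' Q') (⟨b₁, b₂⟩ : LinTensor k A' B') (ttmul (P
  := P') (Q := Q') (d := c) (c := (⟨b₁, b₂⟩ : LinTensor k A' B')) p' q') (ttmul (P := P) (Q := Q) (d := (⟨b₁, b₂⟩ : LinTensor k A'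
  B')) (c := a) p q) := by
  rw [interchangeInvApp, tdesc_ttmul, desc_tmul, interchangeDesc_apply, interchangeMulLeft_tmul]

lemma interchangeHom_invApp (c : LinTensor k A'' B'') (a : LinTensor k A B) (x) : (interchangeHom P P' Q Q').app c a
  (interchangeInvApp P P' Q Q' c a x) = x := by
  induction x using tensor_induction with
  | h0 | hadd => simp [*]
  | htmul x y =>
  induction x using comp_induction with
  | h0 | hadd => simp [*]
  | htmul b₁ p' p =>
  induction y using comp_induction with
  | h0 | hadd => simp [*]
  | htmul b₂ q' q => rw [interchangeInvApp_tmul, interchangeHom_tmul]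

lemma interchangeInvApp_hom (c : LinTensor k A'' B'') (a : LinTensor k A B) (x) : interchangeInvApp P P' Q Q' c a ((interchangeHom
  P P' Q Q').app c a x) = x := by
  induction x using comp_induction with
  | h0 | hadd => simp [*]
  | htmul b x y =>
  induction x using tensor_induction with
  | h0 | hadd => simp [*]
  | htmul p' q' =>
  induction y using tensor_induction with
  | h0 | hadd => simp [*]
  | htmul p q => rw [interchangeHom_tmul, interchangeInvApp_tmul]

lemma nonempty_tensorHom_comp : Nonempty (tensorHom (comp P P') (comp Q Q') ≅ comp (tensorHom P Q) (tensorHom P' Q')) := ⟨(isoMk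
  (fun c a => LinearEquiv.ofLinear ((interchangeHom P P' Q Q').app c a) (interchangeInvApp P P' Q Q' c a) (LinearMap.ext
  (interchangeHom_invApp P P' Q Q' c a)) (LinearMap.ext (interchangeInvApp_hom P P' Q Q' c a))) (interchangeHom P P' Q
  Q').app_act).symm⟩
end

lemma nonempty_tensorHom_id (A B : SmallCat k) : Nonempty (tensorHom (one A) (one B) ≅ one (tensorObj A B)) := ⟨isoMk (fun _ _ =>
  LinearEquiv.refl _ _) (fun g f x => act_tensor (R := one (tensorObj A B)) (fun _ _ => LinearMap.id) (by intros; rfl) g f x)⟩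

section
variable {X Y X' Y' : Type u} [Category.{u} X] [Preadditive X] [Linear k X] [Category.{u} Y] [Preadditive Y] [Linear k Y]
  [Category.{u} X'] [Preadditive X'] [Linear k X'] [Category.{u} Y'] [Preadditive Y'] [Linear k Y']

def tensorFunctor (F : X ⥤ Y) [F.Additive] [F.Linear k] (G : X' ⥤ Y') [G.Additive] [G.Linear k] : LinTensor k X X' ⥤ LinTensor k Y
  Y' := linFunctor (fun X => ⟨F.obj X.fst, G.obj X.snd⟩) (fun X Y => TensorProduct.map (F.mapLinearMap k) (G.mapLinearMap k)) (fun
  X => by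
      change F.map (𝟙 X.fst) ⊗ₜ[k] G.map (𝟙 X.snd) = 𝟙 _ ⊗ₜ[k] 𝟙 _
      simp) (fun X Y Z f g => by
      induction f using hom_induction with
      | h0 | hadd => simp [*]
      | htmul f₁ f₂ =>
      induction g using hom_induction with
      | h0 | hadd => simp [*]
      | htmul g₁ g₂ =>
      change F.map (f₁ ≫ g₁) ⊗ₜ[k] G.map (f₂ ≫ g₂) = (F.map f₁ ≫ F.map g₁) ⊗ₜ[k] (G.map f₂ ≫ G.map g₂)
      rw [F.map_comp, G.map_comp])

variable (F : X ⥤ Y) [F.Additive] [F.Linear k] (G : X' ⥤ Y') [G.Additive] [G.Linear k]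

instance : (tensorFunctor (k := k) F G).Additive := linFunctor_additive
instance : (tensorFunctor (k := k) F G).Linear k := linFunctor_linear
end

lemma nonempty_tensorHom_ofFunctor (F : A ⥤ A') [F.Additive] [F.Linear k] (G : B ⥤ B') [G.Additive] [G.Linear k] : Nonempty
  (tensorHom (ofFunctor F) (ofFunctor G) ≅ ofFunctor' (k := k) (tensorFunctor (k := k) F G)) := ⟨isoMk (fun _ _ =>
  LinearEquiv.refl _ _) (fun g f x => act_tensor (R := ofFunctor' (k := k) (tensorFunctor (k := k) F G)) (fun _ _ => LinearMap.id)
  (by intros; rfl) g f x)⟩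

lemma isFunctorial : (tensorData k).IsFunctorial (SubBicat.whole (SmallCat k)) where
  obj_unit := trivial
  obj_tensor _ _ := trivial
  congr _ _ _ _ _ _ _ _ h h' := nonempty_tensorHom_congr h h'
  id _ _ := nonempty_tensorHom_id _ _
  comp _ _ _ _ _ _ _ _ _ _ := nonempty_tensorHom_comp _ _ _ _
  assocInv_assoc {a b c} _ _ _ := by
    refine (nonempty_ofFunctor_comp (B := tensorObj (tensorObj a b) c) (A := tensorObj a (tensorObj b c)) (C := tensorObj a
      (tensorObj b c)) (assocInvFunctor k a b c) (assocFunctor k a b c)).elim fun i => ?_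
    let e : assocInvFunctor k a b c ⋙ assocFunctor k a b c ≅ 𝟭 (tensorObj a (tensorObj b c)) := NatIso.ofComponents (fun X =>
      Iso.refl X) (fun {X Y} f => by
        refine (comp_id _).trans (Eq.trans ?_ (id_comp _).symm)
        exact (TensorProduct.assoc k (X.fst ⟶ Y.fst) (X.snd.fst ⟶ Y.snd.fst)
          (X.snd.snd ⟶ Y.snd.snd)).apply_symm_apply f)
    obtain ⟨j⟩ := nonempty_ofFunctor_iso (A := tensorObj a (tensorObj b c)) (B := tensorObj a (tensorObj b c)) e
    exact ⟨i ≪≫ j⟩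
end SmallCat

/-! ### Powers of the base field -/

section Pow
def finTensor {m n : ℕ} (X : Fin m → Type u) (Y : Fin n → Type u) [∀ i, AddCommGroup (X i)] [∀ i, Module k (X i)] [∀ i,
  AddCommGroup (Y i)] [∀ i, Module k (Y i)] : ((∀ i, X i) ⊗[k] (∀ j, Y j)) ≃ₗ[k] ∀ l : Fin (m * n), X (finProdFinEquiv.symm l).1
  ⊗[k] Y (finProdFinEquiv.symm l).2 := TensorProduct.piLeft k (∀ j, Y j) X ≪≫ₗ LinearEquiv.piCongrRight (fun i =>
  TensorProduct.piRight k k (X i) Y) ≪≫ₗ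
    ({ toFun z p := z p.1 p.2
       invFun z i j := z (i, j)
       map_add' _ _ := rfl
       map_smul' _ _ := rfl } : (∀ i j, X i ⊗[k] Y j) ≃ₗ[k] ∀ p : Fin m × Fin n, X p.1 ⊗[k] Y p.2) ≪≫ₗ
    LinearEquiv.piCongrLeft' k (fun p : Fin m × Fin n => X p.1 ⊗[k] Y p.2) finProdFinEquiv

def matTensor {m m' n n' : ℕ} (X : Fin m → Fin m' → Type u) (Y : Fin n → Fin n' → Type u) [∀ i j, AddCommGroup (X i j)] [∀ i j,
  Module k (X i j)] [∀ i j, AddCommGroup (Y i j)] [∀ i j, Module k (Y i j)] : ((∀ i j, X i j) ⊗[k] (∀ i j, Y i j)) ≃ₗ[k] ∀ (i :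
  Fin (m * n)) (j : Fin (m' * n')), X (finProdFinEquiv.symm i).1 (finProdFinEquiv.symm j).1 ⊗[k] Y (finProdFinEquiv.symm i).2
  (finProdFinEquiv.symm j).2 := finTensor (fun i => ∀ j, X i j) (fun i => ∀ j, Y i j) ≪≫ₗ LinearEquiv.piCongrRight fun _ =>
  finTensor _ _

lemma matTensor_tmul {m m' n n' : ℕ} (X : Fin m → Fin m' → Type u) (Y : Fin n → Fin n' → Type u) [∀ i j, AddCommGroup (X i j)] [∀
  i j, Module k (X i j)] [∀ i j, AddCommGroup (Y i j)] [∀ i j, Module k (Y i j)] (x : ∀ i j, X i j) (y : ∀ i j, Y i j) (i j) :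
  matTensor (k := k) X Y (x ⊗ₜ y) i j = x (finProdFinEquiv.symm i).1 (finProdFinEquiv.symm j).1 ⊗ₜ y (finProdFinEquiv.symm i).2
  (finProdFinEquiv.symm j).2 := rfl

variable (k)

def pull {ι ι' : Type} (σ : ι' → ι) : (ι → k) →ₐ[k] (ι' → k) := Pi.algHom k _ fun j => Pi.evalAlgHom k _ (σ j)

@[simp] lemma pull_apply {ι ι' : Type} (σ : ι' → ι) (x : ι → k) (j) : pull k σ x j = x (σ j) := rfl

def powMul (m n : ℕ) : ((Fin m → k) ⊗[k] (Fin n → k)) ≃ₐ[k] (Fin (m * n) → k) := AlgEquiv.ofBijective (Algebra.TensorProduct.lift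
  (pull k fun l : Fin (m * n) => (finProdFinEquiv.symm l).1)
    (pull k fun l : Fin (m * n) => (finProdFinEquiv.symm l).2) fun _ _ => Commute.all _ _) (by
    have h : (finTensor (fun _ : Fin m => k) (fun _ : Fin n => k) ≪≫ₗ LinearEquiv.piCongrRight fun _ => TensorProduct.lid k
      k).toLinearMap = (Algebra.TensorProduct.lift (pull k fun l : Fin (m * n) => (finProdFinEquiv.symm l).1) (pull k fun l : Fin
      (m * n) => (finProdFinEquiv.symm l).2) fun _ _ => Commute.all _ _).toLinearMap := TensorProduct.ext' fun x y => by
      rw [AlgHom.toLinearMap_apply, Algebra.TensorProduct.lift_tmul]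
      rfl
    exact (congrArg Function.Bijective (congrArg DFunLike.coe h)).mp (LinearEquiv.bijective _))

lemma powMul_tmul {m n : ℕ} (x : Fin m → k) (y : Fin n → k) (l) : powMul k m n (x ⊗ₜ y) l = x (finProdFinEquiv.symm l).1 * y
  (finProdFinEquiv.symm l).2 := congrFun (Algebra.TensorProduct.lift_tmul (pull k fun l : Fin (m * n) => (finProdFinEquiv.symm
  l).1) (pull k fun l : Fin (m * n) => (finProdFinEquiv.symm l).2) (fun _ _ => Commute.all _ _) x y) l

lemma powMul_tmul' {m n : ℕ} (x : Fin m → k) (y : Fin n → k) (p q) : powMul k m n (x ⊗ₜ y) (finProdFinEquiv (p, q)) = x p * y q :=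
  by
  rw [powMul_tmul, Equiv.symm_apply_apply]

lemma powMul_assoc {l m n : ℕ} (x : Fin l → k) (y : Fin m → k) (z : Fin n → k) : pull k (finCongr (mul_assoc l m n)).symm (powMul
  k (l * m) n (powMul k l m (x ⊗ₜ y) ⊗ₜ z)) = powMul k l (m * n) (x ⊗ₜ powMul k m n (y ⊗ₜ z)) := by
  funext i
  obtain ⟨⟨p, i⟩, rfl⟩ := finProdFinEquiv.surjective i
  obtain ⟨⟨q, r⟩, rfl⟩ := finProdFinEquiv.surjective i
  have h : (finCongr (mul_assoc l m n)).symm _ = _ := KV.finCongr_assoc_symm p q r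
  rw [pull_apply, h, powMul_tmul', powMul_tmul', powMul_tmul', powMul_tmul', mul_assoc]

lemma powMul_one_left {n : ℕ} (r : k) (x : Fin n → k) : pull k (finCongr (one_mul n)).symm (powMul k 1 n ((fun _ => r) ⊗ₜ x)) = r
  • x := by
  funext i
  rw [pull_apply, KV.finCongr_one_mul_symm, powMul_tmul']
  rfl

lemma powMul_one_right {n : ℕ} (r : k) (x : Fin n → k) : pull k (finCongr (mul_one n)).symm (powMul k n 1 (x ⊗ₜ fun _ => r)) = r •
  x := by
  funext i
  rw [pull_apply, KV.finCongr_mul_one_symm, powMul_tmul', mul_comm]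
  rfl

lemma powMul_comm {m n : ℕ} (x : Fin m → k) (y : Fin n → k) : pull k (finProdFinEquiv.symm.trans ((Equiv.prodComm (Fin m) (Fin
  n)).trans finProdFinEquiv)).symm (powMul k m n (x ⊗ₜ y)) = powMul k n m (y ⊗ₜ x) := by
  funext i
  obtain ⟨⟨p, q⟩, rfl⟩ := finProdFinEquiv.surjective i
  have h : (finProdFinEquiv.symm.trans ((Equiv.prodComm (Fin m) (Fin n)).trans
      finProdFinEquiv)).symm (finProdFinEquiv (p, q)) = finProdFinEquiv (q, p) := by simp
  rw [pull_apply, h, powMul_tmul', powMul_tmul', mul_comm]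
end Pow

namespace SmallCat
/-! ### Functors between algebras -/

section StarFunctors
variable {R R' S : Type u} [Ring R] [Algebra k R] [Ring R'] [Algebra k R'] [Ring S] [Algebra k S]

def starMap (f : R →ₐ[k] S) : Star R ⥤ Star S := linFunctor (fun _ => ⟨⟩) (fun _ _ => f.toLinearMap) (fun _ => map_one f) (fun _ _
  _ x y => map_mul f x y)

instance (f : R →ₐ[k] S) : (starMap f).Additive := linFunctor_additive
instance (f : R →ₐ[k] S) : (starMap f).Linear k := linFunctor_linear

def starElt (k : Type u) [Field k] {R : Type u} [Ring R] [Algebra k R] {x y : Star R} : R ≃ₗ[k] (x ⟶ y) := LinearEquiv.refl k R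

/-- The functor from the tensor product of algebras, viewed as categories, to the tensor product of
algebras. -/
def starTensor (k : Type u) [Field k] (R S : Type u) [Ring R] [Algebra k R] [Ring S] [Algebra k S] : LinTensor k (Star R) (Star S)
  ⥤ Star (R ⊗[k] S) := linFunctor (fun _ => ⟨⟩) (fun X Y => (starElt k).toLinearMap ∘ₗ TensorProduct.map (starElt
  k).symm.toLinearMap (starElt k (y := Y.snd)).symm.toLinearMap) (fun _ => rfl) (fun X Y Z f g => by
      induction f using hom_induction with
      | h0 => simp
      | hadd x y hx hy => simp only [map_add, add_comp, hx, hy]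
      | htmul f₁ f₂ =>
      induction g using hom_induction with
      | h0 => simp
      | hadd x y hx hy => simp only [map_add, comp_add, hx, hy]
      | htmul g₁ g₂ =>
      exact (Algebra.TensorProduct.tmul_mul_tmul (R := k) (A := R) (B := S) f₁ g₁ f₂ g₂).symm)

def starTensorInv (k : Type u) [Field k] (R S : Type u) [Ring R] [Algebra k R] [Ring S] [Algebra k S] : Star (R ⊗[k] S) ⥤
  LinTensor k (Star R) (Star S) := linFunctor (fun _ => ⟨⟨⟩, ⟨⟩⟩) (fun _ _ => TensorProduct.map (starElt k (y := ⟨⟩)).toLinearMap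
  (starElt k (x := (⟨⟩ : Star S)) (y := ⟨⟩)).toLinearMap ∘ₗ (starElt k).symm.toLinearMap) (fun _ => rfl) (fun X Y Z f g => by
      obtain ⟨f, rfl⟩ := (starElt k).surjective f
      obtain ⟨g, rfl⟩ := (starElt k).surjective g
      induction f using TensorProduct.induction_on with
      | zero => simp
      | add x y hx hy => simp only [map_add, add_comp, hx, hy]
      | tmul f₁ f₂ =>
      induction g using TensorProduct.induction_on with
      | zero => simp
      | add x y hx hy => simp only [map_add, comp_add, hx, hy]
      | tmul g₁ g₂ =>
      have h := Algebra.TensorProduct.tmul_mul_tmul (R := k) (A := R) (B := S) f₁ g₁ f₂ g₂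
      exact congrArg (TensorProduct.map (starElt k (x := (⟨⟩ : Star R)) (y := ⟨⟩)).toLinearMap
        (starElt k (x := (⟨⟩ : Star S)) (y := ⟨⟩)).toLinearMap) h)

instance : (starTensor k R S).Additive := linFunctor_additive
instance : (starTensor k R S).Linear k := linFunctor_linear
instance : (starTensorInv k R S).Additive := linFunctor_additive
instance : (starTensorInv k R S).Linear k := linFunctor_linear
end StarFunctors

open Ho

section
variable {X Y Z X' Y' : Type u} [Category.{u} X] [Preadditive X] [Linear k X] [Category.{u} Y] [Preadditive Y] [Linear k Y]
  [Category.{u} Z] [Preadditive Z] [Linear k Z] [Category.{u} X'] [Preadditive X'] [Linear k X'] [Category.{u} Y'] [Preadditive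
  Y'] [Linear k Y']

variable (k) in
def fcls (F : X ⥤ Y) [F.Additive] [F.Linear k] : (Ho.mk ⟨X⟩ : Ho (SmallCat k)) ⟶ (Ho.mk ⟨Y⟩ : Ho (SmallCat k)) := cls (ofFunctor'
  F : (⟨X⟩ : SmallCat k) ⟶ ⟨Y⟩)

lemma fcls_comp (F : X ⥤ Y) [F.Additive] [F.Linear k] (G : Y ⥤ Z) [G.Additive] [G.Linear k] : fcls k F ≫ fcls k G = fcls k (F ⋙ G)
  := cls_eq_iff.2 (nonempty_ofFunctor_comp (A := ⟨X⟩) (B := ⟨Y⟩) (C := ⟨Z⟩) F G)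

lemma fcls_id : fcls k (𝟭 X) = 𝟙 _ := rfl

lemma fcls_eq {F G : X ⥤ Y} [F.Additive] [F.Linear k] [G.Additive] [G.Linear k] (e : F ≅ G) : fcls k F = fcls k G := cls_eq_iff.2
  (nonempty_ofFunctor_iso e)

lemma fcls_star {S : Type u} [Ring S] [Algebra k S] {F G : X ⥤ Star S} [F.Additive] [F.Linear k] [G.Additive] [G.Linear k] (h : ∀
  {x y : X} (f : x ⟶ y), F.map f = G.map f) : fcls k F = fcls k G := fcls_eq (NatIso.ofComponents (fun _ => Iso.refl (⟨⟩ : Star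
  S)) fun f => by
    refine (comp_id _).trans ((h f).trans (id_comp _).symm))

lemma fcls_tensor (F : X ⥤ Y) [F.Additive] [F.Linear k] (G : X' ⥤ Y') [G.Additive] [G.Linear k] : cls (B := SmallCat k)
  ((tensorData k).tensorHom (ofFunctor' (k := k) F : (⟨X⟩ : SmallCat k) ⟶ ⟨Y⟩) (ofFunctor' (k := k) G : (⟨X'⟩ : SmallCat k) ⟶
  ⟨Y'⟩)) = fcls k (tensorFunctor (k := k) F G) := cls_eq_iff.2 (nonempty_tensorHom_ofFunctor (A := ⟨X⟩) (A' := ⟨Y⟩) (B := ⟨X'⟩)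
  (B' := ⟨Y'⟩) F G)
end

lemma cls_perm {a b : KV k} (σ : Fin a.n ≃ Fin b.n) : cls ((incl k).map (KV.perm σ : a ⟶ b)) = fcls k (starMap (pull k σ.symm)) :=
  by
  refine cls_eq_iff.2 ⟨isoMk (fun _ _ =>
    { toFun x := fun j => (show PLift (σ (σ.symm j) = j) → k from x (σ.symm j) j)
        ⟨σ.apply_symm_apply j⟩
      invFun y := fun i j => (fun _ => y j : PLift (σ i = j) → k)
      map_add' _ _ := rfl
      map_smul' _ _ := rfl
      left_inv x := by
        refine funext fun i => funext fun j => funext fun (h : PLift (σ i = j)) => ?_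
        obtain ⟨rfl⟩ := h
        have h' (i') (h : i' = i) (h₁ : PLift (σ i' = σ i)) (h₂ : PLift (σ i = σ i)) : (show PLift (σ i' = σ i) → k from x i' (σ
          i)) h₁ = (show PLift (σ i = σ i) → k from x i (σ i)) h₂ := by
          subst h
          exact congrArg _ (Subsingleton.elim h₁ h₂)
        exact h' _ (σ.symm_apply_apply i) _ _
      right_inv _ := rfl }) ?_⟩
  intro d d' c c' g f x
  refine funext fun j => ?_
  change g j * (f (σ.symm j) * _) = g j * (_ * f (σ.symm j))
  congr 1
  exact mul_comm _ _

open Ho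

section
variable {R R' S : Type u} [Ring R] [Algebra k R] [Ring R'] [Algebra k R'] [Ring S] [Algebra k S]

lemma fcls_starMap_comp (f : R →ₐ[k] R') (g : R' →ₐ[k] S) : fcls k (starMap f) ≫ fcls k (starMap g) = fcls k (starMap (g.comp f))
  := (fcls_comp _ _).trans (fcls_star fun _ => rfl)

lemma fcls_starMap_id : fcls k (starMap (AlgHom.id k R)) = 𝟙 (Ho.mk (star k R)) := (fcls_star fun _ => rfl).trans fcls_id

lemma fcls_starMap_equiv (e : R ≃ₐ[k] S) : fcls k (starMap e.toAlgHom) ≫ fcls k (starMap e.symm.toAlgHom) = 𝟙 (Ho.mk (star k R))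
  := by
  rw [fcls_starMap_comp, ← fcls_starMap_id]
  congr 2
  ext x
  exact e.symm_apply_apply x

lemma starTensorInv_map_map {x y : LinTensor k (Star R) (Star S)} (f : x ⟶ y) : (starTensorInv k R S).map ((starTensor k R S).map
  f) = f := by
  induction f using hom_induction with
  | h0 | hadd => simp [*]
  | htmul f g => rfl

lemma starTensor_map_map {x y : Star (R ⊗[k] S)} (f : x ⟶ y) : (starTensor k R S).map ((starTensorInv k R S).map f) = f := by
  obtain ⟨f, rfl⟩ := (starElt k).surjective f
  induction f using TensorProduct.induction_on with
  | zero | add => simp [*]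
  | tmul f g => rfl

lemma fcls_starTensor : fcls k (starTensor k R S) ≫ fcls k (starTensorInv k R S) = 𝟙 _ := by
  have e : starTensor k R S ⋙ starTensorInv k R S ≅ 𝟭 (LinTensor k (Star R) (Star S)) := NatIso.ofComponents (fun x => Iso.refl x)
    fun {x y} f => (comp_id _).trans ((starTensorInv_map_map f).trans (id_comp f).symm)
  rw [fcls_comp, fcls_eq e]
  rfl

lemma fcls_starTensorInv : fcls k (starTensorInv k R S) ≫ fcls k (starTensor k R S) = 𝟙 (Ho.mk (star k (R ⊗[k] S))) := (fcls_comp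
  _ _).trans ((fcls_star fun f => starTensor_map_map f).trans fcls_id)

instance : (starTensor k R S).Full where
  map_surjective f := ⟨(starTensorInv k R S).map f, starTensor_map_map f⟩
end

/-! ### Compatibility with tensor products, for families of algebras -/

section Monoidal
variable {R S Q R' S' Q' U V W : Type u} [Ring R] [Algebra k R] [Ring S] [Algebra k S] [Ring Q] [Algebra k Q] [Ring R'] [Algebra k
  R'] [Ring S'] [Algebra k S'] [Ring Q'] [Algebra k Q'] [Ring U] [Algebra k U] [Ring V] [Algebra k V] [Ring W] [Algebra k W]

abbrev mulFun (e : R ⊗[k] S ≃ₐ[k] Q) : LinTensor k (Star R) (Star S) ⥤ Star Q := starTensor k R S ⋙ starMap e.toAlgHom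

lemma exists_mulFun_equivalence (e : R ⊗[k] S ≃ₐ[k] Q) : ∃ i : Bicategory.Equivalence (tensorObj (star k R) (star k S)) (star k
  Q), i.hom = ofFunctor' (k := k) (mulFun e) := by
  obtain ⟨i, h, -⟩ := Ho.exists_equivalence (B := SmallCat k) (ofFunctor' (mulFun e))
    (ofFunctor' (starMap e.symm.toAlgHom ⋙ starTensorInv k R S)) (by
    change fcls k (mulFun e) ≫ fcls k (starMap _ ⋙ starTensorInv k _ _) = _
    rw [← fcls_comp, ← fcls_comp, assoc, reassoc_of% (fcls_starMap_equiv e),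
      fcls_starTensor]) (by
    change fcls k (starMap _ ⋙ starTensorInv k _ _) ≫ fcls k (mulFun e) = _
    rw [← fcls_comp, ← fcls_comp, assoc, reassoc_of% (fcls_starTensorInv), show fcls k (starMap e.symm.toAlgHom) ≫ fcls k (starMap
      e.toAlgHom) = _
        from fcls_starMap_equiv e.symm])
  exact ⟨i, h⟩

def mulEquiv (e : R ⊗[k] S ≃ₐ[k] Q) : Bicategory.Equivalence (tensorObj (star k R) (star k S)) (star k Q) :=
  (exists_mulFun_equivalence e).choose

lemma mulEquiv_hom (e : R ⊗[k] S ≃ₐ[k] Q) : (mulEquiv e).hom = ofFunctor' (k := k) (mulFun e) := (exists_mulFun_equivalence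
  e).choose_spec

lemma exists_starMap_equivalence (e : R ≃ₐ[k] S) : ∃ i : Bicategory.Equivalence (star k R) (star k S), i.hom = ofFunctor' (k := k)
  (starMap e.toAlgHom) :=
  let ⟨i, h, _⟩ := Ho.exists_equivalence _ _ (fcls_starMap_equiv e) (fcls_starMap_equiv e.symm)
  ⟨i, h⟩

def starEquiv (e : R ≃ₐ[k] S) : Bicategory.Equivalence (star k R) (star k S) := (exists_starMap_equivalence e).choose

lemma starEquiv_hom (e : R ≃ₐ[k] S) : (starEquiv e).hom = ofFunctor' (k := k) (starMap e.toAlgHom) := (exists_starMap_equivalence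
  e).choose_spec

lemma mulEquiv_naturality (e : R ⊗[k] S ≃ₐ[k] Q) (e' : R' ⊗[k] S' ≃ₐ[k] Q') (F : Hom (star k R) (star k R')) (G : Hom (star k S)
  (star k S')) (P : Hom (star k Q) (star k Q')) (θ : (F.obj ⟨⟩ ⟨⟩ ⊗[k] G.obj ⟨⟩ ⟨⟩) ≃ₗ[k] P.obj ⟨⟩ ⟨⟩) (h : ∀ (g₁ : R') (g₂ : S')
  (f₁ : R) (f₂ : S) x y, θ (F.act (d' := ⟨⟩) (c' := ⟨⟩) g₁ f₁ x ⊗ₜ G.act (d' := ⟨⟩) (c' := ⟨⟩) g₂ f₂ y) = P.act (e' (g₁ ⊗ₜ g₂)) (e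
  (f₁ ⊗ₜ f₂)) (θ (x ⊗ₜ y))) : Nonempty ((tensorData k).tensorHom F G ≫ (mulEquiv e').hom ≅ (mulEquiv e).hom ≫ P) := by
  rw [mulEquiv_hom, mulEquiv_hom]
  have h₁ : (mulFun e).Additive := inferInstance
  have h₂ : (mulFun e).Linear k := inferInstance
  have h₁' : (mulFun e').Additive := inferInstance
  have h₂' : (mulFun e').Linear k := inferInstance
  have h₃ : (mulFun e').Full := ⟨fun f => by
      obtain ⟨g, hg⟩ := (starTensor k _ _).map_surjective (starElt k (e'.symm f))
      exact ⟨g, (congrArg (starMap e'.toAlgHom).map hg).trans (e'.apply_symm_apply f)⟩⟩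
  let T := @res₂ k _ (tensorObj (star k R) (star k S)) _ (tensorObj (star k R') (star k S')) _ (mulFun e) h₁ h₂ (mulFun e') h₁'
    h₂' P
  exact nonempty_iso_of_square (A := tensorObj (star k R) (star k S)) (B := tensorObj (star k R') (star k S')) (A' := star k Q)
    (B' := star k Q') (mulFun e) (mulFun e') (fun d => ⟨⟨⟨⟩, ⟨⟩⟩, ⟨Iso.refl d⟩⟩) (P := tensorHom F G) (Q := P) (fun _ _ => θ) (fun
    g' f' x => act_tensor (R := T) (fun _ _ => θ.toLinearMap) (fun g₁ g₂ f₁ f₂ x y => h g₁ g₂ f₁ f₂ x y) g' f' x)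

lemma mulEquiv_associativity (e₁ : R ⊗[k] S ≃ₐ[k] U) (e₂ : U ⊗[k] Q ≃ₐ[k] V) (e₃ : S ⊗[k] Q ≃ₐ[k] W) (e₄ : R ⊗[k] W ≃ₐ[k] R') (α :
  V →ₐ[k] R') {a : star k V ⟶ star k R'} (ha : cls a = fcls k (starMap α)) (h : ∀ f g x, α (e₂ (e₁ (f ⊗ₜ g) ⊗ₜ x)) = e₄ (f ⊗ₜ e₃
  (g ⊗ₜ x))) : Nonempty ((tensorData k).tensorHom (mulEquiv e₁).hom (𝟙 (star k Q)) ≫ (mulEquiv e₂).hom ≫ a ≅ (tensorData k).assoc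
  (star k R) (star k S) (star k Q) ≫ (tensorData k).tensorHom (𝟙 (star k R)) (mulEquiv e₃).hom ≫ (mulEquiv e₄).hom) := by
  rw [mulEquiv_hom, mulEquiv_hom, mulEquiv_hom, mulEquiv_hom]
  refine cls_eq_iff.1 ?_
  refine (congrArg₂ (· ≫ ·) (fcls_tensor (k := k) (mulFun e₁) (𝟭 (Star Q))) (congrArg (fcls k (mulFun e₂) ≫ ·) ha)).trans ?_
  refine Eq.trans ?_ (congrArg (fcls k (assocFunctor k _ _ _) ≫ ·) (congrArg (· ≫ fcls k (mulFun e₄)) (fcls_tensor (k := k) (𝟭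
    (Star R)) (mulFun e₃)))).symm
  refine (congrArg (fcls k (tensorFunctor _ _) ≫ ·) (fcls_comp _ _)).trans ((fcls_comp _ _).trans (Eq.trans ?_ ((congrArg (fcls k
    (assocFunctor k _ _ _) ≫ ·) (fcls_comp _ _)).trans (fcls_comp _ _)).symm))
  refine fcls_star fun {x y} f => ?_
  induction f using hom_induction with
  | h0 => simp
  | hadd x y hx hy => simp only [Functor.map_add, hx, hy]
  | htmul f x =>
  induction f using hom_induction with
  | h0 => simp
  | hadd x y hx hy =>
    simp only [Functor.map_add, map_add, LinearMap.add_apply, hx, hy]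
  | htmul f g => exact h f g x

lemma mulEquiv_left_unitality (e₀ : k ≃ₐ[k] U) (e : U ⊗[k] R ≃ₐ[k] S) (l : S →ₐ[k] R) {a : star k S ⟶ star k R} (ha : cls a = fcls
  k (starMap l)) (h : ∀ t x, l (e (e₀ t ⊗ₜ x)) = t • x) : Nonempty ((tensorData k).tensorHom (starEquiv e₀).hom (𝟙 (star k R)) ≫
  (mulEquiv e).hom ≫ a ≅ (tensorData k).leftUnitor (star k R)) := by
  rw [mulEquiv_hom, starEquiv_hom]
  refine cls_eq_iff.1 ?_
  refine (congrArg₂ (· ≫ ·) (fcls_tensor (starMap _) (𝟭 (Star R))) (congrArg (fcls k (mulFun e) ≫ ·) ha)).trans ?_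
  refine (congrArg (fcls k (tensorFunctor _ _) ≫ ·) (fcls_comp _ _)).trans ((fcls_comp _ _).trans (?_ : _ = fcls k
    (leftUnitorFunctor k (Star R))))
  refine fcls_star fun {x y} f => ?_
  induction f using hom_induction with
  | h0 => simp
  | hadd x y hx hy => simp only [Functor.map_add, hx, hy]
  | htmul f g => exact h f g

lemma mulEquiv_right_unitality (e₀ : k ≃ₐ[k] U) (e : R ⊗[k] U ≃ₐ[k] S) (r : S →ₐ[k] R) {a : star k S ⟶ star k R} (ha : cls a =
  fcls k (starMap r)) (h : ∀ t x, r (e (x ⊗ₜ e₀ t)) = t • x) : Nonempty ((tensorData k).tensorHom (𝟙 (star k R)) (starEquiv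
  e₀).hom ≫ (mulEquiv e).hom ≫ a ≅ (tensorData k).rightUnitor (star k R)) := by
  rw [mulEquiv_hom, starEquiv_hom]
  refine cls_eq_iff.1 ?_
  refine (congrArg₂ (· ≫ ·) (fcls_tensor (𝟭 (Star R)) (starMap _)) (congrArg (fcls k (mulFun e) ≫ ·) ha)).trans ?_
  refine (congrArg (fcls k (tensorFunctor _ _) ≫ ·) (fcls_comp _ _)).trans ((fcls_comp _ _).trans (?_ : _ = fcls k
    (rightUnitorFunctor k (Star R))))
  refine fcls_star fun {x y} f => ?_
  induction f using hom_induction with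
  | h0 => simp
  | hadd x y hx hy => simp only [Functor.map_add, hx, hy]
  | htmul f g => exact h g f

lemma mulEquiv_symmetry (e : R ⊗[k] S ≃ₐ[k] U) (e' : S ⊗[k] R ≃ₐ[k] V) (b : U →ₐ[k] V) {a : star k U ⟶ star k V} (ha : cls a =
  fcls k (starMap b)) (h : ∀ x y, b (e (x ⊗ₜ y)) = e' (y ⊗ₜ x)) : Nonempty ((mulEquiv e).hom ≫ a ≅ (tensorData k).braiding (star k
  R) (star k S) ≫ (mulEquiv e').hom) := by
  rw [mulEquiv_hom, mulEquiv_hom]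
  refine cls_eq_iff.1 ?_
  refine (congrArg (fcls k (mulFun e) ≫ ·) ha).trans ?_
  refine (fcls_comp _ _).trans (Eq.trans ?_ (fcls_comp (braidingFunctor k _ _) (mulFun e')).symm)
  refine fcls_star fun {x y} f => ?_
  induction f using hom_induction with
  | h0 => simp
  | hadd x y hx hy => simp only [Functor.map_add, hx, hy]
  | htmul f g => exact h f g
end Monoidal

def chi (a b : KV k) : Bicategory.Equivalence ((tensorData k).tensorObj ((incl k).obj a) ((incl k).obj b)) ((incl k).obj
  ((KV.tensorData k).tensorObj a b)) := mulEquiv (powMul k a.n b.n)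

def chiUnit (k : Type u) [Field k] : Bicategory.Equivalence (tensorData k).unit ((incl k).obj (KV.tensorData k).unit) := starEquiv
  (AlgEquiv.funUnique k (Fin 1) k).symm

lemma chi_naturality {a a' b b' : KV k} (f : a ⟶ a') (g : b ⟶ b') : Nonempty ((tensorData k).tensorHom ((incl k).map f) ((incl
  k).map g) ≫ (chi a' b').hom ≅ (chi a b).hom ≫ (incl k).map ((KV.tensorData k).tensorHom f g)) := by
  refine mulEquiv_naturality (powMul k a.n b.n) (powMul k a'.n b'.n) (ofMatrix f) (ofMatrix g) (ofMatrix ((KV.tensorData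
    k).tensorHom f g)) (matTensor (fun i j => KV.Hom.entry f i j) (fun i j => KV.Hom.entry g i j)) ?_
  intro g₁ g₂ f₁ f₂ x y
  refine funext fun i => funext fun j => ?_
  refine Eq.trans ?_ (congrArg₂ (fun s t : k => s • t • (matTensor (k := k) (fun i j => KV.Hom.entry f i j) (fun i j =>
    KV.Hom.entry g i j) (x ⊗ₜ y) i j)) (powMul_tmul k g₁ g₂ j) (powMul_tmul k f₁ f₂ i)).symm
  exact (TensorProduct.smul_tmul_smul _ _ _ _).trans ((congrArg _ (TensorProduct.smul_tmul_smul _ _ _ _)).trans rfl)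

lemma preserves_incl (k : Type u) [Field k] : TensorData.Preserves (KV.tensorData k) (tensorData k) (incl k) (chiUnit k) chi where
  naturality := chi_naturality
  associativity a b c := mulEquiv_associativity (powMul k a.n b.n) (powMul k (a.n * b.n) c.n) (powMul k b.n c.n) (powMul k a.n
    (b.n * c.n)) _ (cls_perm (finCongr (mul_assoc a.n b.n c.n))) (powMul_assoc k)
  left_unitality a := mulEquiv_left_unitality _ (powMul k 1 a.n) _ (cls_perm (finCongr (one_mul a.n))) (powMul_one_left k)
  right_unitality a := mulEquiv_right_unitality _ (powMul k a.n 1) _ (cls_perm (finCongr (mul_one a.n))) (powMul_one_right k)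
  symmetry a b := mulEquiv_symmetry (powMul k a.n b.n) (powMul k b.n a.n) _ (cls_perm (finProdFinEquiv.symm.trans ((Equiv.prodComm
    (Fin a.n) (Fin b.n)).trans finProdFinEquiv))) (powMul_comm k)
end SmallCat

/-! ### Products of matrices of vectors -/

section MatMul
variable {a b c d : KV k}

abbrev Mat (M : a ⟶ b) : Type u := ∀ i j, KV.Hom.entry M i j

def matSingle {M : a ⟶ b} (i : Fin a.n) (j : Fin b.n) : KV.Hom.entry M i j →ₗ[k] Mat M := LinearMap.single k (fun i => ∀ j,
  KV.Hom.entry M i j) i ∘ₗ LinearMap.single k (fun j => KV.Hom.entry M i j) j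

lemma matSingle_apply {M : a ⟶ b} (i : Fin a.n) (j : Fin b.n) (x : KV.Hom.entry M i j) (i' j') : matSingle (M := M) i j x i' j' =
      if h : i = i' then if h' : j = j' then h ▸ h' ▸ x else 0 else 0 := by
  change (Pi.single i (Pi.single j x) : Mat M) i' j' = _
  by_cases h : i = i'
  · subst h
    rw [Pi.single_eq_same, dif_pos rfl]
    by_cases h' : j = j'
    · subst h'
      rw [Pi.single_eq_same, dif_pos rfl]
    · rw [Pi.single_eq_of_ne' h', dif_neg h']
  · rw [Pi.single_eq_of_ne' h, dif_neg h]
    rfl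

@[simp]
lemma matSingle_same {M : a ⟶ b} (i : Fin a.n) (j : Fin b.n) (x : KV.Hom.entry M i j) : matSingle (M := M) i j x i j = x := by
  rw [matSingle_apply, dif_pos rfl, dif_pos rfl]

lemma matSingle_ne {M : a ⟶ b} {i i' : Fin a.n} {j j' : Fin b.n} (x : KV.Hom.entry M i j) (h : ¬(i = i' ∧ j = j')) : matSingle (M
  := M) i j x i' j' = 0 := by
  rw [matSingle_apply]
  split_ifs with h₁ h₂
  · exact (h ⟨h₁, h₂⟩).elim
  · rfl
  · rfl

lemma sum_matSingle {M : a ⟶ b} (x : Mat M) : ∑ i, ∑ j, matSingle (M := M) i j (x i j) = x := by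
  funext i j
  simp only [Finset.sum_apply]
  rw [sum_eq_single i, sum_eq_single j, matSingle_same]
  · intro j' _ h
    exact matSingle_ne _ fun h' => h h'.2
  · simp
  · intro i' _ h
    exact sum_eq_zero fun j' _ => matSingle_ne _ fun h' => h h'.1
  · simp

lemma mat_linear_ext {M : a ⟶ b} {X : Type u} [AddCommGroup X] [Module k X] {φ ψ : Mat M →ₗ[k] X} (h : ∀ i j x, φ (matSingle (M :=
  M) i j x) = ψ (matSingle (M := M) i j x)) : φ = ψ := by
  refine LinearMap.ext fun x => ?_
  rw [← sum_matSingle (M := M) x]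
  simp only [map_sum, h]

def rowAct {M : a ⟶ b} : (Fin a.n → k) →ₗ[k] Mat M →ₗ[k] Mat M := ALG.rowSmul fun i j => KV.Hom.entry M i j

def colAct {M : a ⟶ b} : Mat M →ₗ[k] (Fin b.n → k) →ₗ[k] Mat M := ALG.colSmul fun i j => KV.Hom.entry M i j

lemma rowAct_apply {M : a ⟶ b} (r : Fin a.n → k) (x : Mat M) (i j) : rowAct (M := M) r x i j = r i • x i j := rfl

lemma colAct_apply {M : a ⟶ b} (r : Fin b.n → k) (x : Mat M) (i j) : colAct (M := M) x r i j = r j • x i j := rfl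

lemma rowAct_matSingle {M : a ⟶ b} (i : Fin a.n) (j : Fin b.n) (x : KV.Hom.entry M i j) : rowAct (M := M) (Pi.single i 1)
  (matSingle (M := M) i j x) = matSingle (M := M) i j x := by
  funext i' j'
  rw [rowAct_apply]
  by_cases h : i = i'
  · subst h
    rw [Pi.single_eq_same, one_smul]
  · rw [matSingle_ne x fun h' => h h'.1, smul_zero]

lemma colAct_single {M : a ⟶ b} (j : Fin b.n) (x : Mat M) : colAct (M := M) x (Pi.single j 1) = ∑ i, matSingle (M := M) i j (x i
  j) := by
  funext i' j'
  rw [colAct_apply, Finset.sum_apply, Finset.sum_apply]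
  by_cases h : j = j'
  · subst h
    rw [Pi.single_eq_same, one_smul, sum_eq_single i', matSingle_same]
    · intro i _ h
      exact matSingle_ne _ fun h' => h h'.1
    · simp
  · rw [Pi.single_eq_of_ne' h, zero_smul, sum_eq_zero]
    exact fun i _ => matSingle_ne _ fun h' => h h'.2

lemma mat_map_apply {M N : a ⟶ b} (θ : Mat M →ₗ[k] Mat N) (h : ∀ r x, θ (rowAct (M := M) r x) = rowAct (M := N) r (θ x)) (h' : ∀ r
  x, θ (colAct (M := M) x r) = colAct (M := N) (θ x) r) (x : Mat M) (i j) : θ x i j = θ (matSingle (M := M) i j (x i j)) i j := by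
  have h₁ : rowAct (M := M) (Pi.single i 1) (colAct (M := M) x (Pi.single j 1)) = matSingle (M := M) i j (x i j) := by
    funext i' j'
    rw [rowAct_apply, colAct_apply]
    by_cases hi : i = i'
    · subst hi
      by_cases hj : j = j'
      · subst hj
        simp
      · rw [matSingle_ne _ fun h' => hj h'.2, Pi.single_eq_of_ne' hj, zero_smul, smul_zero]
    · rw [matSingle_ne _ fun h' => hi h'.1, Pi.single_eq_of_ne' hi, zero_smul]
  rw [← h₁, h, h', rowAct_apply, colAct_apply, Pi.single_eq_same, Pi.single_eq_same, one_smul, one_smul]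

def matMul {M : a ⟶ b} {N : b ⟶ c} : Mat N →ₗ[k] Mat M →ₗ[k] Mat (M ≫ N) := LinearMap.mk₂ k (fun q p i l => ∑ j, KV.tmul (M := M)
  (N := N) j (p i j) (q j l)) (fun q q' p => by funext i l; simp [sum_add_distrib]) (fun r q p => by funext i l; simp [smul_sum])
  (fun q p p' => by funext i l; simp [sum_add_distrib]) (fun r q p => by funext i l; simp [smul_sum])

lemma matMul_apply {M : a ⟶ b} {N : b ⟶ c} (q : Mat N) (p : Mat M) (i l) : matMul (M := M) (N := N) q p i l = ∑ j, KV.tmul (M :=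
  M) (N := N) j (p i j) (q j l) := rfl

lemma matMul_rowAct_colAct {M : a ⟶ b} {N : b ⟶ c} (s : Fin c.n → k) (r : Fin a.n → k) (q : Mat N) (p : Mat M) : matMul (M := M)
  (N := N) (colAct (M := N) q s) (rowAct (M := M) r p) = colAct (M := M ≫ N) (rowAct (M := M ≫ N) r (matMul (M := M) (N := N) q
  p)) s := by
  funext i l
  rw [colAct_apply, rowAct_apply, matMul_apply, matMul_apply, smul_sum, smul_sum]
  refine sum_congr rfl fun j _ => ?_
  rw [colAct_apply, rowAct_apply, map_smul, map_smul, LinearMap.smul_apply]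

lemma matMul_balanced {M : a ⟶ b} {N : b ⟶ c} (r : Fin b.n → k) (q : Mat N) (p : Mat M) : matMul (M := M) (N := N) (rowAct (M :=
  N) r q) p = matMul (M := M) (N := N) q (colAct (M := M) p r) := by
  funext i l
  rw [matMul_apply, matMul_apply]
  refine sum_congr rfl fun j _ => ?_
  rw [colAct_apply, rowAct_apply, map_smul, map_smul, LinearMap.smul_apply]

section
variable {M : a ⟶ b} {N : b ⟶ c} {X : Type u} [AddCommGroup X] [Module k X]

def matDesc (β : Mat N →ₗ[k] Mat M →ₗ[k] X) : Mat (M ≫ N) →ₗ[k] X := ∑ i, ∑ l, KV.desc (M := M) (N := N) (fun j => (β.compl₁₂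
  (matSingle (M := N) j l) (matSingle (M := M) i j)).flip) ∘ₗ LinearMap.proj l ∘ₗ LinearMap.proj i

lemma matDesc_apply (β : Mat N →ₗ[k] Mat M →ₗ[k] X) (y : Mat (M ≫ N)) : matDesc (M := M) (N := N) β y = ∑ i, ∑ l, KV.desc (M := M)
  (N := N) (fun j => (β.compl₁₂ (matSingle (M := N) j l) (matSingle (M := M) i j)).flip) (y i l) := by
  simp [matDesc]

lemma matDesc_matMul (β : Mat N →ₗ[k] Mat M →ₗ[k] X) (h : ∀ r q p, β (rowAct (M := N) r q) p = β q (colAct (M := M) p r)) (q : Mat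
  N) (p : Mat M) : matDesc (M := M) (N := N) β (matMul (M := M) (N := N) q p) = β q p := by
  have h₁ (i l) : KV.desc (M := M) (N := N) (fun j => (β.compl₁₂ (matSingle (M := N) j l) (matSingle (M := M) i j)).flip) (matMul
    (M := M) (N := N) q p i l) = ∑ j, β (matSingle (M := N) j l (q j l)) (matSingle (M := M) i j (p i j)) := by
    rw [matMul_apply, map_sum]
    exact sum_congr rfl fun j _ => KV.desc_tmul _ _ _ _
  conv_rhs => rw [← sum_matSingle (M := N) q]
  rw [matDesc_apply]
  simp only [h₁, map_sum, LinearMap.sum_apply]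
  have h₂ (j l) : β (matSingle (M := N) j l (q j l)) p = ∑ i, β (matSingle (M := N) j l (q j l)) (matSingle (M := M) i j (p i j))
    := by
    rw [← rowAct_matSingle, h, colAct_single, map_sum, rowAct_matSingle]
  simp only [h₂]
  rw [sum_comm, sum_congr rfl fun l _ => sum_comm, sum_comm]

lemma matMul_ext {φ ψ : Mat (M ≫ N) →ₗ[k] X} (h : ∀ q p, φ (matMul (M := M) (N := N) q p) = ψ (matMul (M := M) (N := N) q p)) : φ
  = ψ := by
  refine mat_linear_ext fun i l x => ?_
  induction x using KV.mul_induction (M := M) (N := N) with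
  | h0 | hadd => simp [*]
  | htmul j m n =>
  have h₁ : matMul (M := M) (N := N) (matSingle (M := N) j l n) (matSingle (M := M) i j m) = matSingle (M := M ≫ N) i l (KV.tmul
    (M := M) (N := N) j m n) := by
    funext i' l'
    rw [matMul_apply, sum_eq_single j]
    · by_cases hi : i = i'
      · subst hi
        by_cases hl : l = l'
        · subst hl
          simp
        · rw [matSingle_ne (M := N) _ fun h' => hl h'.2, matSingle_ne _ fun h' => hl h'.2, map_zero]
      · rw [matSingle_ne (M := M) _ fun h' => hi h'.1, matSingle_ne _ fun h' => hi h'.1, map_zero, LinearMap.zero_apply]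
    · intro j' _ hj
      rw [matSingle_ne (M := N) _ fun h' => hj h'.1.symm, map_zero]
    · simp
  rw [← h₁, h]
end

def matDiag : (Fin a.n → k) →ₗ[k] Mat (𝟙 a) where
  toFun r i j := (fun _ => r j : PLift (i = j) → k)
  map_add' _ _ := rfl
  map_smul' _ _ := rfl

lemma matDiag_bijective : Function.Bijective (matDiag (a := a)) := by
  refine ⟨fun r s h => funext fun i => congrFun (congrFun (congrFun h i) i) ⟨rfl⟩, fun x => ⟨fun j => (show PLift (j = j) → k from
    x j j) ⟨rfl⟩, ?_⟩⟩
  refine funext fun i => funext fun j => funext fun (h : PLift (i = j)) => ?_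
  obtain ⟨rfl⟩ := h
  rfl

lemma matMul_matDiag_one {M : a ⟶ b} (x : Mat M) (i l) : matMul (M := 𝟙 a) (N := M) x (matDiag (fun _ => 1)) i l = KV.tmul (M := 𝟙
  a) (N := M) i (KV.oneElt i) (x i l) := by
  rw [matMul_apply, sum_eq_single i]
  · rfl
  · intro j _ h
    rw [KV.one_zero h.symm (matDiag (fun _ => 1) i j), map_zero, LinearMap.zero_apply]
  · simp

lemma matMul_one_matDiag {M : a ⟶ b} (x : Mat M) (i l) : matMul (M := M) (N := 𝟙 b) (matDiag (fun _ => 1)) x i l = KV.tmul (M :=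
  M) (N := 𝟙 b) l (x i l) (KV.oneElt l) := by
  rw [matMul_apply, sum_eq_single l]
  · rfl
  · intro j _ h
    rw [KV.one_zero h (matDiag (fun _ => 1) j l), map_zero]
  · simp

def matMap {M N : a ⟶ b} (η : M ⟶ N) : Mat M →ₗ[k] Mat N := LinearMap.pi fun i => LinearMap.pi fun j => KV.Hom₂.entry η i j ∘ₗ
  LinearMap.proj j ∘ₗ LinearMap.proj i

lemma matMap_apply {M N : a ⟶ b} (η : M ⟶ N) (x : Mat M) (i j) : matMap η x i j = KV.Hom₂.entry η i j (x i j) := rfl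

lemma matMap_whiskerRight {M M' : a ⟶ b} (η : M ⟶ M') (N : b ⟶ c) (q : Mat N) (p : Mat M) : matMap (η ▷ N) (matMul (M := M) (N :=
  N) q p) = matMul (M := M') (N := N) q (matMap η p) := by
  funext i l
  rw [matMap_apply, matMul_apply, matMul_apply, map_sum]
  exact sum_congr rfl fun j _ => KV.whiskerRight_tmul η N l j _ _

lemma matMap_whiskerLeft (M : a ⟶ b) {N N' : b ⟶ c} (η : N ⟶ N') (q : Mat N) (p : Mat M) : matMap (M ◁ η) (matMul (M := M) (N :=
  N) q p) = matMul (M := M) (N := N') (matMap η q) p := by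
  funext i l
  rw [matMap_apply, matMul_apply, matMul_apply, map_sum]
  exact sum_congr rfl fun j _ => KV.whiskerLeft_tmul M η l j _ _

lemma matMap_associator (M : a ⟶ b) (N : b ⟶ c) (P : c ⟶ d) (r : Mat P) (q : Mat N) (p : Mat M) : matMap (α_ M N P).hom (matMul (M
  := M ≫ N) (N := P) r (matMul (M := M) (N := N) q p)) = matMul (M := M) (N := N ≫ P) (matMul (M := N) (N := P) r q) p := by
  funext i l
  rw [matMap_apply, matMul_apply, matMul_apply]
  simp only [matMul_apply, map_sum, LinearMap.sum_apply]
  rw [sum_comm]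
  exact sum_congr rfl fun j _ => sum_congr rfl fun j' _ => KV.associatorHom_tmul M N P l j j' _ _ _
end MatMul

namespace SmallCat
/-! #### The inclusion into bimodules, as a pseudofunctor -/

variable {a b c d : KV k}

lemma ofMatrix_act_one {M : a ⟶ b} {x : Star (Fin b.n → k)} {y y' : Star (Fin a.n → k)} (f : y ⟶ y') (p : Mat M) : (ofMatrix
  M).act (𝟙 x) f p = rowAct (M := M) f p := funext fun i => funext fun j => one_smul k (f i • p i j)

lemma ofMatrix_one_act {M : a ⟶ b} {x x' : Star (Fin b.n → k)} {y : Star (Fin a.n → k)} (f : x ⟶ x') (p : Mat M) : (ofMatrix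
  M).act f (𝟙 y) p = colAct (M := M) p f := funext fun i => funext fun j => congrArg (fun t : KV.Hom.entry M i j => f j • t)
  (one_smul k (p i j))

def inclComp (M : a ⟶ b) (N : b ⟶ c) : comp (ofMatrix M) (ofMatrix N) ⟶ ofMatrix (M ≫ N) := descHom
    (fun _ _ _ => matMul) (by
      intro c a b b' f q p
      refine Eq.trans (congrArg₂ (fun q p => matMul q p) ?_ ?_) ((matMul_balanced f q p).trans (congrArg₂ (fun q p => matMul q p)
        ?_ ?_))
      · exact ofMatrix_act_one f q
      · rfl
      · rfl
      · exact (ofMatrix_one_act f p).symm)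
    (by
      intro c c' a a' b g f q p
      refine Eq.trans (congrArg₂ (fun q p => matMul q p) ?_ ?_) ((matMul_rowAct_colAct g f q p).trans rfl)
      · exact ofMatrix_one_act g q
      · exact ofMatrix_act_one f p)

lemma inclComp_tmul (M : a ⟶ b) (N : b ⟶ c) (x y z) (q : Mat N) (p : Mat M) : (inclComp M N).app x y (tmul (P := ofMatrix M) (Q :=
  ofMatrix N) z q p) = matMul (M := M) (N := N) q p := descHom_tmul _ _ _ _ _ _ _ _

instance (M : a ⟶ b) (N : b ⟶ c) : IsIso (inclComp M N) := by
  obtain ⟨i, hi⟩ : ∃ i : comp (ofMatrix M) (ofMatrix N) ≅ ofMatrix (M ≫ N), i.hom = inclComp M N := by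
    let inv (x y) : (ofMatrix (M ≫ N)).obj x y →ₗ[k] (comp (ofMatrix M) (ofMatrix N)).obj x y := matDesc (M := M) (N := N) (tmul
      (P := ofMatrix M) (Q := ofMatrix N) (c := x) (a := y) ⟨⟩)
    have h (x y) (q : Mat N) (p : Mat M) : inv x y (matMul (M := M) (N := N) q p) = tmul (P := ofMatrix M) (Q := ofMatrix N) (c :=
      x) (a := y) ⟨⟩ q p := by
      refine matDesc_matMul (M := M) (N := N) _ (fun r q p => ?_) q p
      have := act_tmul (P := ofMatrix M) (Q := ofMatrix N) (c := x) (a := y) (b := ⟨⟩) (b' := ⟨⟩) r q p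
      refine Eq.trans (congrArg₂ (fun q p => tmul (P := ofMatrix M) (Q := ofMatrix N) (c := x) (a := y) ⟨⟩ q p) ?_ ?_) (this.trans
        (congrArg₂ (fun q p => tmul (P := ofMatrix M) (Q := ofMatrix N) (c := x) (a := y) ⟨⟩ q p) ?_ ?_))
      · exact (ofMatrix_act_one r q).symm
      · rfl
      · rfl
      · exact ofMatrix_one_act r p
    refine ⟨isoMk (fun x y => LinearEquiv.ofLinear ((inclComp M N).app x y) (inv x y) ?_ ?_) (inclComp M N).app_act, rfl⟩
    · refine matMul_ext (M := M) (N := N) fun q p => ?_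
      exact (congrArg ((inclComp M N).app x y) (h x y q p)).trans (inclComp_tmul M N x y ⟨⟩ q p)
    · refine comp_linear_ext fun z q p => ?_
      exact (congrArg (inv x y) (inclComp_tmul M N x y z q p)).trans (h x y q p)
  rw [← hi]
  infer_instance

def inclId (a : KV k) : one (star k (Fin a.n → k)) ⟶ ofMatrix (𝟙 a) :=
  Hom₂.mk (fun _ _ => matDiag) (by
    intro d d' c c' g f x
    refine funext fun i => funext fun j => funext fun (h : PLift (i = j)) => ?_
    obtain ⟨rfl⟩ := h
    change g i * (x i * f i) = g i * (f i * x i)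
    rw [mul_comm (x i)])

instance (a : KV k) : IsIso (inclId a) := by
  let i : one (star k (Fin a.n → k)) ≅ ofMatrix (𝟙 a) := isoMk

    (fun x y => LinearEquiv.ofBijective ((inclId a).app x y) matDiag_bijective) (inclId a).app_act
  exact inferInstanceAs (IsIso i.hom)

def inclLax (k : Type u) [Field k] : LaxFunctor (KV k) (SmallCat k) where
  toPrelaxFunctor := incl k
  mapId a := inclId a
  mapComp M N := inclComp M N
  mapComp_naturality_left {a b c M M'} η N := hom_ext_comp fun x y z q p => (congrArg (matMap (η ▷ N)) (inclComp_tmul M N x y z q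
    p)).trans ((matMap_whiskerRight η N q p).trans (inclComp_tmul M' N x y z q (matMap η p)).symm |>.trans (congrArg ((inclComp M'
    N).app x y) (whiskerRight_tmul ((incl k).map₂ η) (ofMatrix N) x y z q p)).symm)
  mapComp_naturality_right {a b c} M {N N'} η := hom_ext_comp fun x y z q p => (congrArg (matMap (M ◁ η)) (inclComp_tmul M N x y z
    q p)).trans ((matMap_whiskerLeft M η q p).trans (inclComp_tmul M N' x y z (matMap η q) p).symm |>.trans (congrArg ((inclComp M
    N').app x y) (whiskerLeft_tmul (ofMatrix M) ((incl k).map₂ η) x y z q p)).symm)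
  map₂_associator {a b c d} M N P := hom_ext_comp_comp fun x y z z' r q p => by
    have h₁ := (congrArg (fun t => matMap (α_ M N P).hom (matMul r t)) (inclComp_tmul M N z y z' q p))
    have h₂ := (congrArg (matMap (α_ M N P).hom) (inclComp_tmul (M ≫ N) P x y z r ((inclComp M N).app z y (tmul z' q p))))
    have h₀ := congrArg (fun t => matMap (α_ M N P).hom ((inclComp (M ≫ N) P).app x y t)) (whiskerRight_tmul (inclComp M N)
      (ofMatrix P) x y z r (tmul z' q p))
    have h₃ := (congrArg (fun t => matMul t p) (inclComp_tmul N P x z' z r q))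
    have h₄ := congrArg ((inclComp M (N ≫ P)).app x y) ((congrArg ((whiskerLeft (ofMatrix M) (inclComp N P)).app x y)
      (associatorHom_tmul (ofMatrix M) (ofMatrix N) (ofMatrix P) x y z z' r q p)).trans (whiskerLeft_tmul (ofMatrix M) (inclComp N
      P) x y z' (tmul z r q) p))
    exact ((h₀.trans h₂).trans h₁).trans ((matMap_associator M N P r q p).trans (h₄.trans ((inclComp_tmul M (N ≫ P) x y z' _
      p).trans h₃)).symm)
  map₂_leftUnitor {a b} M := hom₂_ext fun x y z => by
    have h₁ := congrArg ((inclComp (𝟙 a) M).app x y) (whiskerRight_tmul (inclId a) (ofMatrix M) x y y z (homElt (𝟙 y)))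
    refine Eq.trans (?_ : _ = matMul z (matDiag (fun _ => 1))) (h₁.trans (inclComp_tmul (𝟙 a) M x y y z (matDiag (fun _ =>
      1)))).symm
    exact funext fun i => funext fun l => (matMul_matDiag_one z i l).symm
  map₂_rightUnitor {a b} M := hom₂_ext fun x y z => by
    have h₁ := congrArg ((inclComp M (𝟙 b)).app x y) (whiskerLeft_tmul (ofMatrix M) (inclId b) x y x (homElt (𝟙 x)) z)
    refine Eq.trans (?_ : _ = matMul (matDiag (fun _ => 1)) z) (h₁.trans (inclComp_tmul M (𝟙 b) x y x (matDiag (fun _ => 1))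
      z)).symm
    exact funext fun i => funext fun l => (matMul_one_matDiag z i l).symm

instance (a : KV k) : IsIso ((inclLax k).mapId a) := inferInstanceAs (IsIso (inclId a))

instance {a b c : KV k} (M : a ⟶ b) (N : b ⟶ c) : IsIso ((inclLax k).mapComp M N) := inferInstanceAs (IsIso (inclComp M N))

/-- The inclusion, as a pseudofunctor. -/
def inclPseudo (k : Type u) [Field k] : Pseudofunctor (KV k) (SmallCat k) := Pseudofunctor.mkOfLax' (inclLax k)

lemma inclPseudo_full (a b : KV k) : ((inclPseudo k).mapFunctor a b).Full where
  map_surjective {M N} θ := by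
    let θ' : Hom₂ (ofMatrix M) (ofMatrix N) := θ
    let φ : Mat M →ₗ[k] Mat N := θ'.app ⟨⟩ ⟨⟩
    have h₁ (r x) : φ (rowAct (M := M) r x) = rowAct (M := N) r (φ x) := by
      have := θ'.app_act (d := ⟨⟩) (d' := ⟨⟩) (c := ⟨⟩) (c' := ⟨⟩) (𝟙 _) r x
      refine (congrArg φ (?_ : _ = _)).trans (this.trans ?_)
      · exact (ofMatrix_act_one r x).symm
      · exact ofMatrix_act_one r (φ x)
    have h₂ (r x) : φ (colAct (M := M) x r) = colAct (M := N) (φ x) r := by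
      have := θ'.app_act (d := ⟨⟩) (d' := ⟨⟩) (c := ⟨⟩) (c' := ⟨⟩) r (𝟙 _) x
      refine (congrArg φ (?_ : _ = _)).trans (this.trans ?_)
      · exact (ofMatrix_one_act r x).symm
      · exact ofMatrix_one_act r (φ x)
    refine ⟨KV.Hom₂.mk fun i j => LinearMap.proj j ∘ₗ LinearMap.proj i ∘ₗ φ ∘ₗ matSingle (M := M) i j, hom₂_ext fun _ _ (x : Mat
      M) => ?_⟩
    exact funext fun i => funext fun j => (mat_map_apply (M := M) (N := N) φ h₁ h₂ x i j).symm

lemma inclPseudo_faithful (a b : KV k) : ((inclPseudo k).mapFunctor a b).Faithful where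
  map_injective {M N} η η' h := KV.hom₂_ext fun i j m => by
    have h' : matMap η (matSingle i j m) = matMap η' (matSingle i j m) := congrArg (fun t : Hom₂ (ofMatrix M) (ofMatrix N) =>
      t.app ⟨⟩ ⟨⟩ (matSingle i j m)) h
    have := congrFun (congrFun h' i) j
    rwa [matMap_apply, matMap_apply, matSingle_same] at this

/-! #### Dual bases -/

section DualBasis
variable {A B C D : SmallCat k}

/-- Elements which generate the values of a bimodule at `c`, with natural coordinates. -/
structure DualBasisAt (P : Hom C D) (c : C) (J : Type) [Fintype J] where
  d : J → D
  m (j) : P.obj (d j) c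
  coord (j) (d' : D) : P.obj d' c →ₗ[k] (d' ⟶ d j)
  coord_act (j) {d' d'' : D} (g : d'' ⟶ d') (x : P.obj d' c) : coord j d'' (P.act g (𝟙 c) x) = g ≫ coord j d' x
  total (d') (x : P.obj d' c) : ∑ j, P.act (coord j d' x) (𝟙 c) (m j) = x

/-- All values of a bimodule have finite dual bases. -/
def HasDualBasis (P : Hom C D) : Prop := ∀ c, ∃ n, Nonempty (DualBasisAt P c (Fin n))

lemma exists_sum_tmul {P : Hom A B} {Q : Hom B C} {c a} (x : (comp P Q).obj c a) : ∃ (n : ℕ) (b : Fin n → B) (q : ∀ j, Q.obj c (b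
  j)) (p : ∀ j, P.obj (b j) a), ∑ j, tmul (b j) (q j) (p j) = x := by
  induction x using comp_induction with
  | h0 => exact ⟨0, Fin.elim0, fun j => j.elim0, fun j => j.elim0, rfl⟩
  | hadd x y hx hy =>
    obtain ⟨n, b, q, p, rfl⟩ := hx
    obtain ⟨n', b', q', p', rfl⟩ := hy
    let e : Fin (n + n') ≃ Fin n ⊕ Fin n' := finSumFinEquiv.symm
    let b'' : Fin n ⊕ Fin n' → B := Sum.elim b b'
    let q'' (j) : Q.obj c (b'' j) := j.rec q q'
    let p'' (j) : P.obj (b'' j) a := j.rec p p'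
    refine ⟨n + n', fun j => b'' (e j), fun j => q'' (e j), fun j => p'' (e j), ?_⟩
    exact (e.sum_comp (fun j => tmul (b'' j) (q'' j) (p'' j))).trans (Fintype.sum_sum_type _)
  | htmul b q p => exact ⟨1, fun _ => b, fun _ => q, fun _ => p, by simp⟩

lemma hasDualBasis_of_adjunction {P : C ⟶ D} {Q : D ⟶ C} (adj : Bicategory.Adjunction P Q) : HasDualBasis P := fun c => by
  let P' : Hom C D := P
  let Q' : Hom D C := Q
  let η : one C ⟶ comp P' Q' := adj.unit
  let ζ : comp Q' P' ⟶ one D := adj.counit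
  obtain ⟨n, d, q, p, h⟩ := exists_sum_tmul (η.app c c (homElt (𝟙 c)))
  refine ⟨n, ⟨⟨d, p, fun j d' => homElt.symm.toLinearMap ∘ₗ ζ.app d' (d j) ∘ₗ (tmul c).flip (q j), fun j d' d'' g x => ?_, fun d'
    x => ?_⟩⟩⟩
  · have h₁ := comp_act_tmul Q' P' g (𝟙 (d j)) c x (q j)
    rw [Q'.act_id] at h₁
    have h₂ := ζ.app_act g (𝟙 (d j)) (tmul c x (q j))
    refine (congrArg (ζ.app d'' (d j)) h₁).symm.trans (h₂.trans ?_)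
    exact congrArg (g ≫ ·) (comp_id (homElt.symm (ζ.app d' (d j) (tmul c x (q j)))))
  · have h₁ : whiskerRight η P' ≫ associatorHom P' Q' P' ≫ whiskerLeft P' ζ ≫ rightUnitorHom P' = leftUnitorHom P' := by
      have h : adj.unit ▷ P ≫ (α_ P Q P).hom ≫ P ◁ adj.counit = (Bicategory.leftUnitor P).hom ≫ (Bicategory.rightUnitor P).inv :=
        by
        simpa [Bicategory.leftZigzag, bicategoricalComp] using adj.left_triangle
      have := congrArg (fun t => t ≫ (Bicategory.rightUnitor P).hom) h
      simp at this
      exact this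
    have h₂ := congrArg (fun t => Hom₂.app t d' c (tmul c x (homElt (𝟙 c)))) h₁
    refine Eq.trans ?_ (h₂.trans ((leftUnitorHom_tmul P' d' c c x (𝟙 c)).trans (P'.act_id x)))
    refine Eq.trans ?_ (congrArg (fun t => (associatorHom P' Q' P' ≫ whiskerLeft P' ζ ≫ rightUnitorHom P').app d' c t)
      (whiskerRight_tmul η P' d' c c x (homElt (𝟙 c)))).symm
    rw [← h]
    simp only [map_sum]
    refine sum_congr rfl fun j _ => ?_
    rw [comp_app, comp_app, associatorHom_tmul, whiskerLeft_tmul]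
    exact (rightUnitorHom_tmul P' d' (d j) c (p j) (homElt.symm (ζ.app d' (d j) (tmul c x (q j))))).symm

lemma DualBasisAt.finite {P : Hom C D} {c : C} {J : Type} [Fintype J] (h : DualBasisAt P c J) (d : D) (hd : ∀ d', Module.Finite k
  (d ⟶ d')) : Module.Finite k (P.obj d c) := by
  let φ : (∀ j, d ⟶ h.d j) →ₗ[k] P.obj d c := ∑ j, (((P.act).flip (𝟙 c)).flip (h.m j)) ∘ₗ LinearMap.proj j
  refine Module.Finite.of_surjective φ fun x => ⟨fun j => h.coord j d x, ?_⟩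
  simp only [φ, LinearMap.sum_apply]
  exact h.total d x
end DualBasis

/-! #### Bimodules over products of the ground field -/

section Ess
variable {a b : KV k}

theorem exists_ofMatrix (P : Hom (star k (Fin a.n → k)) (star k (Fin b.n → k))) (hP : HasDualBasis P) : ∃ M : a ⟶ b, Nonempty
  (ofMatrix M ≅ P) := by
  obtain ⟨n, ⟨h⟩⟩ := hP ⟨⟩
  let V := P.obj ⟨⟩ ⟨⟩
  have : Module.Finite k V := h.finite ⟨⟩ fun _ => inferInstanceAs (Module.Finite k (Fin b.n → k))
  let T : (Fin b.n → k) →ₗ[k] (Fin a.n → k) →ₗ[k] V →ₗ[k] V := P.act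
  have hT (g g' f f' x) : T g' f' (T g f x) = T (g' * g) (f' * f) x := by
    rw [mul_comm f']
    exact P.act_act g g' f f' x
  have h1 (x) : T 1 1 x = x := P.act_id (d := ⟨⟩) (c := ⟨⟩) x
  let e (i : Fin a.n) (j : Fin b.n) : V →ₗ[k] V := T (Pi.single j 1) (Pi.single i 1)
  have he (i j g f x) : e i j (T g f x) = g j • f i • e i j x := by
    have hs {n : ℕ} (j : Fin n) (g : Fin n → k) : (Pi.single j 1 : Fin n → k) * g = g j • (Pi.single j 1 : Fin n → k) := by
      funext t
      by_cases ht : t = j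
      · subst ht; simp
      · simp [ht]
    rw [hT, hs, hs, map_smul, map_smul, LinearMap.smul_apply, LinearMap.smul_apply, LinearMap.smul_apply, smul_comm]
  have hsum (x) : ∑ i, ∑ j, e i j x = x := by
    have h₁ (n : ℕ) : ∑ i : Fin n, (Pi.single i 1 : Fin n → k) = 1 := Finset.univ_sum_single (1 : Fin n → k)
    conv_rhs => rw [← h1 x, ← h₁, ← h₁, map_sum, LinearMap.sum_apply]
    simp only [map_sum, LinearMap.sum_apply, e]
  have hee (i j i' j' x) : e i j (e i' j' x) = if i' = i ∧ j' = j then e i j x else 0 := by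
    rw [he]
    by_cases hi : i' = i
    · subst hi
      by_cases hj : j' = j
      · subst hj; simp
      · simp [hj]
    · simp [hi]
  let M : a ⟶ b := KV.Hom.mk fun i j => FGModuleCat.of k (LinearMap.range (e i j))
  let φ : Mat M ≃ₗ[k] V := LinearEquiv.ofLinear (∑ i, ∑ j, (LinearMap.range (e i j)).subtype ∘ₗ LinearMap.proj j ∘ₗ LinearMap.proj
    i) (LinearMap.pi fun i => LinearMap.pi fun j => (e i j).rangeRestrict) (LinearMap.ext fun x => by
      simp only [LinearMap.comp_apply, LinearMap.sum_apply]
      exact hsum x)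
    (LinearMap.ext fun y => by
      refine funext fun i => funext fun j => Subtype.ext ?_
      simp only [LinearMap.comp_apply, LinearMap.sum_apply]
      change e i j (∑ i', ∑ j', (y i' j').1) = (y i j).1
      rw [map_sum, sum_eq_single i, map_sum, sum_eq_single j]
      · obtain ⟨x, hx⟩ := (y i j).2
        rw [← hx, hee, if_pos ⟨rfl, rfl⟩]
      · intro j' _ hj
        obtain ⟨x, hx⟩ := (y i j').2
        rw [← hx, hee, if_neg fun h => hj h.2]
      · simp
      · intro i' _ hi
        rw [map_sum]
        refine sum_eq_zero fun j' _ => ?_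
        obtain ⟨x, hx⟩ := (y i' j').2
        rw [← hx, hee, if_neg fun h => hi h.1]
      · simp)
  refine ⟨M, ⟨(isoMk (P := P) (Q := ofMatrix M) (fun _ _ => φ.symm) ?_).symm⟩⟩
  intro _ _ _ _ g f x
  exact funext fun i => funext fun j => Subtype.ext (he i j g f x)
end Ess

/-! #### Bimodules between full subcategories -/

section Between
variable {A B C : SmallCat k} {X : Type u₁} [Category.{u} X] [Preadditive X] [Linear k X] (J : A ⥤ X) [J.Additive] [J.Linear k]
  (J' : B ⥤ X) [J'.Additive] [J'.Linear k] (J'' : C ⥤ X) [J''.Additive] [J''.Linear k]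

/-- The bimodule `(b, a) ↦ (J' b ⟶ J a)`. -/
def between : Hom A B where
  obj b a := ModuleCat.of k (J'.obj b ⟶ J.obj a)
  act := LinearMap.mk₂ k (fun g f => leftComp k _ (J'.map g) ∘ₗ rightComp k _ (J.map f)) (by intros; ext; simp)
    (by intros; ext; simp) (by intros; ext; simp) (by intros; ext; simp)
  act_id x := by simp
  act_act g g' f f' x := by simp

def betweenElt {b : B} {a : A} : (J'.obj b ⟶ J.obj a) ≃ₗ[k] (between J J').obj b a := LinearEquiv.refl k (J'.obj b ⟶ J.obj a)

lemma betweenElt_act {b b' : B} {a a' : A} (g : b' ⟶ b) (f : a ⟶ a') (x : J'.obj b ⟶ J.obj a) : (between J J').act g f (betweenElt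
  J J' x) = betweenElt J J' (J'.map g ≫ x ≫ J.map f) := rfl

lemma nonempty_between_self [J.Full] [J.Faithful] : Nonempty (between J J ≅ one A) := ⟨(isoMk (fun b a => LinearEquiv.ofBijective
  (J.mapLinearMap k) ⟨J.map_injective, J.map_surjective⟩) (fun g f x => by
      obtain ⟨x, rfl⟩ := homElt.surjective x
      change J.map (g ≫ x ≫ f) = J.map g ≫ J.map x ≫ J.map f
      simp)).symm⟩

def betweenComp : comp (between J J') (between J' J'') ⟶ between J J'' := descHom (fun c a b => (Linear.comp (J''.obj c) (J'.obj
  b) (J.obj a) : (J''.obj c ⟶ J'.obj b) →ₗ[k] (J'.obj b ⟶ J.obj a) →ₗ[k] _))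
    (by
      intro c a b b' f (q : J''.obj c ⟶ J'.obj b) (p : J'.obj b' ⟶ J.obj a)
      change (J''.map (𝟙 c) ≫ q ≫ J'.map f) ≫ p = q ≫ J'.map f ≫ p ≫ J.map (𝟙 a)
      simp)
    (by
      intro c c' a a' b g f (q : J''.obj c ⟶ J'.obj b) (p : J'.obj b ⟶ J.obj a)
      change (J''.map g ≫ q ≫ J'.map (𝟙 b)) ≫ J'.map (𝟙 b) ≫ p ≫ J.map f = J''.map g ≫ (q ≫ p) ≫ J.map f
      simp)

lemma betweenComp_tmul {c a b} (q : J''.obj c ⟶ J'.obj b) (p : J'.obj b ⟶ J.obj a) : (betweenComp J J' J'').app c a (tmul b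
  (betweenElt J' J'' q) (betweenElt J J' p)) = betweenElt J J'' (q ≫ p) := descHom_tmul _ _ _ _ _ _ _ _

lemma nonempty_between_comp [J'.Full] (h : ∀ a, ∃ (I : Type) (_ : Fintype I) (b : I → B) (f : ∀ i, J.obj a ⟶ J'.obj (b i)) (g : ∀
  i, J'.obj (b i) ⟶ J.obj a), ∑ i, f i ≫ g i = 𝟙 _) : Nonempty (comp (between J J') (between J' J'') ≅ between J J'') := by
  refine iso_of_bijective (betweenComp J J' J'') fun c a => ?_
  obtain ⟨I, _, b, f, g, hfg⟩ := h a
  let ψ (x : J''.obj c ⟶ J.obj a) : (comp (between J J') (between J' J'')).obj c a := ∑ i, tmul (b i) (betweenElt J' J'' (x ≫ f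
    i)) (betweenElt J J' (g i))
  have hadd (x y) : ψ (x + y) = ψ x + ψ y := by
    simp only [ψ, add_comp, map_add, LinearMap.add_apply, sum_add_distrib]
  have h₁ (x) : ψ ((betweenElt J J'').symm ((betweenComp J J' J'').app c a x)) = x := by
    induction x using comp_induction with
    | h0 => simp only [ψ, map_zero, Limits.zero_comp, LinearMap.zero_apply, Finset.sum_const_zero]
    | hadd x y hx hy => rw [map_add, map_add, hadd, hx, hy]
    | htmul b₀ q p =>
      obtain ⟨q, rfl⟩ := (betweenElt J' J'').surjective q
      obtain ⟨p, rfl⟩ := (betweenElt J J').surjective p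
      rw [betweenComp_tmul, LinearEquiv.symm_apply_apply]
      have h₂ (i) : tmul (P := between J J') (Q := between J' J'') (b i) (betweenElt J' J'' ((q ≫ p) ≫ f i)) (betweenElt J J' (g
        i)) = tmul b₀ (betweenElt J' J'' q) (betweenElt J J' (p ≫ f i ≫ g i)) := by
        obtain ⟨t, ht⟩ := J'.map_surjective (p ≫ f i)
        have := act_tmul (P := between J J') (Q := between J' J'') (c := c) (a := a) t (betweenElt J' J'' q) (betweenElt J J' (g
          i))
        rw [betweenElt_act, betweenElt_act, ht] at this
        simpa using this
      simp only [ψ, h₂]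
      rw [← map_sum, ← map_sum, ← comp_sum, hfg, comp_id]
  refine ⟨fun x y hxy => by rw [← h₁ x, hxy, h₁ y], fun x => ?_⟩
  obtain ⟨x, rfl⟩ := (betweenElt J J'').surjective x
  refine ⟨ψ x, ?_⟩
  simp only [ψ, map_sum, betweenComp_tmul]
  rw [← map_sum]
  simp only [assoc, ← comp_sum, hfg, comp_id]
end Between

section Star
/-- The category with one object and endomorphism algebra `k × ... × k` is the full subcategory on
a direct sum of simple objects. -/
def simplesFunctor {X : Type u₁} [Category.{u} X] [Preadditive X] [Linear k X] [HasFiniteBiproducts X] {n : ℕ} (S : Fin n → X) :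
  Star (Fin n → k) ⥤ X where
  obj _ := ⨁ S
  map (r : Fin n → k) := biproduct.map fun i => r i • 𝟙 (S i)
  map_id _ := by
    refine biproduct.hom_ext _ _ fun i => ?_
    rw [biproduct.map_π]
    exact (congrArg (_ ≫ ·) (one_smul k _)).trans ((comp_id _).trans (id_comp _).symm)
  map_comp r s := by
    refine biproduct.hom_ext _ _ fun i => ?_
    change biproduct.map (fun i => (r i * s i) • 𝟙 (S i)) ≫ _ = _
    simp [mul_smul, smul_comm (r i)]

section
variable {X : Type u₁} [Category.{u} X] [Preadditive X] [Linear k X] [HasFiniteBiproducts X] {n : ℕ} (S : Fin n → X)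

lemma simplesFunctor_map_π (r : Fin n → k) (x : Star (Fin n → k)) (i : Fin n) : (simplesFunctor S).map (X := x) (Y := x) r ≫
  biproduct.π S i = r i • biproduct.π S i := (biproduct.map_π (fun i => r i • 𝟙 (S i)) i).trans (by rw [comp_smul, comp_id])

instance : (simplesFunctor (k := k) S).Additive where
  map_add {x _ r s} := biproduct.hom_ext _ _ fun i => by
    refine (simplesFunctor_map_π S _ x i).trans ((add_smul (r i : k) (s i) _).trans ?_)
    exact (congrArg₂ (· + ·) (simplesFunctor_map_π S r x i).symm (simplesFunctor_map_π S s x i).symm).trans (add_comp _ _ _ _ _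
      _).symm

instance : (simplesFunctor (k := k) S).Linear k where
  map_smul {x _} s r := biproduct.hom_ext _ _ fun i => by
    refine (simplesFunctor_map_π S _ x i).trans ((mul_smul r (s i : k) _).trans ?_)
    exact (congrArg (r • ·) (simplesFunctor_map_π S s x i).symm).trans (smul_comp _ _ _ _ _ _).symm

lemma simplesFunctor_full (hS : ∀ i (f : S i ⟶ S i), ∃ r : k, f = r • 𝟙 (S i)) (hS' : ∀ {i j}, i ≠ j → ∀ f : S i ⟶ S j, f = 0) :
  (simplesFunctor (k := k) S).Full where
  map_surjective {x y} f := by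
    let f' : ⨁ S ⟶ ⨁ S := f
    choose r hr using fun i => hS i (biproduct.ι S i ≫ f' ≫ biproduct.π S i)
    refine ⟨r, biproduct.hom_ext _ _ fun i => (simplesFunctor_map_π S r x i).trans ?_⟩
    refine biproduct.hom_ext' _ _ fun j => ?_
    by_cases h : j = i
    · subst h
      refine Eq.trans ?_ (hr j).symm
      rw [comp_smul, biproduct.ι_π_self]
    · exact (hS' h _).trans (hS' h _).symm

lemma simplesFunctor_faithful (hS : ∀ i, 𝟙 (S i) ≠ 0) : (simplesFunctor (k := k) S).Faithful where
  map_injective {x y} r s h := funext fun i => by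
    have h₁ := (simplesFunctor_map_π S r x i).symm.trans ((congrArg (· ≫ biproduct.π S i) h).trans (simplesFunctor_map_π S s x i))
    have h₂ := congrArg (biproduct.ι S i ≫ ·) h₁
    simp at h₂
    exact smul_left_injective k (hS i) h₂
end

/-- A linear category whose idempotent completion is semisimple is equivalent, as an object of the
2-category of bimodules, to a product of copies of the ground field. -/
theorem nonempty_equivalence_star {x : SmallCat k} {n : ℕ} (B : SplitBasis k (Karoubi x) (Fin n)) : Nonempty
  (Bicategory.Equivalence (star k (Fin n → k)) x) := by
  let E : Karoubi x ⥤ Mat_ (Karoubi x) := Mat_.embedding _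
  let S (i : Fin n) := E.obj (B.S i)
  let J : x ⥤ Mat_ (Karoubi x) := toKaroubi x ⋙ E
  have : E.Linear k := inferInstanceAs ((Mat_.embedding _).Linear k)
  have : (toKaroubi x).Linear k := ⟨fun _ _ => rfl⟩
  have : J.Linear k := inferInstanceAs ((toKaroubi x ⋙ E).Linear k)
  let J' : star k (Fin n → k) ⥤ Mat_ (Karoubi x) := simplesFunctor S
  have : J'.Additive := inferInstanceAs (simplesFunctor S).Additive
  have : J'.Linear k := inferInstanceAs ((simplesFunctor S).Linear k)
  have : J'.Full := simplesFunctor_full S (fun i f => by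
      obtain ⟨f, rfl⟩ := E.map_surjective f
      obtain ⟨r, rfl⟩ := B.scalar i f
      exact ⟨r, by rw [E.map_smul, E.map_id]⟩)
    (fun h f => by
      obtain ⟨f, rfl⟩ := E.map_surjective f
      rw [B.orth h f, E.map_zero])
  have : J'.Faithful := simplesFunctor_faithful S fun i h => B.nonzero i (E.map_injective ((E.map_id _).trans (h.trans (E.map_zero
    _ _).symm)))
  obtain ⟨i⟩ := nonempty_between_comp J' J J' fun _ => by
    refine ⟨Fin n, inferInstance, fun i => (B.S i).X, fun i => biproduct.π S i ≫ E.map (Karoubi.decompId_i (B.S i)), fun i =>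
      E.map (Karoubi.decompId_p (B.S i)) ≫ biproduct.ι S i, ?_⟩
    refine Eq.trans (sum_congr rfl fun i _ => ?_) biproduct.total
    have h : E.map (Karoubi.decompId_i (B.S i)) ≫ E.map (Karoubi.decompId_p (B.S i)) = 𝟙 (S i) := by
      rw [← E.map_comp, ← Karoubi.decompId, E.map_id]
    exact (assoc _ _ _).trans (congrArg (biproduct.π S i ≫ ·) (((assoc _ _ _).symm.trans (congrArg (· ≫ biproduct.ι S i) h)).trans
      (id_comp _)))
  obtain ⟨j⟩ := nonempty_between_comp J J' J fun a => by
    obtain ⟨I, _, _, idx, f, g, h, -⟩ := B.gen ((toKaroubi x).obj a)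
    refine ⟨I, inferInstance, fun _ => ⟨⟩, fun a => E.map (f a) ≫ biproduct.ι S (idx a), fun a => biproduct.π S (idx a) ≫ E.map (g
      a), ?_⟩
    refine Eq.trans (sum_congr rfl fun b _ => ?_) ((E.map_sum _ _).symm.trans ((congrArg E.map h).trans (E.map_id _)))
    have h : biproduct.ι S (idx b) ≫ biproduct.π S (idx b) ≫ E.map (g b) = E.map (g b) := by simp
    exact ((assoc _ _ _).trans (congrArg (E.map (f b) ≫ ·) h)).trans (E.map_comp _ _).symm
  obtain ⟨i'⟩ := nonempty_between_self J'
  obtain ⟨j'⟩ := nonempty_between_self J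
  obtain ⟨e, -⟩ := Ho.exists_equivalence (B := SmallCat k) (between J' J) (between J J') (Ho.cls_eq_iff.2 ⟨i ≪≫ i'⟩)
    (Ho.cls_eq_iff.2 ⟨j ≪≫ j'⟩)
  exact ⟨e⟩
end Star

section Karoubi
variable {X : Type u₁} [Category.{u} X] [Preadditive X] [Linear k X] {J : Type} [Fintype J]

open Idempotents in
theorem Retract.exists_splitBasis_karoubi [IsAlgClosed k] (R : Retract k X J) : ∃ n, Nonempty (SplitBasis k (Karoubi X) (Fin n))
  := by
  refine exists_splitBasis (fun P Q => ?_) (fun P Q f => ?_) (fun j => (toKaroubi X).obj (R.P j)) fun P => ?_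
  · have := R.finite_hom P.X Q.X
    let φ : (P ⟶ Q) →ₗ[k] (P.X ⟶ Q.X) :=
      { toFun f := f.f
        map_add' _ _ := rfl
        map_smul' _ _ := rfl }
    exact Module.Finite.of_injective φ fun f g h => Karoubi.Hom.ext h
  · obtain ⟨g, hg⟩ := R.regular f.f
    refine ⟨⟨Q.p ≫ g ≫ P.p, by simp⟩, Karoubi.Hom.ext ?_⟩
    simpa using hg
  · obtain ⟨I, hI, idx, f, g, h⟩ := R.gen P.X
    refine ⟨I, hI, idx, fun a => Karoubi.decompId_i P ≫ (toKaroubi X).map (f a), fun a => (toKaroubi X).map (g a) ≫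
      Karoubi.decompId_p P, ?_⟩
    simp only [assoc, ← comp_sum]
    rw [Karoubi.decompId P]
    congr 1
    simp only [← assoc, ← Functor.map_comp, ← sum_comp]
    exact (congrArg (· ≫ _) (((toKaroubi X).map_sum _ _).symm.trans ((congrArg _ h).trans ((toKaroubi X).map_id _)))).trans
      (id_comp _)
end Karoubi

/-! #### Fully dualizable objects -/

section Zigzag
variable {x y : SmallCat k}

def leftUnitorInv' (x : SmallCat k) : x ⥤ LinTensor k (Star k) x := linFunctor (fun X => ⟨⟨⟩, X⟩) (fun X Y => LinTensor.tmul k (X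
  := (⟨⟨⟩, X⟩ : LinTensor k (Star k) x)) (Y := ⟨⟨⟩, Y⟩) (𝟙 (⟨⟩ : Star k))) (fun _ => rfl) (fun X Y Z f g => by
      have := LinTensor.tmul_comp (k := k) (X := ⟨(⟨⟩ : Star k), X⟩) (Y := ⟨⟨⟩, Y⟩) (Z := ⟨⟨⟩, Z⟩) (𝟙 (⟨⟩ : Star k)) f (𝟙 (⟨⟩ :
        Star k)) g
      rw [comp_id] at this
      exact this.symm)

instance : (leftUnitorInv' x).Additive := linFunctor_additive

instance : (leftUnitorInv' x).Linear k := linFunctor_linear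

instance : (leftUnitorFunctor k x).Full where
  map_surjective f := ⟨(TensorProduct.lid k _).symm f, (TensorProduct.lid k _).apply_symm_apply f⟩

lemma leftUnitorInv'_map {X Y : LinTensor k (Star k) x} (f : X ⟶ Y) : (leftUnitorInv' x).map ((leftUnitorFunctor k x).map f) = f
  := by
  refine (TensorProduct.lid k (X.snd ⟶ Y.snd)).injective ?_
  exact one_smul k _

/-- The bimodule `(X', ((X, Y), X'')) ↦ e (X, Y) ⊗ (X' ⟶ X'')`. -/
def evalLeft (e : Hom (tensorObj x y) (star k k)) : Hom (tensorObj (tensorObj x y) x) x := res₂ (𝟭 _) (leftUnitorInv' x)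
  (tensorHom e (one x))

lemma nonempty_evalLeft (e : Hom (tensorObj x y) (star k k)) : Nonempty (comp (tensorHom e (one x)) (ofFunctor' (k := k)
  (leftUnitorFunctor k x)) ≅ evalLeft e) := by
  obtain ⟨i⟩ := nonempty_iso_of_square (𝟭 _) (leftUnitorFunctor k x) (B := tensorObj (star k k) x) (B' := x) (fun d => ⟨⟨⟨⟩, d⟩,
    ⟨Iso.refl d⟩⟩) (P := tensorHom e (one x)) (Q := evalLeft e)
    (fun _ _ => LinearEquiv.refl _ _) (by
      intro b b' a a' g f z
      exact congrArg (fun t => (tensorHom e (one x)).act t f z) (leftUnitorInv'_map g).symm)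
  exact ⟨i.trans (show comp (one _) (evalLeft e) ≅ evalLeft e from Bicategory.leftUnitor (B := SmallCat k) (a := tensorObj
    (tensorObj x y) x) (b := x) (evalLeft e))⟩

def evalRes (e : Hom (tensorObj x y) (star k k)) : Hom (tensorObj x (tensorObj y x)) x := res (assocInvFunctor k x y x) (evalLeft
  e)

lemma nonempty_zigzag {e : Hom (tensorObj x y) (star k k)} {c : Hom (star k k) (tensorObj y x)} (h : (tensorData k).IsDual e c) :
  Nonempty (comp (tensorHom (one x) c) (evalRes e) ≅ ofFunctor' (k := k) (rightUnitorFunctor k x)) := by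
  obtain ⟨i⟩ := h.zigzag₁
  obtain ⟨j⟩ := nonempty_evalLeft e
  let j' := ofFunctorComp (A := tensorObj x (tensorObj y x)) (assocInvFunctor k x y x) (evalLeft e)
  let c' : tensorObj x (star k k) ⟶ tensorObj x (tensorObj y x) := tensorHom (one x) c
  let a : tensorObj x (tensorObj y x) ⟶ tensorObj (tensorObj x y) x := ofFunctor' (assocInvFunctor k x y x)
  exact ⟨(Bicategory.whiskerLeftIso c' ((Bicategory.whiskerLeftIso a j).trans j')).symm.trans i⟩

def evalElt {e : Hom (tensorObj x y) (star k k)} (X' X : x) (t : LinTensor k y x) : e.obj ⟨⟩ ⟨X, t.fst⟩ →ₗ[k] (X' ⟶ t.snd) →ₗ[k]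
  (evalRes e).obj X' ⟨X, t⟩ := (ttmul (P := e) (c := (⟨⟨X, t.fst⟩, t.snd⟩ : LinTensor k (LinTensor k x y) x))).compl₂ (homElt (C
  := x) (c := X') (d := t.snd)).toLinearMap

lemma evalElt_act {e : Hom (tensorObj x y) (star k k)} {X X' Y Y' : x} (t : LinTensor k y x) (g : Y' ⟶ X') (f : X ⟶ Y) (v : e.obj
  ⟨⟩ ⟨X, t.fst⟩) (a : X' ⟶ t.snd) : (evalRes e).act g (LinTensor.tmul k f (𝟙 t) : (⟨X, t⟩ : LinTensor k x (LinTensor k y x)) ⟶ ⟨Y,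
  t⟩) (evalElt X' X t v a) = evalElt Y' Y t (e.act (𝟙 _) (LinTensor.tmul k f (𝟙 t.fst) : (⟨X, t.fst⟩ : LinTensor k x y) ⟶ ⟨Y,
  t.fst⟩) v) (g ≫ a) := congrArg (evalElt Y' Y t _) (congrArg (g ≫ ·) (comp_id a))
end Zigzag
end SmallCat

section
variable {X : Type u₁} [Category.{u} X] [Preadditive X] [Linear k X] {J : Type} [Fintype J]

def Retract.ofMaps (E : J → X ⥤ FGModuleCat.{u} k) (hE : ∀ j, (E j).Additive) (hE' : ∀ j, (E j).Linear k) (P : J → X) (s : ∀ j (x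
  x' : X), (x' ⟶ x) →ₗ[k] (E j).obj x ⊗[k] (x' ⟶ P j)) (r : ∀ j (x x' : X), (E j).obj x ⊗[k] (x' ⟶ P j) →ₗ[k] (x' ⟶ x)) (hs : ∀ j
  {x y x' y' : X} (g : y' ⟶ x') (f : x ⟶ y) (a), s j y y' (g ≫ a ≫ f) = TensorProduct.map ((E j).map f).hom.hom (leftComp k (P j)
  g) (s j x x' a)) (hr : ∀ j {x y x' y' : X} (g : y' ⟶ x') (f : x ⟶ y) (v a), r j y y' (((E j).map f).hom.hom v ⊗ₜ (g ≫ a)) = g ≫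
  r j x x' (v ⊗ₜ a) ≫ f) (hrs : ∀ x x' (a : x' ⟶ x), ∑ j, r j x x' (s j x x' a) = a) : Retract k X J where
  G := E
  additive := hE
  linear := hE'
  P := P
  r j x := r j x (P j) ∘ₗ (TensorProduct.mk k _ _).flip (𝟙 _)
  r_nat j {x y} f v := by
    have := hr j (𝟙 _) f v (𝟙 (P j))
    rwa [id_comp, id_comp] at this
  s j x := TensorProduct.comm k _ _ (s j x x (𝟙 x))
  s_nat j {x y} f := by
    have h₁ (z : (E j).obj y ⊗[k] (y ⟶ P j)) : (leftComp k (P j) f).rTensor _ (TensorProduct.comm k _ _ z) = TensorProduct.comm k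
      _ _ (TensorProduct.map ((E j).map (𝟙 y)).hom.hom (leftComp k (P j) f) z) := by
      rw [(E j).map_id]
      induction z using TensorProduct.induction_on with
      | zero | add => simp [*]
      | tmul v a => rfl
    have h₂ (z : (E j).obj x ⊗[k] (x ⟶ P j)) : ((E j).map f).hom.hom.lTensor _ (TensorProduct.comm k _ _ z) = TensorProduct.comm k
      _ _ (TensorProduct.map ((E j).map f).hom.hom (leftComp k (P j) (𝟙 x)) z) := by
      induction z using TensorProduct.induction_on with
      | zero | add => simp [*]
      | tmul v a => simp
    rw [h₁, h₂, ← hs, ← hs]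
    simp
  retract x := by
    refine Eq.trans (sum_congr rfl fun j _ => ?_) (hrs x x (𝟙 x))
    generalize s j x x (𝟙 x) = z
    induction z using TensorProduct.induction_on with
    | zero | add => simp [*]
    | tmul v a =>
      have := hr j a (𝟙 x) v (𝟙 (P j))
      rw [(E j).map_id, comp_id, comp_id] at this
      exact this.symm
end

namespace SmallCat
section Retract
variable {A A' B B' C : SmallCat k}

def tensorMap {P P' : Hom A A'} {Q Q' : Hom B B'} (η : P ⟶ P') (θ : Q ⟶ Q') : tensorHom P Q ⟶ tensorHom P' Q' := Hom₂.mk (fun d c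
  => TensorProduct.map (η.app d.fst c.fst) (θ.app d.snd c.snd)) (fun g f z => act_tensor (R := tensorHom P' Q')
      (fun d c => TensorProduct.map (η.app d.fst c.fst) (θ.app d.snd c.snd)) (by
        intro d d' c c' g₁ g₂ f₁ f₂ x y
        exact congrArg₂ (fun s t => ttmul s t)
          (η.app_act g₁ f₁ x) (θ.app_act g₂ f₂ y)) g f z)

def pointFunctor (b : B) : Star k ⥤ B := linFunctor (fun _ => b) (fun _ _ => toSpanSingleton k (b ⟶ b) (𝟙 b)) (fun _ => one_smul k
  _) (fun X Y Z f g => by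
      change (f * g) • 𝟙 b = (f • 𝟙 b) ≫ (g • 𝟙 b)
      simp [mul_smul, smul_comm f])

instance (b : B) : (pointFunctor (k := k) b).Additive := linFunctor_additive
instance (b : B) : (pointFunctor (k := k) b).Linear k := linFunctor_linear

/-- The values of a bimodule at the objects `(X, b)`. -/
def pointRes (x : SmallCat k) (b : B) (Q : Hom (tensorObj x B) C) : Hom (tensorObj x (star k k)) C := res (tensorFunctor (𝟭 x)
  (pointFunctor b)) Q

lemma pointRes_act (x : SmallCat k) (b : B) (Q : Hom (tensorObj x B) C) {X Y : x} {d d' : C} (g : d' ⟶ d) (f : X ⟶ Y) (z : Q.obj d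
  (⟨X, b⟩ : LinTensor k x B)) : (pointRes x b Q).act (c := (⟨X, ⟨⟩⟩ : LinTensor k x (Star k))) (c' := (⟨Y, ⟨⟩⟩ : LinTensor k x _))
  g (LinTensor.tmul k f (𝟙 _)) z = Q.act (c := (⟨X, b⟩ : LinTensor k x B)) (c' := (⟨Y, b⟩ : LinTensor k x B)) g (LinTensor.tmul k
  f (𝟙 b)) z := congrArg (fun t => Q.act g (LinTensor.tmul k (Y := ⟨Y, b⟩) f t) z) (one_smul k (𝟙 b))

section
variable {x : SmallCat k} {b : B} {Q : Hom (tensorObj x B) C} {X Y : x}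

lemma rightUnitor_act {X' Y' : x} (g : Y' ⟶ X') (f : X ⟶ Y) (z : X' ⟶ X) : (ofFunctor' (k := k) (rightUnitorFunctor k x)).act (c
  := (⟨X, ⟨⟩⟩ : LinTensor k x (Star k))) (c' := (⟨Y, ⟨⟩⟩ : LinTensor k x (Star k))) g (LinTensor.tmul k f (𝟙 _)) z = g ≫ z ≫ f :=
  congrArg (fun t => g ≫ z ≫ t) (one_smul k f)

lemma toPointRes_app {Q : Hom (tensorObj x B) x} (S : ofFunctor' (k := k) (rightUnitorFunctor k x) ⟶ pointRes x b Q) {X' Y' : x}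
  (g : Y' ⟶ X') (f : X ⟶ Y) (z : X' ⟶ X) : S.app Y' (⟨Y, ⟨⟩⟩ : LinTensor k x (Star k)) (g ≫ z ≫ f) = Q.act (c := (⟨X, b⟩ :
  LinTensor k x B)) (c' := (⟨Y, b⟩ : LinTensor k x B)) g (LinTensor.tmul k f (𝟙 b)) (S.app X' (⟨X, ⟨⟩⟩ : LinTensor k x (Star k))
  z) := by
  have h₁ := congrArg (S.app Y' (⟨Y, ⟨⟩⟩ : LinTensor k x (Star k))) (rightUnitor_act g f z)
  have h₂ := S.app_act (c := (⟨X, ⟨⟩⟩ : LinTensor k x (Star k))) (c' := ⟨Y, ⟨⟩⟩) g (LinTensor.tmul k f (𝟙 _)) z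
  have h₃ := pointRes_act x b Q g f (S.app X' (⟨X, ⟨⟩⟩ : LinTensor k x (Star k)) z)
  exact h₁.symm.trans (h₂.trans h₃)

lemma ofPointRes_app {Q : Hom (tensorObj x B) x} (T : pointRes x b Q ⟶ ofFunctor' (k := k) (rightUnitorFunctor k x)) {X' Y' : x}
  (g : Y' ⟶ X') (f : X ⟶ Y) (z : Q.obj X' (⟨X, b⟩ : LinTensor k x B)) : T.app Y' (⟨Y, ⟨⟩⟩ : LinTensor k x (Star k)) (Q.act (c :=
  (⟨X, b⟩ : LinTensor k x B)) (c' := (⟨Y, b⟩ : LinTensor k x B)) g (LinTensor.tmul k f (𝟙 b)) z) = g ≫ (show X' ⟶ X from T.app X'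
  (⟨X, ⟨⟩⟩ : LinTensor k x (Star k)) z) ≫ f := by
  have h₁ := congrArg (T.app Y' (⟨Y, ⟨⟩⟩ : LinTensor k x (Star k))) (pointRes_act x b Q g f z)
  have h₂ := T.app_act (c := (⟨X, ⟨⟩⟩ : LinTensor k x (Star k))) (c' := ⟨Y, ⟨⟩⟩) g (LinTensor.tmul k f (𝟙 _)) z
  have h₃ := rightUnitor_act g f (T.app X' (⟨X, ⟨⟩⟩ : LinTensor k x (Star k)) z)
  exact h₁.symm.trans (h₂.trans h₃)
end

lemma star_act (c : Hom (star k k) B) {d d' : B} (g : d' ⟶ d) (r : k) (z : c.obj d ⟨⟩) : c.act (c := ⟨⟩) (c' := ⟨⟩) g r z = r •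
  c.act g (𝟙 _) z := by
  have h := (c.act g).map_smul r (𝟙 (⟨⟩ : Star k))
  refine (congrArg (fun t => c.act g t z) ?_).trans (LinearMap.congr_fun h z)
  exact (mul_one r).symm

variable {c : Hom (star k k) B} {J : Type} [Fintype J] (h : DualBasisAt c ⟨⟩ J)

def DualBasisAt.coordHom (j : J) : c ⟶ ofFunctor' (k := k) (pointFunctor (k := k) (h.d j)) := Hom₂.mk
    (fun d _ => h.coord j d) (by
      intro d d' _ _ g r z
      refine (congrArg (h.coord j d') (star_act c g r z)).trans ((map_smul _ r _).trans ((congrArg (r • ·) (h.coord_act j g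
        z)).trans ?_))
      change r • g ≫ h.coord j d z = g ≫ h.coord j d z ≫ (r • 𝟙 _)
      simp)

def DualBasisAt.eltHom (j : J) : ofFunctor' (k := k) (pointFunctor (k := k) (h.d j)) ⟶ c := Hom₂.mk
    (fun d _ => ((c.act).flip (𝟙 _)).flip (h.m j)) (by
      intro d d' _ _ g r (z : d ⟶ h.d j)
      refine Eq.trans ?_ (star_act c g r _).symm
      refine Eq.trans ?_ (congrArg (r • ·) (c.act_act z g (𝟙 _) (𝟙 _) (h.m j))).symm
      change c.act (g ≫ z ≫ (r • 𝟙 _)) (𝟙 _) (h.m j) = _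
      simp)

lemma exists_retract_tensor (x : SmallCat k) (Q : Hom (tensorObj x B) C) : ∃ (s : ∀ j, comp (tensorHom (one x) c) Q ⟶ pointRes x
  (h.d j) Q) (r : ∀ j, pointRes x (h.d j) Q ⟶ comp (tensorHom (one x) c) Q), ∀ d a z, ∑ j, (r j).app d a ((s j).app d a z) = z :=
  by
  let i (j) := (nonempty_tensorHom_ofFunctor (𝟭 x) (B := star k k) (B' := B) (pointFunctor (k := k) (h.d j))).some
  let i' (j) : comp (tensorHom (one x) (ofFunctor' (k := k) (pointFunctor (k := k) (h.d j)))) Q ≅ pointRes x (h.d j) Q :=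
    (Bicategory.whiskerRightIso (B := SmallCat k) (a := tensorObj x (star k k)) (b := tensorObj x B) (i j) Q).trans (ofFunctorComp
    (A := tensorObj x (star k k)) (B := tensorObj x B) _ Q)
  refine ⟨fun j => whiskerRight (tensorMap (𝟙 (one x)) (h.coordHom j)) Q ≫ (i' j).hom, fun j => (i' j).inv ≫ whiskerRight
    (tensorMap (𝟙 (one x)) (h.eltHom j)) Q, fun d a z => ?_⟩
  simp only [comp_app, hom_inv_app]
  induction z using comp_induction with
  | h0 | hadd => simp [*, sum_add_distrib]
  | htmul b q p =>
    simp only [whiskerRight_tmul]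
    refine (map_sum (tmul b q) _ _).symm.trans (congrArg (tmul b q) ?_)
    induction p using tensor_induction with
    | h0 | hadd => simp [*, sum_add_distrib]
    | htmul f p =>
      exact (map_sum (ttmul (P := one x) (Q := c) f) _ _).symm.trans (congrArg (ttmul (P := one x) (Q := c) f) (h.total b.snd p))
end Retract

section Dualizable
variable {x y : SmallCat k}

def evalFunctor (e : Hom (tensorObj x y) (star k k)) (hfin : ∀ t, Module.Finite k (e.obj ⟨⟩ t)) (Y : y) : x ⥤ FGModuleCat.{u} k
  where
  obj X :=
    haveI := hfin ⟨X, Y⟩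
    FGModuleCat.of k (e.obj ⟨⟩ ⟨X, Y⟩)
  map {X X'} f :=
    haveI := hfin ⟨X, Y⟩
    haveI := hfin ⟨X', Y⟩
    FGModuleCat.ofHom (e.act (𝟙 _) (LinTensor.tmul k f (𝟙 Y)))
  map_id X := by
    ext v
    exact e.act_id v
  map_comp {X X' X''} f g := by
    ext v
    refine Eq.trans ?_ (e.act_act (c' := (⟨X', Y⟩ : LinTensor k x y)) (c'' := (⟨X'', Y⟩ : LinTensor k x y)) (𝟙 _) (𝟙 _)
      (LinTensor.tmul k f (𝟙 Y)) (LinTensor.tmul k g (𝟙 Y)) v).symm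
    refine congrArg₂ (fun s t => e.act s t v) (comp_id _).symm ?_
    rw [LinTensor.tmul_comp k, comp_id]

lemma exists_retract_maps {e : Hom (tensorObj x y) (star k k)} {c : Hom (star k k) (tensorObj y x)} (hfin : ∀ t, Module.Finite k
  (e.obj ⟨⟩ t)) {J : Type} [Fintype J] (h : DualBasisAt c ⟨⟩ J) (hec : (tensorData k).IsDual e c) : ∃ (s : ∀ j (X X' : x), (X' ⟶
  X) →ₗ[k] e.obj ⟨⟩ ⟨X, (h.d j).fst⟩ ⊗[k] (X' ⟶ (h.d j).snd)) (r : ∀ j (X X' : x), e.obj ⟨⟩ ⟨X, (h.d j).fst⟩ ⊗[k] (X' ⟶ (h.d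
  j).snd) →ₗ[k] (X' ⟶ X)), (∀ j {X Y X' Y' : x} (g : Y' ⟶ X') (f : X ⟶ Y) (b), s j Y Y' (g ≫ b ≫ f) = TensorProduct.map
  (((evalFunctor e hfin (h.d j).fst).map f).hom.hom) (leftComp k (h.d j).snd g) (s j X X' b)) ∧ (∀ j {X Y X' Y' : x} (g : Y' ⟶ X')
  (f : X ⟶ Y) (z), r j Y Y' (TensorProduct.map (((evalFunctor e hfin (h.d j).fst).map f).hom.hom) (leftComp k (h.d j).snd g) z) =
  g ≫ r j X X' z ≫ f) ∧ ∀ X X' (b : X' ⟶ X), ∑ j, r j X X' (s j X X' b) = b := by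
  obtain ⟨i⟩ := nonempty_zigzag hec
  obtain ⟨s, r, hrs⟩ := exists_retract_tensor h x (evalRes e)
  let a (X : x) : LinTensor k x (Star k) := ⟨X, ⟨⟩⟩
  let R (j) := pointRes x (h.d j) (evalRes e)
  let S (j) : ofFunctor' (rightUnitorFunctor k x) ⟶ R j := i.inv ≫ s j
  let T (j) : R j ⟶ ofFunctor' (rightUnitorFunctor k x) := r j ≫ i.hom
  have hR (j) {X Y X' Y' : x} (g : Y' ⟶ X') (f : X ⟶ Y) (z : e.obj ⟨⟩ ⟨X, (h.d j).fst⟩ ⊗[k] (X' ⟶ (h.d j).snd)) : (evalRes e).act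
    (c := ⟨X, h.d j⟩) (c' := ⟨Y, h.d j⟩) g (LinTensor.tmul k f (𝟙 (h.d j))) z = TensorProduct.map (((evalFunctor e hfin (h.d
    j).fst).map f).hom.hom) (leftComp k (h.d j).snd g) z := by
    induction z using TensorProduct.induction_on with
    | zero => exact (map_zero _).trans (map_zero _).symm
    | add z z' hz hz' =>
      exact (map_add _ _ _).trans ((congrArg₂ (· + ·) hz hz').trans (map_add _ _ _).symm)
    | tmul v b => exact evalElt_act (h.d j) g f v b
  refine ⟨fun j X X' => (S j).app X' (a X), fun j X X' => (T j).app X' (a X), ?_, ?_, fun X X' b => (map_sum (i.hom.app X' (a X))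
    _ _).symm.trans ((congrArg (i.hom.app X' (a X)) (hrs X' (a X) (i.inv.app X' (a X) b))).trans (inv_hom_app i X' (a X) b))⟩
  · intro j X Y X' Y' g f b
    exact (toPointRes_app (S j) g f b).trans (hR j g f _)
  · intro j X Y X' Y' g f z
    exact (congrArg _ (hR j g f z)).symm.trans (ofPointRes_app (T j) g f z)

theorem nonempty_retract {e : Hom (tensorObj x y) (star k k)} {c : Hom (star k k) (tensorObj y x)} (he : HasDualBasis e) (hc :
  HasDualBasis c) (hec : (tensorData k).IsDual e c) : ∃ n, Nonempty (Retract k x (Fin n)) := by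
  have hfin (t) : Module.Finite k (e.obj ⟨⟩ t) := by
    obtain ⟨n, ⟨h⟩⟩ := he t
    exact h.finite ⟨⟩ fun _ => inferInstanceAs (Module.Finite k k)
  obtain ⟨n, ⟨h⟩⟩ := hc ⟨⟩
  obtain ⟨s, r, hs, hr, hrs⟩ := exists_retract_maps hfin h hec
  refine ⟨n, ⟨Retract.ofMaps (fun j => evalFunctor e hfin (h.d j).fst) (fun j => ⟨fun {X Y f g} => ?_⟩) (fun j => ⟨fun {X Y} f t
    => ?_⟩) (fun j => (h.d j).snd) s r hs (fun j {X Y X' Y'} g f v b => hr j g f (v ⊗ₜ b)) hrs⟩⟩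
  · ext v
    let φ := e.act (d := ⟨⟩) (d' := ⟨⟩) (c := (⟨X, (h.d j).fst⟩ : LinTensor k x y)) (c' := (⟨Y, (h.d j).fst⟩ : LinTensor k x y))
      (𝟙 (⟨⟩ : Star k))
    exact (congrArg (fun t => φ t v) ((LinTensor.tmul k (X := ⟨X, (h.d j).fst⟩) (Y := ⟨Y, (h.d j).fst⟩)).map_add₂ f g (𝟙
      _))).trans (LinearMap.congr_fun (φ.map_add _ _) v)
  · ext v
    let φ := e.act (d := ⟨⟩) (d' := ⟨⟩) (c := (⟨X, (h.d j).fst⟩ : LinTensor k x y)) (c' := (⟨Y, (h.d j).fst⟩ : LinTensor k x y))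
      (𝟙 (⟨⟩ : Star k))
    exact (congrArg (fun s => φ s v) ((LinTensor.tmul k (X := ⟨X, (h.d j).fst⟩) (Y := ⟨Y, (h.d j).fst⟩)).map_smul₂ t f (𝟙
      _))).trans (LinearMap.congr_fun (φ.map_smul _ _) v)

/-- Dualizable linear categories with finite duality data are products of copies of the ground
field. -/
theorem exists_equivalence_star [IsAlgClosed k] {e : Hom (tensorObj x y) (star k k)} {c : Hom (star k k) (tensorObj y x)} (he :
  HasDualBasis e) (hc : HasDualBasis c) (hec : (tensorData k).IsDual e c) : ∃ n, Nonempty (Bicategory.Equivalence (star k (Fin n →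
  k)) x) := by
  obtain ⟨n, ⟨R⟩⟩ := nonempty_retract he hc hec
  obtain ⟨m, ⟨B⟩⟩ := Retract.exists_splitBasis_karoubi R
  exact ⟨m, nonempty_equivalence_star B⟩
end Dualizable

theorem inducesEquivalence (k : Type u) [Field k] [IsAlgClosed k] : InducesEquivalence (KV.tensorData k) (tensorData k)
  (SubBicat.whole (SmallCat k)) (incl k) := inducesEquivalence_of (inclPseudo k) (SubBicat.whole _) (SubBicat.whole _) (fun _ =>
  trivial) (fun h => h) isFunctorial (fun a b c => KV.assoc_assocInv a b c) inclPseudo_full inclPseudo_faithful (fun _ => trivial)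
  (fun _ => trivial) KV.exists_adjoint (fun a => ⟨_, _, _, KV.isDual_self a⟩) (fun f _ ⟨g, _, ⟨adj⟩⟩ => exists_ofMatrix f
  (hasDualBasis_of_adjunction adj)) (fun {x y e c} _ _ _ _ ⟨_, _, ⟨he⟩⟩ ⟨_, _, ⟨hc⟩⟩ hec => by
      obtain ⟨n, ⟨i⟩⟩ := exists_equivalence_star (hasDualBasis_of_adjunction he) (hasDualBasis_of_adjunction hc) hec
      exact ⟨⟨n⟩, i, trivial, trivial⟩)
    (preserves_incl k) trivial trivial (fun _ _ => trivial) (fun _ _ => trivial)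
end SmallCat

/-! ### Transport along functors which are equivalences on categories of 1-morphisms -/

section Transport
open Ho

variable {A : Type u₁} [Bicategory.{w₁, v₁} A] {B : Type u₂} [Bicategory.{w₂, v₂} B] {C : Type u₃} [Bicategory.{w₃, v₃} C] (Φ :
  Pseudofunctor B C) [hΦ : ∀ a b, (Φ.mapFunctor a b).IsEquivalence]

lemma exists_lift (ι : PrelaxFunctor A B) (Ψ : Pseudofunctor A C) (h : Ψ.toPrelaxFunctor = ι.comp Φ.toPrelaxFunctor) : ∃ ι' :
  Pseudofunctor A B, ι'.toPrelaxFunctor = ι := by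
  rcases Ψ with ⟨P, i, c, h₁, h₂, h₃, h₄, h₅⟩
  obtain rfl : P = _ := h
  obtain ⟨i, rfl⟩ : ∃ i' : ∀ a, Φ.map (ι.map (𝟙 a)) ≅ 𝟙 (Φ.obj (ι.obj a)), i' = i := ⟨i, rfl⟩
  obtain ⟨c, rfl⟩ : ∃ c' : ∀ {a b c : A} (f : a ⟶ b) (g : b ⟶ c), Φ.map (ι.map (f ≫ g)) ≅ Φ.map (ι.map f) ≫ Φ.map (ι.map g), @c' =
    @c := ⟨@c, rfl⟩
  have hp {a b : B} {f g : a ⟶ b} (e : Φ.map f ≅ Φ.map g) : ∃ e' : f ≅ g, Φ.map₂ e'.hom = e.hom ∧ Φ.map₂ e'.inv = e.inv :=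
    ⟨(Φ.mapFunctor a b).preimageIso e, (Φ.mapFunctor a b).map_preimage e.hom, (Φ.mapFunctor a b).map_preimage e.inv⟩
  have hinj {a b : B} {f g : a ⟶ b} {η θ : f ⟶ g} (h : Φ.map₂ η = Φ.map₂ θ) : η = θ := (Φ.mapFunctor a b).map_injective h
  choose i' hi hi' using fun a => hp (i a ≪≫ (Φ.mapId (ι.obj a)).symm)
  choose c' hc hc' using fun {x y z : A} (f : x ⟶ y) (g : y ⟶ z) => hp (c f g ≪≫ (Φ.mapComp (ι.map f) (ι.map g)).symm)
  refine ⟨{ toPrelaxFunctor := ι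
            mapId := i'
            mapComp := c'
            map₂_whisker_left f _ _ η := hinj ((h₁ f η).trans ?_)
            map₂_whisker_right η h := hinj ((h₂ η h).trans ?_)
            map₂_associator f g h := hinj ((h₃ f g h).trans ?_)
            map₂_left_unitor f := hinj ((h₄ f).trans ?_)
            map₂_right_unitor f := hinj ((h₅ f).trans ?_) }, rfl⟩
  all_goals
    simp only [Φ.map₂_comp, hc, hc', hi, Φ.map₂_whisker_left, Φ.map₂_whisker_right]
    simp
    rfl

variable {Φ}

include hΦ

lemma cls_of_cls_map {a b : B} {f g : a ⟶ b} (h : cls (Φ.map f) = cls (Φ.map g)) : cls f = cls g := by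
  obtain ⟨e⟩ := cls_eq_iff.1 h
  exact cls_eq ((Φ.mapFunctor a b).preimageIso e)

lemma exists_equivalence_of_map {a b : B} (i : Φ.obj a ≌ Φ.obj b) : ∃ j : a ≌ b, cls (Φ.map j.hom) = cls i.hom := by
  let f := (Φ.mapFunctor a b).objPreimage i.hom
  let g := (Φ.mapFunctor b a).objPreimage i.inv
  have hf : cls (Φ.map f) = cls i.hom := cls_eq ((Φ.mapFunctor a b).objObjPreimageIso i.hom)
  have hg : cls (Φ.map g) = cls i.inv := cls_eq ((Φ.mapFunctor b a).objObjPreimageIso i.inv)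
  obtain ⟨j, hj, -⟩ := exists_equivalence f g (cls_of_cls_map ((cls_map_comp Φ f g).trans ((congrArg₂ (· ≫ ·) hf hg).trans ((iso
    i).hom_inv_id.trans (cls_map_id Φ a).symm)))) (cls_of_cls_map ((cls_map_comp Φ g f).trans ((congrArg₂ (· ≫ ·) hg hf).trans
    ((iso i).inv_hom_id.trans (cls_map_id Φ b).symm))))
  exact ⟨j, hj ▸ hf⟩

variable {T : TensorData B} {T' : TensorData C} {κ₀ : T'.unit ≌ Φ.obj T.unit} {κ : ∀ a b, T'.tensorObj (Φ.obj a) (Φ.obj b) ≌ Φ.obj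
  (T.tensorObj a b)} (hκ : TensorData.Preserves T T' Φ.toPrelaxFunctor κ₀ κ) (hT' : T'.IsFunctorial (SubBicat.whole C))

omit hΦ in
include hκ in
lemma TensorData.Preserves.cls_map_tensorHom {a a' b b' : B} (f : a ⟶ a') (g : b ⟶ b') : cls (Φ.map (T.tensorHom f g)) = (iso (κ a
  b)).inv ≫ cls (T'.tensorHom (Φ.map f) (Φ.map g)) ≫ (iso (κ a' b')).hom := (Iso.eq_inv_comp _).2 (cls_eq_iff.2 (hκ.naturality f
  g)).symm

include hκ hT'

lemma TensorData.IsFunctorial.of_preserves (h : ∀ a b c, Nonempty (T.assocInv a b c ≫ T.assoc a b c ≅ 𝟙 _)) : T.IsFunctorial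
  (SubBicat.whole B) where
  obj_unit := trivial
  obj_tensor _ _ := trivial
  congr _ _ _ _ _ _ _ _ h h' := cls_eq_iff.1 (cls_of_cls_map (Φ := Φ) (by
    rw [hκ.cls_map_tensorHom, hκ.cls_map_tensorHom, hT'.cls_congr trivial trivial trivial trivial trivial trivial trivial trivial
      (cls_map_eq Φ (cls_eq_iff.2 h))
      (cls_map_eq Φ (cls_eq_iff.2 h'))]))
  id {a b} _ _ := cls_eq_iff.1 (cls_of_cls_map (Φ := Φ) (by
    rw [hκ.cls_map_tensorHom, hT'.cls_congr trivial trivial trivial trivial trivial trivial trivial trivial (cls_map_id Φ a)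
      (cls_map_id Φ b), cls_eq_iff.2 (hT'.id trivial trivial), cls_id,
      id_comp, Iso.inv_hom_id, cls_map_id]))
  comp {a a' a'' b b' b'' f f' g g'} _ _ _ _ _ _ _ _ _ _ := cls_eq_iff.1 (cls_of_cls_map (Φ := Φ)
    (by
      rw [cls_map_comp, hκ.cls_map_tensorHom, hκ.cls_map_tensorHom, hκ.cls_map_tensorHom, hT'.cls_congr trivial trivial trivial
        trivial trivial trivial trivial trivial (cls_map_comp Φ f f') (cls_map_comp Φ g g'), cls_eq_iff.2 (hT'.comp (f := Φ.map f)
        (g' := Φ.map g') trivial trivial trivial trivial trivial trivial trivial trivial trivial trivial)]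
      simp only [cls_comp, Category.assoc, Iso.hom_inv_id_assoc]))
  assocInv_assoc _ _ _ := h _ _ _

omit hT' hκ in
lemma TensorData.Preserves.exists_of_comp (hκ : Preserves T T' Φ.toPrelaxFunctor κ₀ κ) (hT' : T'.IsFunctorial (SubBicat.whole C))
  {T'' : TensorData A} {ι : PrelaxFunctor A B} {χ₀' : T'.unit ≌ Φ.obj (ι.obj T''.unit)} {χ' : ∀ a b, T'.tensorObj (Φ.obj (ι.obj
  a)) (Φ.obj (ι.obj b)) ≌ Φ.obj (ι.obj (T''.tensorObj a b))} (h : Preserves T'' T' (ι.comp Φ.toPrelaxFunctor) χ₀' χ') : ∃ χ₀ χ,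
  Preserves T'' T ι χ₀ χ := by
  have lift {a b : B} {x : C} (e : x ≌ Φ.obj a) (e' : x ≌ Φ.obj b) : ∃ j : a ≌ b, cls (Φ.map j.hom) = (iso e).inv ≫ cls e'.hom :=
    by
    obtain ⟨i, hi, -⟩ := exists_equivTrans (equivSymm e) e'
    obtain ⟨j, hj⟩ := exists_equivalence_of_map i
    exact ⟨j, hj.trans (congrArg cls hi)⟩
  have hl {a b c : B} {x : C} (e : x ≌ Φ.obj a) (e' : x ≌ Φ.obj b) (j : a ≌ b) (hj : cls (Φ.map j.hom) = (iso e).inv ≫ cls e'.hom)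
    : cls (T'.tensorHom e.hom (𝟙 (Φ.obj c))) ≫ cls (κ a c).hom ≫ cls (Φ.map (T.tensorHom j.hom (𝟙 c))) = cls (T'.tensorHom e'.hom
    (𝟙 (Φ.obj c))) ≫ (iso (κ b c)).hom := by
    rw [hκ.cls_map_tensorHom, hT'.cls_congr (f' := e.inv ≫ e'.hom) trivial trivial trivial trivial trivial trivial trivial trivial
      hj (cls_map_id Φ c), hT'.cls_comp_id trivial trivial trivial trivial trivial trivial, ← iso_hom, Iso.hom_inv_id_assoc,
      Category.assoc]
    exact (reassoc_of% (hT'.cls_inv_hom_id (a := Φ.obj c) trivial (equivSymm e) trivial trivial trivial trivial)) _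
  have hr {a b c : B} {x : C} (e : x ≌ Φ.obj a) (e' : x ≌ Φ.obj b) (j : a ≌ b) (hj : cls (Φ.map j.hom) = (iso e).inv ≫ cls e'.hom)
    : cls (T'.tensorHom (𝟙 (Φ.obj c)) e.hom) ≫ cls (κ c a).hom ≫ cls (Φ.map (T.tensorHom (𝟙 c) j.hom)) = cls (T'.tensorHom (𝟙
    (Φ.obj c)) e'.hom) ≫ (iso (κ c b)).hom := by
    rw [hκ.cls_map_tensorHom, hT'.cls_congr (g' := e.inv ≫ e'.hom) trivial trivial trivial trivial trivial trivial trivial trivial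
      (cls_map_id Φ c) hj, hT'.cls_id_comp trivial trivial trivial trivial trivial trivial, ← iso_hom, Iso.hom_inv_id_assoc,
      Category.assoc]
    exact (reassoc_of% (hT'.cls_id_inv_hom (a := Φ.obj c) trivial (equivSymm e) trivial trivial trivial trivial)) _
  obtain ⟨χ₀, h₀⟩ := lift κ₀ χ₀'
  choose χ hχ using fun a b => lift (κ (ι.obj a) (ι.obj b)) (χ' a b)
  have epi {a c : B} {x : C} (e : x ≌ Φ.obj a) {y : Ho C} {f g : Ho.mk (T'.tensorObj (Φ.obj a) (Φ.obj c)) ⟶ y} (h : cls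
    (T'.tensorHom e.hom (𝟙 _)) ≫ f = cls (T'.tensorHom e.hom (𝟙 _)) ≫ g) : f = g := by
    have h₁ := hT'.cls_inv_hom_id (a := Φ.obj c) trivial e trivial trivial trivial trivial
    simpa only [reassoc_of% h₁] using cls (T'.tensorHom e.inv (𝟙 _)) ≫= h
  have epi' {a c : B} {x : C} (e : x ≌ Φ.obj a) {y : Ho C} {f g : Ho.mk (T'.tensorObj (Φ.obj c) (Φ.obj a)) ⟶ y} (h : cls
    (T'.tensorHom (𝟙 _) e.hom) ≫ f = cls (T'.tensorHom (𝟙 _) e.hom) ≫ g) : f = g := by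
    have h₁ := hT'.cls_id_inv_hom (a := Φ.obj c) trivial e trivial trivial trivial trivial
    simpa only [reassoc_of% h₁] using cls (T'.tensorHom (𝟙 _) e.inv) ≫= h
  refine ⟨χ₀, χ, ⟨fun {a a' b b'} f g => ?_, fun a b c => ?_, fun a => ?_, fun a => ?_, fun a b => ?_⟩⟩ <;> refine cls_eq_iff.1
    (cls_of_cls_map (Φ := Φ) ?_) <;> simp only [cls_map_comp, hχ]
  · have := cls_eq_iff.2 (h.naturality f g)
    simp only [cls_comp] at this
    rw [hκ.cls_map_tensorHom]
    simp only [Category.assoc, Iso.hom_inv_id_assoc]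
    exact congrArg ((iso (κ _ _)).inv ≫ ·) this
  · have h₁ := cls_eq_iff.2 (h.associativity a b c)
    have h₂ := cls_eq_iff.2 (hκ.associativity (ι.obj a) (ι.obj b) (ι.obj c))
    have h₃ := hl (c := ι.obj c) _ _ _ (hχ a b)
    have h₄ := hr (c := ι.obj a) _ _ _ (hχ b c)
    simp only [cls_comp] at h₁ h₂
    refine (cancel_epi (iso (κ _ (ι.obj c))).hom).1 (epi (κ (ι.obj a) (ι.obj b)) ?_)
    rw [iso_hom, reassoc_of% h₃, Category.assoc, Iso.hom_inv_id_assoc, reassoc_of% h₂, reassoc_of% h₄, Iso.hom_inv_id_assoc]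
    exact h₁
  · have h₁ := cls_eq_iff.2 (h.left_unitality a)
    have h₂ := cls_eq_iff.2 (hκ.left_unitality (ι.obj a))
    have h₃ := hl (c := ι.obj a) _ _ _ h₀
    simp only [cls_comp] at h₁ h₂
    refine (cancel_epi (iso (κ _ (ι.obj a))).hom).1 (epi κ₀ ?_)
    rw [iso_hom, reassoc_of% h₃, Category.assoc, Iso.hom_inv_id_assoc, h₂]
    exact h₁
  · have h₁ := cls_eq_iff.2 (h.right_unitality a)
    have h₂ := cls_eq_iff.2 (hκ.right_unitality (ι.obj a))
    have h₃ := hr (c := ι.obj a) _ _ _ h₀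
    simp only [cls_comp] at h₁ h₂
    refine (cancel_epi (iso (κ (ι.obj a) _)).hom).1 (epi' κ₀ ?_)
    rw [iso_hom, reassoc_of% h₃, Category.assoc, Iso.hom_inv_id_assoc, h₂]
    exact h₁
  · have h₁ := cls_eq_iff.2 (h.symmetry a b)
    have h₂ := cls_eq_iff.2 (hκ.symmetry (ι.obj a) (ι.obj b))
    simp only [cls_comp] at h₁ h₂
    rw [← cancel_epi (iso (κ _ _)).hom, Category.assoc, Iso.hom_inv_id_assoc, iso_hom, reassoc_of% h₂, ← iso_hom (κ _ _),
      Iso.hom_inv_id_assoc]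
    exact h₁

omit hT' hκ in
/-- A criterion for a functor to induce an equivalence with the fully-dualizable sub-2-category,
after composition with a functor which is an equivalence on categories of 1-morphisms. -/
theorem inducesEquivalence_of_comp (hκ : TensorData.Preserves T T' Φ.toPrelaxFunctor κ₀ κ) (hT' : T'.IsFunctorial (SubBicat.whole
  C)) {T'' : TensorData A} (hT'' : ∀ a b c, Nonempty (T''.assoc a b c ≫ T''.assocInv a b c ≅ 𝟙 _)) (hT : ∀ a b c, Nonempty
  (T.assocInv a b c ≫ T.assoc a b c ≅ 𝟙 _)) (hT₁ : ∀ a b c, Nonempty (T.assoc a b c ≫ T.assocInv a b c ≅ 𝟙 _)) (S : SubBicat B) (ι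
  : PrelaxFunctor A B) (Ψ : Pseudofunctor A C) (hΨ : Ψ.toPrelaxFunctor = ι.comp Φ.toPrelaxFunctor) (hfull : ∀ a b, (Ψ.mapFunctor a
  b).Full) (hfaithful : ∀ a b, (Ψ.mapFunctor a b).Faithful) (hadj : ∀ {a b : A} (f : a ⟶ b), ∃ g, Nonempty (Bicategory.Adjunction
  f g) ∧ Nonempty (Bicategory.Adjunction g f)) (hdual : ∀ a : A, ∃ (b : A) (e : T''.tensorObj a b ⟶ T''.unit) (c : T''.unit ⟶
  T''.tensorObj b a), T''.IsDual e c) (hess : ∀ {a b : A} (f : Ψ.obj a ⟶ Ψ.obj b) (g), Bicategory.Adjunction f g → ∃ M, Nonempty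
  (Ψ.map M ≅ f)) (hfd : ∀ {x y : C} {e : T'.tensorObj x y ⟶ T'.unit} {c : T'.unit ⟶ T'.tensorObj y x} (g g'),
  Bicategory.Adjunction e g → Bicategory.Adjunction c g' → T'.IsDual e c → ∃ a, Nonempty (Ψ.obj a ≌ x)) {χ₀' : T'.unit ≌ Ψ.obj
  T''.unit} {χ' : ∀ a b, T'.tensorObj (Ψ.obj a) (Ψ.obj b) ≌ Ψ.obj (T''.tensorObj a b)} (h : TensorData.Preserves T'' T'
  Ψ.toPrelaxFunctor χ₀' χ') (hobj : ∀ a, S.obj (ι.obj a)) (hmap : ∀ {a b : A} (f : a ⟶ b), S.hom (ι.map f)) (hunit : S.obj T.unit)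
  (htensor : ∀ {a b}, S.obj a → S.obj b → S.obj (T.tensorObj a b)) (hS : ∀ {a b : B} (i : a ≌ b), S.obj a → S.obj b → S.hom i.hom)
  : InducesEquivalence T'' T S ι := by
  obtain ⟨ι, rfl⟩ := exists_lift Φ ι Ψ hΨ
  rcases Ψ with ⟨P, i, c, h₁, h₂, h₃, h₄, h₅⟩
  obtain rfl : P = _ := hΨ
  have hS' {a b : B} (i : a ≌ b) (ha : S.obj a) (hb : S.obj b) : S.hom i.inv := hS (equivSymm i) hb ha
  obtain ⟨χ₀, χ, hχ⟩ := TensorData.Preserves.exists_of_comp hκ hT' h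
  refine inducesEquivalence_of ι S (SubBicat.whole B) (fun _ => trivial) (fun _ => trivial) (.of_preserves hκ hT' hT) hT'' (fun a
    b => ⟨fun {f g} θ => ?_⟩) (fun a b => ⟨fun {f g η θ} h => ?_⟩) hobj hmap hadj hdual (fun {a b} f _ hf => ?_) (fun {x y e c} hx
    hy _ _ he hc hec => ?_) hχ (hS _ hunit (hobj _)) (hS' _ hunit (hobj _)) (fun a b => hS _ (htensor (hobj a) (hobj b)) (hobj _))
    (fun a b => hS' _ (htensor (hobj a) (hobj b)) (hobj _))
  · obtain ⟨η, hη⟩ := (hfull a b).map_surjective (Φ.map₂ θ)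
    exact ⟨η, (Φ.mapFunctor _ _).map_injective hη⟩
  · exact (hfaithful a b).map_injective (congrArg Φ.map₂ h)
  · obtain ⟨g, _, ⟨adj⟩⟩ := hf
    obtain ⟨M, ⟨e⟩⟩ := hess (Φ.map f) _ (Φ.mapAdjunction adj)
    exact ⟨M, ⟨(Φ.mapFunctor _ _).preimageIso e⟩⟩
  · obtain ⟨g, _, ⟨he⟩⟩ := he
    obtain ⟨g', _, ⟨hc⟩⟩ := hc
    have hd := TensorData.Preserves.isDual hκ hT' hT₁ (fun _ => trivial) (fun _ => trivial) trivial trivial (fun _ _ => trivial)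
      (fun _ _ => trivial) hec
    obtain ⟨a, ⟨i⟩⟩ := hfd _ _ ((equivAdj (κ x y)).comp ((Φ.mapAdjunction he).comp (equivAdj (equivSymm κ₀)))) ((equivAdj κ₀).comp
      ((Φ.mapAdjunction hc).comp (equivAdj (equivSymm (κ y x))))) hd
    obtain ⟨j, -⟩ := exists_equivalence_of_map (Φ := Φ) i
    exact ⟨a, j, hS j (hobj a) hx, hS' j (hobj a) hx⟩
end Transport

namespace ALG
/-! ### Elements of bimodules -/

section Elements
instance opRing (A : ALG k) : Ring A.mon.X :=
  let R := ModuleCat.MonModuleEquivalenceAlgebra.MonObj.toRing A.mon.X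
  { (inferInstance : AddCommGroup A.mon.X) with
    one := R.one
    mul x y := R.mul y x
    npow := @npowRec _ ⟨R.one⟩ ⟨fun x y => R.mul y x⟩
    one_mul := R.mul_one
    mul_one := R.one_mul
    mul_assoc x y z := (R.mul_assoc z y x).symm
    left_distrib x y z := R.right_distrib y z x
    right_distrib x y z := R.left_distrib z x y
    zero_mul := R.mul_zero
    mul_zero := R.zero_mul }

instance (A : ALG k) : Algebra k A.mon.X := Algebra.ofModule (fun r x y => (map_smul ((MonObj.mul (X := A.mon.X)).hom) r (y ⊗ₜ[k]
  x) |>.symm.trans (congrArg (MonObj.mul (X := A.mon.X)).hom (TensorProduct.tmul_smul r y x).symm)).symm) (fun r x y => (map_smul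
  ((MonObj.mul (X := A.mon.X)).hom) r (y ⊗ₜ[k] x)))

variable {A B C D : ALG k} (M : Bimod A.mon B.mon) (N : Bimod B.mon C.mon) (P : Bimod C.mon D.mon)

def lact : A.mon.X →ₗ[k] M.X →ₗ[k] M.X := (TensorProduct.mk k A.mon.X M.X).compr₂ M.actLeft.hom

def ract : M.X →ₗ[k] B.mon.X →ₗ[k] M.X := (TensorProduct.mk k M.X B.mon.X).compr₂ M.actRight.hom

lemma hom_congr {X Y : ModuleCat.{u} k} {f g : X ⟶ Y} (h : f = g) (x : X) : f.hom x = g.hom x := h ▸ rfl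

lemma one_lact (x : M.X) : lact M 1 x = x := (hom_congr M.one_actLeft ((1 : k) ⊗ₜ x)).trans (one_smul k x)

lemma ract_one (x : M.X) : ract M x 1 = x := (hom_congr M.actRight_one (x ⊗ₜ (1 : k))).trans (one_smul k x)

lemma mul_lact (a b : A.mon.X) (x : M.X) : lact M (a * b) x = lact M b (lact M a x) := hom_congr M.left_assoc ((b ⊗ₜ[k] a) ⊗ₜ[k]
  x)

lemma ract_mul (x : M.X) (a b : B.mon.X) : ract M x (a * b) = ract M (ract M x b) a := hom_congr M.right_assoc (x ⊗ₜ[k] (b ⊗ₜ[k]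
  a))

lemma lact_ract (a : A.mon.X) (x : M.X) (b : B.mon.X) : ract M (lact M a x) b = lact M a (ract M x b) := hom_congr M.middle_assoc
  ((a ⊗ₜ[k] x) ⊗ₜ[k] b)

def proj : (M.X ⊗ N.X : ModuleCat.{u} k) ⟶ Bimod.TensorBimod.X M N := coequalizer.π _ _

def tmul : M.X →ₗ[k] N.X →ₗ[k] (M.tensorBimod N).X := (TensorProduct.mk k M.X N.X).compr₂ (proj M N).hom

variable {M N P}

lemma proj_condition : M.actRight ▷ N.X ≫ proj M N = (MonoidalCategoryStruct.associator M.X B.mon.X N.X).hom ≫ M.X ◁ N.actLeft ≫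
  proj M N := (coequalizer.condition _ _).trans (assoc _ _ _)

lemma tmul_balanced (m : M.X) (b : B.mon.X) (n : N.X) : tmul M N (ract M m b) n = tmul M N m (lact N b n) := hom_congr
  proj_condition ((m ⊗ₜ[k] b) ⊗ₜ[k] n)

def desc {X : Type u} [AddCommGroup X] [Module k X] (φ : M.X →ₗ[k] N.X →ₗ[k] X) (h : ∀ m b n, φ (ract M m b) n = φ m (lact N b n))
  : (M.tensorBimod N).X →ₗ[k] X :=
  let f : (M.X ⊗ N.X : ModuleCat.{u} k) ⟶ ModuleCat.of k X := ModuleCat.ofHom (TensorProduct.lift φ)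
  (coequalizer.desc f (ModuleCat.MonoidalCategory.tensor_ext₃' h) : Bimod.TensorBimod.X M N ⟶ ModuleCat.of k X).hom

@[simp] lemma desc_tmul {X : Type u} [AddCommGroup X] [Module k X] (φ : M.X →ₗ[k] N.X →ₗ[k] X) (h m n) : desc φ h (tmul M N m n) =
  φ m n := by
  let f : (M.X ⊗ N.X : ModuleCat.{u} k) ⟶ ModuleCat.of k X := ModuleCat.ofHom (TensorProduct.lift φ)
  have h' : proj M N ≫ ModuleCat.ofHom (desc φ h) = f := coequalizer.π_desc _ _
  exact hom_congr h' (m ⊗ₜ[k] n)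

lemma tmul_ext {X : Type u} [AddCommGroup X] [Module k X] {φ ψ : (M.tensorBimod N).X →ₗ[k] X} (h : ∀ m n, φ (tmul M N m n) = ψ
  (tmul M N m n)) : φ = ψ := by
  have : ModuleCat.ofHom φ = ModuleCat.ofHom ψ := coequalizer.hom_ext (ModuleCat.MonoidalCategory.tensor_ext h)
  exact congrArg ModuleCat.Hom.hom this

lemma lact_tmul (a : A.mon.X) (m : M.X) (n : N.X) : lact (M.tensorBimod N) a (tmul M N m n) = tmul M N (lact M a m) n := hom_congr
  (Bimod.TensorBimod.whiskerLeft_π_actLeft M N) (a ⊗ₜ[k] (m ⊗ₜ[k] n))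

lemma ract_tmul (m : M.X) (n : N.X) (c : C.mon.X) : ract (M.tensorBimod N) (tmul M N m n) c = tmul M N m (ract N n c) := hom_congr
  (Bimod.TensorBimod.π_tensor_id_actRight M N) ((m ⊗ₜ[k] n) ⊗ₜ[k] c)

lemma hom_lact {M M' : Bimod A.mon B.mon} (f : M ⟶ M') (a x) : f.hom.hom (lact M a x) = lact M' a (f.hom.hom x) := hom_congr
  f.left_act_hom (a ⊗ₜ[k] x)

lemma hom_ract {M M' : Bimod A.mon B.mon} (f : M ⟶ M') (x b) : f.hom.hom (ract M x b) = ract M' (f.hom.hom x) b := hom_congr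
  f.right_act_hom (x ⊗ₜ[k] b)

lemma whiskerLeft_tmul (M : Bimod A.mon B.mon) {N N' : Bimod B.mon C.mon} (f : N ⟶ N') (m n) : (Bimod.whiskerLeft M f).hom.hom
  (tmul M N m n) = tmul M N' m (f.hom.hom n) := by
  have h : proj M N ≫ (Bimod.whiskerLeft M f).hom = M.X ◁ f.hom ≫ proj M N' := ι_colimMap _ WalkingParallelPair.one
  exact hom_congr h (m ⊗ₜ[k] n)

lemma whiskerRight_tmul {M M' : Bimod A.mon B.mon} (f : M ⟶ M') (N : Bimod B.mon C.mon) (m n) : (Bimod.whiskerRight f N).hom.hom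
  (tmul M N m n) = tmul M' N (f.hom.hom m) n := by
  have h : proj M N ≫ (Bimod.whiskerRight f N).hom = f.hom ▷ N.X ≫ proj M' N := ι_colimMap _ WalkingParallelPair.one
  exact hom_congr h (m ⊗ₜ[k] n)

lemma associator_tmul (m n p) : (Bimod.associatorBimod M N P).hom.hom.hom (tmul (M.tensorBimod N) P (tmul M N m n) p) = tmul M
  (N.tensorBimod P) m (tmul N P n p) := by
  have h₁ : proj (M.tensorBimod N) P ≫ (Bimod.associatorBimod M N P).hom.hom = Bimod.AssociatorBimod.homAux M N P :=
    coequalizer.π_desc _ _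
  have h₂ : proj M N ▷ P.X ≫ Bimod.AssociatorBimod.homAux M N P = (MonoidalCategoryStruct.associator M.X N.X P.X).hom ≫ M.X ◁ proj
    N P ≫ proj M (N.tensorBimod P) := π_tensor_id_preserves_coequalizer_inv_desc _ _ _ _
  exact (hom_congr h₁ (tmul M N m n ⊗ₜ[k] p)).trans (hom_congr h₂ ((m ⊗ₜ[k] n) ⊗ₜ[k] p))

lemma leftUnitor_tmul (a : A.mon.X) (m : M.X) : (Bimod.leftUnitorBimod M).hom.hom.hom (tmul (Bimod.regular A.mon) M a m) = lact M
  a m := by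
  have h : proj (Bimod.regular A.mon) M ≫ (Bimod.leftUnitorBimod M).hom.hom = M.actLeft := coequalizer.π_desc _ _
  exact hom_congr h (a ⊗ₜ[k] m)

lemma rightUnitor_tmul (m : M.X) (b : B.mon.X) : (Bimod.rightUnitorBimod M).hom.hom.hom (tmul M (Bimod.regular B.mon) m b) = ract
  M m b := by
  have h : proj M (Bimod.regular B.mon) ≫ (Bimod.rightUnitorBimod M).hom.hom = M.actRight := coequalizer.π_desc _ _
  exact hom_congr h (m ⊗ₜ[k] b)

variable (M) in
lemma inv_lact (z : M.X) : (Bimod.leftUnitorBimod M).inv.hom.hom z = tmul (Bimod.regular A.mon) M (1 : A.mon.X) z := (congrArg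
  (Bimod.leftUnitorBimod M).inv.hom.hom ((leftUnitor_tmul 1 z).trans (one_lact M z))).symm.trans (hom_congr (congrArg
  Bimod.Hom.hom (Bimod.leftUnitorBimod M).hom_inv_id) (tmul (Bimod.regular A.mon) M (1 : A.mon.X) z))

variable (M) in
lemma inv_ract (z : M.X) : (Bimod.rightUnitorBimod M).inv.hom.hom z = tmul M (Bimod.regular B.mon) z (1 : B.mon.X) := (congrArg
  (Bimod.rightUnitorBimod M).inv.hom.hom ((rightUnitor_tmul z 1).trans (ract_one M z))).symm.trans (hom_congr (congrArg
  Bimod.Hom.hom (Bimod.rightUnitorBimod M).hom_inv_id) (tmul M (Bimod.regular B.mon) z (1 : B.mon.X)))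
end Elements

variable {A B C D : ALG k}

/-! ### Bimodules over algebras as bimodules over linear categories -/

open SmallCat (star comp hom_ext_comp hom_ext_comp_comp hom₂_ext homElt descHom)

variable (M : Bimod A.mon B.mon) (N : Bimod B.mon C.mon) (P : Bimod C.mon D.mon)

/-- A bimodule over algebras, as a bimodule over linear categories with one object. -/
def phi : SmallCat.Hom (star k A.mon.X) (star k B.mon.X) where
  obj _ _ := M.X
  act := (LinearMap.llcomp k _ _ _).compl₁₂ (ract M).flip (lact M)
  act_id x := (congrArg (ract M · 1) (one_lact M x)).trans (ract_one M x)
  act_act g g' f f' x := by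
    refine Eq.trans (congrArg (ract M · g') (lact_ract M f' (lact M f x) g).symm) ?_
    exact (congrArg (fun t => ract M (ract M t g) g') (mul_lact M f f' x).symm).trans (ract_mul M _ g' g).symm

variable {M N P}

lemma phi_act_one {x : Star B.mon.X} {y y' : Star A.mon.X} (f : y ⟶ y') (p : M.X) : (phi M).act (𝟙 x) f p = lact M f p := ract_one
  M _

lemma phi_one_act {x x' : Star B.mon.X} {y : Star A.mon.X} (f : x ⟶ x') (p : M.X) : (phi M).act f (𝟙 y) p = ract M p f := congrArg
  (ract M · f) (one_lact M p)

def phiMap {M M' : Bimod A.mon B.mon} (f : M ⟶ M') : phi M ⟶ phi M' := SmallCat.Hom₂.mk (fun _ _ => f.hom.hom) (fun b a x =>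
  (hom_ract f (lact M a x) b).trans (congrArg (ract M' · b) (hom_lact f a x)))

variable (M N)

def phiComp : comp (phi M) (phi N) ⟶ phi (M.tensorBimod N) := descHom (fun _ _ _ => (tmul M N).flip) (fun f q p => (congrArg (tmul
  M N p) (phi_act_one f q)).trans ((tmul_balanced p f q).symm.trans (congrArg (tmul M N · q) (phi_one_act f p).symm))) (fun g f q
  p => (congrArg₂ (tmul M N · ·) (phi_act_one f p) (phi_one_act g q)).trans ((ract_tmul _ q g).symm.trans (congrArg (ract
  (M.tensorBimod N) · g) (lact_tmul f p q).symm)))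

lemma phiComp_tmul (x y z) (q : N.X) (p : M.X) : (phiComp M N).app x y (SmallCat.tmul (P := phi M) (Q := phi N) z q p) = tmul M N
  p q := SmallCat.descHom_tmul _ _ _ _ _ _ _ _

instance : IsIso (phiComp M N) := by
  let inv (x y) : (phi (M.tensorBimod N)).obj x y →ₗ[k] (comp (phi M) (phi N)).obj x y := desc (SmallCat.tmul (P := phi M) (Q :=
    phi N) (c := x) (a := y) ⟨⟩).flip fun m b n => (congrArg (SmallCat.tmul (P := phi M) (Q := phi N) (c := x) (a := y) ⟨⟩ n)
    (phi_one_act (x := ⟨⟩) (x' := ⟨⟩) (y := ⟨⟩) b m).symm).trans ((SmallCat.act_tmul (P := phi M) (Q := phi N) (c := x) (a := y)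
    (b := ⟨⟩) (b' := ⟨⟩) b n m).symm.trans (congrArg (SmallCat.tmul (P := phi M) ⟨⟩ · m) (phi_act_one b n)))
  let i : comp (phi M) (phi N) ≅ phi (M.tensorBimod N) := SmallCat.isoMk (fun x y => LinearEquiv.ofLinear ((phiComp M N).app x y)
    (inv x y) (tmul_ext fun m n => (congrArg ((phiComp M N).app x y) (desc_tmul _ _ m n)).trans (phiComp_tmul M N x y ⟨⟩ n m))
    (SmallCat.comp_linear_ext fun z q p => (congrArg (inv x y) (phiComp_tmul M N x y z q p)).trans (desc_tmul _ _ p q))) (phiComp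
    M N).app_act
  exact inferInstanceAs (IsIso i.hom)

variable (A) in
def phiId : SmallCat.one (star k A.mon.X) ⟶ phi (Bimod.regular A.mon) := SmallCat.Hom₂.mk (fun _ _ => LinearMap.id) (fun _ _ _ =>
  rfl)

instance : IsIso (phiId A) := by
  let i : SmallCat.one (star k A.mon.X) ≅ phi (Bimod.regular A.mon) := SmallCat.isoMk

    (fun x y => LinearEquiv.refl k A.mon.X) (phiId A).app_act
  exact inferInstanceAs (IsIso i.hom)

def starPrelax (k : Type u) [Field k] : PrelaxFunctor (ALG k) (SmallCat k) where
  obj A := star k A.mon.X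
  map M := phi (bimod M)
  map₂ f := phiMap f
  map₂_id _ := rfl
  map₂_comp _ _ := rfl

def starLax (k : Type u) [Field k] : LaxFunctor (ALG k) (SmallCat k) where
  toPrelaxFunctor := starPrelax k
  mapId A := phiId A
  mapComp M N := phiComp (bimod M) (bimod N)
  mapComp_naturality_left {A B C M M'} η N := hom_ext_comp fun x y z q p => (congrArg (η ▷ N : Bimod.Hom _ _).hom.hom
    (phiComp_tmul (bimod M) (bimod N) x y z q p)).trans ((whiskerRight_tmul η (bimod N) p q).trans (phiComp_tmul (bimod M') (bimod
    N) x y z q ((η : Bimod.Hom _ _).hom.hom p)).symm |>.trans (congrArg ((phiComp (bimod M') (bimod N)).app x y)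
    (SmallCat.whiskerRight_tmul (phiMap η) (phi (bimod N)) x y z q p)).symm)
  mapComp_naturality_right {A B C} M {N N'} η := hom_ext_comp fun x y z q p => (congrArg (M ◁ η : Bimod.Hom _ _).hom.hom
    (phiComp_tmul (bimod M) (bimod N) x y z q p)).trans ((whiskerLeft_tmul (bimod M) η p q).trans (phiComp_tmul (bimod M) (bimod
    N') x y z ((η : Bimod.Hom _ _).hom.hom q) p).symm |>.trans (congrArg ((phiComp (bimod M) (bimod N')).app x y)
    (SmallCat.whiskerLeft_tmul (phi (bimod M)) (phiMap η) x y z q p)).symm)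
  map₂_associator {A B C D} (M : Bimod A.mon B.mon) (N : Bimod B.mon C.mon) (P : Bimod C.mon D.mon) := hom_ext_comp_comp fun x y z
    z' r q p => by
    let α := (Bimod.associatorBimod M N P).hom.hom.hom
    have h₀ := congrArg (fun t => α ((phiComp (M.tensorBimod N) P).app x y t)) (SmallCat.whiskerRight_tmul (phiComp M N) (phi P) x
      y z r (SmallCat.tmul z' q p))
    have h₁ := congrArg α (phiComp_tmul (M.tensorBimod N) P x y z r ((phiComp M N).app z y (SmallCat.tmul z' q p)))
    have h₂ := congrArg (fun t => α (tmul (M.tensorBimod N) P t r)) (phiComp_tmul M N z y z' q p)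
    have h₃ := congrArg (tmul M (N.tensorBimod P) p) (phiComp_tmul N P x z' z r q)
    have h₄ := congrArg ((phiComp M (N.tensorBimod P)).app x y) ((congrArg ((SmallCat.whiskerLeft (phi M) (phiComp N P)).app x y)
      (SmallCat.associatorHom_tmul (phi M) (phi N) (phi P) x y z z' r q p)).trans (SmallCat.whiskerLeft_tmul (phi M) (phiComp N P)
      x y z' (SmallCat.tmul z r q) p))
    exact ((h₀.trans h₁).trans h₂).trans ((associator_tmul p q r).trans (h₄.trans ((phiComp_tmul M (N.tensorBimod P) x y z' _
      p).trans h₃)).symm)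
  map₂_leftUnitor {A B} (M : Bimod A.mon B.mon) := hom₂_ext fun x y z => by
    have h₁ := congrArg ((phiComp (Bimod.regular A.mon) M).app x y) (SmallCat.whiskerRight_tmul (phiId A) (phi M) x y y z (homElt
      (𝟙 y)))
    have h₂ := h₁.trans (phiComp_tmul (Bimod.regular A.mon) M x y y z (1 : A.mon.X))
    have h₃ : tmul (Bimod.regular A.mon) M (1 : A.mon.X) z = _ := inv_lact M z
    exact h₃.symm.trans h₂.symm
  map₂_rightUnitor {A B} (M : Bimod A.mon B.mon) := hom₂_ext fun x y z => by
    have h₁ := congrArg ((phiComp M (Bimod.regular B.mon)).app x y) (SmallCat.whiskerLeft_tmul (phi M) (phiId B) x y x (homElt (𝟙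
      x)) z)
    have h₂ := h₁.trans (phiComp_tmul M (Bimod.regular B.mon) x y x (1 : B.mon.X) z)
    have h₃ : tmul M (Bimod.regular B.mon) z (1 : B.mon.X) = _ := inv_ract M z
    exact h₃.symm.trans h₂.symm

instance (A : ALG k) : IsIso ((starLax k).mapId A) := inferInstanceAs (IsIso (phiId A))

instance (M : A ⟶ B) (N : B ⟶ C) : IsIso ((starLax k).mapComp M N) := inferInstanceAs (IsIso (phiComp (bimod M) (bimod N)))

/-- Bimodules over algebras as bimodules over linear categories, as a pseudofunctor. -/
def starPseudo (k : Type u) [Field k] : Pseudofunctor (ALG k) (SmallCat k) := Pseudofunctor.mkOfLax' (starLax k)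

instance (A B : ALG k) : ((starPseudo k).mapFunctor A B).Faithful where
  map_injective {M N} f g h := Bimod.hom_ext _ _ (ModuleCat.hom_ext (congrArg (fun t : SmallCat.Hom₂ (phi (bimod M)) (phi (bimod
    N)) => t.app ⟨⟩ ⟨⟩) h))

instance (A B : ALG k) : ((starPseudo k).mapFunctor A B).Full where
  map_surjective {M N} (θ : SmallCat.Hom₂ (phi (bimod M)) (phi (bimod N))) := ⟨Bimod.Hom.mk (ModuleCat.ofHom (θ.app ⟨⟩ ⟨⟩))
    (ModuleCat.MonoidalCategory.tensor_ext fun a x => (congrArg (θ.app ⟨⟩ ⟨⟩) (phi_act_one a x)).symm.trans ((θ.app_act (𝟙 _) a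
    x).trans (phi_act_one a _))) (ModuleCat.MonoidalCategory.tensor_ext fun x b => (congrArg (θ.app ⟨⟩ ⟨⟩) (phi_one_act b
    x)).symm.trans ((θ.app_act b (𝟙 _) x).trans (phi_one_act b _))), hom₂_ext fun _ _ _ => rfl⟩

def mkBimod {X : ModuleCat.{u} k} (l : A.mon.X →ₗ[k] X →ₗ[k] X) (r : X →ₗ[k] B.mon.X →ₗ[k] X) (h₁ : ∀ x, l 1 x = x) (h₂ : ∀ a b x,
  l (a * b) x = l b (l a x)) (h₃ : ∀ x, r x 1 = x) (h₄ : ∀ x a b, r x (a * b) = r (r x b) a) (h₅ : ∀ a x b, r (l a x) b = l a (r x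
  b)) : Bimod A.mon B.mon :=
  have h (D : ALG k) (t : k) : (MonObj.one (X := D.mon.X)).hom t = t • (1 : D.mon.X) := (congrArg _ (mul_one t).symm).trans
    (map_smul (MonObj.one (X := D.mon.X)).hom t (1 : k))
  { X := X
    actLeft := ModuleCat.ofHom (TensorProduct.lift l)
    one_actLeft := ModuleCat.MonoidalCategory.tensor_ext fun t x => (congrArg (l · x) (h A t)).trans (by simp [h₁])
    left_assoc := ModuleCat.MonoidalCategory.tensor_ext₃' fun a b x => h₂ b a x
    actRight := ModuleCat.ofHom (TensorProduct.lift r)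
    actRight_one := ModuleCat.MonoidalCategory.tensor_ext fun x t => (congrArg (r x) (h B t)).trans (by simp [h₃])
    right_assoc := ModuleCat.MonoidalCategory.tensor_ext₃ fun x a b => h₄ x b a
    middle_assoc := ModuleCat.MonoidalCategory.tensor_ext₃' fun a x b => h₅ a x b }

instance (A B : ALG k) : ((starPseudo k).mapFunctor A B).EssSurj where
  mem_essImage (P : SmallCat.Hom (star k A.mon.X) (star k B.mon.X)) := by
    let X := P.obj ⟨⟩ ⟨⟩
    let ρ : B.mon.X →ₗ[k] A.mon.X →ₗ[k] X →ₗ[k] X := P.act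
    have h (g g' f f' x) : ρ g' f' (ρ g f x) = ρ (g' * g) (f * f') x := P.act_act g g' f f' x
    have h₁ (x) : ρ 1 1 x = x := P.act_id x
    let M : Bimod A.mon B.mon := mkBimod (X := X) (ρ 1) (ρ.flip 1).flip h₁ (by simp [h]) h₁ (by simp [h]) (by simp [h])
    refine ⟨M, ⟨SmallCat.isoMk (P := phi M) (Q := P) (fun _ _ => LinearEquiv.refl k X) ?_⟩⟩
    intro _ _ _ _ (g : B.mon.X) (f : A.mon.X) x
    exact (h 1 g f 1 x).trans (congrArg₂ (ρ · · x) (mul_one g) (mul_one f))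

instance (A B : ALG k) : ((starPseudo k).mapFunctor A B).IsEquivalence where

variable {A B C D : ALG k}

open Ho

open SmallCat (star fcls starMap fcls_starMap_comp fcls_starMap_id mulEquiv starEquiv)

/-! ### Compatibility with tensor products -/

def algHom (f : A.mon ⟶ B.mon) : A.mon.X →ₐ[k] B.mon.X := AlgHom.ofLinearMap f.hom.hom (hom_congr (IsMonHom.one_hom f.hom) (1 :
  k)) fun x y => hom_congr (IsMonHom.mul_hom f.hom) (y ⊗ₜ[k] x)

lemma cls_bimodOfHom (f : A.mon ⟶ B.mon) : cls (B := SmallCat k) (phi (bimodOfHom f)) = fcls k (starMap (algHom f)) := rfl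

lemma cls_bimodOfHom_comp (f : A.mon ⟶ B.mon) (g : B.mon ⟶ C.mon) : cls (B := ALG k) (bimodOfHom f) ≫ cls (B := ALG k) (bimodOfHom
  g) = cls (B := ALG k) (bimodOfHom (f ≫ g)) := cls_of_cls_map (Φ := starPseudo k) ((cls_map_comp (starPseudo k) _ _).trans
  (fcls_starMap_comp (algHom f) (algHom g)))

lemma cls_bimodOfHom_id : cls (B := ALG k) (a := A) (b := A) (bimodOfHom (𝟙 A.mon)) = 𝟙 (Ho.mk A) := cls_of_cls_map (Φ :=
  starPseudo k) ((fcls_starMap_id (R := A.mon.X)).trans (cls_map_id (starPseudo k) A).symm)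

def tensorAlgEquiv (A B : ALG k) : A.mon.X ⊗[k] B.mon.X ≃ₐ[k] ((tensorData k).tensorObj A B).mon.X :=
  Algebra.TensorProduct.algEquivOfLinearEquivTensorProduct (R := k) (S := k) (C := ((tensorData k).tensorObj A B).mon.X)
  (LinearEquiv.refl k (A.mon.X ⊗[k] B.mon.X)) (fun _ _ _ _ => rfl) rfl

def unitAlgEquiv (k : Type u) [Field k] : k ≃ₐ[k] (tensorData k).unit.mon.X := AlgEquiv.ofLinearEquiv (LinearEquiv.refl k _) rfl
  fun x y => mul_comm x y

lemma preserves_starPrelax (k : Type u) [Field k] : TensorData.Preserves (tensorData k) (SmallCat.tensorData k) (starPrelax k)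
  (starEquiv (unitAlgEquiv k)) (fun A B => mulEquiv (tensorAlgEquiv A B)) where
  naturality {A A' B B'} M N := SmallCat.mulEquiv_naturality (tensorAlgEquiv A B) (tensorAlgEquiv A' B') (phi (bimod M)) (phi
    (bimod N)) (phi (bimodTensor (bimod M) (bimod N))) (LinearEquiv.refl k _) (fun g₁ g₂ f₁ f₂ x y => rfl)
  associativity A B C := SmallCat.mulEquiv_associativity (tensorAlgEquiv A B) (tensorAlgEquiv _ C) (tensorAlgEquiv B C)
    (tensorAlgEquiv A _) (algHom (MonoidalCategoryStruct.associator A.mon B.mon C.mon).hom) (cls_bimodOfHom _) (fun _ _ _ => rfl)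
  left_unitality A := SmallCat.mulEquiv_left_unitality _ (tensorAlgEquiv _ A) (algHom (A := (tensorData k).tensorObj (tensorData
    k).unit A) (B := A) (MonoidalCategoryStruct.leftUnitor A.mon).hom) (cls_bimodOfHom _) (fun _ _ => rfl)
  right_unitality A := SmallCat.mulEquiv_right_unitality _ (tensorAlgEquiv A _) (algHom (A := (tensorData k).tensorObj A
    (tensorData k).unit) (B := A) (MonoidalCategoryStruct.rightUnitor A.mon).hom) (cls_bimodOfHom _) (fun _ _ => rfl)
  symmetry A B := SmallCat.mulEquiv_symmetry (tensorAlgEquiv A B) (tensorAlgEquiv B A) (algHom (β_ A.mon B.mon).hom)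
    (cls_bimodOfHom _) (fun _ _ => rfl)

variable {A B C D : ALG k}

open Ho

open SmallCat (star matrixAct)

/-! ### The equivalences -/

/-- The one-object category with endomorphism algebra a power of the base field, and the inclusion,
for a given expression of the multiplication. -/
def inclOf (mul : ∀ n, (Fin n → k) → (Fin n → k) → Fin n → k) (h : mul = fun _ x y => x * y) : PrelaxFunctor (KV k) (SmallCat k)
  :=
  let star (n : ℕ) : SmallCat k :=
    letI : Category.{u} (Star (Fin n → k)) :=
      { Hom _ _ := Fin n → k
        id _ := (1 : Fin n → k)
        comp f g := mul n f g
        id_comp := by subst h; exact one_mul (M := Fin n → k)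
        comp_id := by subst h; exact mul_one (M := Fin n → k)
        assoc := by subst h; exact mul_assoc (G := Fin n → k) }
    letI : Preadditive (Star (Fin n → k)) :=
      { homGroup _ _ := inferInstanceAs (AddCommGroup (Fin n → k))
        add_comp := by subst h; exact fun _ _ _ => add_mul (R := Fin n → k)
        comp_add := by subst h; exact fun _ _ _ => mul_add (R := Fin n → k) }
    letI : Linear k (Star (Fin n → k)) :=
      { homModule _ _ := inferInstanceAs (Module k (Fin n → k))
        smul_comp := by subst h; exact fun _ _ _ => smul_mul_assoc (β := Fin n → k)
        comp_smul := by subst h; exact fun _ _ _ f r g => mul_smul_comm (β := Fin n → k) r f g }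
    ⟨Star (Fin n → k)⟩
  let map {a b : KV k} (M : a ⟶ b) : SmallCat.Hom (star a.n) (star b.n) :=
    { obj _ _ := ModuleCat.of k (∀ i j, KV.Hom.entry M i j)
      act := matrixAct fun i j => KV.Hom.entry M i j
      act_id := (SmallCat.ofMatrix M).act_id (d := ⟨⟩) (c := ⟨⟩)
      act_act := by
        subst h; exact (SmallCat.ofMatrix M).act_act (d := ⟨⟩) }
  { obj a := star a.n
    map M := map M
    map₂ {a b M N} η := SmallCat.Hom₂.mk (fun _ _ => ((SmallCat.incl k).map₂ η : SmallCat.Hom₂ (SmallCat.ofMatrix M)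
      (SmallCat.ofMatrix N)).app ⟨⟩ ⟨⟩) (((SmallCat.incl k).map₂ η : SmallCat.Hom₂ (SmallCat.ofMatrix M) (SmallCat.ofMatrix
      N)).app_act)
    map₂_id _ := rfl
    map₂_comp _ _ := rfl }

lemma incl_comp (k : Type u) [Field k] : SmallCat.incl k = (incl k).comp (starPrelax k) := by
  have h : (fun n (x y : Fin n → k) => y * x) = fun n x y => x * y := funext fun n => funext fun x => funext fun y => mul_comm y x
  have h₁ : SmallCat.incl k = inclOf (fun n x y => x * y) rfl := rfl
  have h₂ : (incl k).comp (starPrelax k) = inclOf (fun n x y => y * x) h := rfl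
  have h₃ (mul) (h' : mul = fun n (x y : Fin n → k) => x * y) :
      inclOf mul h' = inclOf (fun n x y => x * y) rfl := by subst h'; rfl
  exact h₁.trans ((h₃ _ h).symm.trans h₂.symm)

variable (k) [IsAlgClosed k]

lemma inducesEquivalence_of_equivalences (S : SubBicat (ALG k)) (hobj : ∀ a, S.obj ((incl k).obj a)) (hmap : ∀ {a b : KV k} (f : a
  ⟶ b), S.hom ((incl k).map f)) (hunit : S.obj (tensorData k).unit) (htensor : ∀ {a b}, S.obj a → S.obj b → S.obj ((tensorData
  k).tensorObj a b)) (hS : ∀ {a b : ALG k} (i : a ≌ b), S.obj a → S.obj b → S.hom i.hom) : InducesEquivalence (KV.tensorData k)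
  (tensorData k) S (incl k) := inducesEquivalence_of_comp (Φ := starPseudo k) (preserves_starPrelax k) SmallCat.isFunctorial
  KV.assoc_assocInv (fun A B C => cls_eq_iff.1 ((cls_bimodOfHom_comp (MonoidalCategoryStruct.associator A.mon B.mon C.mon).inv
  (MonoidalCategoryStruct.associator A.mon B.mon C.mon).hom).trans ((congrArg (fun f => cls (B := ALG k) (bimodOfHom f))
  (Iso.inv_hom_id _)).trans cls_bimodOfHom_id))) (fun A B C => cls_eq_iff.1 ((cls_bimodOfHom_comp
  (MonoidalCategoryStruct.associator A.mon B.mon C.mon).hom (MonoidalCategoryStruct.associator A.mon B.mon C.mon).inv).trans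
  ((congrArg (fun f => cls (B := ALG k) (bimodOfHom f)) (Iso.hom_inv_id _)).trans cls_bimodOfHom_id))) S (incl k)
  (SmallCat.inclPseudo k) (incl_comp k) SmallCat.inclPseudo_full SmallCat.inclPseudo_faithful KV.exists_adjoint (fun a => ⟨_, _,
  _, KV.isDual_self a⟩) (fun f _ adj => SmallCat.exists_ofMatrix f (SmallCat.hasDualBasis_of_adjunction adj)) (fun {x y e c} _ _
  he hc hec => by
      obtain ⟨n, ⟨i⟩⟩ := SmallCat.exists_equivalence_star (SmallCat.hasDualBasis_of_adjunction he)
        (SmallCat.hasDualBasis_of_adjunction hc) hec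
      exact ⟨⟨n⟩, ⟨i⟩⟩)
    (SmallCat.preserves_incl k) hobj hmap hunit htensor hS

theorem inducesEquivalence_whole : InducesEquivalence (KV.tensorData k) (tensorData k) (SubBicat.whole (ALG k)) (incl k) :=
  inducesEquivalence_of_equivalences k _ (fun _ => trivial) (fun _ => trivial) trivial (fun _ _ => trivial) (fun _ _ _ => trivial)

theorem inducesEquivalence_L : InducesEquivalence (KV.tensorData k) (tensorData k) (SubBicat.whole (ALG k)).L (incl k) := by
  refine inducesEquivalence_of_equivalences k _ (fun _ => trivial) (fun {a b} f => ?_) trivial (fun _ _ => trivial) (fun i _ _ =>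
    ⟨trivial, i.inv, trivial, ⟨equivAdj i⟩⟩)
  obtain ⟨ι, h⟩ := exists_lift (starPseudo k) (incl k) (SmallCat.inclPseudo k) (incl_comp k)
  obtain ⟨g, ⟨adj⟩, -⟩ := KV.exists_adjoint f
  rw [← h]
  exact ⟨trivial, ι.map g, trivial, ⟨ι.mapAdjunction adj⟩⟩

theorem inducesEquivalence_alg : InducesEquivalence (KV.tensorData k) (tensorData k) (alg k) (incl k) := by
  refine inducesEquivalence_of_equivalences k _ (fun a => inferInstanceAs (Module.Finite k (Fin a.n → k))) (fun {a b} f =>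
    inferInstanceAs (Module.Finite k (∀ i j, KV.Hom.entry f i j))) (inferInstanceAs (Module.Finite k k)) (fun {A B} hA hB => ?_)
    (fun {A B} i hA hB => ?_)
  · have : Module.Finite k A.mon.X := hA
    have : Module.Finite k B.mon.X := hB
    exact inferInstanceAs (Module.Finite k (A.mon.X ⊗[k] B.mon.X))
  · obtain ⟨n, ⟨h⟩⟩ := SmallCat.hasDualBasis_of_adjunction ((starPseudo k).mapAdjunction (equivAdj i)) ⟨⟩
    exact h.finite ⟨⟩ fun _ => hB
end ALG
end TwoVec

end

theorem mainTheorem10 (k : Type u) [Field k] [IsAlgClosed k] : TwoVec.InducesEquivalence (TwoVec.KV.tensorData k)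
  (TwoVec.ALG.tensorData k) (TwoVec.SubBicat.whole (TwoVec.ALG k)) (TwoVec.ALG.incl k) ∧ TwoVec.InducesEquivalence
  (TwoVec.KV.tensorData k) (TwoVec.ALG.tensorData k) (TwoVec.ALG.alg k) (TwoVec.ALG.incl k) ∧ TwoVec.InducesEquivalence
  (TwoVec.KV.tensorData k) (TwoVec.ALG.tensorData k) (TwoVec.SubBicat.whole (TwoVec.ALG k)).L (TwoVec.ALG.incl k) ∧
  TwoVec.InducesEquivalence (TwoVec.KV.tensorData k) (TwoVec.AddCat.linCatTensorData k) (TwoVec.AddCat.linCat k)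
  (TwoVec.AddCat.incl k) ∧ TwoVec.InducesEquivalence (TwoVec.KV.tensorData k) (TwoVec.AddCat.twoVectTensorData k)
  (TwoVec.AddCat.twoVect k) (TwoVec.AddCat.incl k) ∧ TwoVec.InducesEquivalence (TwoVec.KV.tensorData k)
  (TwoVec.SmallCat.tensorData k) (TwoVec.SubBicat.whole (TwoVec.SmallCat k)) (TwoVec.SmallCat.incl k) := by
  exact ⟨TwoVec.ALG.inducesEquivalence_whole k, TwoVec.ALG.inducesEquivalence_alg k, TwoVec.ALG.inducesEquivalence_L k,
    (TwoVec.AddCat.linCatSetup k).inducesEquivalence, (TwoVec.AddCat.twoVectSetup k).inducesEquivalence,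
    TwoVec.SmallCat.inducesEquivalence k⟩
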